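/- **Setting.** Let $J,K\ge 1$ be integers, $T>0$, and $0=t_0<t_1<\dots<t_N=T$, $\Delta t_n=t_{n+1}-t_n$. Consider a moving curvilinear grid with nodes $(x_{j,k}(t),y_{j,k}(t))$, $0\le j\le J$, $0\le k\le K$, and the semi-discretization of $u_t+\nabla\cdot(u\mathbf b)+cu=\nabla\cdot(a\nabla u)+f$ with $\mathbf b=(b_1,b_2)$, given at the interior nodes $0<j<J$, $0<k<K$ by $$ \begin{aligned} J_{j,k}\dot u_{j,k}+\dot J_{j,k}u_{j,k}&+(q_{1,j+\frac12,k}-q_{1,j-\frac12,k})+(q_{2,j,k+\frac12}-q_{2,j,k-\frac12})+c_{j,k}u_{j,k}J_{j,k}\\ =\ &\tfrac12\big(p_{1,j+\frac12,k+\frac12}-p_{1,j-\frac12,k+\frac12}+p_{1,j+\frac12,k-\frac12}-p_{1,j-\frac12,k-\frac12}\big)\\ &+\tfrac12\big(p_{2,j+\frac12,k+\frac12}-p_{2,j+\frac12,k-\frac12}+p_{2,j-\frac12,k+\frac12}-p_{2,j-\frac12,k-\frac12}\big)+J_{j,k}f_{j,k}, \end{aligned} $$ with $u_{j,k}=g_{j,k}$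 prescribed at the boundary nodes. The convection fluxes are $$ \begin{aligned} q_{1,j-\frac12,k}&=\tfrac{u_{j,k}+u_{j-1,k}}2\big[(J\xi_x)(b_1-\dot x)+(J\xi_y)(b_2-\dot y)\big]_{j-\frac12,k},\\ q_{2,j,k-\frac12}&=\tfrac{u_{j,k}+u_{j,k-1}}2\big[(J\eta_x)(b_1-\dot x)+(J\eta_y)(b_2-\dot y)\big]_{j,k-\frac12}. \end{aligned} $$ With $\delta_1u=u_{j,k}-u_{j-1,k}+u_{j,k-1}-u_{j-1,k-1}$ and $\delta_2u=u_{j,k}-u_{j,k-1}+u_{j-1,k}-u_{j-1,k-1}$, the diffusion fluxes are, all factors being taken at $(j-\frac12,k-\frac12)$, $$ \begin{aligned} p_1&=\tfrac{a}{2J}\big[(J\xi_x)^2+(J\xi_y)^2\big]\delta_1u+\tfrac a{2J}\big[(J\xi_x)(J\eta_x)+(J\xi_y)(J\eta_y)\big]\delta_2u,\\ p_2&=\tfrac a{2J}\big[(J\xi_x)(J\eta_x)+(J\xi_y)(J\eta_y)\big]\delta_1u+\tfrac a{2J}\big[(J\eta_x)^2+(J\eta_y)^2\big]\delta_2u . \end{aligned}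 $$ At the points $(j-\frac12,k-\frac12)$ one takes $J\xi_x=\frac12\delta_2y$, $J\xi_y=-\frac12\delta_2x$, $J\eta_x=-\frac12\delta_1y$, $J\eta_y=\frac12\delta_1x$, $J=(J\xi_x)(J\eta_y)-(J\xi_y)(J\eta_x)$. The quantities $J_{j,k}$, $(J\xi_x)_{j-\frac12,k}$, $(J\xi_y)_{j-\frac12,k}$, $(J\eta_x)_{j,k-\frac12}$, $(J\eta_y)_{j,k-\frac12}$, the mesh velocities $\dot x,\dot y$ at $(j-\frac12,k)$ and $(j,k-\frac12)$, and the half-point values of $a,b_1,b_2$ are chosen functions of time (part of the choice of the scheme). In matrix form for the interior values the scheme reads $M\dot{\mathbf u}=A\mathbf u+\mathbf F$ with $M=\mathrm{diag}(J_{j,k})$, where $A$ is the spatial operator with zero boundary values and $\mathbf F$ collects the contributions of $f$ and $g$. With $\mathbf v=\sqrt M\mathbf u$ and $B=\sqrt M^{-1}\big(A+\sqrt M\frac{d\sqrt M}{dt}\big)\sqrt M^{-1}$ the system becomes $\dot{\mathbf v}=B\mathbf v+\sqrt M^{-1}\mathbf F$. For $m\ge1$ and the Gauss–Legendre points $\rho_1<\dots<\rho_m$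 of $(0,1)$, the *fully discrete scheme* seeks a continuous $\mathbf v_h$ on $[0,T]$, a polynomial of degree at most $m$ on each $[t_n,t_{n+1}]$, that satisfies this system at the points $t_n+\rho_i\Delta t_n$; put $\mathbf u^n=\sqrt M(t_n)^{-1}\mathbf v_h(t_n)$. Write $\|\mathbf w\|_{M(t)}=(\mathbf w^TM(t)\mathbf w)^{1/2}$. Assume that, on $[0,T]$, $J_{j,k}>0$ at all interior nodes and $J>0$, $a>0$ at all half–half points. Assume also, for $0<j<J$, $0<k<K$ and $t$ in every $(t_n,t_{n+1})$, the coefficient condition $$ \begin{aligned} J_{j,k}c_{j,k}&+\tfrac12\Big[(J\xi_xb_1+J\xi_yb_2)_{j+\frac12,k}-(J\xi_xb_1+J\xi_yb_2)_{j-\frac12,k}\Big]\\ &+\tfrac12\Big[(J\eta_xb_1+J\eta_yb_2)_{j,k+\frac12}-(J\eta_xb_1+J\eta_yb_2)_{j,k-\frac12}\Big]\ge0 \end{aligned} $$ and the discrete geometric conservation law ($J_{j,k}$ being differentiable there) $$ \begin{aligned} \dot J_{j,k}=\ &(J\xi_x\dot x+J\xi_y\dot y)_{j+\frac12,k}-(J\xi_x\dot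 x+J\xi_y\dot y)_{j-\frac12,k}\\ &+(J\eta_x\dot x+J\eta_y\dot y)_{j,k+\frac12}-(J\eta_x\dot x+J\eta_y\dot y)_{j,k-\frac12}. \end{aligned} $$ **Theorem.** 1. For all $t\in(t_n,t_{n+1})$, $n<N$, and all vectors $\mathbf z$ of interior values, $\mathbf z^T\big(A+\sqrt M\frac{d\sqrt M}{dt}\big)\mathbf z\le0$. 2. (Unconditional stability.) For every $m\ge1$ and with no restriction on the time steps, the fully discrete scheme has, for all $f_{j,k}(t)$, $g_{j,k}(t)$ and every initial vector, exactly one solution on $[0,T]$. For $f=0$, $g=0$ every solution satisfies $\mathbf v_h(t_{n+1})^T\mathbf v_h(t_{n+1})\le\mathbf v_h(t_n)^T\mathbf v_h(t_n)$, that is, $\|\mathbf u^{n+1}\|_{M(t_{n+1})}\le\|\mathbf u^n\|_{M(t_n)}$, for all $n<N$. 3. (Order $2m$ in time and $2$ in space.) Let $a,b_1,b_2,c,f$ and $u$ be smooth functions of $(x,y,t)$, and let $C,\kappa>0$. There is a constant $C_1$, depending only on these functions and on $T,C,\kappa$, and for all $m,J,K\ge1$ there is a constant $C_2$, depending in addition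 on $m,J,K$, with the following property. Put $h_1=1/J$, $h_2=1/K$. Let $X(\cdot,t)$ be a coordinate transformation of $[0,1]^2$, affine in $t$ on each $[t_n,t_{n+1}]$ and injective on $[0,1]^2$, that is of class $C^4$ in space, with Jacobian at least $\kappa$ and with the spatial derivatives of orders $0,\dots,4$ of the positions $X(\cdot,t_n)$ and of the velocities $(X(\cdot,t_{n+1})-X(\cdot,t_n))/\Delta t_n$ bounded by $C$ on $[0,1]^2$. Let $u$ solve the equation in $\Omega(t)=X((0,1)^2,t)$ for $0<t\le T$, with $u=g$ on $\partial\Omega(t)$ and $u=u^0$ at $t=0$. Take the scheme with nodes $X(j/J,k/K,t)$ and nodal values of $c,f,g,u^0$, such that all of the following hold. * The two conditions displayed above hold, and $J_{j,k}$ and $J_{j-\frac12,k-\frac12}$ are at least $\kappa h_1h_2$. * On the intervals $(t_n,t_{n+1})$ the quantities $J_{j,k}$, $J\xi_x$, $J\xi_y$, $J\eta_x$, $J\eta_y$, $\dot x$, $\dot y$ and the half-point values of $a,b_1,b_2$ are second-order approximations of their exact values with constant $C$. (The exact metric quantities, for unit spacing of the computational mesh, are $h_1h_2\det DX$, $h_2y_\eta$,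 $-h_2x_\eta$, $-h_1y_\xi$, $h_1x_\xi$. The error is at most $C(h_1^2+h_2^2)$ times the scale $h_1h_2$, $h_2$, $h_2$, $h_1$, $h_1$ of the metric quantity, or $1$ for the others. The divided differences of the error satisfy the same bound: in the $\xi$-direction for quantities at $(j-\frac12,k)$, in the $\eta$-direction at $(j,k-\frac12)$, in both directions for $a$; for $J_{j,k}$ only the bound on the error itself is required.) * These quantities are $C^{2m}$ in time on each $(t_n,t_{n+1})$, they and their time derivatives up to order $2m$ are bounded by $C$, and $J_{j,k}$ is continuous on $[0,T]$. Then the semi-discrete system has a solution $\mathbf w$ on $[0,T]$ with $\mathbf w(0)=(u^0_{j,k})$; with $u(t)$ denoting the vector of values of $u$ at the interior nodes at time $t$, $$\|\mathbf w(t)-u(t)\|_{M(t)}\le C_1(h_1^2+h_2^2)\qquad(0\le t\le T).$$ For the fully discrete solution with $\mathbf v_h(0)=\sqrt M(0)\,(u^0_{j,k})$, every $\Delta\ge\max_n\Delta t_n$ and all $n\le N$, $$\|\mathbf u^n-\mathbf w(t_n)\|_{M(t_n)}\le C_2\Delta^{2m},\qquad \|\mathbf u^n-u(t_n)\|_{M(t_n)}\le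 C_2\Delta^{2m}+C_1(h_1^2+h_2^2).$$ -/

import Mathlib

open scoped ContDiff Matrix
open Set

/-! ### Grid functions and the moving-mesh scheme -/

/-- Indices of the interior nodes of a grid with nodes `(j, k)`, `0 ≤ j ≤ J`, `0 ≤ k ≤ K`. -/
abbrev Interior (J K : ℕ) : Type :=
  ↥(Finset.Ioo (0 : ℤ) J ×ˢ Finset.Ioo (0 : ℤ) K)

/-- The grid function with the values `z` at the interior nodes and the values `g` elsewhere. -/
noncomputable def extendGrid {J K : ℕ} (g : ℤ → ℤ → ℝ) (z : Interior J K → ℝ) : ℤ → ℤ → ℝ := fun j k =>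
  if h : (j, k) ∈ Finset.Ioo (0 : ℤ) J ×ˢ Finset.Ioo (0 : ℤ) K then z ⟨(j, k), h⟩ else g j k

/-- All quantities, as functions of time, that the two-dimensional moving-mesh scheme uses.
In a direction in which a quantity lives at half-integer points, the index `j` stands for
`j - 1/2`.  The quantities used in the convection fluxes are free: choosing them is part of
choosing the scheme. -/
structure Scheme (J K : ℕ) where
  /-- `x_{j,k}`, node coordinate -/
  x : ℤ → ℤ → ℝ → ℝ
  /-- `y_{j,k}`, node coordinate -/
  y : ℤ → ℤ → ℝ → ℝ
  /-- `a_{j-1/2,k-1/2}` -/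
  a : ℤ → ℤ → ℝ → ℝ
  /-- `b_{1,j-1/2,k}` -/
  b₁Xi : ℤ → ℤ → ℝ → ℝ
  /-- `b_{2,j-1/2,k}` -/
  b₂Xi : ℤ → ℤ → ℝ → ℝ
  /-- `b_{1,j,k-1/2}` -/
  b₁Eta : ℤ → ℤ → ℝ → ℝ
  /-- `b_{2,j,k-1/2}` -/
  b₂Eta : ℤ → ℤ → ℝ → ℝ
  /-- `c_{j,k}` -/
  c : ℤ → ℤ → ℝ → ℝ
  /-- `J_{j,k}` -/
  jac : ℤ → ℤ → ℝ → ℝ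
  /-- `(J ξ_x)_{j-1/2,k}` -/
  jXix : ℤ → ℤ → ℝ → ℝ
  /-- `(J ξ_y)_{j-1/2,k}` -/
  jXiy : ℤ → ℤ → ℝ → ℝ
  /-- `(J η_x)_{j,k-1/2}` -/
  jEtax : ℤ → ℤ → ℝ → ℝ
  /-- `(J η_y)_{j,k-1/2}` -/
  jEtay : ℤ → ℤ → ℝ → ℝ
  /-- mesh velocity component in `x` at `(j-1/2,k)` -/
  xdotXi : ℤ → ℤ → ℝ → ℝ
  /-- mesh velocity component in `y` at `(j-1/2,k)` -/
  ydotXi : ℤ → ℤ → ℝ → ℝ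
  /-- mesh velocity component in `x` at `(j,k-1/2)` -/
  xdotEta : ℤ → ℤ → ℝ → ℝ
  /-- mesh velocity component in `y` at `(j,k-1/2)` -/
  ydotEta : ℤ → ℤ → ℝ → ℝ

namespace Scheme

variable {J K : ℕ} (S : Scheme J K)

/-- `(J ξ_x)_{j-1/2,k-1/2} = (y_η)_{j-1/2,k-1/2}` by central differences. -/
noncomputable def cXix (j k : ℤ) (t : ℝ) : ℝ :=
  (S.y j k t - S.y j (k - 1) t + S.y (j - 1) k t - S.y (j - 1) (k - 1) t) / 2

/-- `(J ξ_y)_{j-1/2,k-1/2} = -(x_η)_{j-1/2,k-1/2}` by central differences. -/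
noncomputable def cXiy (j k : ℤ) (t : ℝ) : ℝ :=
  -((S.x j k t - S.x j (k - 1) t + S.x (j - 1) k t - S.x (j - 1) (k - 1) t) / 2)

/-- `(J η_x)_{j-1/2,k-1/2} = -(y_ξ)_{j-1/2,k-1/2}` by central differences. -/
noncomputable def cEtax (j k : ℤ) (t : ℝ) : ℝ :=
  -((S.y j k t - S.y (j - 1) k t + S.y j (k - 1) t - S.y (j - 1) (k - 1) t) / 2)

/-- `(J η_y)_{j-1/2,k-1/2} = (x_ξ)_{j-1/2,k-1/2}` by central differences. -/
noncomputable def cEtay (j k : ℤ) (t : ℝ) : ℝ :=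
  (S.x j k t - S.x (j - 1) k t + S.x j (k - 1) t - S.x (j - 1) (k - 1) t) / 2

/-- `J_{j-1/2,k-1/2} = (J ξ_x)(J η_y) - (J ξ_y)(J η_x)`. -/
noncomputable def cJac (j k : ℤ) (t : ℝ) : ℝ :=
  S.cXix j k t * S.cEtay j k t - S.cXiy j k t * S.cEtax j k t

/-- Convection flux `q_{1,j-1/2,k}` of the grid function `u`. -/
noncomputable def q₁ (u : ℤ → ℤ → ℝ) (j k : ℤ) (t : ℝ) : ℝ :=
  (u j k + u (j - 1) k) / 2 *
    (S.jXix j k t * (S.b₁Xi j k t - S.xdotXi j k t)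
      + S.jXiy j k t * (S.b₂Xi j k t - S.ydotXi j k t))

/-- Convection flux `q_{2,j,k-1/2}` of the grid function `u`. -/
noncomputable def q₂ (u : ℤ → ℤ → ℝ) (j k : ℤ) (t : ℝ) : ℝ :=
  (u j k + u j (k - 1)) / 2 *
    (S.jEtax j k t * (S.b₁Eta j k t - S.xdotEta j k t)
      + S.jEtay j k t * (S.b₂Eta j k t - S.ydotEta j k t))

/-- Diffusion flux `p_{1,j-1/2,k-1/2}` of the grid function `u`. -/
noncomputable def p₁ (u : ℤ → ℤ → ℝ) (j k : ℤ) (t : ℝ) : ℝ :=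
  S.a j k t / (2 * S.cJac j k t) * (S.cXix j k t ^ 2 + S.cXiy j k t ^ 2) *
      (u j k - u (j - 1) k + u j (k - 1) - u (j - 1) (k - 1))
    + S.a j k t / (2 * S.cJac j k t) *
        (S.cXix j k t * S.cEtax j k t + S.cXiy j k t * S.cEtay j k t) *
      (u j k - u j (k - 1) + u (j - 1) k - u (j - 1) (k - 1))

/-- Diffusion flux `p_{2,j-1/2,k-1/2}` of the grid function `u`. -/
noncomputable def p₂ (u : ℤ → ℤ → ℝ) (j k : ℤ) (t : ℝ) : ℝ :=
  S.a j k t / (2 * S.cJac j k t) *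
        (S.cXix j k t * S.cEtax j k t + S.cXiy j k t * S.cEtay j k t) *
      (u j k - u (j - 1) k + u j (k - 1) - u (j - 1) (k - 1))
    + S.a j k t / (2 * S.cJac j k t) * (S.cEtax j k t ^ 2 + S.cEtay j k t ^ 2) *
      (u j k - u j (k - 1) + u (j - 1) k - u (j - 1) (k - 1))

/-- The spatial operator of the scheme at the node `(j,k)`: the scheme reads
`J_{j,k} du_{j,k}/dt = S.op u j k t + J_{j,k} f_{j,k}` at the interior nodes. -/
noncomputable def op (u : ℤ → ℤ → ℝ) (j k : ℤ) (t : ℝ) : ℝ :=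
  - deriv (S.jac j k) t * u j k
    - (S.q₁ u (j + 1) k t - S.q₁ u j k t)
    - (S.q₂ u j (k + 1) t - S.q₂ u j k t)
    - S.c j k t * u j k * S.jac j k t
    + (S.p₁ u (j + 1) (k + 1) t - S.p₁ u j (k + 1) t
        + S.p₁ u (j + 1) k t - S.p₁ u j k t) / 2
    + (S.p₂ u (j + 1) (k + 1) t - S.p₂ u (j + 1) k t
        + S.p₂ u j (k + 1) t - S.p₂ u j k t) / 2

/-- The mass matrix `M(t)`. -/
noncomputable def mass (t : ℝ) : Matrix (Interior J K) (Interior J K) ℝ :=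
  Matrix.diagonal fun p => S.jac p.1.1 p.1.2 t

/-- The square root of the mass matrix. -/
noncomputable def sqrtMass (t : ℝ) : Matrix (Interior J K) (Interior J K) ℝ :=
  Matrix.diagonal fun p => √(S.jac p.1.1 p.1.2 t)

/-- The (entrywise) time derivative of the square root of the mass matrix. -/
noncomputable def sqrtMassDeriv (t : ℝ) : Matrix (Interior J K) (Interior J K) ℝ :=
  Matrix.of fun p q => deriv (fun s => S.sqrtMass s p q) t

/-- The stiffness matrix `A(t)`: its columns are the images of the unit vectors, extended by
zero to the boundary, under the spatial operator. -/
noncomputable def stiff (t : ℝ) : Matrix (Interior J K) (Interior J K) ℝ :=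
  Matrix.of fun p q => S.op (extendGrid (fun _ _ => 0) (Pi.single q 1)) p.1.1 p.1.2 t

/-- The source vector: the contribution of the boundary values `g` and of the right-hand
side `f`. -/
noncomputable def source (f g : ℤ → ℤ → ℝ → ℝ) (t : ℝ) : Interior J K → ℝ := fun p =>
  S.op (extendGrid (fun j k => g j k t) (0 : Interior J K → ℝ)) p.1.1 p.1.2 t
    + S.jac p.1.1 p.1.2 t * f p.1.1 p.1.2 t

/-- The spatial operator is linear in the grid function. -/
theorem op_linear (u w : ℤ → ℤ → ℝ) (r : ℝ) (j k : ℤ) (t : ℝ) :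
    S.op (fun i l => u i l + r * w i l) j k t = S.op u j k t + r * S.op w j k t := by
  simp only [op, q₁, q₂, p₁, p₂]
  ring

/-- `A z` plus the source vector is the spatial operator applied to the grid function with
interior values `z` and boundary values `g`, plus the right-hand side. -/
theorem stiff_mulVec_add_source (f g : ℤ → ℤ → ℝ → ℝ) (t : ℝ) (z : Interior J K → ℝ)
    (p : Interior J K) :
    (S.stiff t *ᵥ z + S.source f g t) p
      = S.op (extendGrid (fun j k => g j k t) z) p.1.1 p.1.2 t
        + S.jac p.1.1 p.1.2 t * f p.1.1 p.1.2 t := by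
  have key : ∀ (s : Finset (Interior J K)) (g : ℤ → ℤ → ℝ),
      S.op (fun i l => g i l + ∑ q ∈ s, z q * extendGrid (fun _ _ => 0) (Pi.single q 1) i l)
        p.1.1 p.1.2 t
      = S.op g p.1.1 p.1.2 t
        + ∑ q ∈ s, z q * S.op (extendGrid (fun _ _ => 0) (Pi.single q 1)) p.1.1 p.1.2 t := by
    intro s
    induction s using Finset.induction_on with
    | empty => intro g; simp
    | insert q s hq ih =>
      intro g
      have h := ih (fun i l => g i l + z q * extendGrid (fun _ _ => 0) (Pi.single q 1) i l)
      rw [S.op_linear] at h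
      rw [Finset.sum_insert hq, ← add_assoc, ← h]
      congr 1
      funext i l
      rw [Finset.sum_insert hq]
      ring
  have hz : extendGrid (fun j k => g j k t) z = fun i l =>
      extendGrid (fun j k => g j k t) (0 : Interior J K → ℝ) i l
        + ∑ q, z q * extendGrid (fun _ _ => 0) (Pi.single q 1) i l := by
    funext i l
    by_cases h : (i, l) ∈ Finset.Ioo (0 : ℤ) J ×ˢ Finset.Ioo (0 : ℤ) K
    · simp only [extendGrid, dif_pos h, Pi.zero_apply, zero_add, Pi.single_apply]
      simp
    · simp only [extendGrid, dif_neg h, mul_zero, Finset.sum_const_zero, add_zero]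
  rw [hz, key]
  simp only [Pi.add_apply, Matrix.mulVec, dotProduct, stiff, Matrix.of_apply, source]
  simp only [mul_comm (z _)]
  ring

/-- The matrix `B = M^{-1/2} (A + M^{1/2} d(M^{1/2})/dt) M^{-1/2}` of the system for
`v = M^{1/2} u`. -/
noncomputable def B (t : ℝ) : Matrix (Interior J K) (Interior J K) ℝ :=
  (S.sqrtMass t)⁻¹ * (S.stiff t + S.sqrtMass t * S.sqrtMassDeriv t) * (S.sqrtMass t)⁻¹

/-- The energy norm `(wᵀ M(t) w)^{1/2}`. -/
noncomputable def energyNorm (t : ℝ) (w : Interior J K → ℝ) : ℝ :=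
  √(w ⬝ᵥ (S.mass t *ᵥ w))

end Scheme

/-! ### Time integration -/

/-- `0 = τ 0 < τ 1 < ⋯ < τ N = T`. -/
structure IsPartition (T : ℝ) (N : ℕ) (τ : ℕ → ℝ) : Prop where
  zero : τ 0 = 0
  last : τ N = T
  lt : ∀ n < N, τ n < τ (n + 1)

/-- `ρ` lists the `m` Gauss–Legendre points of `(0,1)` in increasing order. -/
structure IsGaussLegendre {m : ℕ} (ρ : Fin m → ℝ) : Prop where
  strictMono : StrictMono ρ
  mem : ∀ i, ρ i ∈ Ioo (0 : ℝ) 1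
  root : ∀ i, Polynomial.aeval (ρ i) (Polynomial.shiftedLegendre m) = 0

namespace Scheme

variable {J K : ℕ} (S : Scheme J K)

/-- The collocation points `t_n + ρ_i Δt_n`. -/
noncomputable def collocationPoint (τ : ℕ → ℝ) {m : ℕ} (ρ : Fin m → ℝ) (n : ℕ) (i : Fin m) : ℝ :=
  τ n + ρ i * (τ (n + 1) - τ n)

/-- `v` solves the `m`-point collocation scheme for `dv/dt = B v + M^{-1/2} F` : it is
continuous, a polynomial of degree at most `m` on each subinterval, and satisfies the
differential equation at the collocation points. -/
structure IsCollocationSolution (T : ℝ) (N : ℕ) (τ : ℕ → ℝ) {m : ℕ} (ρ : Fin m → ℝ)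
    (F : ℝ → Interior J K → ℝ) (v : ℝ → Interior J K → ℝ) : Prop where
  continuousOn : ContinuousOn v (Icc 0 T)
  polynomial : ∀ n < N, ∀ p : Interior J K, ∃ P : Polynomial ℝ, P.natDegree ≤ m ∧
    ∀ t ∈ Icc (τ n) (τ (n + 1)), v t p = P.eval t
  collocation : ∀ n < N, ∀ i : Fin m,
    HasDerivAt v
      (S.B (collocationPoint τ ρ n i) *ᵥ v (collocationPoint τ ρ n i)
        + (S.sqrtMass (collocationPoint τ ρ n i))⁻¹ *ᵥ F (collocationPoint τ ρ n i))
      (collocationPoint τ ρ n i)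

/-- `w` solves the semi-discrete system `M dw/dt = A w + F` on `[0,T]`; the coefficients may
jump at the points of the partition. -/
structure IsSemidiscreteSolution (T : ℝ) (N : ℕ) (τ : ℕ → ℝ)
    (F : ℝ → Interior J K → ℝ) (w : ℝ → Interior J K → ℝ) : Prop where
  continuousOn : ContinuousOn w (Icc 0 T)
  ode : ∀ n < N, ∀ t ∈ Ioo (τ n) (τ (n + 1)),
    DifferentiableAt ℝ w t ∧ S.mass t *ᵥ deriv w t = S.stiff t *ᵥ w t + F t

/-- Positivity of the mass matrix, of the cell Jacobians and of the diffusion coefficient. -/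
structure IsNondegenerate (T : ℝ) : Prop where
  jac_pos : ∀ t ∈ Icc 0 T, ∀ j k : ℤ, 0 < j → j < J → 0 < k → k < K → 0 < S.jac j k t
  cJac_pos : ∀ t ∈ Icc 0 T, ∀ j k : ℤ, 0 < j → j ≤ J → 0 < k → k ≤ K → 0 < S.cJac j k t
  a_pos : ∀ t ∈ Icc 0 T, ∀ j k : ℤ, 0 < j → j ≤ J → 0 < k → k ≤ K → 0 < S.a j k t

/-- The discrete coefficient condition (a discrete form of `c + (div b)/2 ≥ 0`). -/
def CoefficientCondition (N : ℕ) (τ : ℕ → ℝ) : Prop :=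
  ∀ n < N, ∀ t ∈ Ioo (τ n) (τ (n + 1)),
    ∀ j k : ℤ, 0 < j → j < J → 0 < k → k < K →
      0 ≤ S.jac j k t * S.c j k t
        + (S.jXix (j + 1) k t * S.b₁Xi (j + 1) k t - S.jXix j k t * S.b₁Xi j k t
          + S.jXiy (j + 1) k t * S.b₂Xi (j + 1) k t - S.jXiy j k t * S.b₂Xi j k t) / 2
        + (S.jEtax j (k + 1) t * S.b₁Eta j (k + 1) t - S.jEtax j k t * S.b₁Eta j k t
          + S.jEtay j (k + 1) t * S.b₂Eta j (k + 1) t - S.jEtay j k t * S.b₂Eta j k t) / 2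

/-- The discrete geometric conservation law. -/
def GeometricConservationLaw (N : ℕ) (τ : ℕ → ℝ) : Prop :=
  ∀ n < N, ∀ t ∈ Ioo (τ n) (τ (n + 1)),
    ∀ j k : ℤ, 0 < j → j < J → 0 < k → k < K →
      HasDerivAt (S.jac j k)
        (S.jXix (j + 1) k t * S.xdotXi (j + 1) k t - S.jXix j k t * S.xdotXi j k t
          + S.jXiy (j + 1) k t * S.ydotXi (j + 1) k t - S.jXiy j k t * S.ydotXi j k t
          + S.jEtax j (k + 1) t * S.xdotEta j (k + 1) t - S.jEtax j k t * S.xdotEta j k t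
          + S.jEtay j (k + 1) t * S.ydotEta j (k + 1) t - S.jEtay j k t * S.ydotEta j k t) t

end Scheme

/-! ### The initial-boundary value problem -/

/-- The data of `u_t + div (u b) + c u = div (a grad u) + f`, `u = g` on the boundary,
`u = u₀` at time `0`. Space-time points are written `(x, y, t)`. -/
structure IBVP where
  a : ℝ × ℝ × ℝ → ℝ
  b₁ : ℝ × ℝ × ℝ → ℝ
  b₂ : ℝ × ℝ × ℝ → ℝ
  c : ℝ × ℝ × ℝ → ℝ
  f : ℝ × ℝ × ℝ → ℝ
  g : ℝ × ℝ × ℝ → ℝ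
  u₀ : ℝ × ℝ → ℝ

/-- Partial derivative in `x`. -/
noncomputable def dX (F : ℝ × ℝ × ℝ → ℝ) (p : ℝ × ℝ × ℝ) : ℝ :=
  deriv (fun s => F (s, p.2.1, p.2.2)) p.1

/-- Partial derivative in `y`. -/
noncomputable def dY (F : ℝ × ℝ × ℝ → ℝ) (p : ℝ × ℝ × ℝ) : ℝ :=
  deriv (fun s => F (p.1, s, p.2.2)) p.2.1

/-- Partial derivative in `t`. -/
noncomputable def dT (F : ℝ × ℝ × ℝ → ℝ) (p : ℝ × ℝ × ℝ) : ℝ :=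
  deriv (fun s => F (p.1, p.2.1, s)) p.2.2

namespace IBVP

/-- The coefficients and the right-hand side are smooth. -/
structure IsSmooth (P : IBVP) : Prop where
  a : ContDiff ℝ ∞ P.a
  b₁ : ContDiff ℝ ∞ P.b₁
  b₂ : ContDiff ℝ ∞ P.b₂
  c : ContDiff ℝ ∞ P.c
  f : ContDiff ℝ ∞ P.f

/-- `u` is a classical solution on the moving domain `Ω t`, `0 < t ≤ T`. -/
structure IsSolution (P : IBVP) (T : ℝ) (Ω : ℝ → Set (ℝ × ℝ)) (u : ℝ × ℝ × ℝ → ℝ) : Prop where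
  pde : ∀ t ∈ Ioc 0 T, ∀ z ∈ Ω t,
    dT u (z.1, z.2, t) + dX (fun q => u q * P.b₁ q) (z.1, z.2, t)
        + dY (fun q => u q * P.b₂ q) (z.1, z.2, t) + P.c (z.1, z.2, t) * u (z.1, z.2, t)
      = dX (fun q => P.a q * dX u q) (z.1, z.2, t)
        + dY (fun q => P.a q * dY u q) (z.1, z.2, t) + P.f (z.1, z.2, t)
  boundary : ∀ t ∈ Ioc 0 T, ∀ z ∈ frontier (Ω t), u (z.1, z.2, t) = P.g (z.1, z.2, t)
  initial : ∀ z ∈ Ω 0, u (z.1, z.2, 0) = P.u₀ z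

end IBVP

/-! ### Coordinate transformations -/

/-- The closed unit square, the (rescaled) computational domain. -/
def unitSquare : Set (ℝ × ℝ) := Icc 0 1 ×ˢ Icc 0 1

/-- The physical domain: the image of the open unit square under the coordinate
transformation `X t`. -/
def physicalDomain (X : ℝ → ℝ × ℝ → ℝ × ℝ) (t : ℝ) : Set (ℝ × ℝ) :=
  X t '' (Ioo 0 1 ×ˢ Ioo 0 1)

/-- `x_ξ` -/
noncomputable def xXi (X : ℝ → ℝ × ℝ → ℝ × ℝ) (t : ℝ) (z : ℝ × ℝ) : ℝ := (fderiv ℝ (X t) z (1, 0)).1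
/-- `y_ξ` -/
noncomputable def yXi (X : ℝ → ℝ × ℝ → ℝ × ℝ) (t : ℝ) (z : ℝ × ℝ) : ℝ := (fderiv ℝ (X t) z (1, 0)).2
/-- `x_η` -/
noncomputable def xEta (X : ℝ → ℝ × ℝ → ℝ × ℝ) (t : ℝ) (z : ℝ × ℝ) : ℝ := (fderiv ℝ (X t) z (0, 1)).1
/-- `y_η` -/
noncomputable def yEta (X : ℝ → ℝ × ℝ → ℝ × ℝ) (t : ℝ) (z : ℝ × ℝ) : ℝ := (fderiv ℝ (X t) z (0, 1)).2

/-- The Jacobian determinant of the coordinate transformation. -/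
noncomputable def jacobian (X : ℝ → ℝ × ℝ → ℝ × ℝ) (t : ℝ) (z : ℝ × ℝ) : ℝ :=
  xXi X t z * yEta X t z - xEta X t z * yXi X t z

/-- The mesh velocity. -/
noncomputable def velocity (X : ℝ → ℝ × ℝ → ℝ × ℝ) (t : ℝ) (z : ℝ × ℝ) : ℝ × ℝ :=
  deriv (fun s => X s z) t

/-- `X` is a coordinate transformation that is affine in time on each subinterval, invertible
on the closed square with Jacobian at least `κ`, and whose positions and velocities have all
spatial derivatives of order at most four bounded by `C`. -/
structure IsCoordinateTransformation (T : ℝ) (N : ℕ) (τ : ℕ → ℝ) (C κ : ℝ)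
    (X : ℝ → ℝ × ℝ → ℝ × ℝ) : Prop where
  affine : ∀ n < N, ∀ t ∈ Icc (τ n) (τ (n + 1)), ∀ z,
    X t z = ((τ (n + 1) - t) / (τ (n + 1) - τ n)) • X (τ n) z
      + ((t - τ n) / (τ (n + 1) - τ n)) • X (τ (n + 1)) z
  contDiff : ∀ n ≤ N, ContDiff ℝ 4 (X (τ n))
  bound : ∀ n ≤ N, ∀ i ≤ 4, ∀ z ∈ unitSquare, ‖iteratedFDeriv ℝ i (X (τ n)) z‖ ≤ C
  bound_velocity : ∀ n < N, ∀ i ≤ 4, ∀ z ∈ unitSquare,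
    ‖iteratedFDeriv ℝ i
      (fun z => (τ (n + 1) - τ n)⁻¹ • (X (τ (n + 1)) z - X (τ n) z)) z‖ ≤ C
  injOn : ∀ t ∈ Icc 0 T, InjOn (X t) unitSquare
  jacobian_ge : ∀ t ∈ Icc 0 T, ∀ z ∈ unitSquare, κ ≤ jacobian X t z

/-! ### Second-order consistency in space, regularity in time -/

/-- `h₁² + h₂²` with `h₁ = 1/J`, `h₂ = 1/K`. -/
noncomputable def meshSq (J K : ℕ) : ℝ := (1 / (J : ℝ)) ^ 2 + (1 / (K : ℝ)) ^ 2

/-- Second-order approximation of `s * Q` at the points `(j-1/2,k)` : both the error and its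
divided differences in the first direction are at most `C * s * (h₁² + h₂²)`. -/
def ConsistentXi (J K : ℕ) (C s : ℝ) (Q : ℝ × ℝ → ℝ) (q : ℤ → ℤ → ℝ) : Prop :=
  ∃ e : ℤ → ℤ → ℝ, (∀ j k, q j k = s * Q (((j : ℝ) - 1 / 2) / J, (k : ℝ) / K) + e j k) ∧
    (∀ j k : ℤ, 0 < j → j ≤ J → 0 < k → k < K → |e j k| ≤ C * s * meshSq J K) ∧
    (∀ j k : ℤ, 0 < j → j < J → 0 < k → k < K →
      |e (j + 1) k - e j k| ≤ C * s * meshSq J K * (1 / J))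

/-- Second-order approximation of `s * Q` at the points `(j,k-1/2)` : both the error and its
divided differences in the second direction are at most `C * s * (h₁² + h₂²)`. -/
def ConsistentEta (J K : ℕ) (C s : ℝ) (Q : ℝ × ℝ → ℝ) (q : ℤ → ℤ → ℝ) : Prop :=
  ∃ e : ℤ → ℤ → ℝ, (∀ j k, q j k = s * Q ((j : ℝ) / J, ((k : ℝ) - 1 / 2) / K) + e j k) ∧
    (∀ j k : ℤ, 0 < j → j < J → 0 < k → k ≤ K → |e j k| ≤ C * s * meshSq J K) ∧
    (∀ j k : ℤ, 0 < j → j < J → 0 < k → k < K →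
      |e j (k + 1) - e j k| ≤ C * s * meshSq J K * (1 / K))

/-- Second-order approximation of `Q` at the cell centres `(j-1/2,k-1/2)` : the error and its
divided differences in both directions are at most `C * (h₁² + h₂²)`. -/
def ConsistentCell (J K : ℕ) (C : ℝ) (Q : ℝ × ℝ → ℝ) (q : ℤ → ℤ → ℝ) : Prop :=
  ∃ e : ℤ → ℤ → ℝ,
    (∀ j k, q j k = Q (((j : ℝ) - 1 / 2) / J, ((k : ℝ) - 1 / 2) / K) + e j k) ∧
    (∀ j k : ℤ, 0 < j → j ≤ J → 0 < k → k ≤ K → |e j k| ≤ C * meshSq J K) ∧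
    (∀ j k : ℤ, 0 < j → j < J → 0 < k → k ≤ K →
      |e (j + 1) k - e j k| ≤ C * meshSq J K * (1 / J)) ∧
    (∀ j k : ℤ, 0 < j → j ≤ J → 0 < k → k < K →
      |e j (k + 1) - e j k| ≤ C * meshSq J K * (1 / K))

/-- On each open subinterval `q` has `r` continuous derivatives, and it and these derivatives
are bounded by `C`. -/
def TimeRegular (N : ℕ) (τ : ℕ → ℝ) (r : ℕ) (C : ℝ) (q : ℝ → ℝ) : Prop :=
  ∀ n < N, ContDiffOn ℝ r q (Ioo (τ n) (τ (n + 1))) ∧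
    ∀ i ≤ r, ∀ t ∈ Ioo (τ n) (τ (n + 1)), |iteratedDeriv i q t| ≤ C

namespace Scheme

variable {J K : ℕ} (S : Scheme J K)

/-- Values of a space-time function at the moving nodes. -/
def nodal (φ : ℝ × ℝ × ℝ → ℝ) (j k : ℤ) (t : ℝ) : ℝ := φ (S.x j k t, S.y j k t, t)

/-- Values of a space-time function at the interior nodes. -/
def nodalVec (φ : ℝ × ℝ × ℝ → ℝ) (t : ℝ) : Interior J K → ℝ := fun p => S.nodal φ p.1.1 p.1.2 t

/-- Values of the initial datum at the interior nodes. -/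
def initialVec (φ : ℝ × ℝ → ℝ) : Interior J K → ℝ := fun p =>
  φ (S.x p.1.1 p.1.2 0, S.y p.1.1 p.1.2 0)

/-- `S` is a second-order discretization of the problem `P` on the mesh given by `X` : the nodes
are `X t (j/J, k/K)`, nodal values of `c` are exact, and all other quantities are second-order
approximations of their continuous counterparts, with constant `C`. The factors `1/J`, `1/K`
come from the unit spacing of the computational mesh. -/
structure IsConsistent (P : IBVP) (T : ℝ) (N : ℕ) (τ : ℕ → ℝ) (C : ℝ)
    (X : ℝ → ℝ × ℝ → ℝ × ℝ) : Prop where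
  nodes : ∀ t ∈ Icc 0 T, ∀ j k : ℤ, 0 ≤ j → j ≤ J → 0 ≤ k → k ≤ K →
    (S.x j k t, S.y j k t) = X t ((j : ℝ) / J, (k : ℝ) / K)
  c : ∀ t ∈ Icc 0 T, ∀ j k : ℤ, 0 < j → j < J → 0 < k → k < K → S.c j k t = S.nodal P.c j k t
  a : ∀ n < N, ∀ t ∈ Ioo (τ n) (τ (n + 1)),
    ConsistentCell J K C (fun z => P.a ((X t z).1, (X t z).2, t)) (fun j k => S.a j k t)
  b₁Xi : ∀ n < N, ∀ t ∈ Ioo (τ n) (τ (n + 1)),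
    ConsistentXi J K C 1 (fun z => P.b₁ ((X t z).1, (X t z).2, t)) (fun j k => S.b₁Xi j k t)
  b₂Xi : ∀ n < N, ∀ t ∈ Ioo (τ n) (τ (n + 1)),
    ConsistentXi J K C 1 (fun z => P.b₂ ((X t z).1, (X t z).2, t)) (fun j k => S.b₂Xi j k t)
  b₁Eta : ∀ n < N, ∀ t ∈ Ioo (τ n) (τ (n + 1)),
    ConsistentEta J K C 1 (fun z => P.b₁ ((X t z).1, (X t z).2, t)) (fun j k => S.b₁Eta j k t)
  b₂Eta : ∀ n < N, ∀ t ∈ Ioo (τ n) (τ (n + 1)),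
    ConsistentEta J K C 1 (fun z => P.b₂ ((X t z).1, (X t z).2, t)) (fun j k => S.b₂Eta j k t)
  jac : ∀ n < N, ∀ t ∈ Ioo (τ n) (τ (n + 1)),
    ∀ j k : ℤ, 0 < j → j < J → 0 < k → k < K →
      |S.jac j k t - (1 / J) * (1 / K) * jacobian X t ((j : ℝ) / J, (k : ℝ) / K)|
        ≤ C * ((1 / J) * (1 / K)) * meshSq J K
  jXix : ∀ n < N, ∀ t ∈ Ioo (τ n) (τ (n + 1)),
    ConsistentXi J K C (1 / K) (fun z => yEta X t z) (fun j k => S.jXix j k t)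
  jXiy : ∀ n < N, ∀ t ∈ Ioo (τ n) (τ (n + 1)),
    ConsistentXi J K C (1 / K) (fun z => -xEta X t z) (fun j k => S.jXiy j k t)
  jEtax : ∀ n < N, ∀ t ∈ Ioo (τ n) (τ (n + 1)),
    ConsistentEta J K C (1 / J) (fun z => -yXi X t z) (fun j k => S.jEtax j k t)
  jEtay : ∀ n < N, ∀ t ∈ Ioo (τ n) (τ (n + 1)),
    ConsistentEta J K C (1 / J) (fun z => xXi X t z) (fun j k => S.jEtay j k t)
  xdotXi : ∀ n < N, ∀ t ∈ Ioo (τ n) (τ (n + 1)),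
    ConsistentXi J K C 1 (fun z => (velocity X t z).1) (fun j k => S.xdotXi j k t)
  ydotXi : ∀ n < N, ∀ t ∈ Ioo (τ n) (τ (n + 1)),
    ConsistentXi J K C 1 (fun z => (velocity X t z).2) (fun j k => S.ydotXi j k t)
  xdotEta : ∀ n < N, ∀ t ∈ Ioo (τ n) (τ (n + 1)),
    ConsistentEta J K C 1 (fun z => (velocity X t z).1) (fun j k => S.xdotEta j k t)
  ydotEta : ∀ n < N, ∀ t ∈ Ioo (τ n) (τ (n + 1)),
    ConsistentEta J K C 1 (fun z => (velocity X t z).2) (fun j k => S.ydotEta j k t)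

/-- All quantities of the scheme are `r` times continuously differentiable in time inside each
subinterval, with derivatives bounded by `C`, and `J_{j,k}` is continuous on `[0,T]`. -/
structure IsTimeRegular (T : ℝ) (N : ℕ) (τ : ℕ → ℝ) (r : ℕ) (C : ℝ) : Prop where
  jac_continuousOn : ∀ j k : ℤ, 0 < j → j < J → 0 < k → k < K →
    ContinuousOn (S.jac j k) (Icc 0 T)
  jac : ∀ j k : ℤ, 0 < j → j < J → 0 < k → k < K → TimeRegular N τ r C (S.jac j k)
  a : ∀ j k : ℤ, 0 < j → j ≤ J → 0 < k → k ≤ K → TimeRegular N τ r C (S.a j k)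
  xi : ∀ j k : ℤ, 0 < j → j ≤ J → 0 < k → k < K →
    TimeRegular N τ r C (S.b₁Xi j k) ∧ TimeRegular N τ r C (S.b₂Xi j k) ∧
    TimeRegular N τ r C (S.jXix j k) ∧ TimeRegular N τ r C (S.jXiy j k) ∧
    TimeRegular N τ r C (S.xdotXi j k) ∧ TimeRegular N τ r C (S.ydotXi j k)
  eta : ∀ j k : ℤ, 0 < j → j < J → 0 < k → k ≤ K →
    TimeRegular N τ r C (S.b₁Eta j k) ∧ TimeRegular N τ r C (S.b₂Eta j k) ∧
    TimeRegular N τ r C (S.jEtax j k) ∧ TimeRegular N τ r C (S.jEtay j k) ∧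
    TimeRegular N τ r C (S.xdotEta j k) ∧ TimeRegular N τ r C (S.ydotEta j k)

/-- The discrete Jacobians are at least `κ h₁ h₂`. -/
structure IsUniform (T κ : ℝ) : Prop where
  jac_ge : ∀ t ∈ Icc 0 T, ∀ j k : ℤ, 0 < j → j < J → 0 < k → k < K →
    κ * ((1 / J) * (1 / K)) ≤ S.jac j k t
  cJac_ge : ∀ t ∈ Icc 0 T, ∀ j k : ℤ, 0 < j → j ≤ J → 0 < k → k ≤ K →
    κ * ((1 / J) * (1 / K)) ≤ S.cJac j k t

end Scheme

/-!
The three parts rest on the following ideas.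

*Semidefiniteness.* Summation by parts (`Scheme.sum_mul_op_le`). The diffusive terms give the
quadratic form of `dissipation_nonneg`, a sum of squares since the metric coefficients enter through
`D Dᵀ`. The symmetric averages in the convective fluxes turn `u · δ(q)` into `u² / 2` times the
discrete divergence of the relative velocity; the mesh part of this divergence is `J̇` by the
geometric conservation law and cancels against `A + √M d√M/dt`, and the rest has a sign by the
coefficient condition.

*Collocation.* Let `w` be the positive Gauss–Legendre weights, exact up to degree `2m - 1`. For
`v' = B v` at the Gauss points, `|v|²` changes over a step by the integral of `2 v · v'`, which the
quadrature evaluates exactly as a weighted sum of `2 v · B v ≤ 0`; hence the energy decreases.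
Testing with `v / x` instead of `v` gives uniqueness, and existence since the equations are a square
linear system, without any restriction on the step size. The same test bounds the growth over a step
by the right-hand side, uniformly (`exists_step_growth`).

*Order `2m` in time* (`exists_local_error`). With the solution `ψ` of the dual system that ends in the
direction of the error `E`, `(ψ · E)' = ψ · d`, where the defect `d` of the collocation polynomial
vanishes at the Gauss points. As `ψ · d` is of class `C^{2m}`, the quadrature error bounds its integral
by `O(Δt^{2m+1})`, and dissipativity makes these errors add up.

*Order `2` in space.* The exact solution satisfies a conservation law in the computational coordinates
(`MeshTime.balance`, by the Piola identity). Each numerical flux differs from the exact flux by an error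
that is of second order together with its divided differences; this property (`Grid.Approx`) is
stable under sums, products and inverses, so it passes from the coefficients to the fluxes, and makes
the flux differences consistent although the scheme divides by the mesh width. The truncation error
(`MeshTime.exists_truncation`) then enters a dissipative system, whose error grows by at most a
constant factor (`euclid_le_of_perturbation`).

The constants must not depend on the mesh, the time steps, or the coefficients of the scheme. Estimates
are therefore stated for families: a `Frame` is a parameter space whose points lie on coordinate lines,
and `Frame.Reg k f` says that `f` has derivatives up to order `k` along these lines that are bounded
over the whole parameter space. Taking as parameters all admissible meshes (`MeshStep`, `RegularStep`,
`MeshTime`) turns a bound in the sense of `Frame.Bdd` into a uniform constant.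
-/


/-! ### Uniformly regular families of functions -/

/-- A space `Ω` of parameters and points with coordinate lines in the directions `δ` through
the points of a domain. A function on `Ω` is a family of functions on the slices swept out by
these lines; bounds on the whole of `dom` are bounds that are uniform over the family. -/
structure Frame (Ω δ : Type*) where
  /-- the points at which functions are considered -/
  dom : Set Ω
  /-- the coordinate line in a given direction through a given point -/
  line : δ → Ω → ℝ → Ω
  /-- the parameter at which the coordinate line passes through its point -/
  coord : δ → Ω → ℝ
  /-- the parameters for which the coordinate line stays in the domain -/
  seg : δ → Ω → Set ℝ
  line_coord : ∀ d, ∀ o ∈ dom, line d o (coord d o) = o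
  coord_mem : ∀ d, ∀ o ∈ dom, coord d o ∈ seg d o
  line_mem : ∀ d, ∀ o ∈ dom, ∀ s ∈ seg d o, line d o s ∈ dom

namespace Frame

variable {Ω δ : Type*} (F : Frame Ω δ)

/-- The function is bounded on the domain, uniformly over the family. -/
def Bdd (f : Ω → ℝ) : Prop := ∃ C, ∀ o ∈ F.dom, |f o| ≤ C

/-- `f'` is the partial derivative of `f` in the direction `d`, on the domain. -/
def Der (d : δ) (f f' : Ω → ℝ) : Prop := ∀ o ∈ F.dom,
  HasDerivWithinAt (fun s => f (F.line d o s)) (f' o) (F.seg d o) (F.coord d o)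

/-- The function has partial derivatives up to order `k` on the domain, and these are bounded
uniformly over the family. -/
def Reg : ℕ → (Ω → ℝ) → Prop
  | 0, f => F.Bdd f
  | k + 1, f => F.Bdd f ∧ ∀ d, ∃ f', F.Der d f f' ∧ Reg k f'

variable {F} {k : ℕ} {f g f' g' : Ω → ℝ} {d : δ}

theorem Reg.bdd (h : F.Reg k f) : F.Bdd f := by
  cases k with
  | zero => exact h
  | succ k => exact h.1

theorem Bdd.nonneg (h : F.Bdd f) : ∃ C, 0 ≤ C ∧ ∀ o ∈ F.dom, |f o| ≤ C := by
  obtain ⟨C, hC⟩ := h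
  exact ⟨max C 0, le_max_right _ _, fun o ho => (hC o ho).trans (le_max_left _ _)⟩

theorem Bdd.congr (h : F.Bdd f) (e : EqOn f g F.dom) : F.Bdd g := by
  obtain ⟨C, hC⟩ := h
  exact ⟨C, fun o ho => by rw [← e ho]; exact hC o ho⟩

theorem Der.congr (h : F.Der d f f') (e : EqOn f g F.dom) : F.Der d g f' := by
  intro o ho
  refine (h o ho).congr (fun s hs => (e (F.line_mem d o ho s hs)).symm) ?_
  exact (e (F.line_mem d o ho _ (F.coord_mem d o ho))).symm

theorem Reg.congr (h : F.Reg k f) (e : EqOn f g F.dom) : F.Reg k g := by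
  cases k with
  | zero => exact Bdd.congr h e
  | succ k =>
    refine ⟨h.1.congr e, fun d => ?_⟩
    obtain ⟨f', h1, h2⟩ := h.2 d
    exact ⟨f', h1.congr e, h2⟩

theorem Reg.pred (h : F.Reg (k + 1) f) : F.Reg k f := by
  induction k generalizing f with
  | zero => exact h.1
  | succ k ih =>
    refine ⟨h.1, fun d => ?_⟩
    obtain ⟨f', h1, h2⟩ := h.2 d
    exact ⟨f', h1, ih h2⟩

theorem Reg.mono {l : ℕ} (h : F.Reg k f) (hl : l ≤ k) : F.Reg l f := by
  induction k, hl using Nat.le_induction with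
  | base => exact h
  | succ k _ ih => exact ih h.pred

/-- A bounded function that is constant along the coordinate lines is regular of every order. -/
theorem Reg.of_const_along (hb : F.Bdd f)
    (h : ∀ d, ∀ o ∈ F.dom, ∀ s ∈ F.seg d o, f (F.line d o s) = f o) : F.Reg k f := by
  have h0 : ∀ k, F.Reg k (fun _ => (0 : ℝ)) := by
    intro k
    induction k with
    | zero => exact ⟨0, by simp⟩
    | succ k ih =>
      exact ⟨⟨0, by simp⟩, fun d => ⟨fun _ => 0, fun o _ => hasDerivWithinAt_const _ _ _, ih⟩⟩
  cases k with
  | zero => exact hb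
  | succ k =>
    refine ⟨hb, fun d => ⟨fun _ => 0, fun o ho => ?_, h0 k⟩⟩
    exact (hasDerivWithinAt_const (F.coord d o) (F.seg d o) (f o)).congr (fun s hs => h d o ho s hs)
      (h d o ho _ (F.coord_mem d o ho))

theorem Reg.const (c : ℝ) : F.Reg k (fun _ => c) :=
  Reg.of_const_along ⟨|c|, fun _ _ => le_rfl⟩ (fun _ _ _ _ _ => rfl)

theorem Bdd.add (hf : F.Bdd f) (hg : F.Bdd g) : F.Bdd (fun o => f o + g o) := by
  obtain ⟨C, hC⟩ := hf
  obtain ⟨D, hD⟩ := hg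
  exact ⟨C + D, fun o ho => (abs_add_le _ _).trans (add_le_add (hC o ho) (hD o ho))⟩

theorem Bdd.mul (hf : F.Bdd f) (hg : F.Bdd g) : F.Bdd (fun o => f o * g o) := by
  obtain ⟨C, h0, hC⟩ := hf.nonneg
  obtain ⟨D, hD⟩ := hg
  exact ⟨C * D, fun o ho => by
    rw [abs_mul]; exact mul_le_mul (hC o ho) (hD o ho) (abs_nonneg _) h0⟩

theorem Der.add (hf : F.Der d f f') (hg : F.Der d g g') :
    F.Der d (fun o => f o + g o) (fun o => f' o + g' o) :=
  fun o ho => (hf o ho).add (hg o ho)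

theorem Der.mul (hf : F.Der d f f') (hg : F.Der d g g') :
    F.Der d (fun o => f o * g o) (fun o => f' o * g o + f o * g' o) := by
  intro o ho
  have := (hf o ho).mul (hg o ho)
  rw [F.line_coord d o ho] at this
  exact this

theorem Reg.add (hf : F.Reg k f) (hg : F.Reg k g) : F.Reg k (fun o => f o + g o) := by
  induction k generalizing f g with
  | zero => exact Bdd.add hf hg
  | succ k ih =>
    refine ⟨hf.1.add hg.1, fun d => ?_⟩
    obtain ⟨f', h1, h2⟩ := hf.2 d
    obtain ⟨g', h3, h4⟩ := hg.2 d
    exact ⟨_, h1.add h3, ih h2 h4⟩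

theorem Reg.mul (hf : F.Reg k f) (hg : F.Reg k g) : F.Reg k (fun o => f o * g o) := by
  induction k generalizing f g with
  | zero => exact Bdd.mul hf hg
  | succ k ih =>
    refine ⟨hf.1.mul hg.1, fun d => ?_⟩
    obtain ⟨f', h1, h2⟩ := hf.2 d
    obtain ⟨g', h3, h4⟩ := hg.2 d
    exact ⟨_, h1.mul h3, (ih h2 hg.pred).add (ih hf.pred h4)⟩

theorem Reg.const_mul (c : ℝ) (hf : F.Reg k f) : F.Reg k (fun o => c * f o) :=
  (Reg.const c).mul hf

theorem Reg.neg (hf : F.Reg k f) : F.Reg k (fun o => -f o) :=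
  (hf.const_mul (-1)).congr fun _ _ => by simp

theorem Reg.sub (hf : F.Reg k f) (hg : F.Reg k g) : F.Reg k (fun o => f o - g o) :=
  (hf.add hg.neg).congr fun _ _ => (sub_eq_add_neg _ _).symm

theorem Reg.div_const (c : ℝ) (hf : F.Reg k f) : F.Reg k (fun o => f o / c) :=
  (hf.const_mul c⁻¹).congr fun o _ => by simp only; ring

theorem Reg.pow (hf : F.Reg k f) (n : ℕ) : F.Reg k (fun o => f o ^ n) := by
  induction n with
  | zero => simpa using! Reg.const (F := F) (k := k) 1
  | succ n ih => exact (ih.mul hf).congr fun o _ => (pow_succ _ _).symm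

theorem Reg.sum {ι : Type*} {s : Finset ι} {f : ι → Ω → ℝ} (h : ∀ i ∈ s, F.Reg k (f i)) :
    F.Reg k (fun o => ∑ i ∈ s, f i o) := by
  classical
  induction s using Finset.induction_on with
  | empty => simpa using! Reg.const (F := F) (k := k) 0
  | insert a s ha ih =>
    simp only [Finset.sum_insert ha]
    exact (h a (Finset.mem_insert_self a s)).add
      (ih fun i hi => h i (Finset.mem_insert_of_mem hi))

/-- The inverse of a regular function that is bounded away from zero is regular. -/
theorem Reg.inv {c : ℝ} (hc : 0 < c) (hf : F.Reg k f) (hpos : ∀ o ∈ F.dom, c ≤ f o) :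
    F.Reg k (fun o => (f o)⁻¹) := by
  have hb : F.Bdd (fun o => (f o)⁻¹) := by
    refine ⟨c⁻¹, fun o ho => ?_⟩
    have := hpos o ho
    rw [abs_of_nonneg (inv_nonneg.2 (hc.le.trans this))]
    exact inv_anti₀ hc this
  induction k with
  | zero => exact hb
  | succ k ih =>
    refine ⟨hb, fun d => ?_⟩
    obtain ⟨f', h1, h2⟩ := hf.2 d
    have hi := ih hf.pred
    refine ⟨fun o => -(f' o * ((f o)⁻¹ * (f o)⁻¹)), fun o ho => ?_, (h2.mul (hi.mul hi)).neg⟩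
    have hne : f (F.line d o (F.coord d o)) ≠ 0 := by
      rw [F.line_coord d o ho]; exact (hc.trans_le (hpos o ho)).ne'
    have := (h1 o ho).inv hne
    rw [F.line_coord d o ho] at this
    refine this.congr_deriv ?_
    rw [neg_div, div_eq_mul_inv, sq, mul_inv]

/-- The square root of a regular function that is bounded away from zero is regular. -/
theorem Reg.sqrt {c : ℝ} (hc : 0 < c) (hf : F.Reg k f) (hpos : ∀ o ∈ F.dom, c ≤ f o) :
    F.Reg k (fun o => √(f o)) := by
  have hb : F.Bdd (fun o => √(f o)) := by
    obtain ⟨C, hC⟩ := hf.bdd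
    refine ⟨√C, fun o ho => ?_⟩
    rw [abs_of_nonneg (Real.sqrt_nonneg _)]
    exact Real.sqrt_le_sqrt ((le_abs_self _).trans (hC o ho))
  induction k with
  | zero => exact hb
  | succ k ih =>
    refine ⟨hb, fun d => ?_⟩
    obtain ⟨f', h1, h2⟩ := hf.2 d
    have hi := Reg.inv (Real.sqrt_pos.2 hc) (ih hf.pred)
      (fun o ho => Real.sqrt_le_sqrt (hpos o ho))
    refine ⟨fun o => 2⁻¹ * (f' o * (√(f o))⁻¹), fun o ho => ?_, (h2.mul hi).const_mul _⟩
    have hne : f (F.line d o (F.coord d o)) ≠ 0 := by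
      rw [F.line_coord d o ho]; exact (hc.trans_le (hpos o ho)).ne'
    have := (h1 o ho).sqrt hne
    rw [F.line_coord d o ho] at this
    refine this.congr_deriv ?_
    rw [div_eq_mul_inv, mul_inv]
    ring

end Frame

/-! ### Partial derivatives of functions of `(x, y, t)` -/

theorem dX_eq_fderiv {φ : ℝ × ℝ × ℝ → ℝ} {p : ℝ × ℝ × ℝ} (h : DifferentiableAt ℝ φ p) :
    dX φ p = fderiv ℝ φ p (1, 0, 0) := by
  have : HasDerivAt (fun s : ℝ => (s, p.2.1, p.2.2)) (1, 0, 0) p.1 :=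
    (hasDerivAt_id p.1).prodMk ((hasDerivAt_const _ _).prodMk (hasDerivAt_const _ _))
  exact (h.hasFDerivAt.comp_hasDerivAt (f := fun s : ℝ => (s, p.2.1, p.2.2)) p.1 this).deriv

theorem dY_eq_fderiv {φ : ℝ × ℝ × ℝ → ℝ} {p : ℝ × ℝ × ℝ} (h : DifferentiableAt ℝ φ p) :
    dY φ p = fderiv ℝ φ p (0, 1, 0) := by
  have : HasDerivAt (fun s : ℝ => (p.1, s, p.2.2)) (0, 1, 0) p.2.1 :=
    (hasDerivAt_const _ _).prodMk ((hasDerivAt_id p.2.1).prodMk (hasDerivAt_const _ _))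
  exact (h.hasFDerivAt.comp_hasDerivAt (f := fun s : ℝ => (p.1, s, p.2.2)) p.2.1 this).deriv

theorem dT_eq_fderiv {φ : ℝ × ℝ × ℝ → ℝ} {p : ℝ × ℝ × ℝ} (h : DifferentiableAt ℝ φ p) :
    dT φ p = fderiv ℝ φ p (0, 0, 1) := by
  have : HasDerivAt (fun s : ℝ => (p.1, p.2.1, s)) (0, 0, 1) p.2.2 :=
    (hasDerivAt_const _ _).prodMk ((hasDerivAt_const _ _).prodMk (hasDerivAt_id p.2.2))
  exact (h.hasFDerivAt.comp_hasDerivAt (f := fun s : ℝ => (p.1, p.2.1, s)) p.2.2 this).deriv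

theorem fderiv_eq_dX_dY_dT {φ : ℝ × ℝ × ℝ → ℝ} {p : ℝ × ℝ × ℝ} (h : DifferentiableAt ℝ φ p)
    (r s q : ℝ) : fderiv ℝ φ p (r, s, q) = dX φ p * r + dY φ p * s + dT φ p * q := by
  rw [dX_eq_fderiv h, dY_eq_fderiv h, dT_eq_fderiv h]
  have : ((r, s, q) : ℝ × ℝ × ℝ) = r • (1, 0, 0) + s • (0, 1, 0) + q • (0, 0, 1) := by simp
  rw [this]
  simp only [map_add, map_smul, smul_eq_mul]
  ring

/-- The chain rule along a curve in space-time. -/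
theorem HasDerivWithinAt.comp_spaceTime {φ : ℝ × ℝ × ℝ → ℝ} {x y z : ℝ → ℝ} {x' y' z' t : ℝ}
    {s : Set ℝ} (h : DifferentiableAt ℝ φ (x t, y t, z t)) (hx : HasDerivWithinAt x x' s t)
    (hy : HasDerivWithinAt y y' s t) (hz : HasDerivWithinAt z z' s t) :
    HasDerivWithinAt (fun r => φ (x r, y r, z r))
      (dX φ (x t, y t, z t) * x' + dY φ (x t, y t, z t) * y' + dT φ (x t, y t, z t) * z') s t := by
  rw [← fderiv_eq_dX_dY_dT h]
  exact h.hasFDerivAt.comp_hasDerivWithinAt (f := fun r => (x r, y r, z r)) t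
    (hx.prodMk (hy.prodMk hz))

theorem ContDiff.dX {φ : ℝ × ℝ × ℝ → ℝ} (h : ContDiff ℝ ∞ φ) : ContDiff ℝ ∞ (dX φ) := by
  have : _root_.dX φ = fun p => fderiv ℝ φ p (1, 0, 0) :=
    funext fun p => dX_eq_fderiv (h.differentiable (by simp) p)
  rw [this]
  exact (h.fderiv_right (m := ∞) (by simp)).clm_apply contDiff_const

theorem ContDiff.dY {φ : ℝ × ℝ × ℝ → ℝ} (h : ContDiff ℝ ∞ φ) : ContDiff ℝ ∞ (dY φ) := by
  have : _root_.dY φ = fun p => fderiv ℝ φ p (0, 1, 0) :=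
    funext fun p => dY_eq_fderiv (h.differentiable (by simp) p)
  rw [this]
  exact (h.fderiv_right (m := ∞) (by simp)).clm_apply contDiff_const

theorem ContDiff.dT {φ : ℝ × ℝ × ℝ → ℝ} (h : ContDiff ℝ ∞ φ) : ContDiff ℝ ∞ (dT φ) := by
  have : _root_.dT φ = fun p => fderiv ℝ φ p (0, 0, 1) :=
    funext fun p => dT_eq_fderiv (h.differentiable (by simp) p)
  rw [this]
  exact (h.fderiv_right (m := ∞) (by simp)).clm_apply contDiff_const

/-- A smooth function of regular functions is regular. -/
theorem Frame.Reg.comp_spaceTime {Ω δ : Type*} {F : Frame Ω δ} {k : ℕ} {φ : ℝ × ℝ × ℝ → ℝ}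
    (hφ : ContDiff ℝ ∞ φ) {x y z : Ω → ℝ} (hx : F.Reg k x) (hy : F.Reg k y) (hz : F.Reg k z) :
    F.Reg k (fun o => φ (x o, y o, z o)) := by
  have hb : ∀ φ : ℝ × ℝ × ℝ → ℝ, ContDiff ℝ ∞ φ → F.Bdd (fun o => φ (x o, y o, z o)) := by
    intro φ hφ
    obtain ⟨A, hA⟩ := hx.bdd
    obtain ⟨B, hB⟩ := hy.bdd
    obtain ⟨C, hC⟩ := hz.bdd
    have hK : IsCompact (Icc (-A) A ×ˢ (Icc (-B) B ×ˢ Icc (-C) C)) :=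
      isCompact_Icc.prod (isCompact_Icc.prod isCompact_Icc)
    obtain ⟨D, hD⟩ := hK.exists_bound_of_continuousOn hφ.continuous.continuousOn
    exact ⟨D, fun o ho => hD (x o, y o, z o)
      ⟨abs_le.1 (hA o ho), abs_le.1 (hB o ho), abs_le.1 (hC o ho)⟩⟩
  induction k generalizing φ with
  | zero => exact hb φ hφ
  | succ k ih =>
    refine ⟨hb φ hφ, fun d => ?_⟩
    obtain ⟨x', h1, h2⟩ := hx.2 d
    obtain ⟨y', h3, h4⟩ := hy.2 d
    obtain ⟨z', h5, h6⟩ := hz.2 d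
    refine ⟨_, fun o ho => ?_, (((ih hφ.dX hx.pred hy.pred hz.pred).mul h2).add
      ((ih hφ.dY hx.pred hy.pred hz.pred).mul h4)).add
      ((ih hφ.dT hx.pred hy.pred hz.pred).mul h6)⟩
    have := HasDerivWithinAt.comp_spaceTime (φ := φ) (hφ.differentiable (by simp) _) (h1 o ho)
      (h3 o ho) (h5 o ho)
    simp only [F.line_coord d o ho] at this
    exact this

/-! ### Gauss–Legendre quadrature -/

open Polynomial in
theorem Polynomial.integral_eval_derivative (p : ℝ[X]) (a b : ℝ) :
    ∫ x in a..b, (derivative p).eval x = p.eval b - p.eval a :=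
  intervalIntegral.integral_eq_sub_of_hasDerivAt (fun x _ => p.hasDerivAt x)
    (Polynomial.continuous _).continuousOn.intervalIntegrable

open Polynomial in
theorem Polynomial.exists_derivative_eq (p : ℝ[X]) :
    ∃ q : ℝ[X], derivative q = p ∧ q.natDegree ≤ p.natDegree + 1 := by
  refine ⟨∑ i ∈ Finset.range (p.natDegree + 1), C (p.coeff i / (i + 1)) * X ^ (i + 1), ?_, ?_⟩
  · conv_rhs => rw [p.as_sum_range_C_mul_X_pow]
    rw [derivative_sum]
    refine Finset.sum_congr rfl fun i _ => ?_
    rw [derivative_C_mul_X_pow]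
    congr 2
    push_cast
    field_simp
  · refine natDegree_sum_le_of_forall_le _ _ fun i hi => ?_
    exact (natDegree_C_mul_X_pow_le _ _).trans (Nat.succ_le_succ (Finset.mem_range_succ_iff.1 hi))

open Polynomial in
/-- The shifted Legendre polynomial is orthogonal to all polynomials of lower degree: integrate
Rodrigues' formula by parts. -/
theorem Polynomial.integral_shiftedLegendre_mul (m : ℕ) (q : ℝ[X]) (hq : q.degree < m) :
    ∫ x in (0 : ℝ)..1, ((shiftedLegendre m).map (Int.castRingHom ℝ) * q).eval x = 0 := by
  set R : ℝ[X] := X ^ m * (1 - X) ^ m with hR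
  have hvan : ∀ l < m, (derivative^[l] R).eval 0 = 0 ∧ (derivative^[l] R).eval 1 = 0 := by
    intro l hl
    obtain ⟨r, hr⟩ : X ^ (m - l) ∣ derivative^[l] R :=
      pow_sub_dvd_iterate_derivative_of_pow_dvd l (Dvd.intro _ rfl)
    obtain ⟨s, hs⟩ : (1 - X) ^ (m - l) ∣ derivative^[l] R :=
      pow_sub_dvd_iterate_derivative_of_pow_dvd l (Dvd.intro_left _ rfl)
    refine ⟨by rw [hr]; simp [(Nat.sub_pos_of_lt hl).ne'], by
      rw [hs]; simp [(Nat.sub_pos_of_lt hl).ne']⟩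
  have key : ∀ l ≤ m, ∀ q : ℝ[X], q.degree < l →
      ∫ x in (0 : ℝ)..1, (derivative^[l] R * q).eval x = 0 := by
    intro l
    induction l with
    | zero =>
      intro _ q hq
      have : q = 0 := by
        rw [← degree_eq_bot]
        exact Nat.WithBot.lt_zero_iff.1 (by exact_mod_cast hq)
      simp [this]
    | succ l ih =>
      intro hl q hq
      have h1 := integral_eval_derivative (derivative^[l] R * q) 0 1
      rw [derivative_mul, ← Function.iterate_succ_apply' derivative l R] at h1
      simp only [eval_add, eval_mul, (hvan l hl).1, (hvan l hl).2, zero_mul, sub_zero] at h1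
      rw [intervalIntegral.integral_add] at h1
      · have h2 := ih (Nat.le_of_succ_le hl) (derivative q) (by
          by_cases h0 : q = 0
          · rw [h0, derivative_zero, degree_zero]
            exact WithBot.bot_lt_coe _
          · have := degree_derivative_lt h0
            rw [degree_eq_natDegree h0] at this hq
            have h3 : q.natDegree ≤ l := Nat.lt_succ_iff.1 (by exact_mod_cast hq)
            exact this.trans_le (by exact_mod_cast h3))
        simp only [eval_mul] at h2 ⊢
        rw [h2, add_zero] at h1
        exact h1
      · exact ((Polynomial.continuous _).mul (Polynomial.continuous _)).intervalIntegrable _ _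
      · exact ((Polynomial.continuous _).mul (Polynomial.continuous _)).intervalIntegrable _ _
  have h := key m le_rfl q hq
  have hrod : (m.factorial : ℝ[X]) * (shiftedLegendre m).map (Int.castRingHom ℝ)
      = derivative^[m] R := by
    have := congrArg (Polynomial.map (Int.castRingHom ℝ)) (factorial_mul_shiftedLegendre_eq m)
    rw [← iterate_derivative_map] at this
    simpa [hR] using this
  rw [← hrod] at h
  simp only [eval_mul, eval_natCast, mul_assoc, intervalIntegral.integral_const_mul] at h ⊢
  exact (mul_eq_zero.1 h).resolve_left (by exact_mod_cast m.factorial_ne_zero)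

open Polynomial in
/-- The Gauss–Legendre points carry a quadrature rule with positive weights that is exact up to
degree `2m - 1`; it is stated for an antiderivative `Q` of the integrand. -/
theorem IsGaussLegendre.exists_weights {m : ℕ} {ρ : Fin m → ℝ} (h : IsGaussLegendre ρ)
    (hm : 1 ≤ m) : ∃ w : Fin m → ℝ, (∀ i, 0 < w i) ∧ ∀ Q : ℝ[X], Q.natDegree ≤ 2 * m →
      Q.eval 1 - Q.eval 0 = ∑ i, w i * (derivative Q).eval (ρ i) := by
  classical
  have hinj : Set.InjOn ρ (Finset.univ : Finset (Fin m)) := h.strictMono.injective.injOn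
  set L := (shiftedLegendre m).map (Int.castRingHom ℝ) with hL
  have hLdeg : L.degree = m := by
    rw [hL, degree_map_eq_of_injective (RingHom.injective_int _), degree_shiftedLegendre]
  have hL0 : L ≠ 0 := fun h0 => by simp [h0] at hLdeg
  have hroot : ∀ i, L.eval (ρ i) = 0 := fun i => by
    have := h.root i
    rwa [aeval_def, ← eval_map] at this
  set b := fun i => Lagrange.basis Finset.univ ρ i with hb
  set w : Fin m → ℝ := fun i => ∫ x in (0 : ℝ)..1, (b i).eval x with hw
  have exact : ∀ q : ℝ[X], q.natDegree ≤ 2 * m - 1 →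
      ∫ x in (0 : ℝ)..1, q.eval x = ∑ i, w i * q.eval (ρ i) := by
    intro q hq
    have hmod : (q % L).degree < m := hLdeg ▸ degree_mod_lt q hL0
    have hdiv : (q / L).degree < m := by
      by_cases h0 : q / L = 0
      · rw [h0, degree_zero]; exact WithBot.bot_lt_coe _
      · have hle : L.degree ≤ q.degree := by
          by_contra hlt
          exact h0 ((Polynomial.div_eq_zero_iff hL0).2 (not_le.1 hlt))
        have h1 := degree_add_div hL0 hle
        have hq0 : q ≠ 0 := by rintro rfl; simp at h0
        rw [hLdeg, degree_eq_natDegree h0, degree_eq_natDegree hq0] at h1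
        have h2 : m + (q / L).natDegree = q.natDegree := by exact_mod_cast h1
        rw [degree_eq_natDegree h0]
        exact_mod_cast (show (q / L).natDegree < m by omega)
    have hqe : ∀ x, q.eval x = (L * (q / L)).eval x + (q % L).eval x := fun x => by
      rw [← eval_add, EuclideanDomain.div_add_mod]
    have hint : ∫ x in (0 : ℝ)..1, q.eval x = ∫ x in (0 : ℝ)..1, (q % L).eval x := by
      simp only [hqe]
      rw [intervalIntegral.integral_add ((Polynomial.continuous _).intervalIntegrable _ _)
        ((Polynomial.continuous _).intervalIntegrable _ _),
        integral_shiftedLegendre_mul m _ hdiv, zero_add]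
    have hr : q % L = ∑ i, C (q.eval (ρ i)) * b i := by
      have := Lagrange.eq_interpolate_of_eval_eq (fun i => q.eval (ρ i)) hinj
        (f := q % L) (by simpa using hmod) (fun i _ => by rw [hqe, eval_mul, hroot]; simp)
      rw [this, Lagrange.interpolate_apply]
    rw [hint, hr]
    simp only [eval_finsetSum, eval_mul, eval_C]
    have hi : ∀ i ∈ (Finset.univ : Finset (Fin m)), IntervalIntegrable
        (fun x => q.eval (ρ i) * (b i).eval x) MeasureTheory.volume 0 1 := fun i _ =>
      (continuous_const.mul (Polynomial.continuous _)).intervalIntegrable _ _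
    rw [intervalIntegral.integral_finsetSum hi]
    refine Finset.sum_congr rfl fun i _ => ?_
    rw [intervalIntegral.integral_const_mul, mul_comm]
  refine ⟨w, fun i => ?_, fun Q hQ => ?_⟩
  · have hdeg : (b i * b i).natDegree ≤ 2 * m - 1 := by
      refine natDegree_mul_le.trans ?_
      rw [Lagrange.natDegree_basis hinj (Finset.mem_univ i)]
      simp only [Finset.card_univ, Fintype.card_fin]
      omega
    have h1 := exact _ hdeg
    rw [Finset.sum_eq_single i] at h1
    · rw [eval_mul, Lagrange.eval_basis_self hinj (Finset.mem_univ i), one_mul, mul_one] at h1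
      rw [← h1]
      refine intervalIntegral.integral_pos one_pos (Polynomial.continuous _).continuousOn
        (fun x _ => by rw [eval_mul]; exact mul_self_nonneg _) ⟨ρ i, Ioo_subset_Icc_self (h.mem i), ?_⟩
      rw [eval_mul, Lagrange.eval_basis_self hinj (Finset.mem_univ i)]
      norm_num
    · intro j _ hj
      rw [eval_mul, Lagrange.eval_basis_of_ne hj.symm (Finset.mem_univ j)]
      ring
    · simp
  · rw [← integral_eval_derivative, exact]
    exact (natDegree_derivative_le Q).trans (by omega)

/-! ### One collocation step on the unit interval -/

open Polynomial in
/-- Values at the `m` points bound all derivatives of a polynomial of degree less than `m`. -/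
theorem Polynomial.exists_iterate_derivative_bound {m : ℕ} {ρ : Fin m → ℝ}
    (hρ : Function.Injective ρ) (r : ℕ) : ∃ C, 0 ≤ C ∧ ∀ q : ℝ[X], q.degree < m → ∀ M : ℝ,
      (∀ i, |q.eval (ρ i)| ≤ M) → ∀ s ∈ Icc (0 : ℝ) 1, |(derivative^[r] q).eval s| ≤ C * M := by
  classical
  set b := fun i => Lagrange.basis Finset.univ ρ i with hb
  have hbd : ∀ i, ∃ D, ∀ s ∈ Icc (0 : ℝ) 1, ‖(derivative^[r] (b i)).eval s‖ ≤ D := fun i =>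
    isCompact_Icc.exists_bound_of_continuousOn (Polynomial.continuous _).continuousOn
  choose D hD using hbd
  refine ⟨∑ i, |D i|, Finset.sum_nonneg fun _ _ => abs_nonneg _, fun q hq M hM s hs => ?_⟩
  have h := Lagrange.eq_interpolate (s := Finset.univ) (v := ρ) hρ.injOn (f := q) (by simpa using hq)
  rw [Lagrange.interpolate_apply] at h
  rw [h, iterate_derivative_sum, eval_finsetSum, Finset.sum_mul]
  refine (Finset.abs_sum_le_sum_abs _ _).trans (Finset.sum_le_sum fun i _ => ?_)
  rw [iterate_derivative_C_mul, eval_mul, eval_C, abs_mul, mul_comm]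
  exact mul_le_mul ((hD i s hs).trans (le_abs_self _)) (hM i) (abs_nonneg _) (abs_nonneg _)

namespace Polynomial

variable {σ : Type*} {m : ℕ}

/-- The polynomial with vanishing constant term and the given higher coefficients. -/
noncomputable def ofCoeff (c : Fin m → σ → ℝ) (p : σ) : ℝ[X] :=
  ∑ l : Fin m, C (c l p) * X ^ ((l : ℕ) + 1)

theorem coeff_ofCoeff (c : Fin m → σ → ℝ) (p : σ) (l : Fin m) :
    (ofCoeff c p).coeff (l + 1) = c l p := by
  rw [ofCoeff, finsetSum_coeff, Finset.sum_eq_single l]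
  · simp
  · intro b _ hb
    rw [coeff_C_mul_X_pow, if_neg]
    intro h
    exact hb (Fin.ext (by omega))
  · simp

theorem natDegree_ofCoeff_le (c : Fin m → σ → ℝ) (p : σ) : (ofCoeff c p).natDegree ≤ m :=
  natDegree_sum_le_of_forall_le _ _ fun l _ => (natDegree_C_mul_X_pow_le _ _).trans l.2

theorem eval_zero_ofCoeff (c : Fin m → σ → ℝ) (p : σ) : (ofCoeff c p).eval 0 = 0 := by
  simp [ofCoeff, eval_finsetSum]

end Polynomial

section Reference

variable {σ : Type*} [Fintype σ] {m : ℕ} {ρ : Fin m → ℝ}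

open Polynomial in
/-- The vector polynomial `y` satisfies `y' = B y + G` at the collocation points of the unit
interval; the step size is absorbed into `B` and `G`. -/
structure IsUnitCollocation (ρ : Fin m → ℝ) (B : Fin m → Matrix σ σ ℝ) (G : Fin m → σ → ℝ)
    (y : σ → ℝ[X]) : Prop where
  natDegree_le : ∀ p, (y p).natDegree ≤ m
  eq : ∀ i p, (derivative (y p)).eval (ρ i) = (B i *ᵥ (fun q => (y q).eval (ρ i)) + G i) p

namespace IsUnitCollocation

open Polynomial

variable {B : Fin m → Matrix σ σ ℝ} {G G' : Fin m → σ → ℝ} {y y' : σ → ℝ[X]}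

/-- Energy is not created if `B` is negative semidefinite: `|y|²` has degree `2m`, so its increment
is the quadrature sum of `2 y · y'`. -/
theorem energy_le (h : IsUnitCollocation ρ B 0 y) (hρ : IsGaussLegendre ρ) (hm : 1 ≤ m)
    (hB : ∀ i z, z ⬝ᵥ (B i *ᵥ z) ≤ 0) :
    ∑ p, (y p).eval 1 ^ 2 ≤ ∑ p, (y p).eval 0 ^ 2 := by
  obtain ⟨w, hw, hQ⟩ := hρ.exists_weights hm
  have h1 : ∀ p, (y p).eval 1 ^ 2 - (y p).eval 0 ^ 2
      = ∑ i, w i * (2 * ((y p).eval (ρ i) * (B i *ᵥ (fun q => (y q).eval (ρ i))) p)) := by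
    intro p
    have hdeg : (y p ^ 2).natDegree ≤ 2 * m :=
      natDegree_pow_le.trans (Nat.mul_le_mul_left 2 (h.natDegree_le p))
    have h2 := hQ _ hdeg
    simp only [eval_pow] at h2
    rw [h2]
    refine Finset.sum_congr rfl fun i _ => ?_
    have := h.eq i p
    simp only [Pi.add_apply, Pi.zero_apply, add_zero] at this
    rw [← this, sq, derivative_mul, eval_add, eval_mul, eval_mul]
    ring
  rw [← sub_nonpos, ← Finset.sum_sub_distrib]
  simp only [h1]
  rw [Finset.sum_comm]
  refine Finset.sum_nonpos fun i _ => ?_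
  rw [← Finset.mul_sum, ← Finset.mul_sum]
  have := hB i (fun q => (y q).eval (ρ i))
  exact mul_nonpos_of_nonneg_of_nonpos (hw i).le
    (mul_nonpos_of_nonneg_of_nonpos zero_le_two this)

/-- The increment quotient `(y - y(0)) / s`, which is the polynomial `divX`, is controlled by the
right-hand side at `y(0)`, without any condition on the size of `B`. -/
theorem sum_divX_le (h : IsUnitCollocation ρ B G y)
    (hB : ∀ i z, z ⬝ᵥ (B i *ᵥ z) ≤ 0) (hρ : IsGaussLegendre ρ) (hm : 1 ≤ m)
    {w : Fin m → ℝ} (hw : ∀ i, 0 < w i) (hQ : ∀ Q : ℝ[X], Q.natDegree ≤ 2 * m →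
      Q.eval 1 - Q.eval 0 = ∑ i, w i * (derivative Q).eval (ρ i)) :
    ∑ i, w i * ∑ p, (divX (y p)).eval (ρ i) ^ 2
      ≤ 4 * ∑ i, w i * ∑ p, (B i *ᵥ (fun q => (y q).eval 0) + G i) p ^ 2 := by
  set π : σ → ℝ[X] := fun p => divX (y p) with hπ
  set β : Fin m → σ → ℝ := fun i => B i *ᵥ (fun q => (y q).eval 0) + G i with hβ
  have hy : ∀ p, y p = X * π p + C ((y p).coeff 0) := fun p => (X_mul_divX_add (y p)).symm
  have hy0 : ∀ p, (y p).coeff 0 = (y p).eval 0 := fun p => coeff_zero_eq_eval_zero _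
  -- the quadrature rule applied to `s π²`
  have h1 : ∀ p, 0 ≤ ∑ i, w i * ((π p).eval (ρ i) ^ 2
      + 2 * ρ i * ((π p).eval (ρ i) * (derivative (π p)).eval (ρ i))) := by
    intro p
    have hdeg : (X * π p ^ 2).natDegree ≤ 2 * m := by
      refine natDegree_mul_le.trans ?_
      have h2 : (π p).natDegree ≤ m - 1 := by
        rw [hπ]; simp only
        rw [natDegree_divX_eq_natDegree_tsub_one]
        exact Nat.sub_le_sub_right (h.natDegree_le p) 1
      rw [natDegree_X]
      have := natDegree_pow_le (p := π p) (n := 2)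
      omega
    have h2 := hQ _ hdeg
    have h3 : 0 ≤ (X * π p ^ 2).eval 1 - (X * π p ^ 2).eval 0 := by
      simp only [eval_mul, eval_X, eval_pow, one_mul, zero_mul, sub_zero]
      positivity
    rw [h2] at h3
    refine h3.trans_eq (Finset.sum_congr rfl fun i _ => ?_)
    rw [sq, derivative_mul, derivative_mul, derivative_X]
    simp only [eval_add, eval_mul, eval_X, eval_one]
    ring
  -- the collocation equation tested with `π`
  have h2 : ∀ i, ∑ p, ((π p).eval (ρ i) ^ 2
      + ρ i * ((π p).eval (ρ i) * (derivative (π p)).eval (ρ i)))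
      ≤ ∑ p, (π p).eval (ρ i) * β i p := by
    intro i
    have h3 : ∀ p, (π p).eval (ρ i) + ρ i * (derivative (π p)).eval (ρ i)
        = ρ i * (B i *ᵥ (fun q => (π q).eval (ρ i))) p + β i p := by
      intro p
      have h4 := h.eq i p
      have h5 : (fun q => (y q).eval (ρ i))
          = ρ i • (fun q => (π q).eval (ρ i)) + fun q => (y q).eval 0 := by
        funext q
        have := congrArg (eval (ρ i)) (hy q)
        simpa [hy0] using this
      rw [h5, Matrix.mulVec_add, Matrix.mulVec_smul] at h4
      have h6 : (derivative (y p)).eval (ρ i)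
          = (π p).eval (ρ i) + ρ i * (derivative (π p)).eval (ρ i) := by
        conv_lhs => rw [hy p]
        simp
      rw [← h6, h4, hβ]
      simp only [Pi.add_apply, Pi.smul_apply, smul_eq_mul]
      ring
    have h4 : ∑ p, ((π p).eval (ρ i) ^ 2
        + ρ i * ((π p).eval (ρ i) * (derivative (π p)).eval (ρ i)))
        = ρ i * ((fun q => (π q).eval (ρ i)) ⬝ᵥ (B i *ᵥ (fun q => (π q).eval (ρ i))))
          + ∑ p, (π p).eval (ρ i) * β i p := by
      rw [dotProduct, Finset.mul_sum, ← Finset.sum_add_distrib]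
      refine Finset.sum_congr rfl fun p _ => ?_
      linear_combination (π p).eval (ρ i) * h3 p
    rw [h4]
    have := mul_nonpos_of_nonneg_of_nonpos (hρ.mem i).1.le (hB i fun q => (π q).eval (ρ i))
    linarith
  have h3 : ∑ i, w i * ∑ p, (π p).eval (ρ i) ^ 2
      ≤ ∑ i, w i * ∑ p, 2 * ((π p).eval (ρ i) * β i p) := by
    have h4 : 0 ≤ ∑ i, w i * ∑ p, ((π p).eval (ρ i) ^ 2
        + 2 * ρ i * ((π p).eval (ρ i) * (derivative (π p)).eval (ρ i))) := by
      have := Finset.sum_nonneg fun p (_ : p ∈ Finset.univ) => h1 p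
      rw [Finset.sum_comm] at this
      simpa only [Finset.mul_sum] using this
    have h5 : ∑ i, w i * ∑ p, 2 * ((π p).eval (ρ i) ^ 2
        + ρ i * ((π p).eval (ρ i) * (derivative (π p)).eval (ρ i)))
        ≤ ∑ i, w i * ∑ p, 2 * ((π p).eval (ρ i) * β i p) := by
      refine Finset.sum_le_sum fun i _ => mul_le_mul_of_nonneg_left ?_ (hw i).le
      rw [← Finset.mul_sum, ← Finset.mul_sum]
      exact mul_le_mul_of_nonneg_left (h2 i) zero_le_two
    have h6 : ∑ i, w i * ∑ p, 2 * ((π p).eval (ρ i) ^ 2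
        + ρ i * ((π p).eval (ρ i) * (derivative (π p)).eval (ρ i)))
        = ∑ i, w i * ∑ p, (π p).eval (ρ i) ^ 2 + ∑ i, w i * ∑ p, ((π p).eval (ρ i) ^ 2
        + 2 * ρ i * ((π p).eval (ρ i) * (derivative (π p)).eval (ρ i))) := by
      rw [← Finset.sum_add_distrib]
      refine Finset.sum_congr rfl fun i _ => ?_
      rw [← mul_add, ← Finset.sum_add_distrib]
      congr 1
      refine Finset.sum_congr rfl fun p _ => ?_
      ring
    linarith
  have h4 : ∑ i, w i * ∑ p, 2 * ((π p).eval (ρ i) * β i p)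
      ≤ 2⁻¹ * ∑ i, w i * ∑ p, (π p).eval (ρ i) ^ 2 + 2 * ∑ i, w i * ∑ p, β i p ^ 2 := by
    rw [Finset.mul_sum, Finset.mul_sum, ← Finset.sum_add_distrib]
    refine Finset.sum_le_sum fun i _ => ?_
    have : ∑ p, 2 * ((π p).eval (ρ i) * β i p)
        ≤ ∑ p, (2⁻¹ * (π p).eval (ρ i) ^ 2 + 2 * β i p ^ 2) :=
      Finset.sum_le_sum fun p _ => by nlinarith [sq_nonneg ((π p).eval (ρ i) - 2 * β i p)]
    rw [Finset.sum_add_distrib, ← Finset.mul_sum (a := (2⁻¹ : ℝ)),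
      ← Finset.mul_sum (f := fun p => β i p ^ 2)] at this
    refine (mul_le_mul_of_nonneg_left this (hw i).le).trans_eq ?_
    ring
  linarith

theorem degree_divX_lt (h : IsUnitCollocation ρ B G y) (hm : 1 ≤ m) (p : σ) :
    (divX (y p)).degree < m := by
  refine degree_le_natDegree.trans_lt ?_
  rw [natDegree_divX_eq_natDegree_tsub_one]
  have := h.natDegree_le p
  exact_mod_cast (show (y p).natDegree - 1 < m by omega)

/-- Uniqueness, with no restriction on the size of `B`: for vanishing initial values the polynomials
`y / x` vanish at all Gauss–Legendre points. -/
theorem eq_zero (h : IsUnitCollocation ρ B 0 y) (hρ : IsGaussLegendre ρ) (hm : 1 ≤ m)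
    (hB : ∀ i z, z ⬝ᵥ (B i *ᵥ z) ≤ 0) (h0 : ∀ p, (y p).eval 0 = 0) (p : σ) : y p = 0 := by
  obtain ⟨w, hw, hQ⟩ := hρ.exists_weights hm
  have h1 := h.sum_divX_le hB hρ hm hw hQ
  have hz : (fun q => (y q).eval 0) = (0 : σ → ℝ) := funext h0
  simp only [hz, Matrix.mulVec_zero, add_zero, Pi.zero_apply, ne_eq, OfNat.ofNat_ne_zero,
    not_false_eq_true, zero_pow, Finset.sum_const_zero, mul_zero] at h1
  have h2 : ∀ i, (divX (y p)).eval (ρ i) = 0 := by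
    intro i
    have h3 : ∀ i ∈ Finset.univ, 0 ≤ w i * ∑ p, (divX (y p)).eval (ρ i) ^ 2 := fun i _ =>
      mul_nonneg (hw i).le (Finset.sum_nonneg fun p _ => sq_nonneg _)
    have h4 := (Finset.sum_eq_zero_iff_of_nonneg h3).1 (le_antisymm h1 (Finset.sum_nonneg h3)) i
      (Finset.mem_univ i)
    have h5 := (mul_eq_zero.1 h4).resolve_left (hw i).ne'
    have h6 := (Finset.sum_eq_zero_iff_of_nonneg fun p _ => sq_nonneg _).1 h5 p (Finset.mem_univ p)
    exact pow_eq_zero_iff two_ne_zero |>.1 h6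
  have h3 : divX (y p) = 0 := Polynomial.eq_zero_of_degree_lt_of_eval_index_eq_zero
    (s := Finset.univ) (v := ρ) hρ.strictMono.injective.injOn (by simpa using h.degree_divX_lt hm p)
    (fun i _ => h2 i)
  rw [← X_mul_divX_add (y p), h3, coeff_zero_eq_eval_zero, h0 p]
  simp

theorem sub (h : IsUnitCollocation ρ B G y) (h' : IsUnitCollocation ρ B G' y') :
    IsUnitCollocation ρ B (G - G') (fun p => y p - y' p) := by
  refine ⟨fun p => (natDegree_sub_le _ _).trans (max_le (h.natDegree_le p) (h'.natDegree_le p)),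
    fun i p => ?_⟩
  have : (fun q => (y q - y' q).eval (ρ i))
      = (fun q => (y q).eval (ρ i)) - fun q => (y' q).eval (ρ i) := by
    funext q; simp
  rw [this, Matrix.mulVec_sub, derivative_sub, eval_sub, h.eq, h'.eq]
  simp only [Pi.add_apply, Pi.sub_apply]
  ring

/-- Existence follows from uniqueness, since the collocation equations are a square linear system
for the coefficients. -/
theorem exists_of_semidefinite (hρ : IsGaussLegendre ρ) (hm : 1 ≤ m)
    (hB : ∀ i z, z ⬝ᵥ (B i *ᵥ z) ≤ 0) (G : Fin m → σ → ℝ) (y₀ : σ → ℝ) :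
    ∃ y : σ → ℝ[X], IsUnitCollocation ρ B G y ∧ ∀ p, (y p).eval 0 = y₀ p := by
  have hadd : ∀ (c d : Fin m → σ → ℝ) p, ofCoeff (c + d) p = ofCoeff c p + ofCoeff d p := by
    intro c d p
    simp [ofCoeff, add_mul, Finset.sum_add_distrib]
  have hsmul : ∀ (r : ℝ) (c : Fin m → σ → ℝ) p, ofCoeff (r • c) p = C r * ofCoeff c p := by
    intro r c p
    simp [ofCoeff, mul_assoc, Finset.mul_sum]
  let Φ : (Fin m → σ → ℝ) →ₗ[ℝ] (Fin m → σ → ℝ) :=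
    { toFun := fun c i p => (derivative (ofCoeff c p)).eval (ρ i)
        - (B i *ᵥ fun q => (ofCoeff c q).eval (ρ i)) p
      map_add' := by
        intro c d
        funext i p
        have : (fun q => (ofCoeff (c + d) q).eval (ρ i))
            = (fun q => (ofCoeff c q).eval (ρ i)) + fun q => (ofCoeff d q).eval (ρ i) := by
          funext q; simp [hadd]
        rw [this, Matrix.mulVec_add, hadd, derivative_add, eval_add]
        simp only [Pi.add_apply]
        ring
      map_smul' := by
        intro r c
        funext i p
        have : (fun q => (ofCoeff (r • c) q).eval (ρ i))
            = r • fun q => (ofCoeff c q).eval (ρ i) := by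
          funext q; simp [hsmul]
        rw [this, Matrix.mulVec_smul, hsmul, derivative_C_mul, eval_mul, eval_C]
        simp only [Pi.smul_apply, smul_eq_mul, RingHom.id_apply]
        ring }
  have hinj : Function.Injective Φ := by
    rw [injective_iff_map_eq_zero]
    intro c hc
    have h : IsUnitCollocation ρ B 0 (ofCoeff c) := by
      refine ⟨natDegree_ofCoeff_le c, fun i p => ?_⟩
      have := congrFun (congrFun hc i) p
      simpa [Φ, sub_eq_zero] using this
    funext l p
    rw [← coeff_ofCoeff c p l, h.eq_zero hρ hm hB (eval_zero_ofCoeff c) p]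
    simp
  obtain ⟨c, hc⟩ := LinearMap.injective_iff_surjective.1 hinj fun i => B i *ᵥ y₀ + G i
  refine ⟨fun p => C (y₀ p) + ofCoeff c p, ⟨fun p => ?_, fun i p => ?_⟩, fun p => ?_⟩
  · refine (natDegree_add_le _ _).trans (max_le ?_ (natDegree_ofCoeff_le c p))
    simp
  · have := congrFun (congrFun hc i) p
    have h1 : (fun q => (C (y₀ q) + ofCoeff c q).eval (ρ i))
        = y₀ + fun q => (ofCoeff c q).eval (ρ i) := by
      funext q; simp
    rw [h1, Matrix.mulVec_add, derivative_add, derivative_C, zero_add]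
    simp only [Φ, LinearMap.coe_mk, AddHom.coe_mk, Pi.add_apply] at this ⊢
    linarith
  · simp [eval_zero_ofCoeff]

end IsUnitCollocation

end Reference

/-! ### Linear systems of ordinary differential equations -/

theorem Matrix.norm_mulVec_le_of_entries {σ : Type*} [Fintype σ] {B : Matrix σ σ ℝ} {b₀ : ℝ}
    (hb : 0 ≤ b₀) (hB : ∀ p q, |B p q| ≤ b₀) (x : σ → ℝ) :
    ‖B *ᵥ x‖ ≤ Fintype.card σ * b₀ * ‖x‖ := by
  refine (pi_norm_le_iff_of_nonneg (by positivity)).2 fun p => ?_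
  rw [Real.norm_eq_abs, Matrix.mulVec, dotProduct]
  refine (Finset.abs_sum_le_sum_abs _ _).trans ?_
  have : ∀ q ∈ Finset.univ, |B p q * x q| ≤ b₀ * ‖x‖ := fun q _ => by
    rw [abs_mul]
    exact mul_le_mul (hB p q) (norm_le_pi_norm x q) (abs_nonneg _) hb
  refine (Finset.sum_le_card_nsmul _ _ _ this).trans_eq ?_
  rw [nsmul_eq_mul, Finset.card_univ]
  ring

/-- A linear system whose coefficients are continuous on `ℝ` has a solution on every compact
interval. The vector field is made bounded by clamping the argument; Grönwall's inequality shows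
that the solution of the clamped system never feels the clamp. -/
theorem exists_hasDerivWithinAt_linear {σ : Type*} [Fintype σ] {a b : ℝ} (hab : a < b)
    {B : ℝ → Matrix σ σ ℝ} {G : ℝ → σ → ℝ} (hB : ∀ p q, Continuous fun t => B t p q)
    (hG : Continuous G) (v₀ : σ → ℝ) :
    ∃ v : ℝ → σ → ℝ, v a = v₀ ∧
      ∀ t ∈ Icc a b, HasDerivWithinAt v (B t *ᵥ v t + G t) (Icc a b) t := by
  obtain ⟨b₀, hb0, hb⟩ : ∃ b₀, 0 ≤ b₀ ∧ ∀ t ∈ Icc a b, ∀ p q, |B t p q| ≤ b₀ := by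
    have : ∀ p q, ∃ D, ∀ t ∈ Icc a b, ‖B t p q‖ ≤ D := fun p q =>
      isCompact_Icc.exists_bound_of_continuousOn (hB p q).continuousOn
    choose D hD using this
    refine ⟨∑ p, ∑ q, |D p q|,
      Finset.sum_nonneg fun _ _ => Finset.sum_nonneg fun _ _ => abs_nonneg _,
      fun t ht p q => ((hD p q t ht).trans (le_abs_self _)).trans ?_⟩
    refine (Finset.single_le_sum (f := fun q => |D p q|) (fun _ _ => abs_nonneg _)
      (Finset.mem_univ q)).trans ?_
    exact Finset.single_le_sum (f := fun p => ∑ q, |D p q|)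
      (fun _ _ => Finset.sum_nonneg fun _ _ => abs_nonneg _) (Finset.mem_univ p)
  obtain ⟨γ', hγ'⟩ := isCompact_Icc (a := a) (b := b).exists_bound_of_continuousOn hG.continuousOn
  obtain ⟨γ, hγ0, hγ⟩ : ∃ γ, 0 ≤ γ ∧ ∀ t ∈ Icc a b, ‖G t‖ ≤ γ :=
    ⟨max γ' 0, le_max_right _ _, fun t ht => (hγ' t ht).trans (le_max_left _ _)⟩
  set β : ℝ := Fintype.card σ * b₀ + 1 with hβ
  have hβ0 : 0 < β := by positivity
  have hβx : ∀ t ∈ Icc a b, ∀ x : σ → ℝ, ‖B t *ᵥ x‖ ≤ β * ‖x‖ := fun t ht x =>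
    (Matrix.norm_mulVec_le_of_entries hb0 (hb t ht) x).trans
      (mul_le_mul_of_nonneg_right (by rw [hβ]; linarith) (norm_nonneg x))
  set R : ℝ := gronwallBound ‖v₀‖ β γ (b - a) with hR
  have hmono : ∀ s ≤ b - a, gronwallBound ‖v₀‖ β γ s ≤ R := by
    intro s hs
    rw [hR]
    simp only [gronwallBound_of_K_ne_0 hβ0.ne']
    gcongr
  have hR0 : 0 ≤ R := by
    have := hmono 0 (sub_nonneg.2 hab.le)
    rw [gronwallBound_x0] at this
    exact (norm_nonneg _).trans this
  set cl : (σ → ℝ) → σ → ℝ := fun x p => max (-R) (min R (x p)) with hcl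
  have hcl1 : ∀ x, ‖cl x‖ ≤ R := fun x => (pi_norm_le_iff_of_nonneg hR0).2 fun p => by
    rw [Real.norm_eq_abs, abs_le]
    exact ⟨le_max_left _ _, max_le (by linarith) (min_le_left _ _)⟩
  have hcl2 : ∀ x, ‖cl x‖ ≤ ‖x‖ := fun x => (pi_norm_le_iff_of_nonneg (norm_nonneg x)).2 fun p => by
    refine le_trans ?_ (norm_le_pi_norm x p)
    rw [Real.norm_eq_abs, Real.norm_eq_abs, abs_le]
    have h1 := neg_abs_le (x p)
    have h2 := le_abs_self (x p)
    have h3 := abs_nonneg (x p)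
    exact ⟨le_max_of_le_right (le_min (by linarith) h1),
      max_le (by linarith) ((min_le_right _ _).trans h2)⟩
  have hcl3 : ∀ x, ‖x‖ ≤ R → cl x = x := fun x hx => funext fun p => by
    have := abs_le.1 ((norm_le_pi_norm x p).trans hx)
    rw [hcl]; simp only
    rw [min_eq_right this.2, max_eq_right this.1]
  have hcl4 : ∀ x y, ‖cl x - cl y‖ ≤ ‖x - y‖ := fun x y =>
    (pi_norm_le_iff_of_nonneg (norm_nonneg _)).2 fun p => by
      refine le_trans ?_ (norm_le_pi_norm (x - y) p)
      rw [Real.norm_eq_abs, Real.norm_eq_abs]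
      simp only [hcl, Pi.sub_apply]
      refine (abs_max_sub_max_le_max _ _ _ _).trans (max_le (by simp) ?_)
      exact (abs_min_sub_min_le_max _ _ _ _).trans (max_le (by simp) le_rfl)
  have hL0 : 0 ≤ β * R + γ := by positivity
  have hPL : IsPicardLindelof (fun t x => B t *ᵥ cl x + G t) (tmin := a) (tmax := b)
      ⟨a, left_mem_Icc.2 hab.le⟩ v₀ (⟨(β * R + γ), hL0⟩ * ⟨b - a, sub_nonneg.2 hab.le⟩) 0
      ⟨β * R + γ, hL0⟩ ⟨β, hβ0.le⟩ := by
    refine ⟨fun t ht => ?_, fun x _ => ?_, fun t ht x _ => ?_, ?_⟩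
    · refine LipschitzWith.lipschitzOnWith (LipschitzWith.of_dist_le_mul fun x y => ?_)
      rw [dist_eq_norm, dist_eq_norm, add_sub_add_right_eq_sub, ← Matrix.mulVec_sub]
      exact (hβx t ht _).trans (mul_le_mul_of_nonneg_left (hcl4 x y) hβ0.le)
    · refine Continuous.continuousOn (Continuous.add ?_ hG)
      refine continuous_pi fun p => ?_
      simp only [Matrix.mulVec, dotProduct]
      exact continuous_finsetSum _ fun q _ => (hB p q).mul continuous_const
    · refine (norm_add_le _ _).trans (add_le_add ((hβx t ht _).trans ?_) (hγ t ht))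
      exact mul_le_mul_of_nonneg_left (hcl1 x) hβ0.le
    · simp only [sub_self, max_eq_left (sub_nonneg.2 hab.le), NNReal.coe_zero, sub_zero]
      exact le_rfl
  obtain ⟨v, hv0, hv⟩ := hPL.exists_eq_forall_mem_Icc_hasDerivWithinAt₀
  have hcont : ContinuousOn v (Icc a b) := fun t ht => (hv t ht).continuousWithinAt
  have hbound := norm_le_gronwallBound_of_norm_deriv_right_le (δ := ‖v₀‖) (K := β) (ε := γ) hcont
    (fun t ht => (hv t (Ico_subset_Icc_self ht)).mono_of_mem_nhdsWithin
      (Icc_mem_nhdsGE_of_mem ht)) (by rw [hv0])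
    (fun t ht => (norm_add_le _ _).trans (add_le_add ((hβx t (Ico_subset_Icc_self ht) _).trans
      (mul_le_mul_of_nonneg_left (hcl2 _) hβ0.le)) (hγ t (Ico_subset_Icc_self ht))))
  refine ⟨v, hv0, fun t ht => ?_⟩
  have h1 := hv t ht
  rwa [hcl3 _ ((hbound t ht).trans (hmono _ (sub_le_sub_right ht.2 a)))] at h1

/-- A linear system whose coefficients are Lipschitz continuous on the open interval has a
solution that is continuous up to the end points. -/
theorem exists_hasDerivAt_linear {σ : Type*} [Fintype σ] {a b : ℝ} (hab : a < b)
    {B : ℝ → Matrix σ σ ℝ} {G : ℝ → σ → ℝ}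
    (hB : ∀ p q, ∃ K, LipschitzOnWith K (fun t => B t p q) (Ioo a b))
    (hG : ∀ p, ∃ K, LipschitzOnWith K (fun t => G t p) (Ioo a b)) (v₀ : σ → ℝ) :
    ∃ v : ℝ → σ → ℝ, ContinuousOn v (Icc a b) ∧ v a = v₀ ∧
      ∀ t ∈ Ioo a b, HasDerivAt v (B t *ᵥ v t + G t) t := by
  have hB' : ∀ p q, ∃ f : ℝ → ℝ, Continuous f ∧ EqOn (fun t => B t p q) f (Ioo a b) := fun p q => by
    obtain ⟨K, hK⟩ := hB p q
    obtain ⟨f, h1, h2⟩ := hK.extend_real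
    exact ⟨f, h1.continuous, h2⟩
  have hG' : ∀ p, ∃ f : ℝ → ℝ, Continuous f ∧ EqOn (fun t => G t p) f (Ioo a b) := fun p => by
    obtain ⟨K, hK⟩ := hG p
    obtain ⟨f, h1, h2⟩ := hK.extend_real
    exact ⟨f, h1.continuous, h2⟩
  choose B' hB1 hB2 using hB'
  choose G' hG1 hG2 using hG'
  obtain ⟨v, hv0, hv⟩ := exists_hasDerivWithinAt_linear hab (B := fun t p q => B' p q t)
    (G := fun t p => G' p t) hB1 (continuous_pi hG1) v₀
  refine ⟨v, fun t ht => (hv t ht).continuousWithinAt, hv0, fun t ht => ?_⟩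
  have h := (hv t (Ioo_subset_Icc_self ht)).hasDerivAt (Icc_mem_nhds ht.1 ht.2)
  have e1 : (fun p q => B' p q t) = B t := funext fun p => funext fun q => (hB2 p q ht).symm
  have e2 : (fun p => G' p t) = G t := funext fun p => (hG2 p ht).symm
  rw [e2] at h
  exact e1 ▸ h

/-- The terminal value problem for a linear system, by reflection of the time axis. -/
theorem exists_hasDerivAt_linear_backward {σ : Type*} [Fintype σ] {a b : ℝ} (hab : a < b)
    {B : ℝ → Matrix σ σ ℝ}
    (hB : ∀ p q, ∃ K, LipschitzOnWith K (fun t => B t p q) (Ioo a b)) (v₀ : σ → ℝ) :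
    ∃ v : ℝ → σ → ℝ, ContinuousOn v (Icc a b) ∧ v b = v₀ ∧
      ∀ t ∈ Ioo a b, HasDerivAt v (B t *ᵥ v t) t := by
  have hmaps : ∀ t ∈ Ioo a b, a + b - t ∈ Ioo a b := fun t ht =>
    ⟨by linarith [ht.2], by linarith [ht.1]⟩
  have hlip : LipschitzWith 1 fun t : ℝ => a + b - t :=
    LipschitzWith.of_dist_le_mul fun x y => by
      rw [Real.dist_eq, Real.dist_eq, NNReal.coe_one, one_mul, abs_sub_comm]
      exact le_of_eq (congrArg _ (by ring))
  obtain ⟨v, hc, hv0, hv⟩ := exists_hasDerivAt_linear hab (B := fun t => -B (a + b - t))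
    (G := fun _ => 0) (fun p q => by
      obtain ⟨K, hK⟩ := hB p q
      exact ⟨_, (hK.comp hlip.lipschitzOnWith hmaps).neg⟩)
    (fun p => ⟨0, (LipschitzWith.const _).lipschitzOnWith⟩) v₀
  refine ⟨fun t => v (a + b - t), ?_, ?_, fun t ht => ?_⟩
  · exact hc.comp (hlip.continuous.continuousOn) fun t ht => ⟨by linarith [ht.2], by linarith [ht.1]⟩
  · simpa using hv0
  · have h1 := hv _ (hmaps t ht)
    have h2 : HasDerivAt (fun s : ℝ => a + b - s) (-1) t := by
      simpa using (hasDerivAt_id t).const_sub (a + b)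
    have h3 := h1.scomp t h2
    refine h3.congr_deriv ?_
    simp [Matrix.neg_mulVec]

/-! ### Families of functions of time on open intervals -/

/-- Families of functions of time, the `i`-th one on the open interval `(a i, b i)`. -/
def timeFrame {ι : Type*} (a b : ι → ℝ) : Frame (ι × ℝ) Unit where
  dom := {o | o.2 ∈ Ioo (a o.1) (b o.1)}
  line _ o s := (o.1, s)
  coord _ o := o.2
  seg _ o := Ioo (a o.1) (b o.1)
  line_coord _ _ _ := rfl
  coord_mem _ _ h := h
  line_mem _ _ _ _ h := h

section TimeFrame

variable {ι : Type*} {a b : ι → ℝ} {k : ℕ}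

theorem timeFrame_der_iff {f f' : ι × ℝ → ℝ} : (timeFrame a b).Der () f f' ↔
    ∀ i, ∀ t ∈ Ioo (a i) (b i), HasDerivAt (fun s => f (i, s)) (f' (i, t)) t := by
  constructor
  · intro h i t ht
    exact (h (i, t) ht).hasDerivAt (Ioo_mem_nhds ht.1 ht.2)
  · rintro h ⟨i, t⟩ ht
    exact (h i t ht).hasDerivWithinAt

theorem timeFrame_reg_succ {f f' : ι × ℝ → ℝ} (hf : (timeFrame a b).Bdd f)
    (h : ∀ i, ∀ t ∈ Ioo (a i) (b i), HasDerivAt (fun s => f (i, s)) (f' (i, t)) t)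
    (hf' : (timeFrame a b).Reg k f') : (timeFrame a b).Reg (k + 1) f :=
  ⟨hf, fun _ => ⟨f', timeFrame_der_iff.2 h, hf'⟩⟩

theorem Frame.Reg.exists_lipschitzOnWith {f : ι × ℝ → ℝ} (h : (timeFrame a b).Reg 1 f) (i : ι) :
    ∃ K, LipschitzOnWith K (fun t => f (i, t)) (Ioo (a i) (b i)) := by
  obtain ⟨f', h1, h2⟩ := h.2 ()
  rw [timeFrame_der_iff] at h1
  obtain ⟨C, hC0, hC⟩ := h2.bdd.nonneg
  exact ⟨⟨C, hC0⟩, (convex_Ioo _ _).lipschitzOnWith_of_nnnorm_hasDerivWithin_le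
    (fun t ht => (h1 i t ht).hasDerivWithinAt) fun t ht => hC (i, t) ht⟩

open Polynomial in
theorem timeFrame_reg_eval {P : ι → ℝ[X]} (h : ∀ l ≤ k, (timeFrame a b).Bdd
    fun o => (derivative^[l] (P o.1)).eval o.2) :
    (timeFrame a b).Reg k fun o => (P o.1).eval o.2 := by
  induction k generalizing P with
  | zero => exact h 0 le_rfl
  | succ k ih =>
    refine timeFrame_reg_succ (h 0 (Nat.zero_le _)) (f' := fun o => (derivative (P o.1)).eval o.2)
      (fun i t _ => (P i).hasDerivAt t) (ih (P := fun i => derivative (P i)) fun l hl => ?_)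
    simpa only [← Function.iterate_succ_apply] using h (l + 1) (Nat.succ_le_succ hl)

open Polynomial in
/-- Uniform polynomial approximation of a regular family, of the order of its regularity. -/
theorem Frame.Reg.exists_polynomial_approx (hab : ∀ i, a i < b i) {f : ι × ℝ → ℝ}
    (h : (timeFrame a b).Reg k f) : ∃ M, 0 ≤ M ∧ ∀ i, ∃ Q : ℝ[X], Q.degree < k ∧
      ∀ t ∈ Ioo (a i) (b i), |f (i, t) - Q.eval t| ≤ M * (b i - a i) ^ k := by
  induction k generalizing f with
  | zero =>
    obtain ⟨C, hC0, hC⟩ := h.bdd.nonneg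
    exact ⟨C, hC0, fun i => ⟨0, by rw [degree_zero]; exact WithBot.bot_lt_coe _,
      fun t ht => by simpa using hC (i, t) ht⟩⟩
  | succ k ih =>
    obtain ⟨f', h1, h2⟩ := h.2 ()
    rw [timeFrame_der_iff] at h1
    obtain ⟨M, hM0, hM⟩ := ih h2
    refine ⟨M, hM0, fun i => ?_⟩
    obtain ⟨Q, hQ, hQf⟩ := hM i
    obtain ⟨R, hR, hRd⟩ := Q.exists_derivative_eq
    set c := (a i + b i) / 2 with hc
    have hcm : c ∈ Ioo (a i) (b i) := ⟨by linarith [hab i], by linarith [hab i]⟩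
    refine ⟨R + C (f (i, c) - R.eval c), ?_, fun t ht => ?_⟩
    · by_cases hQ0 : Q = 0
      · have h3 : R.natDegree = 0 := by
          rw [← derivative_eq_zero, hR, hQ0]
        refine (degree_add_le _ _).trans_lt (max_lt ?_ ?_)
        · refine degree_le_natDegree.trans_lt ?_
          rw [h3]
          exact_mod_cast Nat.succ_pos k
        · exact degree_C_le.trans_lt (by exact_mod_cast Nat.succ_pos k)
      · rw [degree_eq_natDegree hQ0] at hQ
        have h3 : Q.natDegree < k := by exact_mod_cast hQ
        refine (degree_add_le _ _).trans_lt (max_lt ?_ ?_)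
        · exact degree_le_natDegree.trans_lt (by exact_mod_cast (by omega : R.natDegree < k + 1))
        · exact degree_C_le.trans_lt (by exact_mod_cast Nat.succ_pos k)
    · have hd : ∀ s ∈ Ioo (a i) (b i), HasDerivWithinAt (fun s => f (i, s) - R.eval s)
          (f' (i, s) - Q.eval s) (Ioo (a i) (b i)) s := fun s hs => by
        have := (h1 i s hs).sub (R.hasDerivAt s)
        rw [hR] at this
        exact this.hasDerivWithinAt
      have h3 := (convex_Ioo _ _).norm_image_sub_le_of_norm_hasDerivWithin_le hd
        (fun s hs => hQf s hs) hcm ht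
      rw [eval_add, eval_C]
      have h4 : f (i, t) - (R.eval t + (f (i, c) - R.eval c))
          = f (i, t) - R.eval t - (f (i, c) - R.eval c) := by ring
      rw [h4]
      refine h3.trans ?_
      rw [pow_succ, ← mul_assoc]
      have h5 : ‖t - c‖ ≤ b i - a i := by
        rw [Real.norm_eq_abs, abs_le]
        exact ⟨by linarith [ht.1, hcm.2], by linarith [ht.2, hcm.1]⟩
      exact mul_le_mul_of_nonneg_left h5
        (mul_nonneg hM0 (pow_nonneg (sub_nonneg.2 (hab i).le) _))

open Polynomial in
theorem Polynomial.iterate_derivative_comp_affine (p : ℝ[X]) (c d : ℝ) (l : ℕ) :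
    derivative^[l] (p.comp (C c + C d * X)) = C (d ^ l) * (derivative^[l] p).comp (C c + C d * X) := by
  induction l with
  | zero => simp
  | succ l ih =>
    rw [Function.iterate_succ_apply', ih, derivative_C_mul, derivative_comp,
      Function.iterate_succ_apply']
    simp [pow_succ]
    ring

open Polynomial in
theorem Polynomial.degree_comp_affine_le (p : ℝ[X]) (c d : ℝ) :
    (p.comp (C c + C d * X)).degree ≤ p.degree := by
  by_cases h0 : p = 0
  · simp [h0]
  rw [degree_eq_natDegree h0]
  refine degree_le_natDegree.trans ?_
  have : (C c + C d * X).natDegree ≤ 1 :=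
    (natDegree_add_le _ _).trans (max_le (by simp) ((natDegree_C_mul_le _ _).trans (by simp)))
  exact_mod_cast natDegree_comp_le.trans ((Nat.mul_le_mul_left _ this).trans (by simp))

open Polynomial in
/-- Interpolation at rescaled points is stable in every `C^l` norm, uniformly in the length of the
interval: subtract a polynomial approximation of order `l` and use the inverse inequality. -/
theorem bdd_iterate_derivative_of_interpolation (hab : ∀ i, a i < b i) {m : ℕ} {ρ : Fin m → ℝ}
    (hρ : Function.Injective ρ) (hmem : ∀ j, ρ j ∈ Ioo (0 : ℝ) 1) {P : ι → ℝ[X]}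
    (hP : ∀ i, (P i).degree < m) {g : ι × ℝ → ℝ} (hg : (timeFrame a b).Reg k g)
    (h : ∀ i j, (P i).eval (a i + ρ j * (b i - a i)) = g (i, a i + ρ j * (b i - a i))) :
    (timeFrame a b).Bdd fun o => (derivative^[k] (P o.1)).eval o.2 := by
  by_cases hk : m ≤ k
  · refine ⟨0, fun o _ => ?_⟩
    simp only
    rw [iterate_derivative_eq_zero_of_degree_lt ((hP o.1).trans_le (by exact_mod_cast hk))]
    simp
  · obtain ⟨M, hM0, hM⟩ := hg.exists_polynomial_approx hab
    obtain ⟨D, hD0, hD⟩ := Polynomial.exists_iterate_derivative_bound hρ k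
    refine ⟨D * M, ?_⟩
    rintro ⟨i, t⟩ ht
    obtain ⟨Q, hQ, hQg⟩ := hM i
    set Δ := b i - a i with hΔ
    have hΔ0 : 0 < Δ := sub_pos.2 (hab i)
    have hdeg : ((P i - Q).comp (C (a i) + C Δ * X)).degree < m :=
      (degree_comp_affine_le _ _ _).trans_lt ((degree_sub_le _ _).trans_lt (max_lt (hP i)
        (hQ.trans (by exact_mod_cast not_le.1 hk))))
    have hval : ∀ j, |((P i - Q).comp (C (a i) + C Δ * X)).eval (ρ j)| ≤ M * Δ ^ k := by
      intro j
      have hj : a i + ρ j * Δ ∈ Ioo (a i) (b i) := by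
        have h1 := mul_pos (hmem j).1 hΔ0
        have h2 := mul_lt_mul_of_pos_right (hmem j).2 hΔ0
        constructor <;> linarith
      have h1 := hQg _ hj
      rw [← h i j] at h1
      simp only [eval_comp, eval_add, eval_C, eval_mul, eval_X, eval_sub]
      rw [mul_comm Δ]
      exact h1
    have hs : (t - a i) / Δ ∈ Icc (0 : ℝ) 1 :=
      ⟨div_nonneg (sub_nonneg.2 ht.1.le) hΔ0.le, (div_le_one hΔ0).2 (by linarith [ht.2])⟩
    have h1 := hD _ hdeg _ hval _ hs
    rw [iterate_derivative_comp_affine, iterate_derivative_sub,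
      iterate_derivative_eq_zero_of_degree_lt hQ, sub_zero] at h1
    have h2 : a i + Δ * ((t - a i) / Δ) = t := by field_simp; ring
    simp only [eval_mul, eval_C, eval_comp, eval_add, eval_X, h2] at h1
    rw [abs_mul, abs_of_pos (pow_pos hΔ0 k)] at h1
    have h3 : Δ ^ k * |(derivative^[k] (P i)).eval t| ≤ Δ ^ k * (D * M) :=
      h1.trans_eq (by ring)
    exact le_of_mul_le_mul_left h3 (pow_pos hΔ0 k)

end TimeFrame

/-! ### The Euclidean norm of a vector -/

/-- The Euclidean norm; the norm of the function type `σ → ℝ` itself is the maximum norm. -/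
noncomputable def euclid {σ : Type*} [Fintype σ] (x : σ → ℝ) : ℝ := √(x ⬝ᵥ x)

section Euclid

variable {σ : Type*} [Fintype σ]

theorem euclid_eq_norm (x : σ → ℝ) : euclid x = ‖WithLp.toLp 2 x‖ := by
  rw [euclid, EuclideanSpace.norm_eq, dotProduct]
  simp [sq]

theorem euclid_nonneg (x : σ → ℝ) : 0 ≤ euclid x := Real.sqrt_nonneg _

theorem euclid_sq (x : σ → ℝ) : euclid x ^ 2 = x ⬝ᵥ x :=
  Real.sq_sqrt (Finset.sum_nonneg fun _ _ => mul_self_nonneg _)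

theorem euclid_zero : euclid (0 : σ → ℝ) = 0 := by simp [euclid]

theorem euclid_add_le (x y : σ → ℝ) : euclid (x + y) ≤ euclid x + euclid y := by
  simp only [euclid_eq_norm]
  exact norm_add_le _ _

theorem dotProduct_le_euclid (x y : σ → ℝ) : x ⬝ᵥ y ≤ euclid x * euclid y := by
  have := real_inner_le_norm (WithLp.toLp 2 y) (WithLp.toLp 2 x)
  rw [← euclid_eq_norm, ← euclid_eq_norm, mul_comm] at this
  simpa [PiLp.inner_apply, dotProduct, mul_comm] using this

theorem euclid_le_of_abs_le {x : σ → ℝ} {M : ℝ} (h : ∀ p, |x p| ≤ M) :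
    euclid x ≤ √(Fintype.card σ) * |M| := by
  have h1 : x ⬝ᵥ x ≤ Fintype.card σ * M ^ 2 := by
    rw [dotProduct]
    refine (Finset.sum_le_card_nsmul _ _ (M ^ 2) fun p _ => ?_).trans_eq (by simp)
    rw [← sq, ← sq_abs]
    exact pow_le_pow_left₀ (abs_nonneg _) (h p) 2
  refine (Real.sqrt_le_sqrt h1).trans_eq ?_
  rw [Real.sqrt_mul (Nat.cast_nonneg _), Real.sqrt_sq_eq_abs]

theorem abs_le_euclid (x : σ → ℝ) (p : σ) : |x p| ≤ euclid x := by
  refine Real.abs_le_sqrt ?_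
  rw [sq]
  exact Finset.single_le_sum (f := fun p => x p * x p) (fun _ _ => mul_self_nonneg _)
    (Finset.mem_univ p)

end Euclid

/-! ### One collocation step on a general interval -/

open Polynomial in
/-- `P` solves the collocation equations for `v' = B v + G` on the interval `[a, b]`. -/
structure IsCollocationStep {σ : Type*} [Fintype σ] {m : ℕ} (ρ : Fin m → ℝ) (a b : ℝ)
    (B : ℝ → Matrix σ σ ℝ) (G : ℝ → σ → ℝ) (P : σ → ℝ[X]) : Prop where
  natDegree_le : ∀ p, (P p).natDegree ≤ m
  eq : ∀ j p, (derivative (P p)).eval (a + ρ j * (b - a))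
    = (B (a + ρ j * (b - a)) *ᵥ (fun q => (P q).eval (a + ρ j * (b - a)))
        + G (a + ρ j * (b - a))) p

section Step

open Polynomial

variable {σ : Type*} [Fintype σ] {m : ℕ} {ρ : Fin m → ℝ}

/-- The increment over a step is bounded by the right-hand side at its start, whatever the size of
the negative semidefinite matrix `B`. -/
theorem IsGaussLegendre.exists_growth (hρ : IsGaussLegendre ρ) (hm : 1 ≤ m) :
    ∃ D, 0 ≤ D ∧ ∀ (B : Fin m → Matrix σ σ ℝ) (G : Fin m → σ → ℝ) (y : σ → ℝ[X]),
      IsUnitCollocation ρ B G y → (∀ i z, z ⬝ᵥ (B i *ᵥ z) ≤ 0) →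
      ∀ M, (∀ i p, |(B i *ᵥ (fun q => (y q).eval 0) + G i) p| ≤ M) →
      ∀ p, ∀ s ∈ Icc (0 : ℝ) 1, |(y p).eval s - (y p).eval 0| ≤ D * M := by
  obtain ⟨w, hw, hQ⟩ := hρ.exists_weights hm
  obtain ⟨D, hD0, hD⟩ := Polynomial.exists_iterate_derivative_bound hρ.strictMono.injective 0
  set W := ∑ i, w i with hW
  have hW0 : 0 ≤ W := Finset.sum_nonneg fun i _ => (hw i).le
  set d : Fin m → ℝ := fun i => √(4 * W * Fintype.card σ / w i) with hd
  refine ⟨D * ∑ i, d i,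
    mul_nonneg hD0 (Finset.sum_nonneg fun i _ => Real.sqrt_nonneg _), ?_⟩
  intro B G y h hB M hM p s hs
  have hM0 : 0 ≤ M := (abs_nonneg _).trans (hM ⟨0, hm⟩ p)
  have h1 := h.sum_divX_le hB hρ hm hw hQ
  have h2 : ∑ i, w i * ∑ p, (B i *ᵥ (fun q => (y q).eval 0) + G i) p ^ 2
      ≤ W * (Fintype.card σ * M ^ 2) := by
    rw [hW, Finset.sum_mul]
    refine Finset.sum_le_sum fun i _ => mul_le_mul_of_nonneg_left ?_ (hw i).le
    refine (Finset.sum_le_card_nsmul _ _ (M ^ 2) fun p _ => ?_).trans_eq (by simp)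
    rw [← sq_abs]
    exact pow_le_pow_left₀ (abs_nonneg _) (hM i p) 2
  have h3 : ∀ i, |(divX (y p)).eval (ρ i)| ≤ (∑ i, d i) * M := by
    intro i
    have h4 : w i * (divX (y p)).eval (ρ i) ^ 2 ≤ 4 * (W * (Fintype.card σ * M ^ 2)) := by
      refine le_trans ?_ (h1.trans (mul_le_mul_of_nonneg_left h2 (by norm_num)))
      refine le_trans ?_ (Finset.single_le_sum
        (f := fun i => w i * ∑ p, (divX (y p)).eval (ρ i) ^ 2)
        (fun i _ => mul_nonneg (hw i).le (Finset.sum_nonneg fun p _ => sq_nonneg _))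
        (Finset.mem_univ i))
      exact mul_le_mul_of_nonneg_left (Finset.single_le_sum
        (f := fun p => (divX (y p)).eval (ρ i) ^ 2) (fun p _ => sq_nonneg _) (Finset.mem_univ p))
        (hw i).le
    have h5 : (divX (y p)).eval (ρ i) ^ 2 ≤ (4 * W * Fintype.card σ / w i) * M ^ 2 := by
      rw [div_mul_eq_mul_div, le_div_iff₀ (hw i), mul_comm]
      exact h4.trans_eq (by ring)
    have h6 := Real.abs_le_sqrt h5
    rw [Real.sqrt_mul (div_nonneg (by positivity) (hw i).le), Real.sqrt_sq hM0] at h6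
    exact h6.trans (mul_le_mul_of_nonneg_right (Finset.single_le_sum (f := d)
      (fun i _ => Real.sqrt_nonneg _) (Finset.mem_univ i)) hM0)
  have h4 := hD _ (h.degree_divX_lt hm p) _ h3 s hs
  have h5 : (y p).eval s - (y p).eval 0 = s * (divX (y p)).eval s := by
    have := congrArg (eval s) (X_mul_divX_add (y p))
    rw [eval_add, eval_mul, eval_X, eval_C, coeff_zero_eq_eval_zero] at this
    linarith
  rw [h5, abs_mul, abs_of_nonneg hs.1, mul_assoc]
  exact (mul_le_of_le_one_left (abs_nonneg _) hs.2).trans h4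

variable {a b : ℝ} {B : ℝ → Matrix σ σ ℝ} {G : ℝ → σ → ℝ} {P : σ → ℝ[X]}

theorem IsCollocationStep.toUnit (h : IsCollocationStep ρ a b B G P) :
    IsUnitCollocation ρ (fun j => (b - a) • B (a + ρ j * (b - a)))
      (fun j => (b - a) • G (a + ρ j * (b - a)))
      (fun p => (P p).comp (C a + C (b - a) * X)) := by
  have hev : ∀ (p : ℝ[X]) s, (p.comp (C a + C (b - a) * X)).eval s = p.eval (a + s * (b - a)) := by
    intro p s
    simp only [eval_comp, eval_add, eval_C, eval_mul, eval_X]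
    rw [mul_comm]
  refine ⟨fun p => ?_, fun i p => ?_⟩
  · refine natDegree_le_of_degree_le ((degree_comp_affine_le _ _ _).trans ?_)
    exact degree_le_of_natDegree_le (h.natDegree_le p)
  · have h1 := iterate_derivative_comp_affine (P p) a (b - a) 1
    simp only [Function.iterate_one, pow_one] at h1
    rw [h1, eval_mul, eval_C, hev, h.eq]
    simp only [hev]
    rw [Matrix.smul_mulVec, ← smul_add]
    rfl

theorem IsCollocationStep.eval_comp_affine (p : ℝ[X]) (s : ℝ) :
    (p.comp (C a + C (b - a) * X)).eval s = p.eval (a + s * (b - a)) := by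
  simp only [eval_comp, eval_add, eval_C, eval_mul, eval_X]
  rw [mul_comm]

theorem smul_semidefinite {B : Matrix σ σ ℝ} (hB : ∀ z, z ⬝ᵥ (B *ᵥ z) ≤ 0) {r : ℝ} (hr : 0 ≤ r)
    (z : σ → ℝ) : z ⬝ᵥ ((r • B) *ᵥ z) ≤ 0 := by
  rw [Matrix.smul_mulVec, dotProduct_smul, smul_eq_mul]
  exact mul_nonpos_of_nonneg_of_nonpos hr (hB z)

theorem IsCollocationStep.energy_le (h : IsCollocationStep ρ a b B 0 P) (hρ : IsGaussLegendre ρ)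
    (hm : 1 ≤ m) (hab : a ≤ b) (hB : ∀ j z, z ⬝ᵥ (B (a + ρ j * (b - a)) *ᵥ z) ≤ 0) :
    ∑ p, (P p).eval b ^ 2 ≤ ∑ p, (P p).eval a ^ 2 := by
  have h0 := h.toUnit
  have h1 : (fun j => (b - a) • (0 : ℝ → σ → ℝ) (a + ρ j * (b - a))) = 0 := by
    funext j; simp
  rw [h1] at h0
  have h2 := h0.energy_le hρ hm fun j => smul_semidefinite (hB j) (sub_nonneg.2 hab)
  simp only [IsCollocationStep.eval_comp_affine] at h2
  simpa using h2

theorem IsCollocationStep.eq_of_eval_eq {P' : σ → ℝ[X]} (h : IsCollocationStep ρ a b B G P)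
    (h' : IsCollocationStep ρ a b B G P') (hρ : IsGaussLegendre ρ) (hm : 1 ≤ m) (hab : a < b)
    (hB : ∀ j z, z ⬝ᵥ (B (a + ρ j * (b - a)) *ᵥ z) ≤ 0)
    (h0 : ∀ p, (P p).eval a = (P' p).eval a) (p : σ) (t : ℝ) : (P p).eval t = (P' p).eval t := by
  have h1 := h.toUnit.sub h'.toUnit
  rw [sub_self] at h1
  have h2 := h1.eq_zero hρ hm (fun j => smul_semidefinite (hB j) (sub_nonneg.2 hab.le))
    (fun p => by
      rw [eval_sub, IsCollocationStep.eval_comp_affine, IsCollocationStep.eval_comp_affine]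
      simp [h0 p]) p
  have h3 := congrArg (eval ((t - a) / (b - a))) h2
  rw [eval_sub, IsCollocationStep.eval_comp_affine, IsCollocationStep.eval_comp_affine,
    div_mul_cancel₀ _ (sub_pos.2 hab).ne', eval_zero, add_sub_cancel] at h3
  linarith

theorem exists_isCollocationStep (hρ : IsGaussLegendre ρ) (hm : 1 ≤ m) (hab : a < b)
    (hB : ∀ j z, z ⬝ᵥ (B (a + ρ j * (b - a)) *ᵥ z) ≤ 0) (G : ℝ → σ → ℝ) (v₀ : σ → ℝ) :
    ∃ P : σ → ℝ[X], IsCollocationStep ρ a b B G P ∧ ∀ p, (P p).eval a = v₀ p := by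
  have hΔ : b - a ≠ 0 := (sub_pos.2 hab).ne'
  obtain ⟨y, hy, hy0⟩ := IsUnitCollocation.exists_of_semidefinite hρ hm
    (fun j => smul_semidefinite (hB j) (sub_nonneg.2 hab.le))
    (fun j => (b - a) • G (a + ρ j * (b - a))) v₀
  have hev : ∀ (p : ℝ[X]) t, (p.comp (C (-a / (b - a)) + C (b - a)⁻¹ * X)).eval t
      = p.eval ((t - a) / (b - a)) := by
    intro p t
    simp only [eval_comp, eval_add, eval_C, eval_mul, eval_X]
    congr 1
    field_simp
    ring
  have hρ' : ∀ s, (a + s * (b - a) - a) / (b - a) = s := fun s => by field_simp; ring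
  refine ⟨fun p => (y p).comp (C (-a / (b - a)) + C (b - a)⁻¹ * X), ⟨fun p => ?_, fun j p => ?_⟩,
    fun p => ?_⟩
  · refine natDegree_le_of_degree_le ((degree_comp_affine_le _ _ _).trans ?_)
    exact degree_le_of_natDegree_le (hy.natDegree_le p)
  · have h1 := iterate_derivative_comp_affine (y p) (-a / (b - a)) (b - a)⁻¹ 1
    simp only [Function.iterate_one, pow_one] at h1
    rw [h1, eval_mul, eval_C]
    simp only [hev, hρ']
    rw [hy.eq, Matrix.smul_mulVec, ← smul_add, Pi.smul_apply, smul_eq_mul, ← mul_assoc,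
      inv_mul_cancel₀ hΔ, one_mul]
  · rw [hev, sub_self, zero_div, hy0]

end Step

/-! ### The local error of a collocation step -/

section LocalError

open Polynomial

variable {ι σ : Type*} [Fintype σ] {a b : ι → ℝ} {m : ℕ} {ρ : Fin m → ℝ}
  {B : ι → ℝ → Matrix σ σ ℝ} {G : ι → ℝ → σ → ℝ}

theorem IsGaussLegendre.point_mem (hρ : IsGaussLegendre ρ) {a b : ℝ} (hab : a < b) (j : Fin m) :
    a + ρ j * (b - a) ∈ Ioo a b := by
  have h1 := mul_pos (hρ.mem j).1 (sub_pos.2 hab)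
  have h2 := mul_lt_mul_of_pos_right (hρ.mem j).2 (sub_pos.2 hab)
  constructor <;> linarith

theorem Frame.exists_forall_le_of_finite {Ω δ κ : Type*} [Finite κ] {F : Frame Ω δ}
    {f : κ → Ω → ℝ} (h : ∀ p, F.Bdd (f p)) : ∃ C, 0 ≤ C ∧ ∀ p, ∀ o ∈ F.dom, |f p o| ≤ C := by
  have := Fintype.ofFinite κ
  choose C hC0 hC using fun p => (h p).nonneg
  exact ⟨∑ p, C p, Finset.sum_nonneg fun p _ => hC0 p, fun p o ho =>
    (hC p o ho).trans (Finset.single_le_sum (fun p _ => hC0 p) (Finset.mem_univ p))⟩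

/-- Over a step the collocation solution changes by at most a multiple of the step size. -/
theorem exists_step_growth (hab : ∀ i, a i < b i) (hρ : IsGaussLegendre ρ) (hm : 1 ≤ m)
    (hB : ∀ p q, (timeFrame a b).Bdd fun o => B o.1 o.2 p q)
    (hG : ∀ p, (timeFrame a b).Bdd fun o => G o.1 o.2 p)
    (hneg : ∀ i, ∀ t ∈ Ioo (a i) (b i), ∀ z, z ⬝ᵥ (B i t *ᵥ z) ≤ 0) :
    ∃ D, 0 ≤ D ∧ ∀ i (P : σ → ℝ[X]), IsCollocationStep ρ (a i) (b i) (B i) (G i) P →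
      ∀ p, ∀ t ∈ Icc (a i) (b i), |(P p).eval t - (P p).eval (a i)|
        ≤ D * (b i - a i) * (‖fun q => (P q).eval (a i)‖ + 1) := by
  obtain ⟨D, hD0, hD⟩ := hρ.exists_growth (σ := σ) hm
  obtain ⟨b₀, hb0, hb⟩ := Frame.exists_forall_le_of_finite (f := fun (pq : σ × σ) (o : ι × ℝ) => B o.1 o.2 pq.1 pq.2)
    fun pq => hB pq.1 pq.2
  obtain ⟨γ, hγ0, hγ⟩ := Frame.exists_forall_le_of_finite (f := fun (p : σ) (o : ι × ℝ) => G o.1 o.2 p) hG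
  set c := Fintype.card σ * b₀ + γ with hc
  have hc0 : 0 ≤ c := by positivity
  refine ⟨D * c, by positivity, fun i P hP p t ht => ?_⟩
  have hΔ := sub_pos.2 (hab i)
  set x : σ → ℝ := fun q => (P q).eval (a i) with hx
  have h1 := hD _ _ _ hP.toUnit
    (fun j => smul_semidefinite (hneg i _ (hρ.point_mem (hab i) j)) hΔ.le)
    ((b i - a i) * (c * (‖x‖ + 1))) (fun j p => by
      simp only [IsCollocationStep.eval_comp_affine, zero_mul, add_zero]
      rw [Matrix.smul_mulVec, ← smul_add, Pi.smul_apply, smul_eq_mul, abs_mul, abs_of_pos hΔ]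
      refine mul_le_mul_of_nonneg_left ?_ hΔ.le
      have hj := hρ.point_mem (hab i) j
      refine (abs_add_le _ _).trans ?_
      have h2 := (norm_le_pi_norm _ p).trans (Matrix.norm_mulVec_le_of_entries hb0
        (fun p q => hb (p, q) (i, _) hj) x)
      have h3 := hγ p (i, _) hj
      rw [Real.norm_eq_abs] at h2
      have h4 : c * (‖x‖ + 1) = Fintype.card σ * b₀ * ‖x‖ + γ + (γ * ‖x‖ + Fintype.card σ * b₀) := by
        rw [hc]; ring
      have h5 : 0 ≤ γ * ‖x‖ + Fintype.card σ * b₀ := by positivity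
      rw [h4]
      linarith) p ((t - a i) / (b i - a i))
      ⟨div_nonneg (sub_nonneg.2 ht.1) hΔ.le, (div_le_one hΔ).2 (by linarith [ht.2])⟩
  rw [IsCollocationStep.eval_comp_affine, IsCollocationStep.eval_comp_affine,
    div_mul_cancel₀ _ hΔ.ne', add_sub_cancel] at h1
  simp only [zero_mul, add_zero] at h1
  exact h1.trans_eq (by ring)

theorem reg_mulVec_add {k : ℕ} {v : ι → ℝ → σ → ℝ}
    (hB : ∀ p q, (timeFrame a b).Reg k fun o => B o.1 o.2 p q)
    (hG : ∀ p, (timeFrame a b).Reg k fun o => G o.1 o.2 p)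
    (hv : ∀ p, (timeFrame a b).Reg k fun o => v o.1 o.2 p) (p : σ) :
    (timeFrame a b).Reg k fun o => (B o.1 o.2 *ᵥ v o.1 o.2 + G o.1 o.2) p := by
  simp only [Pi.add_apply, Matrix.mulVec, dotProduct]
  exact (Frame.Reg.sum fun q _ => (hB p q).mul (hv q)).add (hG p)

/-- Bounded solutions of a linear system are as regular as the system allows. -/
theorem reg_of_hasDerivAt_linear {k : ℕ} {v : ι → ℝ → σ → ℝ}
    (hB : ∀ p q, (timeFrame a b).Reg k fun o => B o.1 o.2 p q)
    (hG : ∀ p, (timeFrame a b).Reg k fun o => G o.1 o.2 p)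
    (hb : ∀ p, (timeFrame a b).Bdd fun o => v o.1 o.2 p)
    (hv : ∀ i, ∀ t ∈ Ioo (a i) (b i), HasDerivAt (v i) (B i t *ᵥ v i t + G i t) t) (p : σ) :
    (timeFrame a b).Reg (k + 1) fun o => v o.1 o.2 p := by
  have key : ∀ l ≤ k + 1, ∀ p, (timeFrame a b).Reg l fun o => v o.1 o.2 p := by
    intro l
    induction l with
    | zero => exact fun _ => hb
    | succ l ih =>
      intro hl p
      refine timeFrame_reg_succ (hb p)
        (f' := fun o => (B o.1 o.2 *ᵥ v o.1 o.2 + G o.1 o.2) p)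
        (fun i t ht => hasDerivAt_pi.1 (hv i t ht) p) ?_
      exact reg_mulVec_add (fun p q => (hB p q).mono (by omega)) (fun p => (hG p).mono (by omega))
        (ih (by omega)) p
  exact key (k + 1) le_rfl p

/-- The derivatives of the collocation solutions are bounded uniformly: on each interval `P'`
interpolates `B P + G`, so the regularity of `P` can be raised order by order. -/
theorem reg_of_isCollocationStep (hab : ∀ i, a i < b i) (hρ : IsGaussLegendre ρ) (hm : 1 ≤ m)
    {k : ℕ} (hB : ∀ p q, (timeFrame a b).Reg k fun o => B o.1 o.2 p q)
    (hG : ∀ p, (timeFrame a b).Reg k fun o => G o.1 o.2 p) {P : ι → σ → ℝ[X]}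
    (hP : ∀ i, IsCollocationStep ρ (a i) (b i) (B i) (G i) (P i))
    (hb : ∀ p, (timeFrame a b).Bdd fun o => (P o.1 p).eval o.2) (p : σ) :
    (timeFrame a b).Reg (k + 1) fun o => (P o.1 p).eval o.2 := by
  have hdeg : ∀ i p, (derivative (P i p)).degree < m := by
    intro i p
    refine degree_le_natDegree.trans_lt ?_
    have h1 := natDegree_derivative_le (P i p)
    have h2 := (hP i).natDegree_le p
    exact_mod_cast (show (derivative (P i p)).natDegree < m by omega)
  have key : ∀ l ≤ k + 1, ∀ p, (timeFrame a b).Reg l fun o => (P o.1 p).eval o.2 := by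
    intro l
    induction l with
    | zero => exact fun _ => hb
    | succ l ih =>
      intro hl p
      refine timeFrame_reg_succ (hb p) (f' := fun o => (derivative (P o.1 p)).eval o.2)
        (fun i t _ => (P i p).hasDerivAt t) ?_
      have hg := reg_mulVec_add (v := fun i t q => (P i q).eval t)
        (fun p q => (hB p q).mono (by omega : l ≤ k)) (fun p => (hG p).mono (by omega))
        (ih (by omega)) p
      exact timeFrame_reg_eval (P := fun i => derivative (P i p)) fun r hr =>
        bdd_iterate_derivative_of_interpolation hab hρ.strictMono.injective hρ.mem
          (fun i => hdeg i p) (hg.mono hr) fun i j => (hP i).eq j p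
  exact key (k + 1) le_rfl p

/-- If `ψ' = -Bᵀ ψ` with `B` negative semidefinite, then `|ψ|` is largest at the end point. -/
theorem euclid_le_of_dual {a b : ℝ} {B : ℝ → Matrix σ σ ℝ}
    (hneg : ∀ t ∈ Ioo a b, ∀ z, z ⬝ᵥ (B t *ᵥ z) ≤ 0) {ψ : ℝ → σ → ℝ}
    (hc : ContinuousOn ψ (Icc a b)) (hψ : ∀ t ∈ Ioo a b, HasDerivAt ψ ((-(B t)ᵀ) *ᵥ ψ t) t) :
    ∀ t ∈ Icc a b, euclid (ψ t) ≤ euclid (ψ b) := by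
  have hcp : ∀ p, ContinuousOn (fun t => ψ t p) (Icc a b) := fun p =>
    (continuous_apply p).comp_continuousOn hc
  have hmono : MonotoneOn (fun t => ψ t ⬝ᵥ ψ t) (Icc a b) := by
    refine monotoneOn_of_hasDerivWithinAt_nonneg (convex_Icc a b)
      (f' := fun t => 2 * (ψ t ⬝ᵥ ((-(B t)ᵀ) *ᵥ ψ t))) ?_ (fun t ht => ?_) fun t ht => ?_
    · exact continuousOn_finsetSum _ fun p _ => (hcp p).mul (hcp p)
    · rw [interior_Icc] at ht
      have h1 : HasDerivAt (fun t => ∑ p, ψ t p * ψ t p)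
          (∑ p, (((-(B t)ᵀ) *ᵥ ψ t) p * ψ t p + ψ t p * ((-(B t)ᵀ) *ᵥ ψ t) p)) t :=
        HasDerivAt.fun_sum fun p _ => (hasDerivAt_pi.1 (hψ t ht) p).mul (hasDerivAt_pi.1 (hψ t ht) p)
      refine (h1.congr_deriv ?_).hasDerivWithinAt
      rw [dotProduct, Finset.mul_sum]
      exact Finset.sum_congr rfl fun p _ => by ring
    · rw [interior_Icc] at ht
      have h1 := hneg t ht (ψ t)
      rw [Matrix.neg_mulVec, dotProduct_neg, Matrix.mulVec_transpose, dotProduct_comm,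
        ← Matrix.dotProduct_mulVec]
      linarith
  intro t ht
  exact Real.sqrt_le_sqrt (hmono ht (right_mem_Icc.2 (ht.1.trans ht.2)) ht.2)

/-- A regular family that vanishes at the Gauss–Legendre points has increments of its
antiderivatives of order `2m + 1`. -/
theorem exists_quadrature_error (hab : ∀ i, a i < b i) (hρ : IsGaussLegendre ρ) (hm : 1 ≤ m)
    {φ Φ : ι × ℝ → ℝ} (hφ : (timeFrame a b).Reg (2 * m) φ)
    (hc : ∀ i, ContinuousOn (fun t => Φ (i, t)) (Icc (a i) (b i)))
    (hΦ : ∀ i, ∀ t ∈ Ioo (a i) (b i), HasDerivAt (fun s => Φ (i, s)) (φ (i, t)) t)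
    (h0 : ∀ i j, φ (i, a i + ρ j * (b i - a i)) = 0) :
    ∃ D, 0 ≤ D ∧ ∀ i, |Φ (i, b i) - Φ (i, a i)| ≤ D * (b i - a i) ^ (2 * m + 1) := by
  obtain ⟨w, hw, hQ⟩ := hρ.exists_weights hm
  obtain ⟨M, hM0, hM⟩ := hφ.exists_polynomial_approx hab
  have hW0 : 0 ≤ ∑ i, w i := Finset.sum_nonneg fun i _ => (hw i).le
  refine ⟨M + (∑ i, w i) * M, by positivity, fun i => ?_⟩
  obtain ⟨Q, hQd, hQφ⟩ := hM i
  obtain ⟨R, hR, hRd⟩ := Q.exists_derivative_eq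
  set Δ := b i - a i with hΔ
  have hΔ0 : 0 < Δ := sub_pos.2 (hab i)
  -- the antiderivatives of the family and of its polynomial approximation
  have h1 : |(Φ (i, b i) - R.eval (b i)) - (Φ (i, a i) - R.eval (a i))| ≤ M * Δ ^ (2 * m) * Δ := by
    obtain ⟨c, hcm, hcd⟩ := exists_hasDerivAt_eq_slope (fun t => Φ (i, t) - R.eval t)
      (fun t => φ (i, t) - Q.eval t) (hab i) ((hc i).sub R.continuous.continuousOn)
      (fun t ht => by
        have := (hΦ i t ht).sub (R.hasDerivAt t)
        rw [hR] at this
        exact this)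
    rw [eq_div_iff hΔ0.ne'] at hcd
    rw [← hcd, abs_mul, abs_of_pos hΔ0]
    exact mul_le_mul_of_nonneg_right (hQφ c hcm) hΔ0.le
  -- the quadrature rule is exact for the polynomial approximation
  have h2 : |R.eval (b i) - R.eval (a i)| ≤ (∑ i, w i) * (M * Δ ^ (2 * m) * Δ) := by
    have hdeg : (R.comp (C (a i) + C Δ * X)).natDegree ≤ 2 * m := by
      refine natDegree_le_of_degree_le ((degree_comp_affine_le _ _ _).trans ?_)
      refine degree_le_of_natDegree_le ?_
      by_cases hQ0 : Q = 0
      · rw [hQ0, natDegree_zero] at hRd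
        omega
      · rw [degree_eq_natDegree hQ0] at hQd
        have : Q.natDegree < 2 * m := by exact_mod_cast hQd
        omega
    have h3 := hQ _ hdeg
    rw [IsCollocationStep.eval_comp_affine, IsCollocationStep.eval_comp_affine, one_mul, zero_mul,
      add_zero, hΔ, add_sub_cancel, ← hΔ] at h3
    rw [h3, Finset.sum_mul]
    refine (Finset.abs_sum_le_sum_abs _ _).trans (Finset.sum_le_sum fun j _ => ?_)
    rw [abs_mul, abs_of_pos (hw j)]
    refine mul_le_mul_of_nonneg_left ?_ (hw j).le
    have h4 := iterate_derivative_comp_affine R (a i) Δ 1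
    simp only [Function.iterate_one, pow_one] at h4
    rw [h4, eval_mul, eval_C, hR, IsCollocationStep.eval_comp_affine, abs_mul, abs_of_pos hΔ0,
      mul_comm]
    refine mul_le_mul_of_nonneg_right ?_ hΔ0.le
    have h5 := hQφ _ (hρ.point_mem (hab i) j)
    rwa [h0 i j, zero_sub, abs_neg] at h5
  have h3 := abs_add_le ((Φ (i, b i) - R.eval (b i)) - (Φ (i, a i) - R.eval (a i)))
    (R.eval (b i) - R.eval (a i))
  have h4 : (Φ (i, b i) - R.eval (b i)) - (Φ (i, a i) - R.eval (a i))
    + (R.eval (b i) - R.eval (a i)) = Φ (i, b i) - Φ (i, a i) := by ring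
  rw [h4] at h3
  refine h3.trans ((add_le_add h1 h2).trans_eq ?_)
  rw [pow_succ]
  ring

/-- **Superconvergence**: the error of the collocation solution grows by `O(Δt^{2m+1})` over a step,
uniformly over the family. The growth is tested with the solution `ψ` of the dual problem
`ψ' = -Bᵀ ψ` that ends in the direction of the error: `(ψ · E)' = ψ · d`, where the defect
`d = P' - B P - G` vanishes at the Gauss–Legendre points. -/
theorem exists_local_error (hab : ∀ i, a i < b i) (hρ : IsGaussLegendre ρ) (hm : 1 ≤ m)
    {T : ℝ} (hT : ∀ i, b i - a i ≤ T)
    (hB : ∀ p q, (timeFrame a b).Reg (2 * m) fun o => B o.1 o.2 p q)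
    (hG : ∀ p, (timeFrame a b).Reg (2 * m) fun o => G o.1 o.2 p)
    (hneg : ∀ i, ∀ t ∈ Ioo (a i) (b i), ∀ z, z ⬝ᵥ (B i t *ᵥ z) ≤ 0) {P : ι → σ → ℝ[X]}
    (hP : ∀ i, IsCollocationStep ρ (a i) (b i) (B i) (G i) (P i))
    (hstart : ∃ R, ∀ i, ‖fun p => (P i p).eval (a i)‖ ≤ R) {v : ι → ℝ → σ → ℝ}
    (hvc : ∀ i, ContinuousOn (v i) (Icc (a i) (b i)))
    (hv : ∀ i, ∀ t ∈ Ioo (a i) (b i), HasDerivAt (v i) (B i t *ᵥ v i t + G i t) t) :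
    ∃ D, 0 ≤ D ∧ ∀ i, euclid (fun p => (P i p).eval (b i) - v i (b i) p)
      ≤ euclid (fun p => (P i p).eval (a i) - v i (a i) p) + D * (b i - a i) ^ (2 * m + 1) := by
  obtain ⟨R, hR⟩ := hstart
  set E : ι → ℝ → σ → ℝ := fun i t p => (P i p).eval t - v i t p with hE
  have hPb : ∀ p, (timeFrame a b).Bdd fun o => (P o.1 p).eval o.2 := by
    obtain ⟨D, hD0, hD⟩ := exists_step_growth hab hρ hm (fun p q => (hB p q).bdd)
      (fun p => (hG p).bdd) hneg
    intro p
    refine ⟨R + D * T * (R + 1), ?_⟩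
    rintro ⟨i, t⟩ ht
    have h1 := hD i _ (hP i) p t (Ioo_subset_Icc_self ht)
    have h2 := (norm_le_pi_norm (fun p => (P i p).eval (a i)) p).trans (hR i)
    rw [Real.norm_eq_abs] at h2
    have h3 : D * (b i - a i) * (‖fun q => (P i q).eval (a i)‖ + 1) ≤ D * T * (R + 1) := by
      have := hR i
      have := hT i
      have := (sub_pos.2 (hab i)).le
      gcongr
      exact mul_nonneg hD0 (this.trans (hT i))
    have h4 := abs_add_le ((P i p).eval t - (P i p).eval (a i)) ((P i p).eval (a i))
    rw [sub_add_cancel] at h4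
    simp only
    linarith
  have hPreg := reg_of_isCollocationStep hab hρ hm hB hG hP hPb
  -- the dual solution, with the normalized error as its value at the end of the step
  have hψ : ∀ i, ∃ ψ : ℝ → σ → ℝ, ContinuousOn ψ (Icc (a i) (b i)) ∧
      ψ (b i) = (euclid (E i (b i)))⁻¹ • E i (b i) ∧
      ∀ t ∈ Ioo (a i) (b i), HasDerivAt ψ ((-(B i t)ᵀ) *ᵥ ψ t) t := fun i =>
    exists_hasDerivAt_linear_backward (hab i) (B := fun t => -(B i t)ᵀ) (fun p q => by
      obtain ⟨K, hK⟩ := ((hB q p).mono (by omega : 1 ≤ 2 * m)).exists_lipschitzOnWith i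
      exact ⟨K, hK.neg⟩) _
  choose ψ hψc hψb hψd using hψ
  have hψ1 : ∀ i, ∀ t ∈ Icc (a i) (b i), euclid (ψ i t) ≤ 1 := by
    intro i t ht
    refine (euclid_le_of_dual (hneg i) (hψc i) (hψd i) t ht).trans ?_
    rw [hψb, euclid, dotProduct_smul, smul_dotProduct, ← euclid_sq]
    simp only [smul_eq_mul]
    refine Real.sqrt_le_one.2 ?_
    by_cases h0 : euclid (E i (b i)) = 0
    · simp [h0]
    · exact le_of_eq (by field_simp)
  have hψreg : ∀ p, (timeFrame a b).Reg (2 * m) fun o => ψ o.1 o.2 p := fun p =>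
    (reg_of_hasDerivAt_linear (B := fun i t => -(B i t)ᵀ) (G := fun _ _ => 0)
      (fun p q => (hB q p).neg) (fun p => Frame.Reg.const 0)
      (fun p => ⟨1, fun o ho => (abs_le_euclid _ p).trans (hψ1 o.1 o.2 (Ioo_subset_Icc_self ho))⟩)
      (fun i t ht => by simpa using hψd i t ht) p).pred
  set d : ι × ℝ → σ → ℝ := fun o p => (derivative (P o.1 p)).eval o.2
    - (B o.1 o.2 *ᵥ (fun q => (P o.1 q).eval o.2) + G o.1 o.2) p with hd
  have hdreg : ∀ p, (timeFrame a b).Reg (2 * m) fun o => d o p := by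
    intro p
    have h1 : (timeFrame a b).Reg (2 * m) fun o => (derivative (P o.1 p)).eval o.2 := by
      obtain ⟨f', h2, h3⟩ := (hPreg p).2 ()
      refine h3.congr ?_
      rintro ⟨i, t⟩ ht
      exact (timeFrame_der_iff.1 h2 i t ht).unique ((P i p).hasDerivAt t)
    exact h1.sub (reg_mulVec_add (v := fun i t q => (P i q).eval t) hB hG
      (fun p => (hPreg p).pred) p)
  have hEd : ∀ i, ∀ t ∈ Ioo (a i) (b i), ∀ p,
      HasDerivAt (fun s => E i s p) ((B i t *ᵥ E i t) p + d (i, t) p) t := by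
    intro i t ht p
    refine (((P i p).hasDerivAt t).sub (hasDerivAt_pi.1 (hv i t ht) p)).congr_deriv ?_
    have h1 : E i t = (fun q => (P i q).eval t) - v i t := rfl
    rw [h1, Matrix.mulVec_sub, hd]
    simp only [Pi.add_apply, Pi.sub_apply]
    ring
  obtain ⟨D, hD0, hD⟩ := exists_quadrature_error hab hρ hm
    (φ := fun o => ∑ p, ψ o.1 o.2 p * d o p) (Φ := fun o => ψ o.1 o.2 ⬝ᵥ E o.1 o.2)
    (Frame.Reg.sum fun p _ => (hψreg p).mul (hdreg p))
    (fun i => continuousOn_finsetSum _ fun p _ =>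
      ((continuous_apply p).comp_continuousOn (hψc i)).mul
        ((P i p).continuous.continuousOn.sub ((continuous_apply p).comp_continuousOn (hvc i))))
    (fun i t ht => by
      have h1 : HasDerivAt (fun s => ∑ p, ψ i s p * E i s p)
          (∑ p, (((-(B i t)ᵀ) *ᵥ ψ i t) p * E i t p
            + ψ i t p * ((B i t *ᵥ E i t) p + d (i, t) p))) t :=
        HasDerivAt.fun_sum fun p _ => (hasDerivAt_pi.1 (hψd i t ht) p).mul (hEd i t ht p)
      refine h1.congr_deriv ?_
      have h2 : ((-(B i t)ᵀ) *ᵥ ψ i t) ⬝ᵥ E i t + ψ i t ⬝ᵥ (B i t *ᵥ E i t) = 0 := by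
        rw [Matrix.neg_mulVec, neg_dotProduct, Matrix.mulVec_transpose,
          ← Matrix.dotProduct_mulVec, neg_add_cancel]
      simp only [dotProduct] at h2
      simp only [mul_add, Finset.sum_add_distrib]
      linarith)
    (fun i j => Finset.sum_eq_zero fun p _ => by
      rw [hd]; simp only
      rw [(hP i).eq j p, sub_self, mul_zero])
  refine ⟨D, hD0, fun i => ?_⟩
  have h1 := (le_abs_self _).trans (hD i)
  have h2 : ψ i (b i) ⬝ᵥ E i (b i) = euclid (E i (b i)) := by
    rw [hψb, smul_dotProduct, ← euclid_sq, smul_eq_mul]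
    by_cases h0 : euclid (E i (b i)) = 0
    · simp [h0]
    · field_simp
  have h3 : ψ i (a i) ⬝ᵥ E i (a i) ≤ euclid (E i (a i)) :=
    (dotProduct_le_euclid _ _).trans (mul_le_of_le_one_left (euclid_nonneg _)
      (hψ1 i _ (left_mem_Icc.2 (hab i).le)))
  simp only [h2] at h1
  change euclid (E i (b i)) ≤ euclid (E i (a i)) + _
  linarith

end LocalError

/-! ### Summation by parts and semidefiniteness -/

theorem Finset.sum_Ioc_shift (J : ℕ) (f : ℤ → ℝ) :
    ∑ j ∈ Finset.Ioc (0 : ℤ) J, f (j - 1) = ∑ j ∈ Finset.Ico (0 : ℤ) J, f j := by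
  refine Finset.sum_nbij (fun j => j - 1) (fun j hj => ?_) (fun i _ j _ h => by simpa using h)
    (fun j hj => ⟨j + 1, ?_, by simp⟩) fun _ _ => rfl
  · rw [Finset.mem_Ioc] at hj
    rw [Finset.mem_Ico]
    omega
  · rw [Finset.mem_coe, Finset.mem_Ico] at hj
    rw [Finset.mem_coe, Finset.mem_Ioc]
    omega

section SummationByParts

variable {J : ℕ} {u : ℤ → ℝ}

theorem sum_Ioo_mul_eq (h0 : u 0 = 0) (P : ℤ → ℝ) :
    ∑ j ∈ Finset.Ioo (0 : ℤ) J, u j * P (j + 1)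
      = ∑ j ∈ Finset.Ioc (0 : ℤ) J, u (j - 1) * P j := by
  have h := Finset.sum_Ioc_shift J fun j => u j * P (j + 1)
  simp only [sub_add_cancel] at h
  rw [h]
  refine Finset.sum_subset (fun j hj => ?_) fun j hj hj' => ?_
  · rw [Finset.mem_Ioo] at hj
    rw [Finset.mem_Ico]
    omega
  · rw [Finset.mem_Ico] at hj
    rw [Finset.mem_Ioo] at hj'
    obtain rfl : j = 0 := by omega
    rw [h0, zero_mul]

theorem sum_Ioo_mul_eq' (hJ : u J = 0) (P : ℤ → ℝ) :
    ∑ j ∈ Finset.Ioo (0 : ℤ) J, u j * P j = ∑ j ∈ Finset.Ioc (0 : ℤ) J, u j * P j := by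
  refine Finset.sum_subset (fun j hj => ?_) fun j hj hj' => ?_
  · rw [Finset.mem_Ioo] at hj
    rw [Finset.mem_Ioc]
    omega
  · rw [Finset.mem_Ioc] at hj
    rw [Finset.mem_Ioo] at hj'
    obtain rfl : j = J := by omega
    rw [hJ, zero_mul]

theorem sum_Ioo_mul_sub (h0 : u 0 = 0) (hJ : u J = 0) (P : ℤ → ℝ) :
    ∑ j ∈ Finset.Ioo (0 : ℤ) J, u j * (P (j + 1) - P j)
      = ∑ j ∈ Finset.Ioc (0 : ℤ) J, (u (j - 1) - u j) * P j := by
  simp only [mul_sub, sub_mul, Finset.sum_sub_distrib]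
  rw [sum_Ioo_mul_eq h0, sum_Ioo_mul_eq' hJ]

theorem sum_Ioo_mul_add (h0 : u 0 = 0) (hJ : u J = 0) (P : ℤ → ℝ) :
    ∑ j ∈ Finset.Ioo (0 : ℤ) J, u j * (P (j + 1) + P j)
      = ∑ j ∈ Finset.Ioc (0 : ℤ) J, (u (j - 1) + u j) * P j := by
  simp only [mul_add, add_mul, Finset.sum_add_distrib]
  rw [sum_Ioo_mul_eq h0, sum_Ioo_mul_eq' hJ]

end SummationByParts

theorem Interior.sum_eq {J K : ℕ} (f : ℤ → ℤ → ℝ) : ∑ p : Interior J K, f p.1.1 p.1.2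
    = ∑ j ∈ Finset.Ioo (0 : ℤ) J, ∑ k ∈ Finset.Ioo (0 : ℤ) K, f j k := by
  rw [← Finset.sum_product' (f := f)]
  exact Finset.sum_coe_sort (Finset.Ioo (0 : ℤ) J ×ˢ Finset.Ioo (0 : ℤ) K) fun p => f p.1 p.2

theorem Interior.bounds {J K : ℕ} (p : Interior J K) :
    0 < p.1.1 ∧ p.1.1 < J ∧ 0 < p.1.2 ∧ p.1.2 < K := by
  have h := p.2
  rw [Finset.mem_product, Finset.mem_Ioo, Finset.mem_Ioo] at h
  exact ⟨h.1.1, h.1.2, h.2.1, h.2.2⟩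

theorem extendGrid_interior {J K : ℕ} (g : ℤ → ℤ → ℝ) (z : Interior J K → ℝ) (p : Interior J K) :
    extendGrid g z p.1.1 p.1.2 = z p := by
  have h : (p.1.1, p.1.2) ∈ Finset.Ioo (0 : ℤ) J ×ˢ Finset.Ioo (0 : ℤ) K := p.2
  rw [extendGrid, dif_pos h]

theorem extendGrid_of_not {J K : ℕ} (g : ℤ → ℤ → ℝ) (z : Interior J K → ℝ) {j k : ℤ}
    (h : ¬(0 < j ∧ j < J ∧ 0 < k ∧ k < K)) : extendGrid g z j k = g j k := by
  rw [extendGrid, dif_neg]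
  rw [Finset.mem_product, Finset.mem_Ioo, Finset.mem_Ioo]
  simp only
  tauto

/-- The expression for the time derivative of `J_{j,k}` in the geometric conservation law. -/
noncomputable def Scheme.jacRate {J K : ℕ} (S : Scheme J K) (j k : ℤ) (t : ℝ) : ℝ :=
  S.jXix (j + 1) k t * S.xdotXi (j + 1) k t - S.jXix j k t * S.xdotXi j k t
    + S.jXiy (j + 1) k t * S.ydotXi (j + 1) k t - S.jXiy j k t * S.ydotXi j k t
    + S.jEtax j (k + 1) t * S.xdotEta j (k + 1) t - S.jEtax j k t * S.xdotEta j k t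
    + S.jEtay j (k + 1) t * S.ydotEta j (k + 1) t - S.jEtay j k t * S.ydotEta j k t

namespace Scheme

variable {J K : ℕ} (S : Scheme J K)

/-- The diffusion fluxes dissipate: the quadratic form is a sum of two squares. -/
theorem dissipation_nonneg (u : ℤ → ℤ → ℝ) {j k : ℤ} {t : ℝ} (hJ : 0 < S.cJac j k t)
    (ha : 0 < S.a j k t) :
    0 ≤ (u j k - u (j - 1) k + u j (k - 1) - u (j - 1) (k - 1)) * S.p₁ u j k t
      + (u j k - u j (k - 1) + u (j - 1) k - u (j - 1) (k - 1)) * S.p₂ u j k t := by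
  rw [p₁, p₂]
  generalize hd1 : u j k - u (j - 1) k + u j (k - 1) - u (j - 1) (k - 1) = d₁
  generalize hd2 : u j k - u j (k - 1) + u (j - 1) k - u (j - 1) (k - 1) = d₂
  have h0 : 0 ≤ S.a j k t / (2 * S.cJac j k t) := by positivity
  have h1 : 0 ≤ S.a j k t / (2 * S.cJac j k t) * ((S.cXix j k t * d₁ + S.cEtax j k t * d₂) ^ 2
    + (S.cXiy j k t * d₁ + S.cEtay j k t * d₂) ^ 2) := by positivity
  refine h1.trans_eq ?_
  ring

/-- Summation by parts: by the geometric conservation law and the coefficient condition, convection,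
reaction and mesh motion together contribute a nonpositive multiple of `u²` at each node. The term
with `jacRate` comes from the derivative of `√M`. -/
theorem sum_mul_op_le {t : ℝ} (hJ : ∀ j k : ℤ, 0 < j → j ≤ J → 0 < k → k ≤ K → 0 < S.cJac j k t)
    (ha : ∀ j k : ℤ, 0 < j → j ≤ J → 0 < k → k ≤ K → 0 < S.a j k t)
    (hC : ∀ j k : ℤ, 0 < j → j < J → 0 < k → k < K →
      0 ≤ S.jac j k t * S.c j k t
        + (S.jXix (j + 1) k t * S.b₁Xi (j + 1) k t - S.jXix j k t * S.b₁Xi j k t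
          + S.jXiy (j + 1) k t * S.b₂Xi (j + 1) k t - S.jXiy j k t * S.b₂Xi j k t) / 2
        + (S.jEtax j (k + 1) t * S.b₁Eta j (k + 1) t - S.jEtax j k t * S.b₁Eta j k t
          + S.jEtay j (k + 1) t * S.b₂Eta j (k + 1) t - S.jEtay j k t * S.b₂Eta j k t) / 2)
    (hG : ∀ j k : ℤ, 0 < j → j < J → 0 < k → k < K → HasDerivAt (S.jac j k) (S.jacRate j k t) t)
    {u : ℤ → ℤ → ℝ} (hu : ∀ j k : ℤ, ¬(0 < j ∧ j < J ∧ 0 < k ∧ k < K) → u j k = 0) :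
    ∑ j ∈ Finset.Ioo (0 : ℤ) J, ∑ k ∈ Finset.Ioo (0 : ℤ) K,
      u j k * (S.op u j k t + 2⁻¹ * S.jacRate j k t * u j k) ≤ 0 := by
  have hu0 : ∀ k, u 0 k = 0 := fun k => hu 0 k (by omega)
  have huJ : ∀ k, u J k = 0 := fun k => hu J k (by omega)
  have hu0' : ∀ j, u j 0 = 0 := fun j => hu j 0 (by omega)
  have huK : ∀ j, u j K = 0 := fun j => hu j K (by omega)
  set α : ℤ → ℤ → ℝ := fun j k => S.jXix j k t * (S.b₁Xi j k t - S.xdotXi j k t)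
      + S.jXiy j k t * (S.b₂Xi j k t - S.ydotXi j k t) with hα
  set β : ℤ → ℤ → ℝ := fun j k => S.jEtax j k t * (S.b₁Eta j k t - S.xdotEta j k t)
      + S.jEtay j k t * (S.b₂Eta j k t - S.ydotEta j k t) with hβ
  -- convection in the two directions
  have e1 : ∑ j ∈ Finset.Ioo (0 : ℤ) J, ∑ k ∈ Finset.Ioo (0 : ℤ) K,
      u j k * (S.q₁ u (j + 1) k t - S.q₁ u j k t)
      = ∑ j ∈ Finset.Ioo (0 : ℤ) J, ∑ k ∈ Finset.Ioo (0 : ℤ) K,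
        u j k ^ 2 * (α (j + 1) k / 2 - α j k / 2) := by
    rw [Finset.sum_comm, Finset.sum_comm (s := Finset.Ioo (0 : ℤ) J) (t := Finset.Ioo (0 : ℤ) K)]
    refine Finset.sum_congr rfl fun k _ => ?_
    rw [sum_Ioo_mul_sub (u := fun j => u j k) (hu0 k) (huJ k) fun j => S.q₁ u j k t,
      sum_Ioo_mul_sub (u := fun j => u j k ^ 2) (by simp [hu0 k]) (by simp [huJ k])
        fun j => α j k / 2]
    refine Finset.sum_congr rfl fun j _ => ?_
    simp only [q₁, hα]
    ring
  have e2 : ∑ j ∈ Finset.Ioo (0 : ℤ) J, ∑ k ∈ Finset.Ioo (0 : ℤ) K,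
      u j k * (S.q₂ u j (k + 1) t - S.q₂ u j k t)
      = ∑ j ∈ Finset.Ioo (0 : ℤ) J, ∑ k ∈ Finset.Ioo (0 : ℤ) K,
        u j k ^ 2 * (β j (k + 1) / 2 - β j k / 2) := by
    refine Finset.sum_congr rfl fun j _ => ?_
    rw [sum_Ioo_mul_sub (u := fun k => u j k) (hu0' j) (huK j) fun k => S.q₂ u j k t,
      sum_Ioo_mul_sub (u := fun k => u j k ^ 2) (by simp [hu0' j]) (by simp [huK j])
        fun k => β j k / 2]
    refine Finset.sum_congr rfl fun k _ => ?_
    simp only [q₂, hβ]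
    ring
  -- diffusion in the two directions
  have e3 : ∑ j ∈ Finset.Ioo (0 : ℤ) J, ∑ k ∈ Finset.Ioo (0 : ℤ) K,
      u j k * (S.p₁ u (j + 1) (k + 1) t - S.p₁ u j (k + 1) t + S.p₁ u (j + 1) k t - S.p₁ u j k t)
      = -∑ j ∈ Finset.Ioc (0 : ℤ) J, ∑ k ∈ Finset.Ioc (0 : ℤ) K,
        (u j k - u (j - 1) k + u j (k - 1) - u (j - 1) (k - 1)) * S.p₁ u j k t := by
    have h1 : ∑ j ∈ Finset.Ioo (0 : ℤ) J, ∑ k ∈ Finset.Ioo (0 : ℤ) K,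
        u j k * (S.p₁ u (j + 1) (k + 1) t - S.p₁ u j (k + 1) t + S.p₁ u (j + 1) k t - S.p₁ u j k t)
        = ∑ k ∈ Finset.Ioo (0 : ℤ) K, ∑ j ∈ Finset.Ioo (0 : ℤ) J,
          u j k * ((S.p₁ u (j + 1) (k + 1) t + S.p₁ u (j + 1) k t)
            - (S.p₁ u j (k + 1) t + S.p₁ u j k t)) := by
      rw [Finset.sum_comm]
      refine Finset.sum_congr rfl fun k _ => Finset.sum_congr rfl fun j _ => ?_
      ring
    have h2 : ∀ k ∈ Finset.Ioo (0 : ℤ) K, _ = _ := fun k _ =>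
      sum_Ioo_mul_sub (u := fun j => u j k) (hu0 k) (huJ k)
        fun j => S.p₁ u j (k + 1) t + S.p₁ u j k t
    rw [h1, Finset.sum_congr rfl h2, Finset.sum_comm, ← Finset.sum_neg_distrib]
    refine Finset.sum_congr rfl fun j _ => ?_
    rw [sum_Ioo_mul_add (u := fun k => u (j - 1) k - u j k) (by simp [hu0']) (by simp [huK])
      fun k => S.p₁ u j k t, ← Finset.sum_neg_distrib]
    refine Finset.sum_congr rfl fun k _ => ?_
    ring
  have e4 : ∑ j ∈ Finset.Ioo (0 : ℤ) J, ∑ k ∈ Finset.Ioo (0 : ℤ) K,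
      u j k * (S.p₂ u (j + 1) (k + 1) t - S.p₂ u (j + 1) k t + S.p₂ u j (k + 1) t - S.p₂ u j k t)
      = -∑ j ∈ Finset.Ioc (0 : ℤ) J, ∑ k ∈ Finset.Ioc (0 : ℤ) K,
        (u j k - u j (k - 1) + u (j - 1) k - u (j - 1) (k - 1)) * S.p₂ u j k t := by
    have h1 : ∑ j ∈ Finset.Ioo (0 : ℤ) J, ∑ k ∈ Finset.Ioo (0 : ℤ) K,
        u j k * (S.p₂ u (j + 1) (k + 1) t - S.p₂ u (j + 1) k t + S.p₂ u j (k + 1) t - S.p₂ u j k t)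
        = ∑ j ∈ Finset.Ioo (0 : ℤ) J, ∑ k ∈ Finset.Ioo (0 : ℤ) K,
          u j k * ((S.p₂ u (j + 1) (k + 1) t + S.p₂ u j (k + 1) t)
            - (S.p₂ u (j + 1) k t + S.p₂ u j k t)) := by
      refine Finset.sum_congr rfl fun j _ => Finset.sum_congr rfl fun k _ => ?_
      ring
    have h2 : ∀ j ∈ Finset.Ioo (0 : ℤ) J, _ = _ := fun j _ =>
      sum_Ioo_mul_sub (u := fun k => u j k) (hu0' j) (huK j)
        fun k => S.p₂ u (j + 1) k t + S.p₂ u j k t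
    rw [h1, Finset.sum_congr rfl h2, Finset.sum_comm,
      Finset.sum_comm (s := Finset.Ioc (0 : ℤ) J) (t := Finset.Ioc (0 : ℤ) K),
      ← Finset.sum_neg_distrib]
    refine Finset.sum_congr rfl fun k _ => ?_
    rw [sum_Ioo_mul_add (u := fun j => u j (k - 1) - u j k) (by simp [hu0]) (by simp [huJ])
      fun j => S.p₂ u j k t, ← Finset.sum_neg_distrib]
    refine Finset.sum_congr rfl fun j _ => ?_
    ring
  have e5 : 0 ≤ ∑ j ∈ Finset.Ioc (0 : ℤ) J, ∑ k ∈ Finset.Ioc (0 : ℤ) K,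
      ((u j k - u (j - 1) k + u j (k - 1) - u (j - 1) (k - 1)) * S.p₁ u j k t
      + (u j k - u j (k - 1) + u (j - 1) k - u (j - 1) (k - 1)) * S.p₂ u j k t) := by
    refine Finset.sum_nonneg fun j hj => Finset.sum_nonneg fun k hk => ?_
    rw [Finset.mem_Ioc] at hj hk
    exact S.dissipation_nonneg u (hJ j k hj.1 hj.2 hk.1 hk.2) (ha j k hj.1 hj.2 hk.1 hk.2)
  have e6 : ∑ j ∈ Finset.Ioo (0 : ℤ) J, ∑ k ∈ Finset.Ioo (0 : ℤ) K,
      u j k * (S.op u j k t + 2⁻¹ * S.jacRate j k t * u j k)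
      = (∑ j ∈ Finset.Ioo (0 : ℤ) J, ∑ k ∈ Finset.Ioo (0 : ℤ) K,
          u j k ^ 2 * (-2⁻¹ * S.jacRate j k t - S.c j k t * S.jac j k t))
        - ∑ j ∈ Finset.Ioo (0 : ℤ) J, ∑ k ∈ Finset.Ioo (0 : ℤ) K,
          u j k * (S.q₁ u (j + 1) k t - S.q₁ u j k t)
        - ∑ j ∈ Finset.Ioo (0 : ℤ) J, ∑ k ∈ Finset.Ioo (0 : ℤ) K,
          u j k * (S.q₂ u j (k + 1) t - S.q₂ u j k t)
        + 2⁻¹ * ∑ j ∈ Finset.Ioo (0 : ℤ) J, ∑ k ∈ Finset.Ioo (0 : ℤ) K, u j k *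
          (S.p₁ u (j + 1) (k + 1) t - S.p₁ u j (k + 1) t + S.p₁ u (j + 1) k t - S.p₁ u j k t)
        + 2⁻¹ * ∑ j ∈ Finset.Ioo (0 : ℤ) J, ∑ k ∈ Finset.Ioo (0 : ℤ) K, u j k *
          (S.p₂ u (j + 1) (k + 1) t - S.p₂ u (j + 1) k t + S.p₂ u j (k + 1) t - S.p₂ u j k t) := by
    simp only [Finset.mul_sum, ← Finset.sum_sub_distrib, ← Finset.sum_add_distrib]
    refine Finset.sum_congr rfl fun j hj => Finset.sum_congr rfl fun k hk => ?_
    rw [Finset.mem_Ioo] at hj hk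
    rw [op, (hG j k hj.1 hj.2 hk.1 hk.2).deriv]
    ring
  have e7 : (∑ j ∈ Finset.Ioo (0 : ℤ) J, ∑ k ∈ Finset.Ioo (0 : ℤ) K,
          u j k ^ 2 * (-2⁻¹ * S.jacRate j k t - S.c j k t * S.jac j k t))
        - ∑ j ∈ Finset.Ioo (0 : ℤ) J, ∑ k ∈ Finset.Ioo (0 : ℤ) K,
          u j k ^ 2 * (α (j + 1) k / 2 - α j k / 2)
        - ∑ j ∈ Finset.Ioo (0 : ℤ) J, ∑ k ∈ Finset.Ioo (0 : ℤ) K,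
          u j k ^ 2 * (β j (k + 1) / 2 - β j k / 2) ≤ 0 := by
    simp only [← Finset.sum_sub_distrib]
    refine Finset.sum_nonpos fun j hj => Finset.sum_nonpos fun k hk => ?_
    rw [Finset.mem_Ioo] at hj hk
    have h1 := mul_nonneg (sq_nonneg (u j k)) (hC j k hj.1 hj.2 hk.1 hk.2)
    rw [← neg_nonpos] at h1
    refine le_trans (le_of_eq ?_) h1
    simp only [hα, hβ, jacRate]
    ring
  rw [e6, e1, e2, e3, e4]
  simp only [Finset.sum_add_distrib] at e5
  linarith

theorem op_zero (j k : ℤ) (t : ℝ) : S.op (fun _ _ => 0) j k t = 0 := by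
  simp [op, q₁, q₂, p₁, p₂]

theorem extendGrid_zero : extendGrid (fun _ _ => 0) (0 : Interior J K → ℝ) = fun _ _ => 0 := by
  funext j k
  unfold extendGrid
  split_ifs <;> rfl

theorem source_zero (t : ℝ) : S.source (fun _ _ _ => 0) (fun _ _ _ => 0) t = 0 := by
  funext p
  simp only [source, extendGrid_zero, op_zero]
  simp

theorem stiff_mulVec (t : ℝ) (z : Interior J K → ℝ) (p : Interior J K) :
    (S.stiff t *ᵥ z) p = S.op (extendGrid (fun _ _ => 0) z) p.1.1 p.1.2 t := by
  have h := S.stiff_mulVec_add_source (fun _ _ _ => 0) (fun _ _ _ => 0) t z p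
  rw [source_zero] at h
  simpa using h

section Matrices

variable {S} {t : ℝ} (hpos : ∀ p : Interior J K, 0 < S.jac p.1.1 p.1.2 t)
include hpos

theorem sqrtMass_inv : (S.sqrtMass t)⁻¹
    = Matrix.diagonal fun p : Interior J K => (√(S.jac p.1.1 p.1.2 t))⁻¹ := by
  refine Matrix.inv_eq_right_inv ?_
  rw [sqrtMass, Matrix.diagonal_mul_diagonal, ← Matrix.diagonal_one]
  congr 1
  funext p
  exact mul_inv_cancel₀ (Real.sqrt_pos.2 (hpos p)).ne'

theorem sqrtMass_mul_deriv
    (hG : ∀ p : Interior J K, HasDerivAt (S.jac p.1.1 p.1.2) (S.jacRate p.1.1 p.1.2 t) t) :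
    S.sqrtMass t * S.sqrtMassDeriv t
      = Matrix.diagonal fun p : Interior J K => 2⁻¹ * S.jacRate p.1.1 p.1.2 t := by
  ext p q
  rw [sqrtMass, Matrix.diagonal_mul, sqrtMassDeriv, Matrix.of_apply]
  by_cases h : p = q
  · subst h
    simp only [sqrtMass, Matrix.diagonal_apply_eq]
    rw [((hG p).sqrt (hpos p).ne').deriv]
    have := (Real.sqrt_pos.2 (hpos p)).ne'
    field_simp
  · simp only [sqrtMass, Matrix.diagonal_apply_ne _ h, deriv_const, mul_zero]

theorem B_apply (hG : ∀ p : Interior J K, HasDerivAt (S.jac p.1.1 p.1.2) (S.jacRate p.1.1 p.1.2 t) t)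
    (p q : Interior J K) : S.B t p q = (√(S.jac p.1.1 p.1.2 t))⁻¹
      * (S.stiff t p q + if p = q then 2⁻¹ * S.jacRate p.1.1 p.1.2 t else 0)
      * (√(S.jac q.1.1 q.1.2 t))⁻¹ := by
  rw [B, sqrtMass_inv hpos, sqrtMass_mul_deriv hpos hG, Matrix.mul_diagonal, Matrix.diagonal_mul,
    Matrix.add_apply, Matrix.diagonal_apply]

theorem B_semidefinite
    (h : ∀ z : Interior J K → ℝ, z ⬝ᵥ ((S.stiff t + S.sqrtMass t * S.sqrtMassDeriv t) *ᵥ z) ≤ 0)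
    (z : Interior J K → ℝ) : z ⬝ᵥ (S.B t *ᵥ z) ≤ 0 := by
  have h1 := h ((S.sqrtMass t)⁻¹ *ᵥ z)
  have h2 : z ⬝ᵥ (S.B t *ᵥ z) = ((S.sqrtMass t)⁻¹ *ᵥ z)
      ⬝ᵥ ((S.stiff t + S.sqrtMass t * S.sqrtMassDeriv t) *ᵥ ((S.sqrtMass t)⁻¹ *ᵥ z)) := by
    rw [B, ← Matrix.mulVec_mulVec, ← Matrix.mulVec_mulVec, Matrix.dotProduct_mulVec]
    congr 1
    rw [sqrtMass_inv hpos]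
    funext p
    rw [Matrix.vecMul_diagonal, Matrix.mulVec_diagonal, mul_comm]
  rw [h2]
  exact h1

theorem energyNorm_eq_euclid (w : Interior J K → ℝ) :
    S.energyNorm t w = euclid (S.sqrtMass t *ᵥ w) := by
  rw [energyNorm, euclid]
  congr 1
  refine Finset.sum_congr rfl fun p _ => ?_
  rw [mass, sqrtMass, Matrix.mulVec_diagonal, Matrix.mulVec_diagonal]
  have := Real.mul_self_sqrt (hpos p).le
  linear_combination (- w p * w p) * this

theorem sqrtMass_mulVec_inv (w : Interior J K → ℝ) :
    S.sqrtMass t *ᵥ ((S.sqrtMass t)⁻¹ *ᵥ w) = w := by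
  rw [sqrtMass_inv hpos]
  funext p
  rw [sqrtMass, Matrix.mulVec_diagonal, Matrix.mulVec_diagonal, ← mul_assoc,
    mul_inv_cancel₀ (Real.sqrt_pos.2 (hpos p)).ne', one_mul]

theorem inv_mulVec_sqrtMass (w : Interior J K → ℝ) :
    (S.sqrtMass t)⁻¹ *ᵥ (S.sqrtMass t *ᵥ w) = w := by
  rw [sqrtMass_inv hpos]
  funext p
  rw [sqrtMass, Matrix.mulVec_diagonal, Matrix.mulVec_diagonal, ← mul_assoc,
    inv_mul_cancel₀ (Real.sqrt_pos.2 (hpos p)).ne', one_mul]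

end Matrices

/-- The estimate of the spatial operator in matrix form. -/
theorem semidefinite {t : ℝ} (hpos : ∀ p : Interior J K, 0 < S.jac p.1.1 p.1.2 t)
    (hJ : ∀ j k : ℤ, 0 < j → j ≤ J → 0 < k → k ≤ K → 0 < S.cJac j k t)
    (ha : ∀ j k : ℤ, 0 < j → j ≤ J → 0 < k → k ≤ K → 0 < S.a j k t)
    (hC : ∀ j k : ℤ, 0 < j → j < J → 0 < k → k < K →
      0 ≤ S.jac j k t * S.c j k t
        + (S.jXix (j + 1) k t * S.b₁Xi (j + 1) k t - S.jXix j k t * S.b₁Xi j k t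
          + S.jXiy (j + 1) k t * S.b₂Xi (j + 1) k t - S.jXiy j k t * S.b₂Xi j k t) / 2
        + (S.jEtax j (k + 1) t * S.b₁Eta j (k + 1) t - S.jEtax j k t * S.b₁Eta j k t
          + S.jEtay j (k + 1) t * S.b₂Eta j (k + 1) t - S.jEtay j k t * S.b₂Eta j k t) / 2)
    (hG : ∀ j k : ℤ, 0 < j → j < J → 0 < k → k < K → HasDerivAt (S.jac j k) (S.jacRate j k t) t)
    (z : Interior J K → ℝ) :
    z ⬝ᵥ ((S.stiff t + S.sqrtMass t * S.sqrtMassDeriv t) *ᵥ z) ≤ 0 := by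
  have hG' : ∀ p : Interior J K, HasDerivAt (S.jac p.1.1 p.1.2) (S.jacRate p.1.1 p.1.2 t) t :=
    fun p => hG _ _ p.bounds.1 p.bounds.2.1 p.bounds.2.2.1 p.bounds.2.2.2
  have h := S.sum_mul_op_le hJ ha hC hG (u := extendGrid (fun _ _ => 0) z)
    fun j k h => extendGrid_of_not _ _ h
  rw [← Interior.sum_eq fun j k => extendGrid (fun _ _ => 0) z j k *
    (S.op (extendGrid (fun _ _ => 0) z) j k t
      + 2⁻¹ * S.jacRate j k t * extendGrid (fun _ _ => 0) z j k)] at h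
  refine le_trans (le_of_eq ?_) h
  refine Finset.sum_congr rfl fun p _ => ?_
  rw [extendGrid_interior, sqrtMass_mul_deriv hpos hG', Matrix.add_mulVec, Pi.add_apply,
    stiff_mulVec, Matrix.mulVec_diagonal]

end Scheme

/-! ### Solutions on the whole time interval -/

theorem IsPartition.monotone {T : ℝ} {N : ℕ} {τ : ℕ → ℝ} (h : IsPartition T N τ) {n k : ℕ}
    (hnk : n ≤ k) (hk : k ≤ N) : τ n ≤ τ k := by
  induction k, hnk using Nat.le_induction with
  | base => exact le_rfl
  | succ k _ ih => exact (ih (Nat.le_of_succ_le hk)).trans (h.lt k hk).le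

theorem IsPartition.Icc_subset {T : ℝ} {N : ℕ} {τ : ℕ → ℝ} (h : IsPartition T N τ) {n : ℕ}
    (hn : n < N) : Icc (τ n) (τ (n + 1)) ⊆ Icc 0 T := by
  have h1 := h.monotone (Nat.zero_le n) hn.le
  have h2 := h.monotone (Nat.succ_le_of_lt hn) le_rfl
  rw [h.zero] at h1
  rw [h.last] at h2
  exact Icc_subset_Icc h1 h2

/-- Solutions on consecutive subintervals can be joined to a continuous function. -/
theorem exists_glue {E : Type*} [TopologicalSpace E] {τ : ℕ → ℝ} {N : ℕ}
    (hτ : ∀ n < N, τ n < τ (n + 1)) {Q : ℕ → (ℝ → E) → Prop}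
    (h : ∀ n < N, ∀ x, ∃ f, ContinuousOn f (Icc (τ n) (τ (n + 1))) ∧ f (τ n) = x ∧ Q n f) (x₀ : E) :
    ∃ v, ContinuousOn v (Icc (τ 0) (τ N)) ∧ v (τ 0) = x₀ ∧
      ∀ n < N, ∃ f, Q n f ∧ EqOn v f (Icc (τ n) (τ (n + 1))) := by
  induction N with
  | zero => exact ⟨fun _ => x₀, continuousOn_const, rfl, by simp⟩
  | succ N ih =>
    obtain ⟨v, hv1, hv2, hv3⟩ := ih (fun n hn => hτ n (by omega)) fun n hn => h n (by omega)
    obtain ⟨f, hf1, hf2, hf3⟩ := h N (Nat.lt_succ_self N) (v (τ N))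
    have hmono : ∀ n ≤ N, τ n ≤ τ N := by
      intro n hn
      induction hn using Nat.decreasingInduction with
      | self => exact le_rfl
      | of_succ k hk ih => exact (hτ k (by omega)).le.trans ih
    have e1 : EqOn (fun t => if t ≤ τ N then v t else f t) v (Iic (τ N)) := fun t ht => if_pos ht
    have e2 : EqOn (fun t => if t ≤ τ N then v t else f t) f (Icc (τ N) (τ (N + 1))) := by
      intro t ht
      by_cases h1 : t ≤ τ N
      · obtain rfl : t = τ N := le_antisymm h1 ht.1
        simp [hf2]
      · exact if_neg h1
    refine ⟨fun t => if t ≤ τ N then v t else f t, ?_, ?_, fun n hn => ?_⟩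
    · rw [← Icc_union_Icc_eq_Icc (hmono 0 (Nat.zero_le N)) (hτ N (Nat.lt_succ_self N)).le]
      exact (hv1.congr (e1.mono Icc_subset_Iic_self)).union_of_isClosed (hf1.congr e2)
        isClosed_Icc isClosed_Icc
    · rw [← hv2]
      exact e1 (hmono 0 (Nat.zero_le N))
    · rcases Nat.lt_succ_iff_lt_or_eq.1 hn with hn | rfl
      · obtain ⟨g, hg1, hg2⟩ := hv3 n hn
        exact ⟨g, hg1, (e1.mono (Icc_subset_Iic_self.trans
          (Iic_subset_Iic.2 (hmono (n + 1) hn)))).trans hg2⟩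
      · exact ⟨f, hf3, e2⟩

namespace Scheme

variable {J K : ℕ} {S : Scheme J K} {T : ℝ} {N : ℕ} {τ : ℕ → ℝ}

section

variable (hτ : IsPartition T N τ) (hS : S.IsNondegenerate T)
include hS

theorem IsNondegenerate.mass_pos {t : ℝ} (ht : t ∈ Icc 0 T) (p : Interior J K) :
    0 < S.jac p.1.1 p.1.2 t :=
  hS.jac_pos t ht _ _ p.bounds.1 p.bounds.2.1 p.bounds.2.2.1 p.bounds.2.2.2

include hτ

theorem stiff_semidefinite (hC : S.CoefficientCondition N τ) (hG : S.GeometricConservationLaw N τ)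
    {n : ℕ} (hn : n < N) {t : ℝ} (ht : t ∈ Ioo (τ n) (τ (n + 1))) (z : Interior J K → ℝ) :
    z ⬝ᵥ ((S.stiff t + S.sqrtMass t * S.sqrtMassDeriv t) *ᵥ z) ≤ 0 := by
  have ht' := hτ.Icc_subset hn (Ioo_subset_Icc_self ht)
  exact S.semidefinite (hS.mass_pos ht') (hS.cJac_pos t ht') (hS.a_pos t ht') (hC n hn t ht)
    (hG n hn t ht) z

theorem B_semidefinite_step (hC : S.CoefficientCondition N τ)
    (hG : S.GeometricConservationLaw N τ) {n : ℕ} (hn : n < N) {t : ℝ}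
    (ht : t ∈ Ioo (τ n) (τ (n + 1))) (z : Interior J K → ℝ) : z ⬝ᵥ (S.B t *ᵥ z) ≤ 0 :=
  B_semidefinite (hS.mass_pos (hτ.Icc_subset hn (Ioo_subset_Icc_self ht)))
    (stiff_semidefinite hτ hS hC hG hn ht) z

end

variable {m : ℕ} {ρ : Fin m → ℝ} {F : ℝ → Interior J K → ℝ}

/-- On a subinterval, a collocation solution is given by polynomials that satisfy the collocation
equations. -/
theorem IsCollocationSolution.exists_step {v : ℝ → Interior J K → ℝ}
    (h : S.IsCollocationSolution T N τ ρ F v) (hρ : IsGaussLegendre ρ) {n : ℕ} (hn : n < N)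
    (hlt : τ n < τ (n + 1)) : ∃ P : Interior J K → Polynomial ℝ,
      IsCollocationStep ρ (τ n) (τ (n + 1)) S.B (fun t => (S.sqrtMass t)⁻¹ *ᵥ F t) P ∧
      ∀ t ∈ Icc (τ n) (τ (n + 1)), v t = fun p => (P p).eval t := by
  choose P hP1 hP2 using h.polynomial n hn
  have hv : ∀ t ∈ Icc (τ n) (τ (n + 1)), v t = fun p => (P p).eval t := fun t ht =>
    funext fun p => hP2 p t ht
  refine ⟨P, ⟨hP1, fun j p => ?_⟩, hv⟩
  have hj := hρ.point_mem hlt j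
  have h1 := h.collocation n hn j
  rw [collocationPoint, hv _ (Ioo_subset_Icc_self hj)] at h1
  have h2 := hasDerivAt_pi.1 h1 p
  have h3 : (fun t => v t p) =ᶠ[nhds (τ n + ρ j * (τ (n + 1) - τ n))] fun t => (P p).eval t := by
    filter_upwards [Icc_mem_nhds hj.1 hj.2] with t ht using hP2 p t ht
  exact ((P p).hasDerivAt _).unique (h2.congr_of_eventuallyEq h3.symm)

theorem exists_isCollocationSolution (hτ : IsPartition T N τ) (hρ : IsGaussLegendre ρ) (hm : 1 ≤ m)
    (hB : ∀ n < N, ∀ t ∈ Ioo (τ n) (τ (n + 1)), ∀ z, z ⬝ᵥ (S.B t *ᵥ z) ≤ 0)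
    (v₀ : Interior J K → ℝ) : ∃ v, S.IsCollocationSolution T N τ ρ F v ∧ v 0 = v₀ := by
  obtain ⟨v, hv1, hv2, hv3⟩ := exists_glue hτ.lt
    (Q := fun n f => ∃ P : Interior J K → Polynomial ℝ,
      IsCollocationStep ρ (τ n) (τ (n + 1)) S.B (fun t => (S.sqrtMass t)⁻¹ *ᵥ F t) P ∧
      f = fun t p => (P p).eval t)
    (fun n hn x => by
      obtain ⟨P, hP, hP0⟩ := exists_isCollocationStep hρ hm (hτ.lt n hn)
        (fun j => hB n hn _ (hρ.point_mem (hτ.lt n hn) j)) (fun t => (S.sqrtMass t)⁻¹ *ᵥ F t) x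
      exact ⟨fun t p => (P p).eval t, continuousOn_pi.2 fun p => (P p).continuous.continuousOn,
        funext hP0, P, hP, rfl⟩) v₀
  rw [hτ.zero, hτ.last] at hv1
  rw [hτ.zero] at hv2
  refine ⟨v, ⟨hv1, fun n hn p => ?_, fun n hn j => ?_⟩, hv2⟩
  · obtain ⟨f, ⟨P, hP, rfl⟩, hf⟩ := hv3 n hn
    exact ⟨P p, hP.natDegree_le p, fun t ht => congrFun (hf ht) p⟩
  · obtain ⟨f, ⟨P, hP, rfl⟩, hf⟩ := hv3 n hn
    have hj := hρ.point_mem (hτ.lt n hn) j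
    rw [collocationPoint, hf (Ioo_subset_Icc_self hj)]
    have h3 : v =ᶠ[nhds (τ n + ρ j * (τ (n + 1) - τ n))] fun t p => (P p).eval t := by
      filter_upwards [Icc_mem_nhds hj.1 hj.2] with t ht using hf ht
    refine HasDerivAt.congr_of_eventuallyEq (hasDerivAt_pi.2 fun p => ?_) h3
    exact ((P p).hasDerivAt _).congr_deriv (hP.eq j p)

theorem IsCollocationSolution.eqOn {v v' : ℝ → Interior J K → ℝ}
    (h : S.IsCollocationSolution T N τ ρ F v) (h' : S.IsCollocationSolution T N τ ρ F v')
    (hτ : IsPartition T N τ) (hρ : IsGaussLegendre ρ) (hm : 1 ≤ m)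
    (hB : ∀ n < N, ∀ t ∈ Ioo (τ n) (τ (n + 1)), ∀ z, z ⬝ᵥ (S.B t *ᵥ z) ≤ 0)
    (h0 : v 0 = v' 0) : EqOn v v' (Icc 0 T) := by
  have key : ∀ n ≤ N, EqOn v v' (Icc 0 (τ n)) := by
    intro n
    induction n with
    | zero =>
      intro _ t ht
      rw [hτ.zero, Icc_self, mem_singleton_iff] at ht
      rw [ht, h0]
    | succ n ih =>
      intro hn t ht
      have ih := ih (by omega)
      rcases le_total t (τ n) with h1 | h1
      · exact ih ⟨ht.1, h1⟩
      · have hlt := hτ.lt n hn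
        obtain ⟨P, hP, hPv⟩ := h.exists_step hρ hn hlt
        obtain ⟨P', hP', hPv'⟩ := h'.exists_step hρ hn hlt
        have hl := left_mem_Icc.2 hlt.le
        have h2 : v (τ n) = v' (τ n) := ih ⟨by
          have := hτ.monotone (Nat.zero_le n) (by omega); rwa [hτ.zero] at this, le_rfl⟩
        rw [hPv _ hl, hPv' _ hl] at h2
        rw [hPv t ⟨h1, ht.2⟩, hPv' t ⟨h1, ht.2⟩]
        funext p
        exact hP.eq_of_eval_eq hP' hρ hm hlt (fun j => hB n hn _ (hρ.point_mem hlt j))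
          (congrFun h2) p t
  have := key N le_rfl
  rwa [hτ.last] at this

theorem IsCollocationSolution.energy_le {v : ℝ → Interior J K → ℝ}
    (h : S.IsCollocationSolution T N τ ρ (S.source (fun _ _ _ => 0) (fun _ _ _ => 0)) v)
    (hτ : IsPartition T N τ) (hρ : IsGaussLegendre ρ) (hm : 1 ≤ m)
    (hB : ∀ n < N, ∀ t ∈ Ioo (τ n) (τ (n + 1)), ∀ z, z ⬝ᵥ (S.B t *ᵥ z) ≤ 0) {n : ℕ} (hn : n < N) :
    v (τ (n + 1)) ⬝ᵥ v (τ (n + 1)) ≤ v (τ n) ⬝ᵥ v (τ n) := by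
  have hlt := hτ.lt n hn
  obtain ⟨P, hP, hPv⟩ := h.exists_step hρ hn hlt
  have h0 : (fun t => (S.sqrtMass t)⁻¹ *ᵥ S.source (fun _ _ _ => 0) (fun _ _ _ => 0) t)
      = (0 : ℝ → Interior J K → ℝ) := by
    funext t
    rw [source_zero, Matrix.mulVec_zero]
    rfl
  rw [h0] at hP
  have h1 := hP.energy_le hρ hm hlt.le fun j => hB n hn _ (hρ.point_mem hlt j)
  rw [hPv _ (right_mem_Icc.2 hlt.le), hPv _ (left_mem_Icc.2 hlt.le)]
  simpa only [dotProduct, ← sq] using h1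

end Scheme

/-! ### Geometry of the moving mesh -/

/-- All the data and hypotheses of the convergence theorem on a `J × K` mesh, with a distinguished
time step `n`. It serves as an index type: estimates that are uniform over `MeshStep` have
constants that only depend on its parameters. -/
structure MeshStep (P : IBVP) (u : ℝ × ℝ × ℝ → ℝ) (T C κ : ℝ) (J K : ℕ) where
  /-- the scheme -/
  S : Scheme J K
  /-- the number of time steps -/
  N : ℕ
  /-- the time levels -/
  τ : ℕ → ℝ
  /-- the coordinate transformation -/
  X : ℝ → ℝ × ℝ → ℝ × ℝ
  /-- the distinguished time step -/
  n : ℕ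
  hn : n < N
  hJ : 0 < J
  hK : 0 < K
  partition : IsPartition T N τ
  trans : IsCoordinateTransformation T N τ C κ X
  sol : P.IsSolution T (physicalDomain X) u
  nondegenerate : S.IsNondegenerate T
  uniform : S.IsUniform T κ
  consistent : S.IsConsistent P T N τ C X
  coefficient : S.CoefficientCondition N τ
  gcl : S.GeometricConservationLaw N τ

namespace MeshStep

variable {P : IBVP} {u : ℝ × ℝ × ℝ → ℝ} {T C κ : ℝ} {J K : ℕ} (s : MeshStep P u T C κ J K)

/-- The beginning of the time step. -/
def a : ℝ := s.τ s.n

/-- The end of the time step. -/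
def b : ℝ := s.τ (s.n + 1)

theorem a_lt_b : s.a < s.b := s.partition.lt s.n s.hn

theorem Icc_subset : Icc s.a s.b ⊆ Icc 0 T := s.partition.Icc_subset s.hn

theorem Ioo_subset_Ioc : Ioo s.a s.b ⊆ Ioc 0 T := fun _ ht =>
  ⟨(s.Icc_subset (left_mem_Icc.2 s.a_lt_b.le)).1.trans_lt ht.1,
    (s.Icc_subset (Ioo_subset_Icc_self ht)).2⟩

/-- The velocity of the coordinate transformation, which is constant in time over a step. -/
noncomputable def V (z : ℝ × ℝ) : ℝ × ℝ := (s.b - s.a)⁻¹ • (s.X s.b z - s.X s.a z)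

theorem X_eq {t : ℝ} (ht : t ∈ Icc s.a s.b) (z : ℝ × ℝ) :
    s.X t z = s.X s.a z + (t - s.a) • s.V z := by
  have h := s.trans.affine s.n s.hn t ht z
  have h0 := (sub_pos.2 s.a_lt_b).ne'
  rw [h, V]
  have h1 : (s.b - t) / (s.b - s.a) = 1 - (t - s.a) / (s.b - s.a) := by
    field_simp
    ring
  change ((s.b - t) / (s.b - s.a)) • s.X s.a z + ((t - s.a) / (s.b - s.a)) • s.X s.b z = _
  rw [h1, smul_smul, ← div_eq_mul_inv]
  module

theorem X_hasDerivAt {t : ℝ} (ht : t ∈ Ioo s.a s.b) (z : ℝ × ℝ) :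
    HasDerivAt (fun r => s.X r z) (s.V z) t := by
  have h1 : HasDerivAt (fun r : ℝ => s.X s.a z + (r - s.a) • s.V z) ((1 : ℝ) • s.V z) t :=
    (((hasDerivAt_id t).sub_const s.a).smul_const (s.V z)).const_add _
  rw [one_smul] at h1
  refine h1.congr_of_eventuallyEq ?_
  filter_upwards [Icc_mem_nhds ht.1 ht.2] with r hr using s.X_eq hr z

theorem velocity_eq {t : ℝ} (ht : t ∈ Ioo s.a s.b) (z : ℝ × ℝ) : velocity s.X t z = s.V z :=
  (s.X_hasDerivAt ht z).deriv

theorem norm_V_le {z : ℝ × ℝ} (hz : z ∈ unitSquare) : ‖s.V z‖ ≤ C := by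
  have := s.trans.bound_velocity s.n s.hn 0 (Nat.zero_le _) z hz
  rwa [norm_iteratedFDeriv_zero] at this

theorem contDiff_V : ContDiff ℝ 4 s.V :=
  ((s.trans.contDiff _ s.hn).sub (s.trans.contDiff _ s.hn.le)).const_smul _

theorem contDiff_X {t : ℝ} (ht : t ∈ Icc s.a s.b) : ContDiff ℝ 4 (s.X t) := by
  have : s.X t = fun z => s.X s.a z + (t - s.a) • s.V z := funext (s.X_eq ht)
  rw [this]
  exact (s.trans.contDiff _ s.hn.le).add (s.contDiff_V.const_smul _)

theorem norm_X_le {t : ℝ} (ht : t ∈ Icc s.a s.b) {z : ℝ × ℝ} (hz : z ∈ unitSquare) :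
    ‖s.X t z‖ ≤ C + T * C := by
  have h1 := s.trans.bound s.n s.hn.le 0 (Nat.zero_le _) z hz
  rw [norm_iteratedFDeriv_zero] at h1
  have h2 := s.norm_V_le hz
  have h3 : t - s.a ≤ T := by
    have := (s.Icc_subset (left_mem_Icc.2 s.a_lt_b.le)).1
    have := (s.Icc_subset ht).2
    linarith
  rw [s.X_eq ht]
  refine (norm_add_le _ _).trans (add_le_add h1 ?_)
  rw [norm_smul, Real.norm_eq_abs, abs_of_nonneg (sub_nonneg.2 ht.1)]
  exact mul_le_mul h3 h2 (norm_nonneg _) ((sub_nonneg.2 ht.1).trans h3)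

/-- The node `(j/J, k/K)` of the computational mesh. -/
noncomputable def node (J K : ℕ) (j k : ℤ) : ℝ × ℝ := ((j : ℝ) / J, (k : ℝ) / K)

theorem node_mem (hJ : 0 < J) (hK : 0 < K) {j k : ℤ} (hj : 0 ≤ j) (hj' : j ≤ J) (hk : 0 ≤ k)
    (hk' : k ≤ K) : node J K j k ∈ unitSquare := by
  have hJ' : (0 : ℝ) < J := by exact_mod_cast hJ
  have hK' : (0 : ℝ) < K := by exact_mod_cast hK
  refine ⟨⟨div_nonneg (by exact_mod_cast hj) hJ'.le, (div_le_one hJ').2 (by exact_mod_cast hj')⟩,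
    ⟨div_nonneg (by exact_mod_cast hk) hK'.le, (div_le_one hK').2 (by exact_mod_cast hk')⟩⟩

theorem node_mem_interior_iff (hJ : 0 < J) (hK : 0 < K) {j k : ℤ} :
    node J K j k ∈ Ioo (0 : ℝ) 1 ×ˢ Ioo (0 : ℝ) 1 ↔ 0 < j ∧ j < J ∧ 0 < k ∧ k < K := by
  have hJ' : (0 : ℝ) < J := by exact_mod_cast hJ
  have hK' : (0 : ℝ) < K := by exact_mod_cast hK
  rw [mem_prod, node, mem_Ioo, mem_Ioo, div_pos_iff_of_pos_right hJ', div_lt_one hJ',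
    div_pos_iff_of_pos_right hK', div_lt_one hK', and_assoc]
  norm_cast

/-- Points on the boundary of the unit square are mapped to the boundary of the physical domain;
this only uses continuity and injectivity. -/
theorem mem_frontier_physicalDomain {X : ℝ → ℝ × ℝ → ℝ × ℝ} {t : ℝ} (hc : Continuous (X t))
    (hinj : InjOn (X t) unitSquare) {z : ℝ × ℝ} (hz : z ∈ unitSquare)
    (hz' : z ∉ Ioo (0 : ℝ) 1 ×ˢ Ioo (0 : ℝ) 1) : X t z ∈ frontier (physicalDomain X t) := by
  refine ⟨image_closure_subset_closure_image hc ⟨z, ?_, rfl⟩, fun h => ?_⟩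
  · rw [closure_prod_eq, closure_Ioo zero_ne_one]
    exact hz
  · obtain ⟨z', h1, h2⟩ := interior_subset h
    have h3 : z' ∈ unitSquare := ⟨Ioo_subset_Icc_self h1.1, Ioo_subset_Icc_self h1.2⟩
    rw [hinj h3 hz h2] at h1
    exact hz' h1

theorem nodes_eq {t : ℝ} (ht : t ∈ Icc s.a s.b) {j k : ℤ} (hj : 0 ≤ j) (hj' : j ≤ J) (hk : 0 ≤ k)
    (hk' : k ≤ K) : (s.S.x j k t, s.S.y j k t) = s.X t (node J K j k) :=
  s.consistent.nodes t (s.Icc_subset ht) j k hj hj' hk hk'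

/-- Values of `u` may replace the boundary data, about which no regularity in time is known. -/
theorem nodal_eq_boundary {t : ℝ} (ht : t ∈ Ioo s.a s.b) {j k : ℤ} (hj : 0 ≤ j) (hj' : j ≤ J)
    (hk : 0 ≤ k) (hk' : k ≤ K) (hb : ¬(0 < j ∧ j < J ∧ 0 < k ∧ k < K)) :
    s.S.nodal P.g j k t = s.S.nodal u j k t := by
  have ht' := Ioo_subset_Icc_self ht
  have h := s.sol.boundary t (s.Ioo_subset_Ioc ht) (s.X t (node J K j k))
    (mem_frontier_physicalDomain (s.contDiff_X ht').continuous
      (s.trans.injOn t (s.Icc_subset ht')) (node_mem s.hJ s.hK hj hj' hk hk')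
      (by rw [node_mem_interior_iff s.hJ s.hK]; exact hb))
  rw [← s.nodes_eq ht' hj hj' hk hk'] at h
  exact h.symm

theorem hasDerivAt_x {t : ℝ} (ht : t ∈ Ioo s.a s.b) {j k : ℤ} (hj : 0 ≤ j) (hj' : j ≤ J)
    (hk : 0 ≤ k) (hk' : k ≤ K) : HasDerivAt (s.S.x j k) (s.V (node J K j k)).1 t := by
  have h : HasDerivAt (fun r => (s.X r (node J K j k)).1) (s.V (node J K j k)).1 t :=
    (s.X_hasDerivAt ht (node J K j k)).fst
  refine h.congr_of_eventuallyEq ?_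
  filter_upwards [Icc_mem_nhds ht.1 ht.2] with r hr
  exact congrArg Prod.fst (s.nodes_eq hr hj hj' hk hk')

theorem hasDerivAt_y {t : ℝ} (ht : t ∈ Ioo s.a s.b) {j k : ℤ} (hj : 0 ≤ j) (hj' : j ≤ J)
    (hk : 0 ≤ k) (hk' : k ≤ K) : HasDerivAt (s.S.y j k) (s.V (node J K j k)).2 t := by
  have h : HasDerivAt (fun r => (s.X r (node J K j k)).2) (s.V (node J K j k)).2 t :=
    (s.X_hasDerivAt ht (node J K j k)).snd
  refine h.congr_of_eventuallyEq ?_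
  filter_upwards [Icc_mem_nhds ht.1 ht.2] with r hr
  exact congrArg Prod.snd (s.nodes_eq hr hj hj' hk hk')

end MeshStep

/-! ### Regularity in time of the semi-discrete system -/

/-- Uniform bounds on iterated derivatives make a family of functions of time regular. -/
theorem timeFrame_reg_of_iteratedDeriv {ι : Type*} {a b : ι → ℝ} {r : ℕ} {C : ℝ} {q : ι → ℝ → ℝ}
    (h : ∀ i, ContDiffOn ℝ r (q i) (Ioo (a i) (b i)) ∧
      ∀ l ≤ r, ∀ t ∈ Ioo (a i) (b i), |iteratedDeriv l (q i) t| ≤ C) :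
    (timeFrame a b).Reg r fun o => q o.1 o.2 := by
  have hb : (timeFrame a b).Bdd fun o => q o.1 o.2 :=
    ⟨C, fun o ho => by simpa using (h o.1).2 0 (Nat.zero_le _) o.2 ho⟩
  induction r generalizing q with
  | zero => exact hb
  | succ r ih =>
    have h1 : ∀ i, DifferentiableOn ℝ (q i) (Ioo (a i) (b i)) ∧
        ContDiffOn ℝ r (deriv (q i)) (Ioo (a i) (b i)) := fun i => by
      have := (contDiffOn_succ_iff_deriv_of_isOpen (n := r) isOpen_Ioo).1 (by exact_mod_cast (h i).1)
      exact ⟨this.1, this.2.2⟩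
    have h2 : ∀ i, ContDiffOn ℝ r (deriv (q i)) (Ioo (a i) (b i)) ∧
        ∀ l ≤ r, ∀ t ∈ Ioo (a i) (b i), |iteratedDeriv l (deriv (q i)) t| ≤ C := fun i =>
      ⟨(h1 i).2, fun l hl t ht => by
        rw [← iteratedDeriv_succ']
        exact (h i).2 (l + 1) (Nat.succ_le_succ hl) t ht⟩
    exact timeFrame_reg_succ hb (f' := fun o => deriv (q o.1) o.2)
      (fun i t ht => ((h1 i).1.differentiableAt (Ioo_mem_nhds ht.1 ht.2)).hasDerivAt)
      (ih h2 ⟨C, fun o ho => by simpa using (h2 o.1).2 0 (Nat.zero_le _) o.2 ho⟩)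

/-- Bounds that are uniform over a family are uniform over a reindexed family. -/
theorem Frame.Reg.comp_index {ι ι' : Type*} {a b : ι → ℝ} {k : ℕ} {f : ι × ℝ → ℝ}
    (h : (timeFrame a b).Reg k f) (g : ι' → ι) :
    (timeFrame (fun i => a (g i)) fun i => b (g i)).Reg k fun o => f (g o.1, o.2) := by
  have hb : ∀ {f : ι × ℝ → ℝ}, (timeFrame a b).Bdd f →
      (timeFrame (fun i => a (g i)) fun i => b (g i)).Bdd fun o => f (g o.1, o.2) := by
    rintro f ⟨D, hD⟩
    exact ⟨D, fun o ho => hD (g o.1, o.2) ho⟩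
  induction k generalizing f with
  | zero => exact hb h
  | succ k ih =>
    obtain ⟨f', h1, h2⟩ := h.2 ()
    exact timeFrame_reg_succ (hb h.1) (f' := fun o => f' (g o.1, o.2))
      (fun i t ht => timeFrame_der_iff.1 h1 (g i) t ht) (ih h2)

/-- Mesh steps with coefficients of class `C^r` in time. -/
abbrev RegularStep (P : IBVP) (u : ℝ × ℝ × ℝ → ℝ) (T C κ : ℝ) (J K r : ℕ) : Type :=
  {s : MeshStep P u T C κ J K // s.S.IsTimeRegular T s.N s.τ r C}

namespace RegularStep

variable {P : IBVP} {u : ℝ × ℝ × ℝ → ℝ} {T C κ : ℝ} {J K r : ℕ}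

/-- The time frame of all regular mesh steps. -/
abbrev frame (P : IBVP) (u : ℝ × ℝ × ℝ → ℝ) (T C κ : ℝ) (J K r : ℕ) :
    Frame (RegularStep P u T C κ J K r × ℝ) Unit :=
  timeFrame (fun s => s.1.a) fun s => s.1.b

theorem reg_of_timeRegular {q : RegularStep P u T C κ J K r → ℝ → ℝ}
    (h : ∀ s, TimeRegular s.1.N s.1.τ r C (q s)) : (frame P u T C κ J K r).Reg r fun o => q o.1 o.2 :=
  timeFrame_reg_of_iteratedDeriv fun s => h s s.1.n s.1.hn

theorem reg_time {k : ℕ} : (frame P u T C κ J K r).Reg k fun o => o.2 := by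
  have hb : (frame P u T C κ J K r).Bdd fun o => o.2 := ⟨T, fun o ho => by
    have := o.1.1.Icc_subset (Ioo_subset_Icc_self ho)
    exact (abs_of_nonneg this.1).trans_le this.2⟩
  cases k with
  | zero => exact hb
  | succ k =>
    exact timeFrame_reg_succ hb (f' := fun _ => 1) (fun _ t _ => hasDerivAt_id t)
      (Frame.Reg.const 1)

variable {j k : ℤ}

theorem reg_x (hj : 0 ≤ j) (hj' : j ≤ J) (hk : 0 ≤ k) (hk' : k ≤ K) {l : ℕ} :
    (frame P u T C κ J K r).Reg l fun o => o.1.1.S.x j k o.2 := by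
  have hb : (frame P u T C κ J K r).Bdd fun o => o.1.1.S.x j k o.2 := ⟨C + T * C, fun o ho => by
    have h1 := o.1.1.norm_X_le (Ioo_subset_Icc_self ho) (MeshStep.node_mem o.1.1.hJ o.1.1.hK hj hj' hk hk')
    rw [← o.1.1.nodes_eq (Ioo_subset_Icc_self ho) hj hj' hk hk'] at h1
    exact (norm_fst_le _).trans h1⟩
  cases l with
  | zero => exact hb
  | succ l =>
    refine timeFrame_reg_succ hb (f' := fun o => (o.1.1.V (MeshStep.node J K j k)).1)
      (fun s t ht => s.1.hasDerivAt_x ht hj hj' hk hk') (Frame.Reg.of_const_along ⟨C, fun o _ => ?_⟩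
        fun _ _ _ _ _ => rfl)
    exact (norm_fst_le _).trans (o.1.1.norm_V_le (MeshStep.node_mem o.1.1.hJ o.1.1.hK hj hj' hk hk'))

theorem reg_y (hj : 0 ≤ j) (hj' : j ≤ J) (hk : 0 ≤ k) (hk' : k ≤ K) {l : ℕ} :
    (frame P u T C κ J K r).Reg l fun o => o.1.1.S.y j k o.2 := by
  have hb : (frame P u T C κ J K r).Bdd fun o => o.1.1.S.y j k o.2 := ⟨C + T * C, fun o ho => by
    have h1 := o.1.1.norm_X_le (Ioo_subset_Icc_self ho) (MeshStep.node_mem o.1.1.hJ o.1.1.hK hj hj' hk hk')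
    rw [← o.1.1.nodes_eq (Ioo_subset_Icc_self ho) hj hj' hk hk'] at h1
    exact (norm_snd_le _).trans h1⟩
  cases l with
  | zero => exact hb
  | succ l =>
    refine timeFrame_reg_succ hb (f' := fun o => (o.1.1.V (MeshStep.node J K j k)).2)
      (fun s t ht => s.1.hasDerivAt_y ht hj hj' hk hk') (Frame.Reg.of_const_along ⟨C, fun o _ => ?_⟩
        fun _ _ _ _ _ => rfl)
    exact (norm_snd_le _).trans (o.1.1.norm_V_le (MeshStep.node_mem o.1.1.hJ o.1.1.hK hj hj' hk hk'))

theorem reg_nodal {φ : ℝ × ℝ × ℝ → ℝ} (hφ : ContDiff ℝ ∞ φ) (hj : 0 ≤ j) (hj' : j ≤ J)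
    (hk : 0 ≤ k) (hk' : k ≤ K) {l : ℕ} : (frame P u T C κ J K r).Reg l fun o => o.1.1.S.nodal φ j k o.2 :=
  Frame.Reg.comp_spaceTime hφ (reg_x hj hj' hk hk') (reg_y hj hj' hk hk') reg_time

section Cell

variable (hj : 0 < j) (hj' : j ≤ J) (hk : 0 < k) (hk' : k ≤ K) {l : ℕ}
include hj hj' hk hk'

theorem reg_cXix : (frame P u T C κ J K r).Reg l fun o => o.1.1.S.cXix j k o.2 :=
  ((((reg_y (by omega) (by omega) (by omega) (by omega)).sub
    (reg_y (by omega) (by omega) (by omega) (by omega))).add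
    (reg_y (by omega) (by omega) (by omega) (by omega))).sub
    (reg_y (by omega) (by omega) (by omega) (by omega))).div_const 2

theorem reg_cXiy : (frame P u T C κ J K r).Reg l fun o => o.1.1.S.cXiy j k o.2 :=
  ((((reg_x (by omega) (by omega) (by omega) (by omega)).sub
    (reg_x (by omega) (by omega) (by omega) (by omega))).add
    (reg_x (by omega) (by omega) (by omega) (by omega))).sub
    (reg_x (by omega) (by omega) (by omega) (by omega))).div_const 2 |>.neg

theorem reg_cEtax : (frame P u T C κ J K r).Reg l fun o => o.1.1.S.cEtax j k o.2 :=
  ((((reg_y (by omega) (by omega) (by omega) (by omega)).sub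
    (reg_y (by omega) (by omega) (by omega) (by omega))).add
    (reg_y (by omega) (by omega) (by omega) (by omega))).sub
    (reg_y (by omega) (by omega) (by omega) (by omega))).div_const 2 |>.neg

theorem reg_cEtay : (frame P u T C κ J K r).Reg l fun o => o.1.1.S.cEtay j k o.2 :=
  ((((reg_x (by omega) (by omega) (by omega) (by omega)).sub
    (reg_x (by omega) (by omega) (by omega) (by omega))).add
    (reg_x (by omega) (by omega) (by omega) (by omega))).sub
    (reg_x (by omega) (by omega) (by omega) (by omega))).div_const 2

theorem reg_cJac : (frame P u T C κ J K r).Reg l fun o => o.1.1.S.cJac j k o.2 :=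
  ((reg_cXix hj hj' hk hk').mul (reg_cEtay hj hj' hk hk')).sub
    ((reg_cXiy hj hj' hk hk').mul (reg_cEtax hj hj' hk hk'))

/-- The factor `a / (2 J)` of the diffusion fluxes. -/
theorem reg_a_div (hκ : 0 < κ) :
    (frame P u T C κ J K r).Reg r fun o => o.1.1.S.a j k o.2 / (2 * o.1.1.S.cJac j k o.2) := by
  have ha : (frame P u T C κ J K r).Reg r fun o => o.1.1.S.a j k o.2 :=
    reg_of_timeRegular (q := fun s => s.1.S.a j k) fun s => s.2.a j k hj hj' hk hk'
  by_cases hJK : 0 < J ∧ 0 < K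
  · have hJ' : (0 : ℝ) < J := by exact_mod_cast hJK.1
    have hK' : (0 : ℝ) < K := by exact_mod_cast hJK.2
    have hc : 0 < κ * ((1 / (J : ℝ)) * (1 / (K : ℝ))) := by positivity
    refine ((ha.mul (Frame.Reg.inv hc (reg_cJac hj hj' hk hk') fun o ho =>
      o.1.1.uniform.cJac_ge _ (o.1.1.Icc_subset (Ioo_subset_Icc_self ho)) j k hj hj' hk hk')).const_mul
      2⁻¹).congr fun o _ => ?_
    simp only [div_eq_mul_inv, mul_inv]
    ring
  · omega

end Cell

section Xi

variable (hj : 0 < j) (hj' : j ≤ J) (hk : 0 < k) (hk' : k < K)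
include hj hj' hk hk'

theorem reg_xi : (frame P u T C κ J K r).Reg r (fun o => o.1.1.S.b₁Xi j k o.2) ∧
    (frame P u T C κ J K r).Reg r (fun o => o.1.1.S.b₂Xi j k o.2) ∧
    (frame P u T C κ J K r).Reg r (fun o => o.1.1.S.jXix j k o.2) ∧
    (frame P u T C κ J K r).Reg r (fun o => o.1.1.S.jXiy j k o.2) ∧
    (frame P u T C κ J K r).Reg r (fun o => o.1.1.S.xdotXi j k o.2) ∧
    (frame P u T C κ J K r).Reg r (fun o => o.1.1.S.ydotXi j k o.2) := by
  have h := fun s : RegularStep P u T C κ J K r => s.2.xi j k hj hj' hk hk'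
  exact ⟨reg_of_timeRegular (q := fun s => s.1.S.b₁Xi j k) fun s => (h s).1,
    reg_of_timeRegular (q := fun s => s.1.S.b₂Xi j k) fun s => (h s).2.1,
    reg_of_timeRegular (q := fun s => s.1.S.jXix j k) fun s => (h s).2.2.1,
    reg_of_timeRegular (q := fun s => s.1.S.jXiy j k) fun s => (h s).2.2.2.1,
    reg_of_timeRegular (q := fun s => s.1.S.xdotXi j k) fun s => (h s).2.2.2.2.1,
    reg_of_timeRegular (q := fun s => s.1.S.ydotXi j k) fun s => (h s).2.2.2.2.2⟩

end Xi

section Eta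

variable (hj : 0 < j) (hj' : j < J) (hk : 0 < k) (hk' : k ≤ K)
include hj hj' hk hk'

theorem reg_eta : (frame P u T C κ J K r).Reg r (fun o => o.1.1.S.b₁Eta j k o.2) ∧
    (frame P u T C κ J K r).Reg r (fun o => o.1.1.S.b₂Eta j k o.2) ∧
    (frame P u T C κ J K r).Reg r (fun o => o.1.1.S.jEtax j k o.2) ∧
    (frame P u T C κ J K r).Reg r (fun o => o.1.1.S.jEtay j k o.2) ∧
    (frame P u T C κ J K r).Reg r (fun o => o.1.1.S.xdotEta j k o.2) ∧
    (frame P u T C κ J K r).Reg r (fun o => o.1.1.S.ydotEta j k o.2) := by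
  have h := fun s : RegularStep P u T C κ J K r => s.2.eta j k hj hj' hk hk'
  exact ⟨reg_of_timeRegular (q := fun s => s.1.S.b₁Eta j k) fun s => (h s).1,
    reg_of_timeRegular (q := fun s => s.1.S.b₂Eta j k) fun s => (h s).2.1,
    reg_of_timeRegular (q := fun s => s.1.S.jEtax j k) fun s => (h s).2.2.1,
    reg_of_timeRegular (q := fun s => s.1.S.jEtay j k) fun s => (h s).2.2.2.1,
    reg_of_timeRegular (q := fun s => s.1.S.xdotEta j k) fun s => (h s).2.2.2.2.1,
    reg_of_timeRegular (q := fun s => s.1.S.ydotEta j k) fun s => (h s).2.2.2.2.2⟩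

end Eta

section Fluxes

variable {U : RegularStep P u T C κ J K r × ℝ → ℤ → ℤ → ℝ}
  (hU : ∀ j k : ℤ, 0 ≤ j → j ≤ J → 0 ≤ k → k ≤ K → (frame P u T C κ J K r).Reg r fun o => U o j k)
include hU

theorem reg_q₁ (hj : 0 < j) (hj' : j ≤ J) (hk : 0 < k) (hk' : k < K) :
    (frame P u T C κ J K r).Reg r fun o => o.1.1.S.q₁ (U o) j k o.2 := by
  obtain ⟨h1, h2, h3, h4, h5, h6⟩ := reg_xi (P := P) (u := u) (T := T) (C := C) (κ := κ) (r := r)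
    hj hj' hk hk'
  exact (((hU j k (by omega) (by omega) (by omega) (by omega)).add
    (hU (j - 1) k (by omega) (by omega) (by omega) (by omega))).div_const 2).mul
    ((h3.mul (h1.sub h5)).add (h4.mul (h2.sub h6)))

theorem reg_q₂ (hj : 0 < j) (hj' : j < J) (hk : 0 < k) (hk' : k ≤ K) :
    (frame P u T C κ J K r).Reg r fun o => o.1.1.S.q₂ (U o) j k o.2 := by
  obtain ⟨h1, h2, h3, h4, h5, h6⟩ := reg_eta (P := P) (u := u) (T := T) (C := C) (κ := κ) (r := r)
    hj hj' hk hk'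
  exact (((hU j k (by omega) (by omega) (by omega) (by omega)).add
    (hU j (k - 1) (by omega) (by omega) (by omega) (by omega))).div_const 2).mul
    ((h3.mul (h1.sub h5)).add (h4.mul (h2.sub h6)))

variable (hκ : 0 < κ)
include hκ

theorem reg_p₁ (hj : 0 < j) (hj' : j ≤ J) (hk : 0 < k) (hk' : k ≤ K) :
    (frame P u T C κ J K r).Reg r fun o => o.1.1.S.p₁ (U o) j k o.2 := by
  have h1 := hU j k (by omega) (by omega) (by omega) (by omega)
  have h2 := hU (j - 1) k (by omega) (by omega) (by omega) (by omega)
  have h3 := hU j (k - 1) (by omega) (by omega) (by omega) (by omega)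
  have h4 := hU (j - 1) (k - 1) (by omega) (by omega) (by omega) (by omega)
  have ha := reg_a_div (P := P) (u := u) (T := T) (C := C) (r := r) hj hj' hk hk' hκ
  exact ((ha.mul (((reg_cXix hj hj' hk hk').pow 2).add ((reg_cXiy hj hj' hk hk').pow 2))).mul
    (((h1.sub h2).add h3).sub h4)).add
    ((ha.mul (((reg_cXix hj hj' hk hk').mul (reg_cEtax hj hj' hk hk')).add
      ((reg_cXiy hj hj' hk hk').mul (reg_cEtay hj hj' hk hk')))).mul (((h1.sub h3).add h2).sub h4))

theorem reg_p₂ (hj : 0 < j) (hj' : j ≤ J) (hk : 0 < k) (hk' : k ≤ K) :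
    (frame P u T C κ J K r).Reg r fun o => o.1.1.S.p₂ (U o) j k o.2 := by
  have h1 := hU j k (by omega) (by omega) (by omega) (by omega)
  have h2 := hU (j - 1) k (by omega) (by omega) (by omega) (by omega)
  have h3 := hU j (k - 1) (by omega) (by omega) (by omega) (by omega)
  have h4 := hU (j - 1) (k - 1) (by omega) (by omega) (by omega) (by omega)
  have ha := reg_a_div (P := P) (u := u) (T := T) (C := C) (r := r) hj hj' hk hk' hκ
  exact ((ha.mul (((reg_cXix hj hj' hk hk').mul (reg_cEtax hj hj' hk hk')).add
      ((reg_cXiy hj hj' hk hk').mul (reg_cEtay hj hj' hk hk')))).mul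
      (((h1.sub h2).add h3).sub h4)).add
    ((ha.mul (((reg_cEtax hj hj' hk hk').pow 2).add ((reg_cEtay hj hj' hk hk').pow 2))).mul
    (((h1.sub h3).add h2).sub h4))

end Fluxes

variable (hj : 0 < j) (hj' : j < J) (hk : 0 < k) (hk' : k < K)
include hj hj' hk hk'

theorem reg_jac : (frame P u T C κ J K r).Reg r fun o => o.1.1.S.jac j k o.2 :=
  reg_of_timeRegular (q := fun s => s.1.S.jac j k) fun s => s.2.jac j k hj hj' hk hk'

/-- By the geometric conservation law, `J_{j,k}` has one derivative more than was assumed. -/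
theorem reg_jacRate : (frame P u T C κ J K r).Reg r fun o => o.1.1.S.jacRate j k o.2 := by
  obtain ⟨-, -, h3, h4, h5, h6⟩ := reg_xi (P := P) (u := u) (T := T) (C := C) (κ := κ) (r := r)
    hj hj'.le hk hk'
  obtain ⟨-, -, h3', h4', h5', h6'⟩ := reg_xi (P := P) (u := u) (T := T) (C := C) (κ := κ) (r := r)
    (by omega : 0 < j + 1) (by omega : j + 1 ≤ J) hk hk'
  obtain ⟨-, -, g3, g4, g5, g6⟩ := reg_eta (P := P) (u := u) (T := T) (C := C) (κ := κ) (r := r)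
    hj hj' hk hk'.le
  obtain ⟨-, -, g3', g4', g5', g6'⟩ := reg_eta (P := P) (u := u) (T := T) (C := C) (κ := κ) (r := r)
    hj hj' (by omega : 0 < k + 1) (by omega : k + 1 ≤ K)
  exact (((((((h3'.mul h5').sub (h3.mul h5)).add (h4'.mul h6')).sub (h4.mul h6)).add
    (g3'.mul g5')).sub (g3.mul g5)).add (g4'.mul g6')).sub (g4.mul g6)

theorem reg_op (hP : P.IsSmooth) (hκ : 0 < κ) {U : RegularStep P u T C κ J K r × ℝ → ℤ → ℤ → ℝ}
    (hU : ∀ j k : ℤ, 0 ≤ j → j ≤ J → 0 ≤ k → k ≤ K →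
      (frame P u T C κ J K r).Reg r fun o => U o j k) :
    (frame P u T C κ J K r).Reg r fun o => o.1.1.S.op (U o) j k o.2 := by
  have hu := hU j k hj.le hj'.le hk.le hk'.le
  have hc : (frame P u T C κ J K r).Reg r fun o => o.1.1.S.c j k o.2 :=
    (reg_nodal hP.c hj.le hj'.le hk.le hk'.le).congr fun o ho =>
      (o.1.1.consistent.c _ (o.1.1.Icc_subset (Ioo_subset_Icc_self ho)) j k hj hj' hk hk').symm
  have hd : (frame P u T C κ J K r).Reg r fun o => deriv (o.1.1.S.jac j k) o.2 :=
    (reg_jacRate hj hj' hk hk').congr fun o ho =>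
      (o.1.1.gcl o.1.1.n o.1.1.hn o.2 ho j k hj hj' hk hk').deriv.symm
  have hp1 := fun (j k : ℤ) => reg_p₁ (j := j) (k := k) hU hκ
  have hp2 := fun (j k : ℤ) => reg_p₂ (j := j) (k := k) hU hκ
  have p1 := (((hp1 (j + 1) (k + 1) (by omega) (by omega) (by omega) (by omega)).sub
    (hp1 j (k + 1) (by omega) (by omega) (by omega) (by omega))).add
    (hp1 (j + 1) k (by omega) (by omega) (by omega) (by omega))).sub
    (hp1 j k (by omega) (by omega) (by omega) (by omega))
  have p2 := (((hp2 (j + 1) (k + 1) (by omega) (by omega) (by omega) (by omega)).sub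
    (hp2 (j + 1) k (by omega) (by omega) (by omega) (by omega))).add
    (hp2 j (k + 1) (by omega) (by omega) (by omega) (by omega))).sub
    (hp2 j k (by omega) (by omega) (by omega) (by omega))
  exact (((((hd.neg.mul hu).sub ((reg_q₁ hU (by omega : 0 < j + 1) (by omega : j + 1 ≤ J) hk hk').sub
    (reg_q₁ hU hj hj'.le hk hk'))).sub ((reg_q₂ hU hj hj' (by omega : 0 < k + 1) (by omega : k + 1 ≤ K)).sub
    (reg_q₂ hU hj hj' hk hk'.le))).sub ((hc.mul hu).mul (reg_jac hj hj' hk hk'))).add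
    (p1.div_const 2)).add (p2.div_const 2)

omit hj hj' hk hk'

theorem reg_sqrt_jac_inv (hκ : 0 < κ) (p : Interior J K) :
    (frame P u T C κ J K r).Reg r fun o => (√(o.1.1.S.jac p.1.1 p.1.2 o.2))⁻¹ := by
  obtain ⟨h1, h2, h3, h4⟩ := p.bounds
  have hJ' : (0 : ℝ) < J := by exact_mod_cast h1.trans h2
  have hK' : (0 : ℝ) < K := by exact_mod_cast h3.trans h4
  have hc : 0 < κ * ((1 / (J : ℝ)) * (1 / (K : ℝ))) := by positivity
  have hge : ∀ o ∈ (frame P u T C κ J K r).dom,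
      κ * ((1 / (J : ℝ)) * (1 / (K : ℝ))) ≤ o.1.1.S.jac p.1.1 p.1.2 o.2 := fun o ho =>
    o.1.1.uniform.jac_ge _ (o.1.1.Icc_subset (Ioo_subset_Icc_self ho)) _ _ h1 h2 h3 h4
  exact Frame.Reg.inv (Real.sqrt_pos.2 hc) (Frame.Reg.sqrt hc (reg_jac h1 h2 h3 h4) hge)
    fun o ho => Real.sqrt_le_sqrt (hge o ho)

theorem reg_extendGrid {g : RegularStep P u T C κ J K r × ℝ → ℤ → ℤ → ℝ} (z : Interior J K → ℝ)
    (hg : ∀ j k : ℤ, 0 ≤ j → j ≤ J → 0 ≤ k → k ≤ K → ¬(0 < j ∧ j < J ∧ 0 < k ∧ k < K) →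
      (frame P u T C κ J K r).Reg r fun o => g o j k) {j k : ℤ} (hj : 0 ≤ j) (hj' : j ≤ J)
    (hk : 0 ≤ k) (hk' : k ≤ K) :
    (frame P u T C κ J K r).Reg r fun o => extendGrid (g o) z j k := by
  by_cases h : (0 < j ∧ j < J ∧ 0 < k ∧ k < K)
  · have h' : (j, k) ∈ Finset.Ioo (0 : ℤ) J ×ˢ Finset.Ioo (0 : ℤ) K := by
      rw [Finset.mem_product, Finset.mem_Ioo, Finset.mem_Ioo]
      exact ⟨⟨h.1, h.2.1⟩, h.2.2.1, h.2.2.2⟩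
    refine (Frame.Reg.const (z ⟨(j, k), h'⟩)).congr fun o _ => ?_
    exact (extendGrid_interior (g o) z ⟨(j, k), h'⟩).symm
  · exact (hg j k hj hj' hk hk' h).congr fun o _ => (extendGrid_of_not _ _ h).symm

theorem reg_B (hP : P.IsSmooth) (hκ : 0 < κ) (p q : Interior J K) :
    (frame P u T C κ J K r).Reg r fun o => o.1.1.S.B o.2 p q := by
  obtain ⟨h1, h2, h3, h4⟩ := p.bounds
  have hs : (frame P u T C κ J K r).Reg r fun o => o.1.1.S.stiff o.2 p q :=
    reg_op h1 h2 h3 h4 hP hκ fun j k hj hj' hk hk' =>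
      reg_extendGrid (g := fun _ _ _ => 0) _ (fun _ _ _ _ _ _ _ => Frame.Reg.const 0) hj hj' hk hk'
  have hd : (frame P u T C κ J K r).Reg r fun o =>
      if p = q then 2⁻¹ * o.1.1.S.jacRate p.1.1 p.1.2 o.2 else 0 := by
    by_cases h : p = q
    · simp only [if_pos h]
      exact (reg_jacRate h1 h2 h3 h4).const_mul _
    · simp only [if_neg h]
      exact Frame.Reg.const 0
  refine (((reg_sqrt_jac_inv hκ p).mul (hs.add hd)).mul (reg_sqrt_jac_inv hκ q)).congr
    fun o ho => ?_
  exact (Scheme.B_apply (o.1.1.nondegenerate.mass_pos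
    (o.1.1.Icc_subset (Ioo_subset_Icc_self ho))) (fun p => o.1.1.gcl _ o.1.1.hn _ ho _ _ p.bounds.1
      p.bounds.2.1 p.bounds.2.2.1 p.bounds.2.2.2) p q).symm

theorem reg_source (hP : P.IsSmooth) (hu : ContDiff ℝ ∞ u) (hκ : 0 < κ) (p : Interior J K) :
    (frame P u T C κ J K r).Reg r fun o =>
      ((o.1.1.S.sqrtMass o.2)⁻¹ *ᵥ o.1.1.S.source (o.1.1.S.nodal P.f) (o.1.1.S.nodal P.g) o.2) p := by
  obtain ⟨h1, h2, h3, h4⟩ := p.bounds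
  have hs : (frame P u T C κ J K r).Reg r fun o => o.1.1.S.op (extendGrid
      (fun j k => o.1.1.S.nodal P.g j k o.2) (0 : Interior J K → ℝ)) p.1.1 p.1.2 o.2 :=
    reg_op h1 h2 h3 h4 hP hκ fun j k hj hj' hk hk' =>
      reg_extendGrid (g := fun o j k => o.1.1.S.nodal P.g j k o.2) _
        (fun j k hj hj' hk hk' hb => (reg_nodal hu hj hj' hk hk').congr fun o ho =>
          (o.1.1.nodal_eq_boundary ho hj hj' hk hk' hb).symm) hj hj' hk hk'
  refine ((reg_sqrt_jac_inv hκ p).mul (hs.add ((reg_jac h1 h2 h3 h4).mul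
    (reg_nodal hP.f h1.le h2.le h3.le h4.le)))).congr fun o ho => ?_
  simp only
  rw [Scheme.sqrtMass_inv (o.1.1.nondegenerate.mass_pos
    (o.1.1.Icc_subset (Ioo_subset_Icc_self ho))), Matrix.mulVec_diagonal]
  rfl

end RegularStep

/-! ### Central differences and symmetric averages on the unit square -/

theorem abs_image_sub_le_of_hasDerivWithinAt {f f' : ℝ → ℝ} {a b M : ℝ}
    (h : ∀ x ∈ Icc a b, HasDerivWithinAt f (f' x) (Icc a b) x) (hM : ∀ x ∈ Icc a b, |f' x| ≤ M)
    {x y : ℝ} (hx : x ∈ Icc a b) (hy : y ∈ Icc a b) : |f y - f x| ≤ M * |y - x| :=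
  (convex_Icc a b).norm_image_sub_le_of_norm_hasDerivWithin_le h hM hx hy

/-- The interval `[s - p, s + p]` is contained in `[0, 1]`. -/
structure Centered (s p : ℝ) : Prop where
  nonneg : 0 ≤ p
  le : p ≤ s
  add_le : s + p ≤ 1

namespace Centered

variable {s p : ℝ}

theorem mem (h : Centered s p) : s ∈ Icc (0 : ℝ) 1 :=
  ⟨h.nonneg.trans h.le, by linarith [h.nonneg, h.add_le]⟩

theorem add_mem (h : Centered s p) : s + p ∈ Icc (0 : ℝ) 1 :=
  ⟨add_nonneg h.mem.1 h.nonneg, h.add_le⟩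

theorem sub_mem (h : Centered s p) : s - p ∈ Icc (0 : ℝ) 1 :=
  ⟨sub_nonneg.2 h.le, by linarith [h.nonneg, h.add_le]⟩

theorem mono (h : Centered s p) {q : ℝ} (hq : q ∈ Icc 0 p) : Centered s q :=
  ⟨hq.1, hq.2.trans h.le, by linarith [h.add_le, hq.2]⟩

/-- The centres of the intervals of half-width `p` in `[0, 1]`. -/
theorem _root_.centered_iff (hp : 0 ≤ p) : Centered s p ↔ s ∈ Icc p (1 - p) :=
  ⟨fun h => ⟨h.le, by linarith [h.add_le]⟩, fun h => ⟨hp, h.1, by linarith [h.2]⟩⟩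

theorem hasDerivWithinAt_add (_ : Centered s p) {f : ℝ → ℝ} {f' : ℝ}
    (hf : HasDerivWithinAt f f' (Icc 0 1) (s + p)) :
    HasDerivWithinAt (fun q => f (s + q)) f' {q | Centered s q} p := by
  have := hf.comp p ((hasDerivAt_id p).const_add s).hasDerivWithinAt
    (s := {q | Centered s q}) fun q hq => hq.add_mem
  simpa using! this

theorem hasDerivWithinAt_sub (_ : Centered s p) {f : ℝ → ℝ} {f' : ℝ}
    (hf : HasDerivWithinAt f f' (Icc 0 1) (s - p)) :
    HasDerivWithinAt (fun q => f (s - q)) (-f') {q | Centered s q} p := by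
  have := hf.comp p ((hasDerivAt_id p).const_sub s).hasDerivWithinAt
    (s := {q | Centered s q}) fun q hq => hq.sub_mem
  simpa using! this

end Centered

/-- The first-order terms of a symmetric second difference cancel. -/
theorem abs_symmetric_average_sub_le {f f' f'' : ℝ → ℝ} {M s p : ℝ}
    (h : ∀ x ∈ Icc (0 : ℝ) 1, HasDerivWithinAt f (f' x) (Icc 0 1) x)
    (h' : ∀ x ∈ Icc (0 : ℝ) 1, HasDerivWithinAt f' (f'' x) (Icc 0 1) x)
    (hM : ∀ x ∈ Icc (0 : ℝ) 1, |f'' x| ≤ M) (hp : Centered s p) :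
    |f (s + p) + f (s - p) - 2 * f s| ≤ 2 * M * p ^ 2 := by
  have hM0 : 0 ≤ M := (abs_nonneg _).trans (hM s hp.mem)
  have key := abs_image_sub_le_of_hasDerivWithinAt (a := 0) (b := p)
    (f := fun q => f (s + q) + f (s - q)) (f' := fun q => f' (s + q) - f' (s - q))
    (M := 2 * M * p) (fun q hq => ?_) (fun q hq => ?_) (left_mem_Icc.2 hp.nonneg)
    (right_mem_Icc.2 hp.nonneg)
  · simp only [add_zero, sub_zero, abs_of_nonneg hp.nonneg] at key
    calc _ = |f (s + p) + f (s - p) - (f s + f s)| := by ring_nf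
      _ ≤ _ := key.trans_eq (by ring)
  · have hq' := hp.mono hq
    have := ((hq'.hasDerivWithinAt_add (h _ hq'.add_mem)).add
      (hq'.hasDerivWithinAt_sub (h _ hq'.sub_mem))).mono (s := Icc 0 p) fun r hr => hp.mono hr
    rwa [← sub_eq_add_neg] at this
  · have hq' := hp.mono hq
    have := abs_image_sub_le_of_hasDerivWithinAt h' hM hq'.sub_mem hq'.add_mem
    refine this.trans ?_
    rw [show s + q - (s - q) = 2 * q by ring, abs_of_nonneg (by linarith [hq.1])]
    nlinarith [hq.1, hq.2]

/-- Families of functions on the unit square; the directions `true` and `false` are those of the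
first and of the second variable. -/
def squareFrame (ι : Type*) : Frame (ι × ℝ × ℝ) Bool where
  dom := {o | o.2 ∈ unitSquare}
  line d o s := bif d then (o.1, s, o.2.2) else (o.1, o.2.1, s)
  coord d o := bif d then o.2.1 else o.2.2
  seg _ _ := Icc 0 1
  line_coord d o _ := by cases d <;> rfl
  coord_mem d o ho := by cases d; exacts [ho.2, ho.1]
  line_mem d o ho s hs := by cases d; exacts [⟨ho.1, hs⟩, ⟨hs, ho.2⟩]

section SquareFrame

variable {ι : Type*} {f g Y : ι × ℝ × ℝ → ℝ} {k : ℕ}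

theorem squareFrame_der_true : (squareFrame ι).Der true f g ↔ ∀ i, ∀ x ∈ Icc (0 : ℝ) 1,
    ∀ y ∈ Icc (0 : ℝ) 1, HasDerivWithinAt (fun s => f (i, s, y)) (g (i, x, y)) (Icc 0 1) x :=
  ⟨fun h i x hx y hy => h (i, x, y) ⟨hx, hy⟩, fun h o ho => h o.1 o.2.1 ho.1 o.2.2 ho.2⟩

theorem squareFrame_der_false : (squareFrame ι).Der false f g ↔ ∀ i, ∀ x ∈ Icc (0 : ℝ) 1,
    ∀ y ∈ Icc (0 : ℝ) 1, HasDerivWithinAt (fun s => f (i, x, s)) (g (i, x, y)) (Icc 0 1) y :=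
  ⟨fun h i x hx y hy => h (i, x, y) ⟨hx, hy⟩, fun h o ho => h o.1 o.2.1 ho.1 o.2.2 ho.2⟩

theorem squareFrame_der_unique {d : Bool} {f' f'' : ι × ℝ × ℝ → ℝ}
    (h : (squareFrame ι).Der d f f') (h' : (squareFrame ι).Der d f f'') :
    EqOn f' f'' (squareFrame ι).dom := fun o ho =>
  ((uniqueDiffOn_Icc zero_lt_one).uniqueDiffWithinAt ((squareFrame ι).coord_mem d o ho)).eq_deriv _
    (h o ho) (h' o ho)

theorem squareFrame_der_swap {d : Bool} (h : (squareFrame ι).Der d f g) :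
    (squareFrame ι).Der (!d) (fun o => f (o.1, o.2.2, o.2.1)) fun o => g (o.1, o.2.2, o.2.1) := by
  intro o ho
  have := h (o.1, o.2.2, o.2.1) ⟨ho.2, ho.1⟩
  cases d <;> exact this

theorem squareFrame_reg_swap (h : (squareFrame ι).Reg k f) :
    (squareFrame ι).Reg k fun o => f (o.1, o.2.2, o.2.1) := by
  have hb : ∀ {f : ι × ℝ × ℝ → ℝ}, (squareFrame ι).Bdd f →
      (squareFrame ι).Bdd fun o => f (o.1, o.2.2, o.2.1) := by
    rintro f ⟨D, hD⟩
    exact ⟨D, fun o ho => hD (o.1, o.2.2, o.2.1) ⟨ho.2, ho.1⟩⟩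
  induction k generalizing f with
  | zero => exact hb h
  | succ k ih =>
    refine ⟨hb h.1, fun d => ?_⟩
    obtain ⟨f', h1, h2⟩ := h.2 (!d)
    have := squareFrame_der_swap h1
    rw [Bool.not_not] at this
    exact ⟨_, this, ih h2⟩

/-- The average over the vertices of a rectangle centred at `(x, y)`, minus the value at the
centre. -/
noncomputable def averageError (f : ι × ℝ × ℝ → ℝ) (i : ι) (x y p q : ℝ) : ℝ :=
  (f (i, x + p, y + q) + f (i, x - p, y + q) + f (i, x + p, y - q) + f (i, x - p, y - q)) / 4
    - f (i, x, y)

theorem Frame.Reg.exists_averageError_le (hg : (squareFrame ι).Reg 2 g) :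
    ∃ M, 0 ≤ M ∧ ∀ i x y p q, Centered x p → Centered y q →
      |averageError g i x y p q| ≤ M * (p ^ 2 + q ^ 2) := by
  obtain ⟨g1, h1, h1'⟩ := hg.2 true
  obtain ⟨g11, h2, h2'⟩ := h1'.2 true
  obtain ⟨g2, h3, h3'⟩ := hg.2 false
  obtain ⟨g22, h4, h4'⟩ := h3'.2 false
  obtain ⟨A, hA0, hA⟩ := Frame.Bdd.nonneg h2'
  obtain ⟨B, hB0, hB⟩ := Frame.Bdd.nonneg h4'
  rw [squareFrame_der_true] at h1 h2
  rw [squareFrame_der_false] at h3 h4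
  refine ⟨A + B, by positivity, fun i x y p q hx hy => ?_⟩
  have a1 := abs_symmetric_average_sub_le (fun s hs => h1 i s hs _ hy.add_mem)
    (fun s hs => h2 i s hs _ hy.add_mem) (fun s hs => hA (i, s, _) ⟨hs, hy.add_mem⟩) hx
  have a2 := abs_symmetric_average_sub_le (fun s hs => h1 i s hs _ hy.sub_mem)
    (fun s hs => h2 i s hs _ hy.sub_mem) (fun s hs => hA (i, s, _) ⟨hs, hy.sub_mem⟩) hx
  have a3 := abs_symmetric_average_sub_le (fun s hs => h3 i x hx.mem s hs)
    (fun s hs => h4 i x hx.mem s hs) (fun s hs => hB (i, x, s) ⟨hx.mem, hs⟩) hy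
  rw [abs_le] at a1 a2 a3 ⊢
  have e1 : 0 ≤ A * q ^ 2 := by positivity
  have e2 : 0 ≤ B * p ^ 2 := by positivity
  unfold averageError
  constructor <;> linarith [a1.1, a1.2, a2.1, a2.2, a3.1, a3.2]

theorem averageError_swap (i : ι) (x y p q : ℝ) :
    averageError (fun o => g (o.1, o.2.2, o.2.1)) i y x q p = averageError g i x y p q := by
  simp only [averageError]
  ring

/-- The error of the average is itself Lipschitz with a second-order constant, because its
derivative is the error of the average of the derivative. -/
theorem Frame.Reg.exists_averageError_sub_le (hg : (squareFrame ι).Reg 3 g) :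
    ∃ M, 0 ≤ M ∧ ∀ i x x' y p q, Centered x p → Centered x' p → Centered y q →
      |averageError g i x' y p q - averageError g i x y p q| ≤ M * (p ^ 2 + q ^ 2) * |x' - x| := by
  obtain ⟨g1, h1, h1'⟩ := hg.2 true
  rw [squareFrame_der_true] at h1
  obtain ⟨M, hM0, hM⟩ := h1'.exists_averageError_le
  refine ⟨M, hM0, fun i x x' y p q hx hx' hy => ?_⟩
  refine abs_image_sub_le_of_hasDerivWithinAt (a := p) (b := 1 - p)
    (f := fun s => averageError g i s y p q) (f' := fun s => averageError g1 i s y p q)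
    (fun s hs => ?_) (fun s hs => hM i s y p q ((centered_iff hx.nonneg).2 hs) hy)
    ((centered_iff hx.nonneg).1 hx) ((centered_iff hx.nonneg).1 hx')
  have hs' := (centered_iff hx.nonneg).2 hs
  have add : ∀ r ∈ Icc (0 : ℝ) 1,
      HasDerivWithinAt (fun s => g (i, s + p, r)) (g1 (i, s + p, r)) (Icc p (1 - p)) s := by
    intro r hr
    have := (h1 i _ hs'.add_mem r hr).comp s ((hasDerivAt_id s).add_const p).hasDerivWithinAt
      (s := Icc p (1 - p)) fun s hs => ((centered_iff hx.nonneg).2 hs).add_mem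
    simpa using! this
  have sub : ∀ r ∈ Icc (0 : ℝ) 1,
      HasDerivWithinAt (fun s => g (i, s - p, r)) (g1 (i, s - p, r)) (Icc p (1 - p)) s := by
    intro r hr
    have := (h1 i _ hs'.sub_mem r hr).comp s ((hasDerivAt_id s).sub_const p).hasDerivWithinAt
      (s := Icc p (1 - p)) fun s hs => ((centered_iff hx.nonneg).2 hs).sub_mem
    simpa using! this
  exact (((((add _ hy.add_mem).add (sub _ hy.add_mem)).add (add _ hy.sub_mem)).add
    (sub _ hy.sub_mem)).div_const 4).sub ((h1 i s hs'.mem y hy.mem).mono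
      fun s hs => ((centered_iff hx.nonneg).2 hs).mem)

theorem Frame.Reg.exists_averageError_sub_le' (hg : (squareFrame ι).Reg 3 g) :
    ∃ M, 0 ≤ M ∧ ∀ i x y y' p q, Centered x p → Centered y q → Centered y' q →
      |averageError g i x y' p q - averageError g i x y p q| ≤ M * (p ^ 2 + q ^ 2) * |y' - y| := by
  obtain ⟨M, hM0, hM⟩ := (squareFrame_reg_swap hg).exists_averageError_sub_le
  refine ⟨M, hM0, fun i x y y' p q hx hy hy' => ?_⟩
  have := hM i y y' x q p hy hy' hx
  rwa [averageError_swap, averageError_swap, add_comm (q ^ 2)] at this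

/-- The central difference of `Y` in the first variable, averaged in the second variable, minus
the value of `g`, which will be the derivative of `Y`. -/
noncomputable def differenceError (Y g : ι × ℝ × ℝ → ℝ) (i : ι) (x y p q : ℝ) : ℝ :=
  (Y (i, x + p, y + q) - Y (i, x - p, y + q) + Y (i, x + p, y - q) - Y (i, x - p, y - q)) / (4 * p)
    - g (i, x, y)

/-- The same as `differenceError` with the roles of the two variables exchanged. -/
noncomputable def differenceError' (Y g : ι × ℝ × ℝ → ℝ) (i : ι) (x y p q : ℝ) : ℝ :=
  (Y (i, x + p, y + q) - Y (i, x + p, y - q) + Y (i, x - p, y + q) - Y (i, x - p, y - q)) / (4 * q)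
    - g (i, x, y)

theorem differenceError_swap (i : ι) (x y p q : ℝ) :
    differenceError (fun o => Y (o.1, o.2.2, o.2.1)) (fun o => g (o.1, o.2.2, o.2.1)) i y x q p
      = differenceError' Y g i x y p q := by
  simp only [differenceError, differenceError']

theorem hasDerivWithinAt_difference (h : (squareFrame ι).Der true Y g) {i : ι} {x y p q r : ℝ}
    (hx : Centered x p) (hy : Centered y q) (hr : r ∈ Icc 0 p) :
    HasDerivWithinAt
      (fun r => Y (i, x + r, y + q) - Y (i, x - r, y + q) + Y (i, x + r, y - q)
        - Y (i, x - r, y - q) - 4 * r * g (i, x, y))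
      (4 * averageError g i x y r q) (Icc 0 p) r := by
  rw [squareFrame_der_true] at h
  have hr' := hx.mono hr
  have a1 : ∀ z ∈ Icc (0 : ℝ) 1,
      HasDerivWithinAt (fun r => Y (i, x + r, z)) (g (i, x + r, z)) (Icc 0 p) r := fun z hz =>
    (hr'.hasDerivWithinAt_add (f := fun s => Y (i, s, z)) (h i _ hr'.add_mem z hz)).mono
      fun r hr => hx.mono hr
  have a2 : ∀ z ∈ Icc (0 : ℝ) 1,
      HasDerivWithinAt (fun r => Y (i, x - r, z)) (-g (i, x - r, z)) (Icc 0 p) r := fun z hz =>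
    (hr'.hasDerivWithinAt_sub (f := fun s => Y (i, s, z)) (h i _ hr'.sub_mem z hz)).mono
      fun r hr => hx.mono hr
  have a3 : HasDerivWithinAt (fun r => 4 * r * g (i, x, y)) (4 * 1 * g (i, x, y)) (Icc 0 p) r :=
    (((hasDerivAt_id r).const_mul 4).mul_const _).hasDerivWithinAt
  refine (((((a1 _ hy.add_mem).sub (a2 _ hy.add_mem)).add (a1 _ hy.sub_mem)).sub
    (a2 _ hy.sub_mem)).sub a3).congr_deriv ?_
  simp only [averageError]
  ring

/-- Up to normalization the error of the central difference is the integral of the errors of the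
averages of the derivative. -/
theorem Frame.Der.abs_differenceError_le (h : (squareFrame ι).Der true Y g) {i : ι}
    {x y p q M : ℝ} (hp : 0 < p) (hx : Centered x p) (hy : Centered y q)
    (hM : ∀ r ∈ Icc 0 p, |averageError g i x y r q| ≤ M) : |differenceError Y g i x y p q| ≤ M := by
  have key := abs_image_sub_le_of_hasDerivWithinAt (M := 4 * M)
    (fun r hr => hasDerivWithinAt_difference h (i := i) hx hy hr)
    (fun r hr => by
      rw [abs_mul, abs_of_pos (by norm_num : (0 : ℝ) < 4)]
      exact mul_le_mul_of_nonneg_left (hM r hr) (by norm_num))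
    (left_mem_Icc.2 hp.le) (right_mem_Icc.2 hp.le)
  simp only [add_zero, zero_add, sub_zero, sub_self, mul_zero, zero_mul, abs_of_pos hp] at key
  have e : differenceError Y g i x y p q = (Y (i, x + p, y + q) - Y (i, x - p, y + q)
      + Y (i, x + p, y - q) - Y (i, x - p, y - q) - 4 * p * g (i, x, y)) / (4 * p) := by
    simp only [differenceError]
    field_simp
  rw [e, abs_div, abs_of_pos (by positivity : 0 < 4 * p), div_le_iff₀ (by positivity)]
  exact key.trans_eq (by ring)

/-- The same representation for a difference of two such errors. -/
theorem Frame.Der.abs_differenceError_sub_le (h : (squareFrame ι).Der true Y g) {i : ι}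
    {x y x' y' p q M : ℝ} (hp : 0 < p) (hx : Centered x p) (hy : Centered y q)
    (hx' : Centered x' p) (hy' : Centered y' q)
    (hM : ∀ r ∈ Icc 0 p, |averageError g i x' y' r q - averageError g i x y r q| ≤ M) :
    |differenceError Y g i x' y' p q - differenceError Y g i x y p q| ≤ M := by
  have key := abs_image_sub_le_of_hasDerivWithinAt (M := 4 * M)
    (fun r hr => (hasDerivWithinAt_difference h (i := i) hx' hy' hr).sub
      (hasDerivWithinAt_difference h (i := i) hx hy hr))
    (fun r hr => by
      rw [← mul_sub, abs_mul, abs_of_pos (by norm_num : (0 : ℝ) < 4)]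
      exact mul_le_mul_of_nonneg_left (hM r hr) (by norm_num))
    (left_mem_Icc.2 hp.le) (right_mem_Icc.2 hp.le)
  simp only [add_zero, zero_add, sub_zero, sub_self, mul_zero, zero_mul, abs_of_pos hp, Pi.sub_apply] at key
  have e : ∀ x y, differenceError Y g i x y p q = (Y (i, x + p, y + q) - Y (i, x - p, y + q)
      + Y (i, x + p, y - q) - Y (i, x - p, y - q) - 4 * p * g (i, x, y)) / (4 * p) := by
    intro x y
    simp only [differenceError]
    field_simp
  rw [e, e, ← sub_div, abs_div, abs_of_pos (by positivity : 0 < 4 * p), div_le_iff₀ (by positivity)]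
  exact key.trans_eq (by ring)

theorem sq_add_sq_le_of_mem {p q r : ℝ} (hr : r ∈ Icc 0 p) : r ^ 2 + q ^ 2 ≤ p ^ 2 + q ^ 2 := by
  gcongr
  exacts [hr.1, hr.2]

theorem Frame.Der.exists_differenceError_le (h : (squareFrame ι).Der true Y g)
    (hg : (squareFrame ι).Reg 2 g) :
    ∃ M, 0 ≤ M ∧ ∀ i x y p q, 0 < p → Centered x p → Centered y q →
      |differenceError Y g i x y p q| ≤ M * (p ^ 2 + q ^ 2) := by
  obtain ⟨M, hM0, hM⟩ := hg.exists_averageError_le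
  exact ⟨M, hM0, fun i x y p q hp hx hy => h.abs_differenceError_le hp hx hy fun r hr =>
    (hM i x y r q (hx.mono hr) hy).trans
      (mul_le_mul_of_nonneg_left (sq_add_sq_le_of_mem hr) hM0)⟩

theorem Frame.Der.exists_differenceError_sub_le (h : (squareFrame ι).Der true Y g)
    (hg : (squareFrame ι).Reg 3 g) :
    ∃ M, 0 ≤ M ∧ (∀ i x x' y p q, 0 < p → Centered x p → Centered x' p → Centered y q →
      |differenceError Y g i x' y p q - differenceError Y g i x y p q|
        ≤ M * (p ^ 2 + q ^ 2) * |x' - x|) ∧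
      ∀ i x y y' p q, 0 < p → Centered x p → Centered y q → Centered y' q →
      |differenceError Y g i x y' p q - differenceError Y g i x y p q|
        ≤ M * (p ^ 2 + q ^ 2) * |y' - y| := by
  obtain ⟨A, hA0, hA⟩ := hg.exists_averageError_sub_le
  obtain ⟨B, hB0, hB⟩ := hg.exists_averageError_sub_le'
  refine ⟨max A B, le_max_of_le_left hA0, fun i x x' y p q hp hx hx' hy => ?_,
    fun i x y y' p q hp hx hy hy' => ?_⟩
  · refine h.abs_differenceError_sub_le hp hx hy hx' hy fun r hr =>
      (hA i x x' y r q (hx.mono hr) (hx'.mono hr) hy).trans ?_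
    gcongr
    exacts [le_max_left _ _, hr.1, hr.2]
  · refine h.abs_differenceError_sub_le hp hx hy hx hy' fun r hr =>
      (hB i x y y' r q (hx.mono hr) hy hy').trans ?_
    gcongr
    exacts [le_max_right _ _, hr.1, hr.2]

theorem Frame.Der.exists_differenceError'_le (h : (squareFrame ι).Der false Y g)
    (hg : (squareFrame ι).Reg 2 g) :
    ∃ M, 0 ≤ M ∧ ∀ i x y p q, 0 < q → Centered x p → Centered y q →
      |differenceError' Y g i x y p q| ≤ M * (p ^ 2 + q ^ 2) := by
  obtain ⟨M, hM0, hM⟩ := (squareFrame_der_swap h).exists_differenceError_le (squareFrame_reg_swap hg)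
  refine ⟨M, hM0, fun i x y p q hq hx hy => ?_⟩
  have := hM i y x q p hq hy hx
  rwa [differenceError_swap, add_comm (q ^ 2)] at this

theorem Frame.Der.exists_differenceError'_sub_le (h : (squareFrame ι).Der false Y g)
    (hg : (squareFrame ι).Reg 3 g) :
    ∃ M, 0 ≤ M ∧ (∀ i x x' y p q, 0 < q → Centered x p → Centered x' p → Centered y q →
      |differenceError' Y g i x' y p q - differenceError' Y g i x y p q|
        ≤ M * (p ^ 2 + q ^ 2) * |x' - x|) ∧
      ∀ i x y y' p q, 0 < q → Centered x p → Centered y q → Centered y' q →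
      |differenceError' Y g i x y' p q - differenceError' Y g i x y p q|
        ≤ M * (p ^ 2 + q ^ 2) * |y' - y| := by
  obtain ⟨M, hM0, h1, h2⟩ :=
    (squareFrame_der_swap h).exists_differenceError_sub_le (squareFrame_reg_swap hg)
  refine ⟨M, hM0, fun i x x' y p q hq hx hx' hy => ?_, fun i x y y' p q hq hx hy hy' => ?_⟩
  · have := h2 i y x x' q p hq hy hx hx'
    rwa [differenceError_swap, differenceError_swap, add_comm (q ^ 2)] at this
  · have := h1 i y y' x q p hq hy hy' hx
    rwa [differenceError_swap, differenceError_swap, add_comm (q ^ 2)] at this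

end SquareFrame

/-! ### Second-order approximations of grid functions -/

/-- A family of grids in the unit square, indexed by `ι`. -/
structure Grid (ι : Type*) where
  /-- the grid points, given by their indices -/
  dom : Set (ι × ℤ × ℤ)
  /-- neighbouring grid points and their distance -/
  edge : ι × ℤ × ℤ → ι × ℤ × ℤ → ℝ → Prop
  /-- the location of the grid points -/
  point : ι × ℤ × ℤ → ι × ℝ × ℝ
  /-- the size of a second-order error -/
  size : ι × ℤ × ℤ → ℝ
  point_mem : ∀ γ ∈ dom, (point γ).2 ∈ unitSquare
  left_mem : ∀ {γ γ' l}, edge γ γ' l → γ ∈ dom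
  right_mem : ∀ {γ γ' l}, edge γ γ' l → γ' ∈ dom
  length_nonneg : ∀ {γ γ' l}, edge γ γ' l → 0 ≤ l
  edge_point : ∀ {γ γ' l}, edge γ γ' l →
    point γ' = ((point γ).1, (point γ).2.1 + l, (point γ).2.2) ∨
    point γ' = ((point γ).1, (point γ).2.1, (point γ).2.2 + l)
  size_edge : ∀ {γ γ' l}, edge γ γ' l → size γ' = size γ
  size_nonneg : ∀ γ ∈ dom, 0 ≤ size γ
  size_le : ∀ γ ∈ dom, size γ ≤ 2

namespace Grid

variable {ι : Type*} (G : Grid ι)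

/-- The grid function and its divided differences are of the size of the `n`-th power of a
second-order error. -/
def Lip (n : ℕ) (e : ι × ℤ × ℤ → ℝ) : Prop := ∃ M, 0 ≤ M ∧
  (∀ γ ∈ G.dom, |e γ| ≤ M * G.size γ ^ n) ∧
  ∀ γ γ' l, G.edge γ γ' l → |e γ' - e γ| ≤ M * G.size γ ^ n * l

/-- `Q` has bounded divided differences, and `q` approximates it to second order together with the
divided differences. -/
def Approx (q Q : ι × ℤ × ℤ → ℝ) : Prop := G.Lip 0 Q ∧ G.Lip 1 fun γ => q γ - Q γ

variable {G} {m n : ℕ} {e e' q q' Q Q' : ι × ℤ × ℤ → ℝ}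

theorem Lip.congr (h : G.Lip n e) (he : EqOn e e' G.dom) : G.Lip n e' := by
  obtain ⟨M, h0, h1, h2⟩ := h
  exact ⟨M, h0, fun γ hγ => by rw [← he hγ]; exact h1 γ hγ, fun γ γ' l hl => by
    rw [← he (G.left_mem hl), ← he (G.right_mem hl)]; exact h2 γ γ' l hl⟩

theorem Lip.add (h : G.Lip n e) (h' : G.Lip n e') : G.Lip n fun γ => e γ + e' γ := by
  obtain ⟨M, h0, h1, h2⟩ := h
  obtain ⟨M', h0', h1', h2'⟩ := h'
  refine ⟨M + M', by positivity, fun γ hγ => ?_, fun γ γ' l hl => ?_⟩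
  · exact (abs_add_le _ _).trans ((add_le_add (h1 γ hγ) (h1' γ hγ)).trans_eq (by ring))
  · rw [add_sub_add_comm]
    exact (abs_add_le _ _).trans
      ((add_le_add (h2 γ γ' l hl) (h2' γ γ' l hl)).trans_eq (by ring))

theorem Lip.mul (h : G.Lip m e) (h' : G.Lip n e') : G.Lip (m + n) fun γ => e γ * e' γ := by
  obtain ⟨M, h0, h1, h2⟩ := h
  obtain ⟨M', h0', h1', h2'⟩ := h'
  refine ⟨2 * (M * M'), by positivity, fun γ hγ => ?_, fun γ γ' l hl => ?_⟩
  · have hs := G.size_nonneg γ hγ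
    rw [abs_mul]
    calc _ ≤ (M * G.size γ ^ m) * (M' * G.size γ ^ n) :=
          mul_le_mul (h1 γ hγ) (h1' γ hγ) (abs_nonneg _) (by positivity)
      _ = M * M' * G.size γ ^ (m + n) := by ring
      _ ≤ _ := mul_le_mul_of_nonneg_right (by linarith [mul_nonneg h0 h0']) (pow_nonneg hs _)
  · have hs := G.size_nonneg γ (G.left_mem hl)
    have hl0 := G.length_nonneg hl
    have a1 := h1' γ' (G.right_mem hl)
    rw [G.size_edge hl] at a1
    calc |e γ' * e' γ' - e γ * e' γ| = |(e γ' - e γ) * e' γ' + e γ * (e' γ' - e' γ)| := by ring_nf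
      _ ≤ |e γ' - e γ| * |e' γ'| + |e γ| * |e' γ' - e' γ| := by
        rw [← abs_mul, ← abs_mul]; exact abs_add_le _ _
      _ ≤ (M * G.size γ ^ m * l) * (M' * G.size γ ^ n)
          + (M * G.size γ ^ m) * (M' * G.size γ ^ n * l) :=
        add_le_add
          (mul_le_mul (h2 γ γ' l hl) a1 (abs_nonneg _) (by positivity))
          (mul_le_mul (h1 γ (G.left_mem hl)) (h2' γ γ' l hl) (abs_nonneg _) (by positivity))
      _ = _ := by ring

theorem Lip.const (c : ℝ) : G.Lip 0 fun _ => c :=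
  ⟨|c|, abs_nonneg _, fun _ _ => by simp, fun γ γ' l hl => by
    simpa using mul_nonneg (abs_nonneg c) (G.length_nonneg hl)⟩

theorem Lip.const_mul (c : ℝ) (h : G.Lip n e) : G.Lip n fun γ => c * e γ := by
  have := (Lip.const (G := G) c).mul h
  rwa [zero_add] at this

theorem Lip.neg (h : G.Lip n e) : G.Lip n fun γ => -e γ :=
  (h.const_mul (-1)).congr fun γ _ => by simp

theorem Lip.sub (h : G.Lip n e) (h' : G.Lip n e') : G.Lip n fun γ => e γ - e' γ :=
  (h.add h'.neg).congr fun _ _ => (sub_eq_add_neg _ _).symm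

theorem Lip.pred (h : G.Lip 1 e) : G.Lip 0 e := by
  obtain ⟨M, h0, h1, h2⟩ := h
  refine ⟨M * 2, by positivity, fun γ hγ => ?_, fun γ γ' l hl => ?_⟩
  · refine (h1 γ hγ).trans ?_
    rw [pow_one, pow_zero, mul_one]
    exact mul_le_mul_of_nonneg_left (G.size_le γ hγ) h0
  · refine (h2 γ γ' l hl).trans ?_
    rw [pow_one, pow_zero, mul_one]
    exact mul_le_mul_of_nonneg_right
      (mul_le_mul_of_nonneg_left (G.size_le γ (G.left_mem hl)) h0) (G.length_nonneg hl)

theorem Lip.inv {c : ℝ} (hc : 0 < c) (h : G.Lip 0 e) (hpos : ∀ γ ∈ G.dom, c ≤ e γ) :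
    G.Lip 0 fun γ => (e γ)⁻¹ := by
  obtain ⟨M, h0, h1, h2⟩ := h
  refine ⟨max c⁻¹ (M * (c⁻¹ * c⁻¹)), le_max_of_le_left (inv_nonneg.2 hc.le), fun γ hγ => ?_,
    fun γ γ' l hl => ?_⟩
  · have := hpos γ hγ
    rw [abs_of_nonneg (inv_nonneg.2 (hc.le.trans this)), pow_zero, mul_one]
    exact (inv_anti₀ hc this).trans (le_max_left _ _)
  · have p1 := hpos γ (G.left_mem hl)
    have p2 := hpos γ' (G.right_mem hl)
    have q1 := hc.trans_le p1
    have q2 := hc.trans_le p2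
    have a := h2 γ γ' l hl
    rw [pow_zero, mul_one] at a ⊢
    calc |(e γ')⁻¹ - (e γ)⁻¹| = |e γ' - e γ| * ((e γ')⁻¹ * (e γ)⁻¹) := by
          rw [inv_sub_inv q2.ne' q1.ne', abs_div, abs_sub_comm, abs_of_pos (mul_pos q2 q1),
            div_eq_mul_inv, mul_inv]
      _ ≤ (M * l) * (c⁻¹ * c⁻¹) :=
        mul_le_mul a (mul_le_mul (inv_anti₀ hc p2) (inv_anti₀ hc p1) (inv_nonneg.2 q1.le)
          (inv_nonneg.2 hc.le)) (mul_nonneg (inv_nonneg.2 q2.le) (inv_nonneg.2 q1.le))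
          (mul_nonneg h0 (G.length_nonneg hl))
      _ = M * (c⁻¹ * c⁻¹) * l := by ring
      _ ≤ _ := mul_le_mul_of_nonneg_right (le_max_right _ _) (G.length_nonneg hl)

theorem Approx.lip (h : G.Approx q Q) : G.Lip 0 q :=
  (h.1.add h.2.pred).congr fun _ _ => add_sub_cancel _ _

theorem Approx.congr (h : G.Approx q Q) (hq : EqOn q q' G.dom) (hQ : EqOn Q Q' G.dom) :
    G.Approx q' Q' :=
  ⟨h.1.congr hQ, h.2.congr fun γ hγ => by simp only [hq hγ, hQ hγ]⟩

theorem Approx.add (h : G.Approx q Q) (h' : G.Approx q' Q') :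
    G.Approx (fun γ => q γ + q' γ) fun γ => Q γ + Q' γ :=
  ⟨h.1.add h'.1, (h.2.add h'.2).congr fun _ _ => by ring⟩

theorem Approx.sub (h : G.Approx q Q) (h' : G.Approx q' Q') :
    G.Approx (fun γ => q γ - q' γ) fun γ => Q γ - Q' γ :=
  ⟨h.1.sub h'.1, (h.2.sub h'.2).congr fun _ _ => by ring⟩

theorem Approx.mul (h : G.Approx q Q) (h' : G.Approx q' Q') :
    G.Approx (fun γ => q γ * q' γ) fun γ => Q γ * Q' γ :=
  ⟨h.1.mul h'.1, ((h.2.mul h'.lip).add ((h'.2.mul h.1))).congr fun _ _ => by ring⟩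

theorem Approx.neg (h : G.Approx q Q) : G.Approx (fun γ => -q γ) fun γ => -Q γ :=
  ⟨h.1.neg, h.2.neg.congr fun _ _ => by ring⟩

theorem Approx.inv {c : ℝ} (hc : 0 < c) (h : G.Approx q Q) (hq : ∀ γ ∈ G.dom, c ≤ q γ)
    (hQ : ∀ γ ∈ G.dom, c ≤ Q γ) : G.Approx (fun γ => (q γ)⁻¹) fun γ => (Q γ)⁻¹ :=
  ⟨h.1.inv hc hQ, (h.2.neg.mul ((h.lip.inv hc hq).mul (h.1.inv hc hQ))).congr fun γ hγ => by
    have h1 := (hc.trans_le (hq γ hγ)).ne'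
    have h2 := (hc.trans_le (hQ γ hγ)).ne'
    simp only
    field_simp
    ring⟩

/-- Restrictions of functions with bounded derivatives have bounded divided differences. -/
theorem lip_of_reg {f : ι × ℝ × ℝ → ℝ} (hf : (squareFrame ι).Reg 1 f) :
    G.Lip 0 fun γ => f (G.point γ) := by
  obtain ⟨A, hA0, hA⟩ := Frame.Bdd.nonneg hf.1
  obtain ⟨f1, h1, h1'⟩ := hf.2 true
  obtain ⟨f2, h2, h2'⟩ := hf.2 false
  obtain ⟨B, hB0, hB⟩ := Frame.Bdd.nonneg h1'
  obtain ⟨D, hD0, hD⟩ := Frame.Bdd.nonneg h2'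
  rw [squareFrame_der_true] at h1
  rw [squareFrame_der_false] at h2
  refine ⟨A + B + D, by positivity, fun γ hγ => ?_, fun γ γ' l hl => ?_⟩
  · rw [pow_zero, mul_one]
    exact (hA _ (G.point_mem γ hγ)).trans (by linarith)
  · have hl0 := G.length_nonneg hl
    have m1 := G.point_mem γ (G.left_mem hl)
    have m2 := G.point_mem γ' (G.right_mem hl)
    rw [pow_zero, mul_one]
    rcases G.edge_point hl with e | e
    · dsimp only
      rw [e] at m2 ⊢
      have := abs_image_sub_le_of_hasDerivWithinAt (fun s hs => h1 (G.point γ).1 s hs _ m1.2)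
        (fun s hs => hB (_, s, _) ⟨hs, m1.2⟩) m1.1 m2.1
      rw [add_sub_cancel_left, abs_of_nonneg hl0] at this
      exact this.trans (mul_le_mul_of_nonneg_right (by linarith) hl0)
    · dsimp only
      rw [e] at m2 ⊢
      have := abs_image_sub_le_of_hasDerivWithinAt (fun s hs => h2 (G.point γ).1 _ m1.1 s hs)
        (fun s hs => hD (_, _, s) ⟨m1.1, hs⟩) m1.2 m2.2
      rw [add_sub_cancel_left, abs_of_nonneg hl0] at this
      exact this.trans (mul_le_mul_of_nonneg_right (by linarith) hl0)

end Grid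

/-! ### The staggered grids -/

section Staggered

variable {ι : Type*} {J K : ι → ℕ}

theorem meshSq_nonneg (J K : ℕ) : 0 ≤ meshSq J K := by unfold meshSq; positivity

theorem meshSq_le {J K : ℕ} (hJ : 0 < J) (hK : 0 < K) : meshSq J K ≤ 2 := by
  have h1 : (1 / (J : ℝ)) ^ 2 ≤ 1 := pow_le_one₀ (by positivity)
    ((div_le_one (by exact_mod_cast hJ)).2 (by exact_mod_cast hJ))
  have h2 : (1 / (K : ℝ)) ^ 2 ≤ 1 := pow_le_one₀ (by positivity)
    ((div_le_one (by exact_mod_cast hK)).2 (by exact_mod_cast hK))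
  unfold meshSq
  linarith

/-- A point between two nodes. -/
theorem centered_half {J : ℕ} {j : ℤ} (hj : 0 < j) (hj' : j ≤ J) :
    Centered (((j : ℝ) - 1 / 2) / J) (1 / (2 * J)) := by
  have h1 : (1 : ℝ) ≤ j := by exact_mod_cast hj
  have h2 : (j : ℝ) ≤ J := by exact_mod_cast hj'
  have h3 : (0 : ℝ) < J := by linarith
  refine ⟨by positivity, ?_, ?_⟩
  · rw [div_le_div_iff₀ (by positivity) h3]
    nlinarith
  · rw [div_add_div _ _ h3.ne' (by positivity), div_le_one (by positivity)]
    nlinarith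

theorem centered_node {J : ℕ} {j : ℤ} (hj : 0 < j) (hj' : j < J) :
    Centered ((j : ℝ) / J) (1 / (2 * J)) := by
  have h1 : (1 : ℝ) ≤ j := by exact_mod_cast hj
  have h2 : (j : ℝ) + 1 ≤ J := by exact_mod_cast hj'
  have h3 : (0 : ℝ) < J := by linarith
  refine ⟨by positivity, ?_, ?_⟩
  · rw [div_le_div_iff₀ (by positivity) h3]
    nlinarith
  · rw [div_add_div _ _ h3.ne' (by positivity), div_le_one (by positivity)]
    nlinarith

theorem centered_zero {s : ℝ} (h : s ∈ Icc (0 : ℝ) 1) : Centered s 0 :=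
  ⟨le_rfl, h.1, by simpa using h.2⟩

theorem midpoint_add_half {J : ℕ} (hJ : 0 < J) (j : ℤ) :
    ((j : ℝ) - 1 / 2) / J + 1 / (2 * J) = (j : ℝ) / J := by
  have : (J : ℝ) ≠ 0 := by exact_mod_cast hJ.ne'
  field_simp
  ring

theorem midpoint_sub_half {J : ℕ} (hJ : 0 < J) (j : ℤ) :
    ((j : ℝ) - 1 / 2) / J - 1 / (2 * J) = ((j - 1 : ℤ) : ℝ) / J := by
  have : (J : ℝ) ≠ 0 := by exact_mod_cast hJ.ne'
  push_cast
  field_simp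
  ring

theorem node_add_half {J : ℕ} (hJ : 0 < J) (j : ℤ) :
    (j : ℝ) / J + 1 / (2 * J) = (((j + 1 : ℤ) : ℝ) - 1 / 2) / J := by
  have : (J : ℝ) ≠ 0 := by exact_mod_cast hJ.ne'
  push_cast
  field_simp
  ring

theorem node_sub_half {J : ℕ} (hJ : 0 < J) (j : ℤ) :
    (j : ℝ) / J - 1 / (2 * J) = ((j : ℝ) - 1 / 2) / J := by
  have : (J : ℝ) ≠ 0 := by exact_mod_cast hJ.ne'
  field_simp

theorem midpoint_succ {J : ℕ} (j : ℤ) :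
    (((j + 1 : ℤ) : ℝ) - 1 / 2) / J = ((j : ℝ) - 1 / 2) / J + 1 / J := by
  push_cast
  ring

theorem node_mem_Icc {J : ℕ} {j : ℤ} (hj : 0 < j) (hj' : j < J) : (j : ℝ) / J ∈ Icc (0 : ℝ) 1 :=
  (centered_node hj hj').mem

theorem half_mem_Icc {J : ℕ} {j : ℤ} (hj : 0 < j) (hj' : j ≤ J) :
    ((j : ℝ) - 1 / 2) / J ∈ Icc (0 : ℝ) 1 :=
  (centered_half hj hj').mem

/-- Squares of half mesh widths are at most the size of a second-order error. -/
theorem half_sq_add_half_sq_le (J K : ℕ) :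
    (1 / (2 * (J : ℝ))) ^ 2 + (1 / (2 * (K : ℝ))) ^ 2 ≤ meshSq J K := by
  have e : ∀ J : ℕ, (1 / (2 * (J : ℝ))) ^ 2 = 1 / 4 * (1 / (J : ℝ)) ^ 2 := fun J => by ring
  rw [e, e, meshSq]
  have h1 := sq_nonneg (1 / (J : ℝ))
  have h2 := sq_nonneg (1 / (K : ℝ))
  linarith

theorem half_sq_le (J K : ℕ) : (1 / (2 * (J : ℝ))) ^ 2 + 0 ^ 2 ≤ meshSq J K := by
  refine le_trans ?_ (half_sq_add_half_sq_le J K)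
  gcongr
  positivity

theorem half_sq_le' (J K : ℕ) : (0 : ℝ) ^ 2 + (1 / (2 * (K : ℝ))) ^ 2 ≤ meshSq J K := by
  refine le_trans ?_ (half_sq_add_half_sq_le J K)
  gcongr
  positivity

/-- The points `(j - 1/2, k)` of the meshes. -/
noncomputable def xiGrid (hJ : ∀ i, 0 < J i) (hK : ∀ i, 0 < K i) : Grid ι where
  dom := {γ | 0 < γ.2.1 ∧ γ.2.1 ≤ J γ.1 ∧ 0 < γ.2.2 ∧ γ.2.2 < K γ.1}
  edge γ γ' l := γ' = (γ.1, γ.2.1 + 1, γ.2.2) ∧ l = 1 / (J γ.1 : ℝ) ∧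
    0 < γ.2.1 ∧ γ.2.1 < J γ.1 ∧ 0 < γ.2.2 ∧ γ.2.2 < K γ.1
  point γ := (γ.1, ((γ.2.1 : ℝ) - 1 / 2) / J γ.1, (γ.2.2 : ℝ) / K γ.1)
  size γ := meshSq (J γ.1) (K γ.1)
  point_mem _ h := ⟨half_mem_Icc h.1 h.2.1, node_mem_Icc h.2.2.1 h.2.2.2⟩
  left_mem h := ⟨h.2.2.1, h.2.2.2.1.le, h.2.2.2.2⟩
  right_mem := by
    rintro ⟨i, j, k⟩ _ _ ⟨rfl, rfl, h1, h2, h3⟩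
    exact ⟨by dsimp only at *; omega, by dsimp only at *; omega, h3⟩
  length_nonneg h := by rw [h.2.1]; positivity
  edge_point := by
    rintro ⟨i, j, k⟩ _ _ ⟨rfl, rfl, -⟩
    left
    simp only [midpoint_succ]
  size_edge h := by rw [h.1]
  size_nonneg _ _ := meshSq_nonneg _ _
  size_le _ _ := meshSq_le (hJ _) (hK _)

/-- The points `(j, k - 1/2)` of the meshes. -/
noncomputable def etaGrid (hJ : ∀ i, 0 < J i) (hK : ∀ i, 0 < K i) : Grid ι where
  dom := {γ | 0 < γ.2.1 ∧ γ.2.1 < J γ.1 ∧ 0 < γ.2.2 ∧ γ.2.2 ≤ K γ.1}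
  edge γ γ' l := γ' = (γ.1, γ.2.1, γ.2.2 + 1) ∧ l = 1 / (K γ.1 : ℝ) ∧
    0 < γ.2.1 ∧ γ.2.1 < J γ.1 ∧ 0 < γ.2.2 ∧ γ.2.2 < K γ.1
  point γ := (γ.1, (γ.2.1 : ℝ) / J γ.1, ((γ.2.2 : ℝ) - 1 / 2) / K γ.1)
  size γ := meshSq (J γ.1) (K γ.1)
  point_mem _ h := ⟨node_mem_Icc h.1 h.2.1, half_mem_Icc h.2.2.1 h.2.2.2⟩
  left_mem h := ⟨h.2.2.1, h.2.2.2.1, h.2.2.2.2.1, h.2.2.2.2.2.le⟩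
  right_mem := by
    rintro ⟨i, j, k⟩ _ _ ⟨rfl, rfl, h1, h2, h3, h4⟩
    exact ⟨h1, h2, by dsimp only at *; omega, by dsimp only at *; omega⟩
  length_nonneg h := by rw [h.2.1]; positivity
  edge_point := by
    rintro ⟨i, j, k⟩ _ _ ⟨rfl, rfl, -⟩
    right
    simp only [midpoint_succ]
  size_edge h := by rw [h.1]
  size_nonneg _ _ := meshSq_nonneg _ _
  size_le _ _ := meshSq_le (hJ _) (hK _)

/-- The points `(j - 1/2, k - 1/2)` of the meshes. -/
noncomputable def cellGrid (hJ : ∀ i, 0 < J i) (hK : ∀ i, 0 < K i) : Grid ι where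
  dom := {γ | 0 < γ.2.1 ∧ γ.2.1 ≤ J γ.1 ∧ 0 < γ.2.2 ∧ γ.2.2 ≤ K γ.1}
  edge γ γ' l :=
    (γ' = (γ.1, γ.2.1 + 1, γ.2.2) ∧ l = 1 / (J γ.1 : ℝ) ∧
      0 < γ.2.1 ∧ γ.2.1 < J γ.1 ∧ 0 < γ.2.2 ∧ γ.2.2 ≤ K γ.1) ∨
    (γ' = (γ.1, γ.2.1, γ.2.2 + 1) ∧ l = 1 / (K γ.1 : ℝ) ∧
      0 < γ.2.1 ∧ γ.2.1 ≤ J γ.1 ∧ 0 < γ.2.2 ∧ γ.2.2 < K γ.1)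
  point γ := (γ.1, ((γ.2.1 : ℝ) - 1 / 2) / J γ.1, ((γ.2.2 : ℝ) - 1 / 2) / K γ.1)
  size γ := meshSq (J γ.1) (K γ.1)
  point_mem _ h := ⟨half_mem_Icc h.1 h.2.1, half_mem_Icc h.2.2.1 h.2.2.2⟩
  left_mem := by
    rintro γ _ _ (⟨-, -, h1, h2, h3, h4⟩ | ⟨-, -, h1, h2, h3, h4⟩)
    exacts [⟨h1, h2.le, h3, h4⟩, ⟨h1, h2, h3, h4.le⟩]
  right_mem := by
    rintro ⟨i, j, k⟩ _ _ (⟨rfl, -, h1, h2, h3, h4⟩ | ⟨rfl, -, h1, h2, h3, h4⟩)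
    · exact ⟨by dsimp only at *; omega, by dsimp only at *; omega, h3, h4⟩
    · exact ⟨h1, h2, by dsimp only at *; omega, by dsimp only at *; omega⟩
  length_nonneg := by
    rintro γ _ _ (⟨-, rfl, -⟩ | ⟨-, rfl, -⟩) <;> positivity
  edge_point := by
    rintro ⟨i, j, k⟩ _ _ (⟨rfl, rfl, -⟩ | ⟨rfl, rfl, -⟩)
    · left
      simp only [midpoint_succ]
    · right
      simp only [midpoint_succ]
  size_edge := by
    rintro γ _ _ (⟨rfl, -⟩ | ⟨rfl, -⟩) <;> rfl
  size_nonneg _ _ := meshSq_nonneg _ _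
  size_le _ _ := meshSq_le (hJ _) (hK _)

variable {hJ : ∀ i, 0 < J i} {hK : ∀ i, 0 < K i} {Q f g Y : ι × ℝ × ℝ → ℝ} {C : ℝ} {s : ι → ℝ}

theorem approx_of_consistentXi {q : ι → ℤ → ℤ → ℝ} (hs : ∀ i, 0 < s i)
    (hQ : (squareFrame ι).Reg 1 Q)
    (h : ∀ i, ConsistentXi (J i) (K i) C (s i) (fun z => Q (i, z)) (q i)) :
    (xiGrid hJ hK).Approx (fun γ => q γ.1 γ.2.1 γ.2.2 / s γ.1)
      fun γ => Q ((xiGrid hJ hK).point γ) := by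
  refine ⟨Grid.lip_of_reg hQ, |C|, abs_nonneg _, ?_, ?_⟩
  · rintro ⟨i, j, k⟩ hγ
    obtain ⟨e, h1, h2, -⟩ := h i
    have := h2 j k hγ.1 hγ.2.1 hγ.2.2.1 hγ.2.2.2
    change |q i j k / s i - Q (i, ((j : ℝ) - 1 / 2) / J i, (k : ℝ) / K i)|
      ≤ |C| * meshSq (J i) (K i) ^ 1
    rw [h1, pow_one, add_div, mul_div_cancel_left₀ _ (hs i).ne', add_sub_cancel_left, abs_div,
      abs_of_pos (hs i), div_le_iff₀ (hs i)]
    refine this.trans ?_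
    rw [mul_right_comm]
    have := meshSq_nonneg (J i) (K i)
    have := (hs i).le
    gcongr
    exact le_abs_self _
  · rintro ⟨i, j, k⟩ _ _ ⟨rfl, rfl, hγ⟩
    obtain ⟨e, h1, -, h2⟩ := h i
    have := h2 j k hγ.1 hγ.2.1 hγ.2.2.1 hγ.2.2.2
    change |q i (j + 1) k / s i - Q (i, (((j + 1 : ℤ) : ℝ) - 1 / 2) / J i, (k : ℝ) / K i)
        - (q i j k / s i - Q (i, ((j : ℝ) - 1 / 2) / J i, (k : ℝ) / K i))|
      ≤ |C| * meshSq (J i) (K i) ^ 1 * (1 / J i)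
    rw [h1, h1, pow_one, add_div, mul_div_cancel_left₀ _ (hs i).ne', add_sub_cancel_left, add_div,
      mul_div_cancel_left₀ _ (hs i).ne', add_sub_cancel_left, ← sub_div, abs_div,
      abs_of_pos (hs i), div_le_iff₀ (hs i)]
    refine this.trans ?_
    have e : |C| * meshSq (J i) (K i) * (1 / (J i : ℝ)) * s i
      = |C| * s i * meshSq (J i) (K i) * (1 / (J i : ℝ)) := by ring
    rw [e]
    have := meshSq_nonneg (J i) (K i)
    have := (hs i).le
    gcongr
    exact le_abs_self _

theorem approx_of_consistentEta {q : ι → ℤ → ℤ → ℝ} (hs : ∀ i, 0 < s i)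
    (hQ : (squareFrame ι).Reg 1 Q)
    (h : ∀ i, ConsistentEta (J i) (K i) C (s i) (fun z => Q (i, z)) (q i)) :
    (etaGrid hJ hK).Approx (fun γ => q γ.1 γ.2.1 γ.2.2 / s γ.1)
      fun γ => Q ((etaGrid hJ hK).point γ) := by
  refine ⟨Grid.lip_of_reg hQ, |C|, abs_nonneg _, ?_, ?_⟩
  · rintro ⟨i, j, k⟩ hγ
    obtain ⟨e, h1, h2, -⟩ := h i
    have := h2 j k hγ.1 hγ.2.1 hγ.2.2.1 hγ.2.2.2
    change |q i j k / s i - Q (i, (j : ℝ) / J i, ((k : ℝ) - 1 / 2) / K i)|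
      ≤ |C| * meshSq (J i) (K i) ^ 1
    rw [h1, pow_one, add_div, mul_div_cancel_left₀ _ (hs i).ne', add_sub_cancel_left, abs_div,
      abs_of_pos (hs i), div_le_iff₀ (hs i)]
    refine this.trans ?_
    rw [mul_right_comm]
    have := meshSq_nonneg (J i) (K i)
    have := (hs i).le
    gcongr
    exact le_abs_self _
  · rintro ⟨i, j, k⟩ _ _ ⟨rfl, rfl, hγ⟩
    obtain ⟨e, h1, -, h2⟩ := h i
    have := h2 j k hγ.1 hγ.2.1 hγ.2.2.1 hγ.2.2.2
    change |q i j (k + 1) / s i - Q (i, (j : ℝ) / J i, (((k + 1 : ℤ) : ℝ) - 1 / 2) / K i)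
        - (q i j k / s i - Q (i, (j : ℝ) / J i, ((k : ℝ) - 1 / 2) / K i))|
      ≤ |C| * meshSq (J i) (K i) ^ 1 * (1 / K i)
    rw [h1, h1, pow_one, add_div, mul_div_cancel_left₀ _ (hs i).ne', add_sub_cancel_left, add_div,
      mul_div_cancel_left₀ _ (hs i).ne', add_sub_cancel_left, ← sub_div, abs_div,
      abs_of_pos (hs i), div_le_iff₀ (hs i)]
    refine this.trans ?_
    have e : |C| * meshSq (J i) (K i) * (1 / (K i : ℝ)) * s i
      = |C| * s i * meshSq (J i) (K i) * (1 / (K i : ℝ)) := by ring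
    rw [e]
    have := meshSq_nonneg (J i) (K i)
    have := (hs i).le
    gcongr
    exact le_abs_self _

theorem approx_of_consistentCell {q : ι → ℤ → ℤ → ℝ} (hQ : (squareFrame ι).Reg 1 Q)
    (h : ∀ i, ConsistentCell (J i) (K i) C (fun z => Q (i, z)) (q i)) :
    (cellGrid hJ hK).Approx (fun γ => q γ.1 γ.2.1 γ.2.2)
      fun γ => Q ((cellGrid hJ hK).point γ) := by
  refine ⟨Grid.lip_of_reg hQ, |C|, abs_nonneg _, ?_, ?_⟩
  · rintro ⟨i, j, k⟩ hγ
    obtain ⟨e, h1, h2, -⟩ := h i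
    change |q i j k - Q (i, ((j : ℝ) - 1 / 2) / J i, ((k : ℝ) - 1 / 2) / K i)|
      ≤ |C| * meshSq (J i) (K i) ^ 1
    rw [h1, pow_one, add_sub_cancel_left]
    exact (h2 j k hγ.1 hγ.2.1 hγ.2.2.1 hγ.2.2.2).trans
      (mul_le_mul_of_nonneg_right (le_abs_self _) (meshSq_nonneg _ _))
  · rintro ⟨i, j, k⟩ _ _ (⟨rfl, rfl, hγ⟩ | ⟨rfl, rfl, hγ⟩)
    · obtain ⟨e, h1, -, h2, -⟩ := h i
      change |q i (j + 1) k - Q (i, (((j + 1 : ℤ) : ℝ) - 1 / 2) / J i, ((k : ℝ) - 1 / 2) / K i)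
          - (q i j k - Q (i, ((j : ℝ) - 1 / 2) / J i, ((k : ℝ) - 1 / 2) / K i))|
        ≤ |C| * meshSq (J i) (K i) ^ 1 * (1 / J i)
      rw [h1, h1, pow_one, add_sub_cancel_left, add_sub_cancel_left]
      exact (h2 j k hγ.1 hγ.2.1 hγ.2.2.1 hγ.2.2.2).trans (mul_le_mul_of_nonneg_right
        (mul_le_mul_of_nonneg_right (le_abs_self _) (meshSq_nonneg _ _)) (by positivity))
    · obtain ⟨e, h1, -, -, h2⟩ := h i
      change |q i j (k + 1) - Q (i, ((j : ℝ) - 1 / 2) / J i, (((k + 1 : ℤ) : ℝ) - 1 / 2) / K i)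
          - (q i j k - Q (i, ((j : ℝ) - 1 / 2) / J i, ((k : ℝ) - 1 / 2) / K i))|
        ≤ |C| * meshSq (J i) (K i) ^ 1 * (1 / K i)
      rw [h1, h1, pow_one, add_sub_cancel_left, add_sub_cancel_left]
      exact (h2 j k hγ.1 hγ.2.1 hγ.2.2.1 hγ.2.2.2).trans (mul_le_mul_of_nonneg_right
        (mul_le_mul_of_nonneg_right (le_abs_self _) (meshSq_nonneg _ _)) (by positivity))

end Staggered

/-! ### Averages, differences and flux balances on the staggered grids -/

section Staggered

variable {ι : Type*} {J K : ι → ℕ} {hJ : ∀ i, 0 < J i} {hK : ∀ i, 0 < K i}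
  {f g Q Y : ι × ℝ × ℝ → ℝ} {q : ι × ℤ × ℤ → ℝ}

theorem approx_average_xi (hf : (squareFrame ι).Reg 3 f) :
    (xiGrid hJ hK).Approx
      (fun γ => (f (γ.1, (γ.2.1 : ℝ) / J γ.1, (γ.2.2 : ℝ) / K γ.1)
        + f (γ.1, ((γ.2.1 - 1 : ℤ) : ℝ) / J γ.1, (γ.2.2 : ℝ) / K γ.1)) / 2)
      fun γ => f ((xiGrid hJ hK).point γ) := by
  obtain ⟨A, hA0, hA⟩ := (hf.mono (by norm_num : 2 ≤ 3)).exists_averageError_le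
  obtain ⟨B, hB0, hB⟩ := hf.exists_averageError_sub_le
  have key : ∀ (i : ι) (j k : ℤ),
      (f (i, (j : ℝ) / J i, (k : ℝ) / K i) + f (i, ((j - 1 : ℤ) : ℝ) / J i, (k : ℝ) / K i)) / 2
          - f (i, ((j : ℝ) - 1 / 2) / J i, (k : ℝ) / K i)
        = averageError f i (((j : ℝ) - 1 / 2) / J i) ((k : ℝ) / K i) (1 / (2 * J i)) 0 := by
    intro i j k
    rw [averageError, midpoint_add_half (hJ i), midpoint_sub_half (hJ i), add_zero, sub_zero]
    ring
  refine ⟨Grid.lip_of_reg (hf.mono (by norm_num)), A + B, by positivity, ?_, ?_⟩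
  · rintro ⟨i, j, k⟩ hγ
    change |_ - f (i, ((j : ℝ) - 1 / 2) / J i, (k : ℝ) / K i)| ≤ _ * meshSq (J i) (K i) ^ 1
    rw [key, pow_one]
    refine (hA i _ _ _ _ (centered_half hγ.1 hγ.2.1)
      (centered_zero (node_mem_Icc hγ.2.2.1 hγ.2.2.2))).trans ?_
    exact mul_le_mul (by linarith) (half_sq_le _ _) (by positivity) (by positivity)
  · rintro ⟨i, j, k⟩ _ _ ⟨rfl, rfl, h1, h2, h3, h4⟩
    change |_ - f (i, (((j + 1 : ℤ) : ℝ) - 1 / 2) / J i, (k : ℝ) / K i)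
      - (_ - f (i, ((j : ℝ) - 1 / 2) / J i, (k : ℝ) / K i))|
      ≤ _ * meshSq (J i) (K i) ^ 1 * (1 / J i)
    rw [key, key, pow_one]
    refine (hB i _ _ _ _ _ (centered_half h1 h2.le) (centered_half (by dsimp only at *; omega) (by dsimp only at *; omega))
      (centered_zero (node_mem_Icc h3 h4))).trans ?_
    rw [midpoint_succ, add_sub_cancel_left, abs_of_nonneg (by positivity)]
    exact mul_le_mul_of_nonneg_right
      (mul_le_mul (by linarith) (half_sq_le _ _) (by positivity) (by positivity)) (by positivity)

theorem approx_average_eta (hf : (squareFrame ι).Reg 3 f) :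
    (etaGrid hJ hK).Approx
      (fun γ => (f (γ.1, (γ.2.1 : ℝ) / J γ.1, (γ.2.2 : ℝ) / K γ.1)
        + f (γ.1, (γ.2.1 : ℝ) / J γ.1, ((γ.2.2 - 1 : ℤ) : ℝ) / K γ.1)) / 2)
      fun γ => f ((etaGrid hJ hK).point γ) := by
  obtain ⟨A, hA0, hA⟩ := (hf.mono (by norm_num : 2 ≤ 3)).exists_averageError_le
  obtain ⟨B, hB0, hB⟩ := hf.exists_averageError_sub_le'
  have key : ∀ (i : ι) (j k : ℤ),
      (f (i, (j : ℝ) / J i, (k : ℝ) / K i) + f (i, (j : ℝ) / J i, ((k - 1 : ℤ) : ℝ) / K i)) / 2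
          - f (i, (j : ℝ) / J i, ((k : ℝ) - 1 / 2) / K i)
        = averageError f i ((j : ℝ) / J i) (((k : ℝ) - 1 / 2) / K i) 0 (1 / (2 * K i)) := by
    intro i j k
    rw [averageError, midpoint_add_half (hK i), midpoint_sub_half (hK i), add_zero, sub_zero]
    ring
  refine ⟨Grid.lip_of_reg (hf.mono (by norm_num)), A + B, by positivity, ?_, ?_⟩
  · rintro ⟨i, j, k⟩ hγ
    change |_ - f (i, (j : ℝ) / J i, ((k : ℝ) - 1 / 2) / K i)| ≤ _ * meshSq (J i) (K i) ^ 1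
    rw [key, pow_one]
    refine (hA i _ _ _ _ (centered_zero (node_mem_Icc hγ.1 hγ.2.1))
      (centered_half hγ.2.2.1 hγ.2.2.2)).trans ?_
    exact mul_le_mul (by linarith) (half_sq_le' _ _) (by positivity) (by positivity)
  · rintro ⟨i, j, k⟩ _ _ ⟨rfl, rfl, h1, h2, h3, h4⟩
    change |_ - f (i, (j : ℝ) / J i, (((k + 1 : ℤ) : ℝ) - 1 / 2) / K i)
      - (_ - f (i, (j : ℝ) / J i, ((k : ℝ) - 1 / 2) / K i))|
      ≤ _ * meshSq (J i) (K i) ^ 1 * (1 / K i)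
    rw [key, key, pow_one]
    refine (hB i _ _ _ _ _ (centered_zero (node_mem_Icc h1 h2)) (centered_half h3 h4.le)
      (centered_half (by dsimp only at *; omega) (by dsimp only at *; omega))).trans ?_
    rw [midpoint_succ, add_sub_cancel_left, abs_of_nonneg (by positivity)]
    exact mul_le_mul_of_nonneg_right
      (mul_le_mul (by linarith) (half_sq_le' _ _) (by positivity) (by positivity)) (by positivity)

theorem approx_difference_cell (h : (squareFrame ι).Der true Y g) (hg : (squareFrame ι).Reg 3 g) :
    (cellGrid hJ hK).Approx
      (fun γ => (Y (γ.1, (γ.2.1 : ℝ) / J γ.1, (γ.2.2 : ℝ) / K γ.1)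
        - Y (γ.1, ((γ.2.1 - 1 : ℤ) : ℝ) / J γ.1, (γ.2.2 : ℝ) / K γ.1)
        + Y (γ.1, (γ.2.1 : ℝ) / J γ.1, ((γ.2.2 - 1 : ℤ) : ℝ) / K γ.1)
        - Y (γ.1, ((γ.2.1 - 1 : ℤ) : ℝ) / J γ.1, ((γ.2.2 - 1 : ℤ) : ℝ) / K γ.1)) / 2 * J γ.1)
      fun γ => g ((cellGrid hJ hK).point γ) := by
  obtain ⟨A, hA0, hA⟩ := h.exists_differenceError_le (hg.mono (by norm_num : 2 ≤ 3))
  obtain ⟨B, hB0, hB, hB'⟩ := h.exists_differenceError_sub_le hg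
  have key : ∀ (i : ι) (j k : ℤ),
      (Y (i, (j : ℝ) / J i, (k : ℝ) / K i) - Y (i, ((j - 1 : ℤ) : ℝ) / J i, (k : ℝ) / K i)
          + Y (i, (j : ℝ) / J i, ((k - 1 : ℤ) : ℝ) / K i)
          - Y (i, ((j - 1 : ℤ) : ℝ) / J i, ((k - 1 : ℤ) : ℝ) / K i)) / 2 * J i
          - g (i, ((j : ℝ) - 1 / 2) / J i, ((k : ℝ) - 1 / 2) / K i)
        = differenceError Y g i (((j : ℝ) - 1 / 2) / J i) (((k : ℝ) - 1 / 2) / K i)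
          (1 / (2 * J i)) (1 / (2 * K i)) := by
    intro i j k
    rw [differenceError, midpoint_add_half (hJ i), midpoint_sub_half (hJ i),
      midpoint_add_half (hK i), midpoint_sub_half (hK i)]
    have : (J i : ℝ) ≠ 0 := by exact_mod_cast (hJ i).ne'
    field_simp
    ring
  have hp : ∀ i, 0 < 1 / (2 * (J i : ℝ)) := fun i => by
    have : (0 : ℝ) < J i := by exact_mod_cast hJ i
    positivity
  refine ⟨Grid.lip_of_reg (hg.mono (by norm_num)), A + B, by positivity, ?_, ?_⟩
  · rintro ⟨i, j, k⟩ hγ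
    change |_ - g (i, ((j : ℝ) - 1 / 2) / J i, ((k : ℝ) - 1 / 2) / K i)|
      ≤ _ * meshSq (J i) (K i) ^ 1
    rw [key, pow_one]
    refine (hA i _ _ _ _ (hp i) (centered_half hγ.1 hγ.2.1)
      (centered_half hγ.2.2.1 hγ.2.2.2)).trans ?_
    exact mul_le_mul (by linarith) (half_sq_add_half_sq_le _ _) (by positivity) (by positivity)
  · rintro ⟨i, j, k⟩ _ _ (⟨rfl, rfl, h1, h2, h3, h4⟩ | ⟨rfl, rfl, h1, h2, h3, h4⟩)
    · change |_ - g (i, (((j + 1 : ℤ) : ℝ) - 1 / 2) / J i, ((k : ℝ) - 1 / 2) / K i)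
        - (_ - g (i, ((j : ℝ) - 1 / 2) / J i, ((k : ℝ) - 1 / 2) / K i))|
        ≤ _ * meshSq (J i) (K i) ^ 1 * (1 / J i)
      rw [key, key, pow_one]
      refine (hB i _ _ _ _ _ (hp i) (centered_half h1 h2.le)
        (centered_half (by dsimp only at *; omega) (by dsimp only at *; omega)) (centered_half h3 h4)).trans ?_
      rw [midpoint_succ, add_sub_cancel_left, abs_of_nonneg (by positivity)]
      exact mul_le_mul_of_nonneg_right
        (mul_le_mul (by linarith) (half_sq_add_half_sq_le _ _) (by positivity) (by positivity))
        (by positivity)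
    · change |_ - g (i, ((j : ℝ) - 1 / 2) / J i, (((k + 1 : ℤ) : ℝ) - 1 / 2) / K i)
        - (_ - g (i, ((j : ℝ) - 1 / 2) / J i, ((k : ℝ) - 1 / 2) / K i))|
        ≤ _ * meshSq (J i) (K i) ^ 1 * (1 / K i)
      rw [key, key, pow_one]
      refine (hB' i _ _ _ _ _ (hp i) (centered_half h1 h2) (centered_half h3 h4.le)
        (centered_half (by dsimp only at *; omega) (by dsimp only at *; omega))).trans ?_
      rw [midpoint_succ, add_sub_cancel_left, abs_of_nonneg (by positivity)]
      exact mul_le_mul_of_nonneg_right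
        (mul_le_mul (by linarith) (half_sq_add_half_sq_le _ _) (by positivity) (by positivity))
        (by positivity)

theorem approx_difference_cell' (h : (squareFrame ι).Der false Y g)
    (hg : (squareFrame ι).Reg 3 g) :
    (cellGrid hJ hK).Approx
      (fun γ => (Y (γ.1, (γ.2.1 : ℝ) / J γ.1, (γ.2.2 : ℝ) / K γ.1)
        - Y (γ.1, (γ.2.1 : ℝ) / J γ.1, ((γ.2.2 - 1 : ℤ) : ℝ) / K γ.1)
        + Y (γ.1, ((γ.2.1 - 1 : ℤ) : ℝ) / J γ.1, (γ.2.2 : ℝ) / K γ.1)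
        - Y (γ.1, ((γ.2.1 - 1 : ℤ) : ℝ) / J γ.1, ((γ.2.2 - 1 : ℤ) : ℝ) / K γ.1)) / 2 * K γ.1)
      fun γ => g ((cellGrid hJ hK).point γ) := by
  obtain ⟨A, hA0, hA⟩ := h.exists_differenceError'_le (hg.mono (by norm_num : 2 ≤ 3))
  obtain ⟨B, hB0, hB, hB'⟩ := h.exists_differenceError'_sub_le hg
  have key : ∀ (i : ι) (j k : ℤ),
      (Y (i, (j : ℝ) / J i, (k : ℝ) / K i) - Y (i, (j : ℝ) / J i, ((k - 1 : ℤ) : ℝ) / K i)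
          + Y (i, ((j - 1 : ℤ) : ℝ) / J i, (k : ℝ) / K i)
          - Y (i, ((j - 1 : ℤ) : ℝ) / J i, ((k - 1 : ℤ) : ℝ) / K i)) / 2 * K i
          - g (i, ((j : ℝ) - 1 / 2) / J i, ((k : ℝ) - 1 / 2) / K i)
        = differenceError' Y g i (((j : ℝ) - 1 / 2) / J i) (((k : ℝ) - 1 / 2) / K i)
          (1 / (2 * J i)) (1 / (2 * K i)) := by
    intro i j k
    rw [differenceError', midpoint_add_half (hJ i), midpoint_sub_half (hJ i),
      midpoint_add_half (hK i), midpoint_sub_half (hK i)]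
    have : (K i : ℝ) ≠ 0 := by exact_mod_cast (hK i).ne'
    field_simp
    ring
  have hp : ∀ i, 0 < 1 / (2 * (K i : ℝ)) := fun i => by
    have : (0 : ℝ) < K i := by exact_mod_cast hK i
    positivity
  refine ⟨Grid.lip_of_reg (hg.mono (by norm_num)), A + B, by positivity, ?_, ?_⟩
  · rintro ⟨i, j, k⟩ hγ
    change |_ - g (i, ((j : ℝ) - 1 / 2) / J i, ((k : ℝ) - 1 / 2) / K i)|
      ≤ _ * meshSq (J i) (K i) ^ 1
    rw [key, pow_one]
    refine (hA i _ _ _ _ (hp i) (centered_half hγ.1 hγ.2.1)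
      (centered_half hγ.2.2.1 hγ.2.2.2)).trans ?_
    exact mul_le_mul (by linarith) (half_sq_add_half_sq_le _ _) (by positivity) (by positivity)
  · rintro ⟨i, j, k⟩ _ _ (⟨rfl, rfl, h1, h2, h3, h4⟩ | ⟨rfl, rfl, h1, h2, h3, h4⟩)
    · change |_ - g (i, (((j + 1 : ℤ) : ℝ) - 1 / 2) / J i, ((k : ℝ) - 1 / 2) / K i)
        - (_ - g (i, ((j : ℝ) - 1 / 2) / J i, ((k : ℝ) - 1 / 2) / K i))|
        ≤ _ * meshSq (J i) (K i) ^ 1 * (1 / J i)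
      rw [key, key, pow_one]
      refine (hB i _ _ _ _ _ (hp i) (centered_half h1 h2.le)
        (centered_half (by dsimp only at *; omega) (by dsimp only at *; omega)) (centered_half h3 h4)).trans ?_
      rw [midpoint_succ, add_sub_cancel_left, abs_of_nonneg (by positivity)]
      exact mul_le_mul_of_nonneg_right
        (mul_le_mul (by linarith) (half_sq_add_half_sq_le _ _) (by positivity) (by positivity))
        (by positivity)
    · change |_ - g (i, ((j : ℝ) - 1 / 2) / J i, (((k + 1 : ℤ) : ℝ) - 1 / 2) / K i)
        - (_ - g (i, ((j : ℝ) - 1 / 2) / J i, ((k : ℝ) - 1 / 2) / K i))|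
        ≤ _ * meshSq (J i) (K i) ^ 1 * (1 / K i)
      rw [key, key, pow_one]
      refine (hB' i _ _ _ _ _ (hp i) (centered_half h1 h2) (centered_half h3 h4.le)
        (centered_half (by dsimp only at *; omega) (by dsimp only at *; omega))).trans ?_
      rw [midpoint_succ, add_sub_cancel_left, abs_of_nonneg (by positivity)]
      exact mul_le_mul_of_nonneg_right
        (mul_le_mul (by linarith) (half_sq_add_half_sq_le _ _) (by positivity) (by positivity))
        (by positivity)

/-- The divided difference of a numerical flux in the first direction approximates the
derivative of the exact flux at the nodes. -/
theorem Grid.Approx.exists_flux_xi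
    (hq : (xiGrid hJ hK).Approx q fun γ => Q ((xiGrid hJ hK).point γ))
    (h : (squareFrame ι).Der true Q g) (hg : (squareFrame ι).Reg 2 g) :
    ∃ M, 0 ≤ M ∧ ∀ (i : ι) (j k : ℤ), 0 < j → j < J i → 0 < k → k < K i →
      |(q (i, j + 1, k) - q (i, j, k)) * J i - g (i, (j : ℝ) / J i, (k : ℝ) / K i)|
        ≤ M * meshSq (J i) (K i) := by
  obtain ⟨A, hA0, hA⟩ := h.exists_differenceError_le hg
  obtain ⟨-, B, hB0, -, hB⟩ := hq
  refine ⟨A + B, by positivity, fun i j k h1 h2 h3 h4 => ?_⟩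
  have hJ0 : (0 : ℝ) < J i := by exact_mod_cast hJ i
  have a1 := hA i _ _ (1 / (2 * J i)) 0 (by positivity) (centered_node h1 h2)
    (centered_zero (node_mem_Icc h3 h4))
  have a2 := hB (i, j, k) (i, j + 1, k) _ ⟨rfl, rfl, h1, h2, h3, h4⟩
  rw [pow_one] at a2
  change |q (i, j + 1, k) - Q (i, (((j + 1 : ℤ) : ℝ) - 1 / 2) / J i, (k : ℝ) / K i)
    - (q (i, j, k) - Q (i, ((j : ℝ) - 1 / 2) / J i, (k : ℝ) / K i))|
      ≤ B * meshSq (J i) (K i) * (1 / J i) at a2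
  rw [differenceError, node_add_half (hJ i), node_sub_half (hJ i), add_zero, sub_zero] at a1
  set Q1 := Q (i, (((j + 1 : ℤ) : ℝ) - 1 / 2) / J i, (k : ℝ) / K i)
  set Q0 := Q (i, ((j : ℝ) - 1 / 2) / J i, (k : ℝ) / K i)
  have e1 : (Q1 - Q0 + Q1 - Q0) / (4 * (1 / (2 * (J i : ℝ)))) = (Q1 - Q0) * J i := by
    field_simp
    ring
  rw [e1] at a1
  have a3 := mul_le_mul_of_nonneg_right a2 hJ0.le
  rw [← abs_of_pos hJ0, ← abs_mul, abs_of_pos hJ0, mul_assoc _ (1 / (J i : ℝ)),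
    one_div_mul_cancel hJ0.ne', mul_one] at a3
  have a4 := mul_le_mul_of_nonneg_left (half_sq_le (J i) (K i)) hA0
  calc _ = |(q (i, j + 1, k) - Q1 - (q (i, j, k) - Q0)) * J i
        + ((Q1 - Q0) * J i - g (i, (j : ℝ) / J i, (k : ℝ) / K i))| := by ring_nf
    _ ≤ _ := (abs_add_le _ _).trans ((add_le_add a3 (a1.trans a4)).trans_eq (by ring))

theorem Grid.Approx.exists_flux_eta
    (hq : (etaGrid hJ hK).Approx q fun γ => Q ((etaGrid hJ hK).point γ))
    (h : (squareFrame ι).Der false Q g) (hg : (squareFrame ι).Reg 2 g) :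
    ∃ M, 0 ≤ M ∧ ∀ (i : ι) (j k : ℤ), 0 < j → j < J i → 0 < k → k < K i →
      |(q (i, j, k + 1) - q (i, j, k)) * K i - g (i, (j : ℝ) / J i, (k : ℝ) / K i)|
        ≤ M * meshSq (J i) (K i) := by
  obtain ⟨A, hA0, hA⟩ := h.exists_differenceError'_le hg
  obtain ⟨-, B, hB0, -, hB⟩ := hq
  refine ⟨A + B, by positivity, fun i j k h1 h2 h3 h4 => ?_⟩
  have hK0 : (0 : ℝ) < K i := by exact_mod_cast hK i
  have a1 := hA i _ _ 0 (1 / (2 * K i)) (by positivity) (centered_zero (node_mem_Icc h1 h2))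
    (centered_node h3 h4)
  have a2 := hB (i, j, k) (i, j, k + 1) _ ⟨rfl, rfl, h1, h2, h3, h4⟩
  rw [pow_one] at a2
  change |q (i, j, k + 1) - Q (i, (j : ℝ) / J i, (((k + 1 : ℤ) : ℝ) - 1 / 2) / K i)
    - (q (i, j, k) - Q (i, (j : ℝ) / J i, ((k : ℝ) - 1 / 2) / K i))|
      ≤ B * meshSq (J i) (K i) * (1 / K i) at a2
  rw [differenceError', node_add_half (hK i), node_sub_half (hK i), add_zero, sub_zero] at a1
  set Q1 := Q (i, (j : ℝ) / J i, (((k + 1 : ℤ) : ℝ) - 1 / 2) / K i)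
  set Q0 := Q (i, (j : ℝ) / J i, ((k : ℝ) - 1 / 2) / K i)
  have e1 : (Q1 - Q0 + Q1 - Q0) / (4 * (1 / (2 * (K i : ℝ)))) = (Q1 - Q0) * K i := by
    field_simp
    ring
  rw [e1] at a1
  have a3 := mul_le_mul_of_nonneg_right a2 hK0.le
  rw [← abs_of_pos hK0, ← abs_mul, abs_of_pos hK0, mul_assoc _ (1 / (K i : ℝ)),
    one_div_mul_cancel hK0.ne', mul_one] at a3
  have a4 := mul_le_mul_of_nonneg_left (half_sq_le' (J i) (K i)) hA0
  calc _ = |(q (i, j, k + 1) - Q1 - (q (i, j, k) - Q0)) * K i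
        + ((Q1 - Q0) * K i - g (i, (j : ℝ) / J i, (k : ℝ) / K i))| := by ring_nf
    _ ≤ _ := (abs_add_le _ _).trans ((add_le_add a3 (a1.trans a4)).trans_eq (by ring))

theorem Grid.Approx.exists_flux_cell
    (hq : (cellGrid hJ hK).Approx q fun γ => Q ((cellGrid hJ hK).point γ))
    (h : (squareFrame ι).Der true Q g) (hg : (squareFrame ι).Reg 2 g) :
    ∃ M, 0 ≤ M ∧ ∀ (i : ι) (j k : ℤ), 0 < j → j < J i → 0 < k → k < K i →
      |(q (i, j + 1, k + 1) - q (i, j, k + 1) + q (i, j + 1, k) - q (i, j, k)) / 2 * J i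
          - g (i, (j : ℝ) / J i, (k : ℝ) / K i)|
        ≤ M * meshSq (J i) (K i) := by
  obtain ⟨A, hA0, hA⟩ := h.exists_differenceError_le hg
  obtain ⟨-, B, hB0, -, hB⟩ := hq
  refine ⟨A + B, by positivity, fun i j k h1 h2 h3 h4 => ?_⟩
  have hJ0 : (0 : ℝ) < J i := by exact_mod_cast hJ i
  have a1 := hA i _ _ (1 / (2 * J i)) (1 / (2 * K i)) (by positivity) (centered_node h1 h2)
    (centered_node h3 h4)
  have a2 := hB (i, j, k) (i, j + 1, k) _ (Or.inl ⟨rfl, rfl, h1, h2, h3, h4.le⟩)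
  have a2' := hB (i, j, k + 1) (i, j + 1, k + 1) _
    (Or.inl ⟨rfl, rfl, h1, h2, by dsimp only; omega, by dsimp only; omega⟩)
  rw [pow_one] at a2 a2'
  change |q (i, j + 1, k) - Q (i, (((j + 1 : ℤ) : ℝ) - 1 / 2) / J i, ((k : ℝ) - 1 / 2) / K i)
    - (q (i, j, k) - Q (i, ((j : ℝ) - 1 / 2) / J i, ((k : ℝ) - 1 / 2) / K i))|
      ≤ B * meshSq (J i) (K i) * (1 / J i) at a2
  change |q (i, j + 1, k + 1)
      - Q (i, (((j + 1 : ℤ) : ℝ) - 1 / 2) / J i, (((k + 1 : ℤ) : ℝ) - 1 / 2) / K i)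
    - (q (i, j, k + 1) - Q (i, ((j : ℝ) - 1 / 2) / J i, (((k + 1 : ℤ) : ℝ) - 1 / 2) / K i))|
      ≤ B * meshSq (J i) (K i) * (1 / J i) at a2'
  rw [differenceError, node_add_half (hJ i), node_sub_half (hJ i), node_add_half (hK i),
    node_sub_half (hK i)] at a1
  set Q1 := Q (i, (((j + 1 : ℤ) : ℝ) - 1 / 2) / J i, ((k : ℝ) - 1 / 2) / K i)
  set Q0 := Q (i, ((j : ℝ) - 1 / 2) / J i, ((k : ℝ) - 1 / 2) / K i)
  set Q1' := Q (i, (((j + 1 : ℤ) : ℝ) - 1 / 2) / J i, (((k + 1 : ℤ) : ℝ) - 1 / 2) / K i)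
  set Q0' := Q (i, ((j : ℝ) - 1 / 2) / J i, (((k + 1 : ℤ) : ℝ) - 1 / 2) / K i)
  have e1 : (Q1' - Q0' + Q1 - Q0) / (4 * (1 / (2 * (J i : ℝ))))
      = (Q1' - Q0' + Q1 - Q0) / 2 * J i := by
    field_simp
    ring
  rw [e1] at a1
  have e2 : B * meshSq (J i) (K i) * (1 / J i) * J i = B * meshSq (J i) (K i) := by
    field_simp
  have a3 : |(q (i, j + 1, k) - Q1 - (q (i, j, k) - Q0)) * J i| ≤ B * meshSq (J i) (K i) := by
    rw [abs_mul, abs_of_pos hJ0, ← e2]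
    exact mul_le_mul_of_nonneg_right a2 hJ0.le
  have a3' : |(q (i, j + 1, k + 1) - Q1' - (q (i, j, k + 1) - Q0')) * J i|
      ≤ B * meshSq (J i) (K i) := by
    rw [abs_mul, abs_of_pos hJ0, ← e2]
    exact mul_le_mul_of_nonneg_right a2' hJ0.le
  have a4 := mul_le_mul_of_nonneg_left (half_sq_add_half_sq_le (J i) (K i)) hA0
  rw [abs_le] at a1 a3 a3' ⊢
  constructor <;> linarith [a1.1, a1.2, a3.1, a3.2, a3'.1, a3'.2]

theorem Grid.Approx.exists_flux_cell'
    (hq : (cellGrid hJ hK).Approx q fun γ => Q ((cellGrid hJ hK).point γ))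
    (h : (squareFrame ι).Der false Q g) (hg : (squareFrame ι).Reg 2 g) :
    ∃ M, 0 ≤ M ∧ ∀ (i : ι) (j k : ℤ), 0 < j → j < J i → 0 < k → k < K i →
      |(q (i, j + 1, k + 1) - q (i, j + 1, k) + q (i, j, k + 1) - q (i, j, k)) / 2 * K i
          - g (i, (j : ℝ) / J i, (k : ℝ) / K i)|
        ≤ M * meshSq (J i) (K i) := by
  obtain ⟨A, hA0, hA⟩ := h.exists_differenceError'_le hg
  obtain ⟨-, B, hB0, -, hB⟩ := hq
  refine ⟨A + B, by positivity, fun i j k h1 h2 h3 h4 => ?_⟩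
  have hK0 : (0 : ℝ) < K i := by exact_mod_cast hK i
  have a1 := hA i _ _ (1 / (2 * J i)) (1 / (2 * K i)) (by positivity) (centered_node h1 h2)
    (centered_node h3 h4)
  have a2 := hB (i, j, k) (i, j, k + 1) _ (Or.inr ⟨rfl, rfl, h1, h2.le, h3, h4⟩)
  have a2' := hB (i, j + 1, k) (i, j + 1, k + 1) _
    (Or.inr ⟨rfl, rfl, by dsimp only; omega, by dsimp only; omega, h3, h4⟩)
  rw [pow_one] at a2 a2'
  change |q (i, j, k + 1) - Q (i, ((j : ℝ) - 1 / 2) / J i, (((k + 1 : ℤ) : ℝ) - 1 / 2) / K i)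
    - (q (i, j, k) - Q (i, ((j : ℝ) - 1 / 2) / J i, ((k : ℝ) - 1 / 2) / K i))|
      ≤ B * meshSq (J i) (K i) * (1 / K i) at a2
  change |q (i, j + 1, k + 1)
      - Q (i, (((j + 1 : ℤ) : ℝ) - 1 / 2) / J i, (((k + 1 : ℤ) : ℝ) - 1 / 2) / K i)
    - (q (i, j + 1, k) - Q (i, (((j + 1 : ℤ) : ℝ) - 1 / 2) / J i, ((k : ℝ) - 1 / 2) / K i))|
      ≤ B * meshSq (J i) (K i) * (1 / K i) at a2'
  rw [differenceError', node_add_half (hJ i), node_sub_half (hJ i), node_add_half (hK i),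
    node_sub_half (hK i)] at a1
  set Q1 := Q (i, ((j : ℝ) - 1 / 2) / J i, (((k + 1 : ℤ) : ℝ) - 1 / 2) / K i)
  set Q0 := Q (i, ((j : ℝ) - 1 / 2) / J i, ((k : ℝ) - 1 / 2) / K i)
  set Q1' := Q (i, (((j + 1 : ℤ) : ℝ) - 1 / 2) / J i, (((k + 1 : ℤ) : ℝ) - 1 / 2) / K i)
  set Q0' := Q (i, (((j + 1 : ℤ) : ℝ) - 1 / 2) / J i, ((k : ℝ) - 1 / 2) / K i)
  have e1 : (Q1' - Q0' + Q1 - Q0) / (4 * (1 / (2 * (K i : ℝ))))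
      = (Q1' - Q0' + Q1 - Q0) / 2 * K i := by
    field_simp
    ring
  rw [e1] at a1
  have e2 : B * meshSq (J i) (K i) * (1 / K i) * K i = B * meshSq (J i) (K i) := by
    field_simp
  have a3 : |(q (i, j, k + 1) - Q1 - (q (i, j, k) - Q0)) * K i| ≤ B * meshSq (J i) (K i) := by
    rw [abs_mul, abs_of_pos hK0, ← e2]
    exact mul_le_mul_of_nonneg_right a2 hK0.le
  have a3' : |(q (i, j + 1, k + 1) - Q1' - (q (i, j + 1, k) - Q0')) * K i|
      ≤ B * meshSq (J i) (K i) := by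
    rw [abs_mul, abs_of_pos hK0, ← e2]
    exact mul_le_mul_of_nonneg_right a2' hK0.le
  have a4 := mul_le_mul_of_nonneg_left (half_sq_add_half_sq_le (J i) (K i)) hA0
  rw [abs_le] at a1 a3 a3' ⊢
  constructor <;> linarith [a1.1, a1.2, a3.1, a3.2, a3'.1, a3'.2]

end Staggered

/-! ### The coordinate transformation as a regular family -/

/-- Spatial derivatives of bounded norm make a family of functions regular. -/
theorem squareFrame_reg_of_iteratedFDeriv {ι E : Type*} [NormedAddCommGroup E] [NormedSpace ℝ E]
    {k : ℕ} {C : ℝ} {Y : ι → ℝ × ℝ → E} (L : E →L[ℝ] ℝ) (hY : ∀ i, ContDiff ℝ k (Y i))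
    (hC : ∀ i, ∀ l ≤ k, ∀ z ∈ unitSquare, ‖iteratedFDeriv ℝ l (Y i) z‖ ≤ C) :
    (squareFrame ι).Reg k fun o => L (Y o.1 o.2) := by
  have hb : (squareFrame ι).Bdd fun o => L (Y o.1 o.2) := ⟨‖L‖ * C, fun o ho => by
    have := hC o.1 0 (Nat.zero_le _) o.2 ho
    rw [norm_iteratedFDeriv_zero] at this
    exact (L.le_opNorm _).trans (mul_le_mul_of_nonneg_left this (norm_nonneg _))⟩
  induction k generalizing Y C with
  | zero => exact hb
  | succ k ih =>
    have h1 : ∀ i, ContDiff ℝ k (fderiv ℝ (Y i)) := fun i =>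
      (hY i).fderiv_right (by norm_cast)
    have hd : ∀ i, Differentiable ℝ (Y i) := fun i => (hY i).differentiable (by simp)
    have key : ∀ v : ℝ × ℝ, (squareFrame ι).Reg k fun o => L (fderiv ℝ (Y o.1) o.2 v) := by
      intro v
      have h2 : ∀ i, ContDiff ℝ k fun z => fderiv ℝ (Y i) z v := fun i =>
        (h1 i).clm_apply contDiff_const
      have h3 : ∀ i, ∀ l ≤ k, ∀ z ∈ unitSquare,
          ‖iteratedFDeriv ℝ l (fun z => fderiv ℝ (Y i) z v) z‖ ≤ ‖v‖ * C := fun i l hl z hz => by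
        refine (norm_iteratedFDeriv_clm_apply_const (h1 i).contDiffAt
          (by exact_mod_cast hl)).trans ?_
        rw [norm_iteratedFDeriv_fderiv]
        exact mul_le_mul_of_nonneg_left (hC i _ (Nat.succ_le_succ hl) z hz) (norm_nonneg _)
      refine ih h2 h3 ⟨‖L‖ * (‖v‖ * C), fun o ho => ?_⟩
      have := h3 o.1 0 (Nat.zero_le _) o.2 ho
      rw [norm_iteratedFDeriv_zero] at this
      exact (L.le_opNorm _).trans (mul_le_mul_of_nonneg_left this (norm_nonneg _))
    refine ⟨hb, fun d => ?_⟩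
    cases d with
    | true =>
      refine ⟨_, fun o ho => ?_, key (1, 0)⟩
      have e : HasDerivAt (fun s : ℝ => (s, o.2.2)) ((1 : ℝ), (0 : ℝ)) o.2.1 :=
        (hasDerivAt_id _).prodMk (hasDerivAt_const _ _)
      exact (L.hasFDerivAt.comp_hasDerivAt o.2.1 (((hd o.1) o.2).hasFDerivAt.comp_hasDerivAt
        (f := fun s : ℝ => (s, o.2.2)) o.2.1 e)).hasDerivWithinAt
    | false =>
      refine ⟨_, fun o ho => ?_, key (0, 1)⟩
      have e : HasDerivAt (fun s : ℝ => (o.2.1, s)) ((0 : ℝ), (1 : ℝ)) o.2.2 :=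
        (hasDerivAt_const _ _).prodMk (hasDerivAt_id _)
      exact (L.hasFDerivAt.comp_hasDerivAt o.2.2 (((hd o.1) o.2).hasFDerivAt.comp_hasDerivAt
        (f := fun s : ℝ => (o.2.1, s)) o.2.2 e)).hasDerivWithinAt

/-- A mesh together with a point of time in the interior of its distinguished time step. -/
structure MeshTime (P : IBVP) (u : ℝ × ℝ × ℝ → ℝ) (T C κ : ℝ) where
  /-- the number of mesh cells in the first direction -/
  J : ℕ
  /-- the number of mesh cells in the second direction -/
  K : ℕ
  /-- the mesh and the time step -/
  s : MeshStep P u T C κ J K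
  /-- the point of time -/
  t : ℝ
  ht : t ∈ Ioo s.a s.b

namespace MeshTime

variable {P : IBVP} {u : ℝ × ℝ × ℝ → ℝ} {T C κ : ℝ}

/-- The frame of all coordinate transformations. -/
abbrev frame (P : IBVP) (u : ℝ × ℝ × ℝ → ℝ) (T C κ : ℝ) :
    Frame (MeshTime P u T C κ × ℝ × ℝ) Bool := squareFrame _

/-- A function of space and time in the computational coordinates. -/
def pull (φ : ℝ × ℝ × ℝ → ℝ) (o : MeshTime P u T C κ × ℝ × ℝ) : ℝ :=
  φ ((o.1.s.X o.1.t o.2).1, (o.1.s.X o.1.t o.2).2, o.1.t)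

/-- `x_ξ` for all mesh times. -/
noncomputable def x₁ (o : MeshTime P u T C κ × ℝ × ℝ) : ℝ := xXi o.1.s.X o.1.t o.2
/-- `x_η` for all mesh times. -/
noncomputable def x₂ (o : MeshTime P u T C κ × ℝ × ℝ) : ℝ := xEta o.1.s.X o.1.t o.2
/-- `y_ξ` for all mesh times. -/
noncomputable def y₁ (o : MeshTime P u T C κ × ℝ × ℝ) : ℝ := yXi o.1.s.X o.1.t o.2
/-- `y_η` for all mesh times. -/
noncomputable def y₂ (o : MeshTime P u T C κ × ℝ × ℝ) : ℝ := yEta o.1.s.X o.1.t o.2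
/-- The first component of the mesh velocity. -/
noncomputable def v₁ (o : MeshTime P u T C κ × ℝ × ℝ) : ℝ := (velocity o.1.s.X o.1.t o.2).1
/-- The second component of the mesh velocity. -/
noncomputable def v₂ (o : MeshTime P u T C κ × ℝ × ℝ) : ℝ := (velocity o.1.s.X o.1.t o.2).2
/-- The Jacobian determinant. -/
noncomputable def jac (o : MeshTime P u T C κ × ℝ × ℝ) : ℝ := x₁ o * y₂ o - x₂ o * y₁ o
/-- `x_ξη` for all mesh times. -/
noncomputable def x₁₂ (o : MeshTime P u T C κ × ℝ × ℝ) : ℝ :=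
  (fderiv ℝ (fderiv ℝ (o.1.s.X o.1.t)) o.2 (1, 0) (0, 1)).1
/-- `y_ξη` for all mesh times. -/
noncomputable def y₁₂ (o : MeshTime P u T C κ × ℝ × ℝ) : ℝ :=
  (fderiv ℝ (fderiv ℝ (o.1.s.X o.1.t)) o.2 (1, 0) (0, 1)).2

theorem reg_velocity (L : ℝ × ℝ →L[ℝ] ℝ) :
    (frame P u T C κ).Reg 4 fun o => L (velocity o.1.s.X o.1.t o.2) :=
  (squareFrame_reg_of_iteratedFDeriv (Y := fun i : MeshTime P u T C κ => i.s.V) L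
    (fun i => i.s.contDiff_V) fun i => i.s.trans.bound_velocity i.s.n i.s.hn).congr
    fun o _ => by rw [o.1.s.velocity_eq o.1.ht]

theorem reg_v₁ : (frame P u T C κ).Reg 4 v₁ := reg_velocity (ContinuousLinearMap.fst ℝ ℝ ℝ)

theorem reg_v₂ : (frame P u T C κ).Reg 4 v₂ := reg_velocity (ContinuousLinearMap.snd ℝ ℝ ℝ)

theorem time_mem (i : MeshTime P u T C κ) : i.t ∈ Icc 0 T :=
  i.s.Icc_subset (Ioo_subset_Icc_self i.ht)

theorem reg_time {k : ℕ} : (frame P u T C κ).Reg k fun o => o.1.t :=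
  Frame.Reg.of_const_along ⟨T, fun o _ => by
    rw [abs_of_nonneg o.1.time_mem.1]; exact o.1.time_mem.2⟩ fun d o _ s _ => by cases d <;> rfl

theorem reg_position (L : ℝ × ℝ →L[ℝ] ℝ) :
    (frame P u T C κ).Reg 4 fun o => L (o.1.s.X o.1.t o.2) := by
  have h1 : (frame P u T C κ).Reg 4 fun o => L (o.1.s.X o.1.s.a o.2) :=
    squareFrame_reg_of_iteratedFDeriv (Y := fun i : MeshTime P u T C κ => i.s.X i.s.a) L
      (fun i => i.s.trans.contDiff _ i.s.hn.le) fun i => i.s.trans.bound i.s.n i.s.hn.le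
  have h2 : (frame P u T C κ).Reg 4 fun o => o.1.t - o.1.s.a :=
    Frame.Reg.of_const_along ⟨T, fun o _ => by
      have := o.1.time_mem.2
      have := (o.1.s.Icc_subset (left_mem_Icc.2 o.1.s.a_lt_b.le)).1
      rw [abs_of_nonneg (sub_nonneg.2 o.1.ht.1.le)]
      linarith⟩ fun d o _ s _ => by cases d <;> rfl
  refine (h1.add (h2.mul (reg_velocity L))).congr fun o _ => ?_
  simp only
  rw [o.1.s.velocity_eq o.1.ht, o.1.s.X_eq (Ioo_subset_Icc_self o.1.ht) o.2, map_add, map_smul,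
    smul_eq_mul]

theorem contDiff (i : MeshTime P u T C κ) : ContDiff ℝ 4 (i.s.X i.t) :=
  i.s.contDiff_X (Ioo_subset_Icc_self i.ht)

theorem der_position (L : ℝ × ℝ →L[ℝ] ℝ) (d : Bool) :
    (frame P u T C κ).Der d (fun o => L (o.1.s.X o.1.t o.2))
      fun o => L (fderiv ℝ (o.1.s.X o.1.t) o.2 (bif d then (1, 0) else (0, 1))) := by
  intro o ho
  have hd : HasFDerivAt (o.1.s.X o.1.t) (fderiv ℝ (o.1.s.X o.1.t) o.2) o.2 :=
    (o.1.contDiff.differentiable (by simp) o.2).hasFDerivAt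
  cases d with
  | true =>
    have e : HasDerivAt (fun s : ℝ => (s, o.2.2)) ((1 : ℝ), (0 : ℝ)) o.2.1 :=
      (hasDerivAt_id _).prodMk (hasDerivAt_const _ _)
    exact (L.hasFDerivAt.comp_hasDerivAt o.2.1 (hd.comp_hasDerivAt
      (f := fun s : ℝ => (s, o.2.2)) o.2.1 e)).hasDerivWithinAt
  | false =>
    have e : HasDerivAt (fun s : ℝ => (o.2.1, s)) ((0 : ℝ), (1 : ℝ)) o.2.2 :=
      (hasDerivAt_const _ _).prodMk (hasDerivAt_id _)
    exact (L.hasFDerivAt.comp_hasDerivAt o.2.2 (hd.comp_hasDerivAt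
      (f := fun s : ℝ => (o.2.1, s)) o.2.2 e)).hasDerivWithinAt

theorem der_derivative (L : ℝ × ℝ →L[ℝ] ℝ) (v : ℝ × ℝ) (d : Bool) :
    (frame P u T C κ).Der d (fun o => L (fderiv ℝ (o.1.s.X o.1.t) o.2 v))
      fun o => L (fderiv ℝ (fderiv ℝ (o.1.s.X o.1.t)) o.2 (bif d then (1, 0) else (0, 1)) v) := by
  intro o ho
  have hd : HasFDerivAt (fderiv ℝ (o.1.s.X o.1.t)) (fderiv ℝ (fderiv ℝ (o.1.s.X o.1.t)) o.2) o.2 :=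
    ((o.1.contDiff.fderiv_right (m := 1) (by norm_num)).differentiable (by simp) o.2).hasFDerivAt
  cases d with
  | true =>
    have e : HasDerivAt (fun s : ℝ => (s, o.2.2)) ((1 : ℝ), (0 : ℝ)) o.2.1 :=
      (hasDerivAt_id _).prodMk (hasDerivAt_const _ _)
    exact ((L.comp (ContinuousLinearMap.apply ℝ (ℝ × ℝ) v)).hasFDerivAt.comp_hasDerivAt o.2.1
      (hd.comp_hasDerivAt (f := fun s : ℝ => (s, o.2.2)) o.2.1 e)).hasDerivWithinAt
  | false =>
    have e : HasDerivAt (fun s : ℝ => (o.2.1, s)) ((0 : ℝ), (1 : ℝ)) o.2.2 :=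
      (hasDerivAt_const _ _).prodMk (hasDerivAt_id _)
    exact ((L.comp (ContinuousLinearMap.apply ℝ (ℝ × ℝ) v)).hasFDerivAt.comp_hasDerivAt o.2.2
      (hd.comp_hasDerivAt (f := fun s : ℝ => (o.2.1, s)) o.2.2 e)).hasDerivWithinAt

theorem reg_derivative (L : ℝ × ℝ →L[ℝ] ℝ) (d : Bool) :
    (frame P u T C κ).Reg 3
      fun o => L (fderiv ℝ (o.1.s.X o.1.t) o.2 (bif d then (1, 0) else (0, 1))) := by
  obtain ⟨f', h1, h2⟩ := (reg_position (P := P) (u := u) (T := T) (C := C) (κ := κ) L).2 d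
  exact h2.congr (squareFrame_der_unique h1 (der_position L d))

theorem reg_x₁ : (frame P u T C κ).Reg 3 x₁ := reg_derivative (ContinuousLinearMap.fst ℝ ℝ ℝ) true
theorem reg_y₁ : (frame P u T C κ).Reg 3 y₁ := reg_derivative (ContinuousLinearMap.snd ℝ ℝ ℝ) true
theorem reg_x₂ : (frame P u T C κ).Reg 3 x₂ := reg_derivative (ContinuousLinearMap.fst ℝ ℝ ℝ) false
theorem reg_y₂ : (frame P u T C κ).Reg 3 y₂ := reg_derivative (ContinuousLinearMap.snd ℝ ℝ ℝ) false

theorem second_symm (o : MeshTime P u T C κ × ℝ × ℝ) :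
    fderiv ℝ (fderiv ℝ (o.1.s.X o.1.t)) o.2 (0, 1) (1, 0)
      = fderiv ℝ (fderiv ℝ (o.1.s.X o.1.t)) o.2 (1, 0) (0, 1) :=
  (o.1.contDiff.contDiffAt.isSymmSndFDerivAt (by simp; norm_num)) (0, 1) (1, 0)

theorem der_x₁ : (frame P u T C κ).Der false x₁ x₁₂ := fun o ho => by
  have := der_derivative (ContinuousLinearMap.fst ℝ ℝ ℝ) (1, 0) false o ho
  simp only [cond_false, second_symm] at this
  exact this
theorem der_y₁ : (frame P u T C κ).Der false y₁ y₁₂ := fun o ho => by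
  have := der_derivative (ContinuousLinearMap.snd ℝ ℝ ℝ) (1, 0) false o ho
  simp only [cond_false, second_symm] at this
  exact this
theorem der_x₂ : (frame P u T C κ).Der true x₂ x₁₂ :=
  der_derivative (ContinuousLinearMap.fst ℝ ℝ ℝ) (0, 1) true
theorem der_y₂ : (frame P u T C κ).Der true y₂ y₁₂ :=
  der_derivative (ContinuousLinearMap.snd ℝ ℝ ℝ) (0, 1) true

theorem reg_pull {φ : ℝ × ℝ × ℝ → ℝ} (hφ : ContDiff ℝ ∞ φ) : (frame P u T C κ).Reg 4 (pull φ) :=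
  Frame.Reg.comp_spaceTime hφ (reg_position (ContinuousLinearMap.fst ℝ ℝ ℝ))
    (reg_position (ContinuousLinearMap.snd ℝ ℝ ℝ)) reg_time

theorem der_pull {φ : ℝ × ℝ × ℝ → ℝ} (hφ : ContDiff ℝ ∞ φ) :
    (frame P u T C κ).Der true (pull φ) fun o => pull (dX φ) o * x₁ o + pull (dY φ) o * y₁ o := by
  intro o ho
  have := HasDerivWithinAt.comp_spaceTime (φ := φ) (z := fun _ => o.1.t)
    (hφ.differentiable (by simp) _) (der_position (ContinuousLinearMap.fst ℝ ℝ ℝ) true o ho)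
    (der_position (ContinuousLinearMap.snd ℝ ℝ ℝ) true o ho) (hasDerivWithinAt_const _ _ _)
  simp only [mul_zero, add_zero] at this
  exact this

theorem der_pull' {φ : ℝ × ℝ × ℝ → ℝ} (hφ : ContDiff ℝ ∞ φ) :
    (frame P u T C κ).Der false (pull φ) fun o => pull (dX φ) o * x₂ o + pull (dY φ) o * y₂ o := by
  intro o ho
  have := HasDerivWithinAt.comp_spaceTime (φ := φ) (z := fun _ => o.1.t)
    (hφ.differentiable (by simp) _) (der_position (ContinuousLinearMap.fst ℝ ℝ ℝ) false o ho)
    (der_position (ContinuousLinearMap.snd ℝ ℝ ℝ) false o ho) (hasDerivWithinAt_const _ _ _)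
  simp only [mul_zero, add_zero] at this
  exact this

theorem jac_ge (o : MeshTime P u T C κ × ℝ × ℝ) (ho : o ∈ (frame P u T C κ).dom) : κ ≤ jac o :=
  o.1.s.trans.jacobian_ge _ o.1.time_mem _ ho

end MeshTime

/-! ### The spatial truncation error -/

theorem Frame.Der.neg {Ω δ : Type*} {F : Frame Ω δ} {d : δ} {f f' : Ω → ℝ} (h : F.Der d f f') :
    F.Der d (fun o => -f o) fun o => -f' o := fun o ho => (h o ho).neg

theorem Frame.Der.sub {Ω δ : Type*} {F : Frame Ω δ} {d : δ} {f f' g g' : Ω → ℝ}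
    (h : F.Der d f f') (h' : F.Der d g g') : F.Der d (fun o => f o - g o) fun o => f' o - g' o :=
  fun o ho => (h o ho).sub (h' o ho)

theorem dX_sub {φ ψ : ℝ × ℝ × ℝ → ℝ} (hφ : ContDiff ℝ ∞ φ) (hψ : ContDiff ℝ ∞ ψ)
    (p : ℝ × ℝ × ℝ) : dX (fun q => φ q - ψ q) p = dX φ p - dX ψ p := by
  have h1 := hφ.differentiable (by simp) p
  have h2 := hψ.differentiable (by simp) p
  change dX (φ - ψ) p = _
  rw [dX_eq_fderiv (h1.sub h2), dX_eq_fderiv h1, dX_eq_fderiv h2, fderiv_sub h1 h2]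
  rfl

theorem dY_sub {φ ψ : ℝ × ℝ × ℝ → ℝ} (hφ : ContDiff ℝ ∞ φ) (hψ : ContDiff ℝ ∞ ψ)
    (p : ℝ × ℝ × ℝ) : dY (fun q => φ q - ψ q) p = dY φ p - dY ψ p := by
  have h1 := hφ.differentiable (by simp) p
  have h2 := hψ.differentiable (by simp) p
  change dY (φ - ψ) p = _
  rw [dY_eq_fderiv (h1.sub h2), dY_eq_fderiv h1, dY_eq_fderiv h2, fderiv_sub h1 h2]
  rfl

namespace MeshTime

variable {P : IBVP} {u : ℝ × ℝ × ℝ → ℝ} {T C κ : ℝ}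

/-- The first component of a flux in the computational coordinates. -/
noncomputable def flux₁ (f g : MeshTime P u T C κ × ℝ × ℝ → ℝ) (o : MeshTime P u T C κ × ℝ × ℝ) :
    ℝ := y₂ o * f o + -x₂ o * g o

/-- The second component of a flux in the computational coordinates. -/
noncomputable def flux₂ (f g : MeshTime P u T C κ × ℝ × ℝ → ℝ) (o : MeshTime P u T C κ × ℝ × ℝ) :
    ℝ := -y₁ o * f o + x₁ o * g o

theorem reg_flux₁ {f g : MeshTime P u T C κ × ℝ × ℝ → ℝ} (hf : (frame P u T C κ).Reg 3 f)
    (hg : (frame P u T C κ).Reg 3 g) : (frame P u T C κ).Reg 3 (flux₁ f g) :=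
  (reg_y₂.mul hf).add (reg_x₂.neg.mul hg)

theorem reg_flux₂ {f g : MeshTime P u T C κ × ℝ × ℝ → ℝ} (hf : (frame P u T C κ).Reg 3 f)
    (hg : (frame P u T C κ).Reg 3 g) : (frame P u T C κ).Reg 3 (flux₂ f g) :=
  (reg_y₁.neg.mul hf).add (reg_x₁.mul hg)

/-- The Piola identity. -/
theorem divergence_flux {φ ψ : ℝ × ℝ × ℝ → ℝ} (hφ : ContDiff ℝ ∞ φ) (hψ : ContDiff ℝ ∞ ψ)
    {g₁ g₂ : MeshTime P u T C κ × ℝ × ℝ → ℝ}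
    (h₁ : (frame P u T C κ).Der true (flux₁ (pull φ) (pull ψ)) g₁)
    (h₂ : (frame P u T C κ).Der false (flux₂ (pull φ) (pull ψ)) g₂)
    {o : MeshTime P u T C κ × ℝ × ℝ} (ho : o ∈ (frame P u T C κ).dom) :
    g₁ o + g₂ o = jac o * (pull (dX φ) o + pull (dY ψ) o) := by
  have e1 := squareFrame_der_unique h₁
    ((der_y₂.mul (der_pull hφ)).add (der_x₂.neg.mul (der_pull hψ))) ho
  have e2 := squareFrame_der_unique h₂
    ((der_y₁.neg.mul (der_pull' hφ)).add (der_x₁.mul (der_pull' hψ))) ho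
  rw [e1, e2, jac]
  ring

/-- The first component of the convective flux relative to the moving mesh. -/
noncomputable def conv₁ : MeshTime P u T C κ × ℝ × ℝ → ℝ := fun o =>
  pull u o * flux₁ (fun o => pull P.b₁ o - v₁ o) (fun o => pull P.b₂ o - v₂ o) o
/-- The second component of the convective flux relative to the moving mesh. -/
noncomputable def conv₂ : MeshTime P u T C κ × ℝ × ℝ → ℝ := fun o =>
  pull u o * flux₂ (fun o => pull P.b₁ o - v₁ o) (fun o => pull P.b₂ o - v₂ o) o
/-- The first component of the diffusive flux. -/
noncomputable def diff₁ : MeshTime P u T C κ × ℝ × ℝ → ℝ :=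
  flux₁ (fun o => pull P.a o * pull (dX u) o) (fun o => pull P.a o * pull (dY u) o)
/-- The second component of the diffusive flux. -/
noncomputable def diff₂ : MeshTime P u T C κ × ℝ × ℝ → ℝ :=
  flux₂ (fun o => pull P.a o * pull (dX u) o) (fun o => pull P.a o * pull (dY u) o)

/-- The material derivative of `u` along the mesh. -/
noncomputable def rate (o : MeshTime P u T C κ × ℝ × ℝ) : ℝ :=
  pull (dT u) o + pull (dX u) o * v₁ o + pull (dY u) o * v₂ o

section

variable (hP : P.IsSmooth) (hu : ContDiff ℝ ∞ u)
include hP hu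

/-- The differential equation in divergence form, at a point of the computational domain. -/
theorem pde {i : MeshTime P u T C κ} {z : ℝ × ℝ} (hz : z ∈ Ioo (0 : ℝ) 1 ×ˢ Ioo (0 : ℝ) 1) :
    pull (dT u) (i, z) + pull (dX fun q => u q * P.b₁ q - P.a q * dX u q) (i, z)
      + pull (dY fun q => u q * P.b₂ q - P.a q * dY u q) (i, z) + pull P.c (i, z) * pull u (i, z)
      = pull P.f (i, z) := by
  have h := i.s.sol.pde i.t (i.s.Ioo_subset_Ioc i.ht) (i.s.X i.t z) ⟨z, hz, rfl⟩
  have e1 := dX_sub (hu.mul hP.b₁) (hP.a.mul hu.dX) ((i.s.X i.t z).1, (i.s.X i.t z).2, i.t)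
  have e2 := dY_sub (hu.mul hP.b₂) (hP.a.mul hu.dY) ((i.s.X i.t z).1, (i.s.X i.t z).2, i.t)
  simp only [pull]
  rw [e1, e2]
  linarith

/-- The conservation law in the moving computational coordinates. The total flux is the sum of
the convective flux relative to the mesh, of the diffusive flux, and of the flux that is caused by
the motion of the mesh. -/
theorem balance {g₁ g₂ k₁ k₂ l₁ l₂ : MeshTime P u T C κ × ℝ × ℝ → ℝ}
    (hg₁ : (frame P u T C κ).Der true conv₁ g₁) (hg₂ : (frame P u T C κ).Der false conv₂ g₂)
    (hk₁ : (frame P u T C κ).Der true diff₁ k₁) (hk₂ : (frame P u T C κ).Der false diff₂ k₂)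
    (hl₁ : (frame P u T C κ).Der true (flux₁ v₁ v₂) l₁)
    (hl₂ : (frame P u T C κ).Der false (flux₂ v₁ v₂) l₂)
    {i : MeshTime P u T C κ} {z : ℝ × ℝ} (hz : z ∈ Ioo (0 : ℝ) 1 ×ˢ Ioo (0 : ℝ) 1) :
    jac (i, z) * (rate (i, z) + pull P.c (i, z) * pull u (i, z) - pull P.f (i, z))
      + pull u (i, z) * (l₁ (i, z) + l₂ (i, z)) + (g₁ (i, z) + g₂ (i, z))
      - (k₁ (i, z) + k₂ (i, z)) = 0 := by
  have hz' : (i, z) ∈ (frame P u T C κ).dom := ⟨Ioo_subset_Icc_self hz.1, Ioo_subset_Icc_self hz.2⟩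
  have h1 : (frame P u T C κ).Der true
      (flux₁ (pull fun q => u q * P.b₁ q - P.a q * dX u q)
        (pull fun q => u q * P.b₂ q - P.a q * dY u q)) _ :=
    ((hg₁.add ((der_pull hu).mul hl₁)).sub hk₁).congr fun o _ => by
      simp only [conv₁, diff₁, flux₁, pull]
      ring
  have h2 : (frame P u T C κ).Der false
      (flux₂ (pull fun q => u q * P.b₁ q - P.a q * dX u q)
        (pull fun q => u q * P.b₂ q - P.a q * dY u q)) _ :=
    ((hg₂.add ((der_pull' hu).mul hl₂)).sub hk₂).congr fun o _ => by
      simp only [conv₂, diff₂, flux₂, pull]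
      ring
  have h3 := divergence_flux ((hu.mul hP.b₁).sub (hP.a.mul hu.dX))
    ((hu.mul hP.b₂).sub (hP.a.mul hu.dY)) h1 h2 hz'
  have h4 := pde hP hu (i := i) hz
  simp only [flux₁, flux₂] at h3
  have h5 : pull P.f (i, z) = pull (dT u) (i, z)
      + pull (dX fun q => u q * P.b₁ q - P.a q * dX u q) (i, z)
      + pull (dY fun q => u q * P.b₂ q - P.a q * dY u q) (i, z) + pull P.c (i, z) * pull u (i, z) :=
    h4.symm
  rw [h5, rate]
  simp only [jac] at h3 ⊢
  linear_combination h3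

end

/-! ### Consistency of the numerical fluxes -/

theorem hJ (i : MeshTime P u T C κ) : 0 < i.J := i.s.hJ
theorem hK (i : MeshTime P u T C κ) : 0 < i.K := i.s.hK

theorem inv_J_pos (i : MeshTime P u T C κ) : 0 < 1 / (i.J : ℝ) :=
  one_div_pos.2 (by exact_mod_cast i.hJ)
theorem inv_K_pos (i : MeshTime P u T C κ) : 0 < 1 / (i.K : ℝ) :=
  one_div_pos.2 (by exact_mod_cast i.hK)

/-- The points `(j - 1/2, k)`. -/
noncomputable abbrev xi (P : IBVP) (u : ℝ × ℝ × ℝ → ℝ) (T C κ : ℝ) : Grid (MeshTime P u T C κ) :=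
  xiGrid hJ hK
/-- The points `(j, k - 1/2)`. -/
noncomputable abbrev eta (P : IBVP) (u : ℝ × ℝ × ℝ → ℝ) (T C κ : ℝ) : Grid (MeshTime P u T C κ) :=
  etaGrid hJ hK
/-- The points `(j - 1/2, k - 1/2)`. -/
noncomputable abbrev cell (P : IBVP) (u : ℝ × ℝ × ℝ → ℝ) (T C κ : ℝ) : Grid (MeshTime P u T C κ) :=
  cellGrid hJ hK

/-- The nodal values of `u`. -/
noncomputable def nodalValue (i : MeshTime P u T C κ) (j k : ℤ) : ℝ :=
  pull u (i, (j : ℝ) / i.J, (k : ℝ) / i.K)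

theorem approx_jXix : (xi P u T C κ).Approx
    (fun γ => γ.1.s.S.jXix γ.2.1 γ.2.2 γ.1.t / (1 / γ.1.K)) fun γ => y₂ ((xi P u T C κ).point γ) :=
  approx_of_consistentXi (q := fun i j k => i.s.S.jXix j k i.t) inv_K_pos (reg_y₂.mono (by norm_num))
    fun i => i.s.consistent.jXix _ i.s.hn _ i.ht

theorem approx_jXiy : (xi P u T C κ).Approx
    (fun γ => γ.1.s.S.jXiy γ.2.1 γ.2.2 γ.1.t / (1 / γ.1.K)) fun γ => -x₂ ((xi P u T C κ).point γ) :=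
  approx_of_consistentXi (Q := fun o => -x₂ o) (q := fun i j k => i.s.S.jXiy j k i.t) inv_K_pos
    (reg_x₂.neg.mono (by norm_num)) fun i => i.s.consistent.jXiy _ i.s.hn _ i.ht

theorem approx_jEtax : (eta P u T C κ).Approx
    (fun γ => γ.1.s.S.jEtax γ.2.1 γ.2.2 γ.1.t / (1 / γ.1.J)) fun γ => -y₁ ((eta P u T C κ).point γ) :=
  approx_of_consistentEta (Q := fun o => -y₁ o) (q := fun i j k => i.s.S.jEtax j k i.t) inv_J_pos
    (reg_y₁.neg.mono (by norm_num)) fun i => i.s.consistent.jEtax _ i.s.hn _ i.ht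

theorem approx_jEtay : (eta P u T C κ).Approx
    (fun γ => γ.1.s.S.jEtay γ.2.1 γ.2.2 γ.1.t / (1 / γ.1.J)) fun γ => x₁ ((eta P u T C κ).point γ) :=
  approx_of_consistentEta (q := fun i j k => i.s.S.jEtay j k i.t) inv_J_pos
    (reg_x₁.mono (by norm_num)) fun i => i.s.consistent.jEtay _ i.s.hn _ i.ht

theorem approx_xdotXi : (xi P u T C κ).Approx
    (fun γ => γ.1.s.S.xdotXi γ.2.1 γ.2.2 γ.1.t / 1) fun γ => v₁ ((xi P u T C κ).point γ) :=
  approx_of_consistentXi (q := fun i j k => i.s.S.xdotXi j k i.t) (s := fun _ => 1)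
    (fun _ => one_pos) (reg_v₁.mono (by norm_num))
    fun i => i.s.consistent.xdotXi _ i.s.hn _ i.ht

theorem approx_ydotXi : (xi P u T C κ).Approx
    (fun γ => γ.1.s.S.ydotXi γ.2.1 γ.2.2 γ.1.t / 1) fun γ => v₂ ((xi P u T C κ).point γ) :=
  approx_of_consistentXi (q := fun i j k => i.s.S.ydotXi j k i.t) (s := fun _ => 1)
    (fun _ => one_pos) (reg_v₂.mono (by norm_num))
    fun i => i.s.consistent.ydotXi _ i.s.hn _ i.ht

theorem approx_xdotEta : (eta P u T C κ).Approx
    (fun γ => γ.1.s.S.xdotEta γ.2.1 γ.2.2 γ.1.t / 1) fun γ => v₁ ((eta P u T C κ).point γ) :=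
  approx_of_consistentEta (q := fun i j k => i.s.S.xdotEta j k i.t) (s := fun _ => 1)
    (fun _ => one_pos) (reg_v₁.mono (by norm_num))
    fun i => i.s.consistent.xdotEta _ i.s.hn _ i.ht

theorem approx_ydotEta : (eta P u T C κ).Approx
    (fun γ => γ.1.s.S.ydotEta γ.2.1 γ.2.2 γ.1.t / 1) fun γ => v₂ ((eta P u T C κ).point γ) :=
  approx_of_consistentEta (q := fun i j k => i.s.S.ydotEta j k i.t) (s := fun _ => 1)
    (fun _ => one_pos) (reg_v₂.mono (by norm_num))
    fun i => i.s.consistent.ydotEta _ i.s.hn _ i.ht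

theorem approx_meshFlux_xi : (xi P u T C κ).Approx
    (fun γ => (γ.1.s.S.jXix γ.2.1 γ.2.2 γ.1.t * γ.1.s.S.xdotXi γ.2.1 γ.2.2 γ.1.t
      + γ.1.s.S.jXiy γ.2.1 γ.2.2 γ.1.t * γ.1.s.S.ydotXi γ.2.1 γ.2.2 γ.1.t) / (1 / γ.1.K))
    fun γ => flux₁ v₁ v₂ ((xi P u T C κ).point γ) :=
  ((approx_jXix.mul approx_xdotXi).add (approx_jXiy.mul approx_ydotXi)).congr
    (fun γ _ => by ring) fun _ _ => rfl

theorem approx_meshFlux_eta : (eta P u T C κ).Approx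
    (fun γ => (γ.1.s.S.jEtax γ.2.1 γ.2.2 γ.1.t * γ.1.s.S.xdotEta γ.2.1 γ.2.2 γ.1.t
      + γ.1.s.S.jEtay γ.2.1 γ.2.2 γ.1.t * γ.1.s.S.ydotEta γ.2.1 γ.2.2 γ.1.t) / (1 / γ.1.J))
    fun γ => flux₂ v₁ v₂ ((eta P u T C κ).point γ) :=
  ((approx_jEtax.mul approx_xdotEta).add (approx_jEtay.mul approx_ydotEta)).congr
    (fun γ _ => by ring) fun _ _ => rfl

section

variable (hP : P.IsSmooth) (hu : ContDiff ℝ ∞ u)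
include hP hu

theorem approx_q₁ : (xi P u T C κ).Approx
    (fun γ => γ.1.s.S.q₁ (nodalValue γ.1) γ.2.1 γ.2.2 γ.1.t / (1 / γ.1.K))
    fun γ => conv₁ ((xi P u T C κ).point γ) := by
  have h1 := approx_of_consistentXi (hJ := hJ) (hK := hK) (q := fun i j k => i.s.S.b₁Xi j k i.t)
    (s := fun _ => 1) (fun _ => one_pos)
    ((reg_pull (P := P) (u := u) (T := T) (C := C) (κ := κ) hP.b₁).mono (by norm_num))
    fun i => i.s.consistent.b₁Xi _ i.s.hn _ i.ht
  have h2 := approx_of_consistentXi (hJ := hJ) (hK := hK) (q := fun i j k => i.s.S.b₂Xi j k i.t)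
    (s := fun _ => 1) (fun _ => one_pos)
    ((reg_pull (P := P) (u := u) (T := T) (C := C) (κ := κ) hP.b₂).mono (by norm_num))
    fun i => i.s.consistent.b₂Xi _ i.s.hn _ i.ht
  have h3 := approx_average_xi (hJ := hJ) (hK := hK)
    ((reg_pull (P := P) (u := u) (T := T) (C := C) (κ := κ) hu).mono (by norm_num))
  exact (h3.mul ((approx_jXix.mul (h1.sub approx_xdotXi)).add
    (approx_jXiy.mul (h2.sub approx_ydotXi)))).congr
    (fun γ _ => by simp only [Scheme.q₁, nodalValue]; ring) fun _ _ => rfl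

theorem approx_q₂ : (eta P u T C κ).Approx
    (fun γ => γ.1.s.S.q₂ (nodalValue γ.1) γ.2.1 γ.2.2 γ.1.t / (1 / γ.1.J))
    fun γ => conv₂ ((eta P u T C κ).point γ) := by
  have h1 := approx_of_consistentEta (hJ := hJ) (hK := hK) (q := fun i j k => i.s.S.b₁Eta j k i.t)
    (s := fun _ => 1) (fun _ => one_pos)
    ((reg_pull (P := P) (u := u) (T := T) (C := C) (κ := κ) hP.b₁).mono (by norm_num))
    fun i => i.s.consistent.b₁Eta _ i.s.hn _ i.ht
  have h2 := approx_of_consistentEta (hJ := hJ) (hK := hK) (q := fun i j k => i.s.S.b₂Eta j k i.t)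
    (s := fun _ => 1) (fun _ => one_pos)
    ((reg_pull (P := P) (u := u) (T := T) (C := C) (κ := κ) hP.b₂).mono (by norm_num))
    fun i => i.s.consistent.b₂Eta _ i.s.hn _ i.ht
  have h3 := approx_average_eta (hJ := hJ) (hK := hK)
    ((reg_pull (P := P) (u := u) (T := T) (C := C) (κ := κ) hu).mono (by norm_num))
  exact (h3.mul ((approx_jEtax.mul (h1.sub approx_xdotEta)).add
    (approx_jEtay.mul (h2.sub approx_ydotEta)))).congr
    (fun γ _ => by simp only [Scheme.q₂, nodalValue]; ring) fun _ _ => rfl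

end

theorem scheme_x_eq (i : MeshTime P u T C κ) {j k : ℤ} (hj : 0 ≤ j) (hj' : j ≤ i.J) (hk : 0 ≤ k)
    (hk' : k ≤ i.K) : i.s.S.x j k i.t = (i.s.X i.t ((j : ℝ) / i.J, (k : ℝ) / i.K)).1 :=
  congrArg Prod.fst (i.s.nodes_eq (Ioo_subset_Icc_self i.ht) hj hj' hk hk')

theorem scheme_y_eq (i : MeshTime P u T C κ) {j k : ℤ} (hj : 0 ≤ j) (hj' : j ≤ i.J) (hk : 0 ≤ k)
    (hk' : k ≤ i.K) : i.s.S.y j k i.t = (i.s.X i.t ((j : ℝ) / i.J, (k : ℝ) / i.K)).2 :=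
  congrArg Prod.snd (i.s.nodes_eq (Ioo_subset_Icc_self i.ht) hj hj' hk hk')

theorem approx_cXix : (cell P u T C κ).Approx
    (fun γ => γ.1.s.S.cXix γ.2.1 γ.2.2 γ.1.t * γ.1.K) fun γ => y₂ ((cell P u T C κ).point γ) := by
  refine (approx_difference_cell' (hJ := hJ) (hK := hK)
    (der_position (ContinuousLinearMap.snd ℝ ℝ ℝ) false) reg_y₂).congr ?_ fun _ _ => rfl
  rintro ⟨i, j, k⟩ ⟨h1, h2, h3, h4⟩
  dsimp only at h1 h2 h3 h4
  simp only [Scheme.cXix, ContinuousLinearMap.coe_snd']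
  rw [i.scheme_y_eq h1.le h2 h3.le h4, i.scheme_y_eq (by omega : 0 ≤ j - 1) (by omega) h3.le h4,
    i.scheme_y_eq h1.le h2 (by omega : 0 ≤ k - 1) (by omega),
    i.scheme_y_eq (by omega : 0 ≤ j - 1) (by omega) (by omega : 0 ≤ k - 1) (by omega)]

theorem approx_cXiy : (cell P u T C κ).Approx
    (fun γ => γ.1.s.S.cXiy γ.2.1 γ.2.2 γ.1.t * γ.1.K) fun γ => -x₂ ((cell P u T C κ).point γ) := by
  refine (approx_difference_cell' (hJ := hJ) (hK := hK)
    (der_position (ContinuousLinearMap.fst ℝ ℝ ℝ) false) reg_x₂).neg.congr ?_ fun _ _ => rfl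
  rintro ⟨i, j, k⟩ ⟨h1, h2, h3, h4⟩
  dsimp only at h1 h2 h3 h4
  simp only [Scheme.cXiy, ContinuousLinearMap.coe_fst', neg_mul]
  rw [i.scheme_x_eq h1.le h2 h3.le h4, i.scheme_x_eq (by omega : 0 ≤ j - 1) (by omega) h3.le h4,
    i.scheme_x_eq h1.le h2 (by omega : 0 ≤ k - 1) (by omega),
    i.scheme_x_eq (by omega : 0 ≤ j - 1) (by omega) (by omega : 0 ≤ k - 1) (by omega)]

theorem approx_cEtax : (cell P u T C κ).Approx
    (fun γ => γ.1.s.S.cEtax γ.2.1 γ.2.2 γ.1.t * γ.1.J) fun γ => -y₁ ((cell P u T C κ).point γ) := by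
  refine (approx_difference_cell (hJ := hJ) (hK := hK)
    (der_position (ContinuousLinearMap.snd ℝ ℝ ℝ) true) reg_y₁).neg.congr ?_ fun _ _ => rfl
  rintro ⟨i, j, k⟩ ⟨h1, h2, h3, h4⟩
  dsimp only at h1 h2 h3 h4
  simp only [Scheme.cEtax, ContinuousLinearMap.coe_snd', neg_mul]
  rw [i.scheme_y_eq h1.le h2 h3.le h4, i.scheme_y_eq (by omega : 0 ≤ j - 1) (by omega) h3.le h4,
    i.scheme_y_eq h1.le h2 (by omega : 0 ≤ k - 1) (by omega),
    i.scheme_y_eq (by omega : 0 ≤ j - 1) (by omega) (by omega : 0 ≤ k - 1) (by omega)]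

theorem approx_cEtay : (cell P u T C κ).Approx
    (fun γ => γ.1.s.S.cEtay γ.2.1 γ.2.2 γ.1.t * γ.1.J) fun γ => x₁ ((cell P u T C κ).point γ) := by
  refine (approx_difference_cell (hJ := hJ) (hK := hK)
    (der_position (ContinuousLinearMap.fst ℝ ℝ ℝ) true) reg_x₁).congr ?_ fun _ _ => rfl
  rintro ⟨i, j, k⟩ ⟨h1, h2, h3, h4⟩
  dsimp only at h1 h2 h3 h4
  simp only [Scheme.cEtay, ContinuousLinearMap.coe_fst']
  rw [i.scheme_x_eq h1.le h2 h3.le h4, i.scheme_x_eq (by omega : 0 ≤ j - 1) (by omega) h3.le h4,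
    i.scheme_x_eq h1.le h2 (by omega : 0 ≤ k - 1) (by omega),
    i.scheme_x_eq (by omega : 0 ≤ j - 1) (by omega) (by omega : 0 ≤ k - 1) (by omega)]

theorem approx_cJac_inv (hκ : 0 < κ) : (cell P u T C κ).Approx
    (fun γ => (γ.1.s.S.cJac γ.2.1 γ.2.2 γ.1.t * (γ.1.J * γ.1.K))⁻¹)
    fun γ => (jac ((cell P u T C κ).point γ))⁻¹ := by
  have h : (cell P u T C κ).Approx
      (fun γ => γ.1.s.S.cJac γ.2.1 γ.2.2 γ.1.t * (γ.1.J * γ.1.K))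
      fun γ => jac ((cell P u T C κ).point γ) :=
    ((approx_cXix.mul approx_cEtay).sub (approx_cXiy.mul approx_cEtax)).congr
      (fun γ _ => by simp only [Scheme.cJac]; ring) fun γ _ => by simp only [jac]; ring
  refine h.inv hκ (fun γ hγ => ?_) fun γ hγ => jac_ge _ ((cell P u T C κ).point_mem γ hγ)
  have h0 := γ.1.s.uniform.cJac_ge γ.1.t γ.1.time_mem _ _ hγ.1 hγ.2.1 hγ.2.2.1 hγ.2.2.2
  have hJ0 : (0 : ℝ) < γ.1.J := by exact_mod_cast γ.1.hJ
  have hK0 : (0 : ℝ) < γ.1.K := by exact_mod_cast γ.1.hK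
  calc κ = κ * (1 / γ.1.J * (1 / γ.1.K)) * (γ.1.J * γ.1.K) := by field_simp
    _ ≤ _ := mul_le_mul_of_nonneg_right h0 (by positivity)

/-- The transformed diffusion matrix applied to the computational gradient is the diffusive flux. -/
theorem diff₁_eq {o : MeshTime P u T C κ × ℝ × ℝ} (ho : jac o ≠ 0) :
    pull P.a o * (jac o)⁻¹ * ((y₂ o * y₂ o + -x₂ o * -x₂ o)
        * (pull (dX u) o * x₁ o + pull (dY u) o * y₁ o))
      + pull P.a o * (jac o)⁻¹ * ((y₂ o * -y₁ o + -x₂ o * x₁ o)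
        * (pull (dX u) o * x₂ o + pull (dY u) o * y₂ o)) = diff₁ o := by
  have h := mul_inv_cancel₀ ho
  simp only [jac, diff₁, flux₁] at h ⊢
  linear_combination (pull P.a o * (y₂ o * pull (dX u) o - x₂ o * pull (dY u) o)) * h

theorem diff₂_eq {o : MeshTime P u T C κ × ℝ × ℝ} (ho : jac o ≠ 0) :
    pull P.a o * (jac o)⁻¹ * ((y₂ o * -y₁ o + -x₂ o * x₁ o)
        * (pull (dX u) o * x₁ o + pull (dY u) o * y₁ o))
      + pull P.a o * (jac o)⁻¹ * ((-y₁ o * -y₁ o + x₁ o * x₁ o)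
        * (pull (dX u) o * x₂ o + pull (dY u) o * y₂ o)) = diff₂ o := by
  have h := mul_inv_cancel₀ ho
  simp only [jac, diff₂, flux₂] at h ⊢
  linear_combination (pull P.a o * (-y₁ o * pull (dX u) o + x₁ o * pull (dY u) o)) * h

section

variable (hP : P.IsSmooth) (hu : ContDiff ℝ ∞ u)
include hu

theorem approx_differences : (cell P u T C κ).Approx
      (fun γ => (nodalValue γ.1 γ.2.1 γ.2.2 - nodalValue γ.1 (γ.2.1 - 1) γ.2.2
        + nodalValue γ.1 γ.2.1 (γ.2.2 - 1) - nodalValue γ.1 (γ.2.1 - 1) (γ.2.2 - 1)) / 2 * γ.1.J)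
      (fun γ => pull (dX u) ((cell P u T C κ).point γ) * x₁ ((cell P u T C κ).point γ)
        + pull (dY u) ((cell P u T C κ).point γ) * y₁ ((cell P u T C κ).point γ)) ∧
    (cell P u T C κ).Approx
      (fun γ => (nodalValue γ.1 γ.2.1 γ.2.2 - nodalValue γ.1 γ.2.1 (γ.2.2 - 1)
        + nodalValue γ.1 (γ.2.1 - 1) γ.2.2 - nodalValue γ.1 (γ.2.1 - 1) (γ.2.2 - 1)) / 2 * γ.1.K)
      (fun γ => pull (dX u) ((cell P u T C κ).point γ) * x₂ ((cell P u T C κ).point γ)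
        + pull (dY u) ((cell P u T C κ).point γ) * y₂ ((cell P u T C κ).point γ)) := by
  have h1 := (reg_pull (P := P) (u := u) (T := T) (C := C) (κ := κ) hu.dX).pred
  have h2 := (reg_pull (P := P) (u := u) (T := T) (C := C) (κ := κ) hu.dY).pred
  exact ⟨approx_difference_cell (hJ := hJ) (hK := hK) (der_pull hu)
      ((h1.mul reg_x₁).add (h2.mul reg_y₁)),
    approx_difference_cell' (hJ := hJ) (hK := hK) (der_pull' hu)
      ((h1.mul reg_x₂).add (h2.mul reg_y₂))⟩

include hP

theorem approx_p₁ (hκ : 0 < κ) : (cell P u T C κ).Approx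
    (fun γ => γ.1.s.S.p₁ (nodalValue γ.1) γ.2.1 γ.2.2 γ.1.t * γ.1.K)
    fun γ => diff₁ ((cell P u T C κ).point γ) := by
  have ha := approx_of_consistentCell (hJ := hJ) (hK := hK) (q := fun i j k => i.s.S.a j k i.t)
    ((reg_pull (P := P) (u := u) (T := T) (C := C) (κ := κ) hP.a).mono (by norm_num))
    fun i => i.s.consistent.a _ i.s.hn _ i.ht
  obtain ⟨d1, d2⟩ := approx_differences (P := P) (T := T) (C := C) (κ := κ) hu
  have hm := ha.mul (approx_cJac_inv hκ)
  refine ((hm.mul (((approx_cXix.mul approx_cXix).add (approx_cXiy.mul approx_cXiy)).mul d1)).add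
    (hm.mul (((approx_cXix.mul approx_cEtax).add (approx_cXiy.mul approx_cEtay)).mul d2))).congr
    (fun γ hγ => ?_) fun γ hγ => ?_
  · have hJ0 : (γ.1.J : ℝ) ≠ 0 := by exact_mod_cast γ.1.hJ.ne'
    have hK0 : (γ.1.K : ℝ) ≠ 0 := by exact_mod_cast γ.1.hK.ne'
    have hc : γ.1.s.S.cJac γ.2.1 γ.2.2 γ.1.t ≠ 0 :=
      (γ.1.s.nondegenerate.cJac_pos _ γ.1.time_mem _ _ hγ.1 hγ.2.1 hγ.2.2.1 hγ.2.2.2).ne'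
    simp only [Scheme.p₁]
    field_simp
  · have h0 := (hκ.trans_le (jac_ge _ ((cell P u T C κ).point_mem γ hγ))).ne'
    exact diff₁_eq h0

theorem approx_p₂ (hκ : 0 < κ) : (cell P u T C κ).Approx
    (fun γ => γ.1.s.S.p₂ (nodalValue γ.1) γ.2.1 γ.2.2 γ.1.t * γ.1.J)
    fun γ => diff₂ ((cell P u T C κ).point γ) := by
  have ha := approx_of_consistentCell (hJ := hJ) (hK := hK) (q := fun i j k => i.s.S.a j k i.t)
    ((reg_pull (P := P) (u := u) (T := T) (C := C) (κ := κ) hP.a).mono (by norm_num))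
    fun i => i.s.consistent.a _ i.s.hn _ i.ht
  obtain ⟨d1, d2⟩ := approx_differences (P := P) (T := T) (C := C) (κ := κ) hu
  have hm := ha.mul (approx_cJac_inv hκ)
  refine ((hm.mul (((approx_cXix.mul approx_cEtax).add (approx_cXiy.mul approx_cEtay)).mul d1)).add
    (hm.mul (((approx_cEtax.mul approx_cEtax).add (approx_cEtay.mul approx_cEtay)).mul d2))).congr
    (fun γ hγ => ?_) fun γ hγ => ?_
  · have hJ0 : (γ.1.J : ℝ) ≠ 0 := by exact_mod_cast γ.1.hJ.ne'
    have hK0 : (γ.1.K : ℝ) ≠ 0 := by exact_mod_cast γ.1.hK.ne'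
    have hc : γ.1.s.S.cJac γ.2.1 γ.2.2 γ.1.t ≠ 0 :=
      (γ.1.s.nondegenerate.cJac_pos _ γ.1.time_mem _ _ hγ.1 hγ.2.1 hγ.2.2.1 hγ.2.2.2).ne'
    simp only [Scheme.p₂]
    field_simp
  · have h0 := (hκ.trans_le (jac_ge _ ((cell P u T C κ).point_mem γ hγ))).ne'
    exact diff₂_eq h0

end

end MeshTime

namespace MeshTime

variable {P : IBVP} {u : ℝ × ℝ × ℝ → ℝ} {T C κ : ℝ}

theorem node_mem_Ioo (i : MeshTime P u T C κ) {j k : ℤ} (hj : 0 < j) (hj' : j < i.J) (hk : 0 < k)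
    (hk' : k < i.K) : ((j : ℝ) / i.J, (k : ℝ) / i.K) ∈ Ioo (0 : ℝ) 1 ×ˢ Ioo (0 : ℝ) 1 :=
  (MeshStep.node_mem_interior_iff i.hJ i.hK).2 ⟨hj, hj', hk, hk'⟩

/-- The exact solution satisfies the semi-discrete system up to a second-order error. -/
theorem exists_truncation (hP : P.IsSmooth) (hu : ContDiff ℝ ∞ u) (hκ : 0 < κ) :
    ∃ D, 0 ≤ D ∧ ∀ (i : MeshTime P u T C κ) (j k : ℤ), 0 < j → j < i.J → 0 < k → k < i.K →
      |i.s.S.jac j k i.t * rate (i, (j : ℝ) / i.J, (k : ℝ) / i.K)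
          - i.s.S.op i.nodalValue j k i.t
          - i.s.S.jac j k i.t * pull P.f (i, (j : ℝ) / i.J, (k : ℝ) / i.K)|
        ≤ D * meshSq i.J i.K * (1 / i.J * (1 / i.K)) := by
  have rd := fun (φ : ℝ × ℝ × ℝ → ℝ) (h : ContDiff ℝ ∞ φ) =>
    (reg_pull (P := P) (u := u) (T := T) (C := C) (κ := κ) h).pred
  have rv₁ := (reg_v₁ (P := P) (u := u) (T := T) (C := C) (κ := κ)).pred
  have rv₂ := (reg_v₂ (P := P) (u := u) (T := T) (C := C) (κ := κ)).pred
  have ru := rd u hu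
  have rb₁ := (rd _ hP.b₁).sub rv₁
  have rb₂ := (rd _ hP.b₂).sub rv₂
  have ra₁ := (rd _ hP.a).mul (rd _ hu.dX)
  have ra₂ := (rd _ hP.a).mul (rd _ hu.dY)
  obtain ⟨g₁, dg₁, rg₁⟩ := (ru.mul (reg_flux₁ rb₁ rb₂)).2 true
  obtain ⟨g₂, dg₂, rg₂⟩ := (ru.mul (reg_flux₂ rb₁ rb₂)).2 false
  obtain ⟨k₁, dk₁, rk₁⟩ := (reg_flux₁ ra₁ ra₂).2 true
  obtain ⟨k₂, dk₂, rk₂⟩ := (reg_flux₂ ra₁ ra₂).2 false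
  obtain ⟨l₁, dl₁, rl₁⟩ := (reg_flux₁ rv₁ rv₂).2 true
  obtain ⟨l₂, dl₂, rl₂⟩ := (reg_flux₂ rv₁ rv₂).2 false
  obtain ⟨G₁, hG₁0, hG₁⟩ := (approx_q₁ (T := T) (C := C) (κ := κ) hP hu).exists_flux_xi dg₁ rg₁
  obtain ⟨G₂, hG₂0, hG₂⟩ := (approx_q₂ (T := T) (C := C) (κ := κ) hP hu).exists_flux_eta dg₂ rg₂
  obtain ⟨K₁, hK₁0, hK₁⟩ := (approx_p₁ (T := T) (C := C) hP hu hκ).exists_flux_cell dk₁ rk₁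
  obtain ⟨K₂, hK₂0, hK₂⟩ := (approx_p₂ (T := T) (C := C) hP hu hκ).exists_flux_cell' dk₂ rk₂
  obtain ⟨L₁, hL₁0, hL₁⟩ := approx_meshFlux_xi.exists_flux_xi dl₁ rl₁
  obtain ⟨L₂, hL₂0, hL₂⟩ := approx_meshFlux_eta.exists_flux_eta dl₂ rl₂
  obtain ⟨A, hA0, hA⟩ := ru.bdd.nonneg
  have rr : (frame P u T C κ).Reg 3 fun o =>
      rate o + pull P.c o * pull u o - pull P.f o :=
    ((((rd _ hu.dT).add ((rd _ hu.dX).mul rv₁)).add ((rd _ hu.dY).mul rv₂)).add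
      ((rd _ hP.c).mul ru)).sub (rd _ hP.f)
  obtain ⟨B, hB0, hB⟩ := rr.bdd.nonneg
  refine ⟨|C| * B + A * (L₁ + L₂) + (G₁ + G₂) + (K₁ + K₂), by positivity,
    fun i j k h1 h2 h3 h4 => ?_⟩
  have hJ0 : (0 : ℝ) < i.J := by exact_mod_cast i.hJ
  have hK0 : (0 : ℝ) < i.K := by exact_mod_cast i.hK
  have hμ := meshSq_nonneg i.J i.K
  set z : ℝ × ℝ := ((j : ℝ) / i.J, (k : ℝ) / i.K) with hz
  have hzI := i.node_mem_Ioo h1 h2 h3 h4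
  have hzd : (i, z) ∈ (frame P u T C κ).dom :=
    ⟨Ioo_subset_Icc_self hzI.1, Ioo_subset_Icc_self hzI.2⟩
  have bal := balance hP hu dg₁ dg₂ dk₁ dk₂ dl₁ dl₂ (i := i) hzI
  rw [← hz] at bal
  have eg₁ := hG₁ i j k h1 h2 h3 h4
  have eg₂ := hG₂ i j k h1 h2 h3 h4
  have ek₁ := hK₁ i j k h1 h2 h3 h4
  have ek₂ := hK₂ i j k h1 h2 h3 h4
  have el₁ := hL₁ i j k h1 h2 h3 h4
  have el₂ := hL₂ i j k h1 h2 h3 h4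
  have eA := hA _ hzd
  have eB := hB _ hzd
  have ej : |i.s.S.jac j k i.t * (i.J * i.K) - jac (i, z)| ≤ |C| * meshSq i.J i.K := by
    have h := i.s.consistent.jac _ i.s.hn _ i.ht j k h1 h2 h3 h4
    have h' : |i.s.S.jac j k i.t - 1 / i.J * (1 / i.K) * jac (i, z)|
      ≤ C * (1 / i.J * (1 / i.K)) * meshSq i.J i.K := h
    have e : i.s.S.jac j k i.t * (i.J * i.K) - jac (i, z)
        = (i.s.S.jac j k i.t - 1 / i.J * (1 / i.K) * jac (i, z)) * (i.J * i.K) := by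
      field_simp
    rw [e, abs_mul, abs_of_pos (mul_pos hJ0 hK0)]
    calc _ ≤ C * (1 / i.J * (1 / i.K)) * meshSq i.J i.K * (i.J * i.K) :=
          mul_le_mul_of_nonneg_right h' (by positivity)
      _ = C * meshSq i.J i.K := by field_simp
      _ ≤ _ := mul_le_mul_of_nonneg_right (le_abs_self _) hμ
  have hd : deriv (i.s.S.jac j k) i.t = i.s.S.jacRate j k i.t :=
    (i.s.gcl _ i.s.hn _ i.ht j k h1 h2 h3 h4).deriv
  have hc : i.s.S.c j k i.t = pull P.c (i, z) := by
    rw [i.s.consistent.c _ i.time_mem j k h1 h2 h3 h4]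
    simp only [Scheme.nodal, pull]
    rw [i.scheme_x_eq h1.le h2.le h3.le h4.le, i.scheme_y_eq h1.le h2.le h3.le h4.le]
  have hU : i.nodalValue j k = pull u (i, z) := rfl
  rw [← div_le_iff₀ (by positivity), ← abs_of_pos (by positivity : 0 < 1 / (i.J : ℝ) * (1 / i.K)),
    ← abs_div]
  simp only [Scheme.op, hd, hc, hU, Scheme.jacRate]
  rw [← hz] at eg₁ eg₂ ek₁ ek₂ el₁ el₂
  set μ := meshSq i.J i.K
  set U := pull u (i, z)
  have e0 := abs_mul (i.s.S.jac j k i.t * (i.J * i.K) - jac (i, z))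
    (rate (i, z) + pull P.c (i, z) * U - pull P.f (i, z))
  have e1 := mul_le_mul ej eB (abs_nonneg _) (by positivity)
  rw [← e0] at e1
  have e2 := mul_le_mul eA (abs_add_le _ _ |>.trans (add_le_add el₁ el₂)) (abs_nonneg _) hA0
  rw [← abs_mul] at e2
  dsimp only at eg₁ eg₂ ek₁ ek₂ e2
  refine le_of_eq_of_le (congrArg _ ?_) ((abs_add_le _ _).trans (add_le_add ((abs_add_le _ _).trans
    (add_le_add e1 e2)) ((abs_sub _ _).trans (add_le_add
      ((abs_add_le _ _).trans (add_le_add eg₁ eg₂))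
      ((abs_add_le _ _).trans (add_le_add ek₁ ek₂)))))) |>.trans_eq ?_
  · have e : ∀ x y : ℝ, x / (1 / y) = x * y := fun x y => by rw [one_div, div_inv_eq_mul]
    have e' : ∀ x : ℝ, x / (1 / (i.J : ℝ) * (1 / i.K)) = x * (i.J * i.K) := fun x => by
      rw [one_div_mul_one_div_rev, e, mul_comm (i.K : ℝ)]
    simp only [e, e']
    linear_combination bal
  · ring

end MeshTime

/-! ### The semi-discrete solution -/

namespace Scheme

variable {J K : ℕ} (S : Scheme J K)

/-- At an interior node the spatial operator only uses values at nodes of the grid. -/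
theorem op_congr {U V : ℤ → ℤ → ℝ} (h : ∀ j k : ℤ, 0 ≤ j → j ≤ J → 0 ≤ k → k ≤ K → U j k = V j k)
    {j k : ℤ} (hj : 0 < j) (hj' : j < J) (hk : 0 < k) (hk' : k < K) (t : ℝ) :
    S.op U j k t = S.op V j k t := by
  have e1 : j + 1 - 1 = j := by ring
  have e2 : k + 1 - 1 = k := by ring
  simp only [op, q₁, q₂, p₁, p₂, e1, e2]
  rw [h j k (by omega) (by omega) (by omega) (by omega),
    h (j + 1) k (by omega) (by omega) (by omega) (by omega),
    h (j - 1) k (by omega) (by omega) (by omega) (by omega),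
    h j (k + 1) (by omega) (by omega) (by omega) (by omega),
    h j (k - 1) (by omega) (by omega) (by omega) (by omega),
    h (j + 1) (k + 1) (by omega) (by omega) (by omega) (by omega),
    h (j + 1) (k - 1) (by omega) (by omega) (by omega) (by omega),
    h (j - 1) (k + 1) (by omega) (by omega) (by omega) (by omega),
    h (j - 1) (k - 1) (by omega) (by omega) (by omega) (by omega)]

variable {S} in
/-- The right-hand side of the symmetrized system in terms of the original unknowns. -/
theorem B_mulVec_sqrtMass_add {t : ℝ} (hpos : ∀ p : Interior J K, 0 < S.jac p.1.1 p.1.2 t)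
    (hG : ∀ p : Interior J K, HasDerivAt (S.jac p.1.1 p.1.2) (S.jacRate p.1.1 p.1.2 t) t)
    (w F : Interior J K → ℝ) (p : Interior J K) :
    (S.B t *ᵥ (S.sqrtMass t *ᵥ w) + (S.sqrtMass t)⁻¹ *ᵥ F) p = (√(S.jac p.1.1 p.1.2 t))⁻¹
      * ((S.stiff t *ᵥ w + F) p + 2⁻¹ * S.jacRate p.1.1 p.1.2 t * w p) := by
  have h1 : S.B t *ᵥ (S.sqrtMass t *ᵥ w) = (S.sqrtMass t)⁻¹ *ᵥ
      ((S.stiff t + S.sqrtMass t * S.sqrtMassDeriv t) *ᵥ w) := by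
    rw [B, ← Matrix.mulVec_mulVec, ← Matrix.mulVec_mulVec, inv_mulVec_sqrtMass hpos]
  rw [h1, ← Matrix.mulVec_add, sqrtMass_mul_deriv hpos hG, sqrtMass_inv hpos,
    Matrix.mulVec_diagonal, Matrix.add_mulVec]
  simp only [Pi.add_apply, Matrix.mulVec_diagonal]
  ring

end Scheme

/-- All the data and hypotheses of the convergence theorem on a `J × K` mesh, with coefficients of
class `C^r` in time. -/
structure RegularMesh (P : IBVP) (u : ℝ × ℝ × ℝ → ℝ) (T C κ : ℝ) (J K r : ℕ) where
  /-- the scheme -/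
  S : Scheme J K
  /-- the number of time steps -/
  N : ℕ
  /-- the time levels -/
  τ : ℕ → ℝ
  /-- the coordinate transformation -/
  X : ℝ → ℝ × ℝ → ℝ × ℝ
  hJ : 0 < J
  hK : 0 < K
  partition : IsPartition T N τ
  trans : IsCoordinateTransformation T N τ C κ X
  sol : P.IsSolution T (physicalDomain X) u
  nondegenerate : S.IsNondegenerate T
  uniform : S.IsUniform T κ
  consistent : S.IsConsistent P T N τ C X
  coefficient : S.CoefficientCondition N τ
  gcl : S.GeometricConservationLaw N τ
  regular : S.IsTimeRegular T N τ r C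

namespace RegularMesh

variable {P : IBVP} {u : ℝ × ℝ × ℝ → ℝ} {T C κ : ℝ} {J K r : ℕ} (i : RegularMesh P u T C κ J K r)

/-- The mesh with the time step `n` singled out. -/
def step {n : ℕ} (hn : n < i.N) : RegularStep P u T C κ J K r :=
  ⟨⟨i.S, i.N, i.τ, i.X, n, hn, i.hJ, i.hK, i.partition, i.trans, i.sol, i.nondegenerate, i.uniform,
    i.consistent, i.coefficient, i.gcl⟩, i.regular⟩

/-- The source vector of the scheme. -/
noncomputable def source : ℝ → Interior J K → ℝ := i.S.source (i.S.nodal P.f) (i.S.nodal P.g)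

/-- The exact solution at the interior nodes in the unknowns `v = √M u` of the scheme. -/
noncomputable def exactVec (t : ℝ) : Interior J K → ℝ := i.S.sqrtMass t *ᵥ i.S.nodalVec u t

theorem mass_pos {t : ℝ} (ht : t ∈ Icc 0 T) (p : Interior J K) : 0 < i.S.jac p.1.1 p.1.2 t :=
  i.nondegenerate.mass_pos ht p

theorem mem_Icc {n : ℕ} (hn : n < i.N) {t : ℝ} (ht : t ∈ Ioo (i.τ n) (i.τ (n + 1))) : t ∈ Icc 0 T :=
  i.partition.Icc_subset hn (Ioo_subset_Icc_self ht)

theorem hasDerivAt_jac {n : ℕ} (hn : n < i.N) {t : ℝ} (ht : t ∈ Ioo (i.τ n) (i.τ (n + 1)))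
    (p : Interior J K) : HasDerivAt (i.S.jac p.1.1 p.1.2) (i.S.jacRate p.1.1 p.1.2 t) t :=
  i.gcl n hn t ht _ _ p.bounds.1 p.bounds.2.1 p.bounds.2.2.1 p.bounds.2.2.2

theorem continuousOn_jac (p : Interior J K) : ContinuousOn (i.S.jac p.1.1 p.1.2) (Icc 0 T) :=
  i.regular.jac_continuousOn _ _ p.bounds.1 p.bounds.2.1 p.bounds.2.2.1 p.bounds.2.2.2

/-- `v` solves the semi-discrete system in the unknowns `v = √M u`, starting at the initial
values of the scheme. -/
structure Solves (v : ℝ → Interior J K → ℝ) : Prop where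
  continuousOn : ContinuousOn v (Icc 0 T)
  initial : v 0 = i.S.sqrtMass 0 *ᵥ i.S.initialVec P.u₀
  ode : ∀ n < i.N, ∀ t ∈ Ioo (i.τ n) (i.τ (n + 1)),
    HasDerivAt v (i.S.B t *ᵥ v t + (i.S.sqrtMass t)⁻¹ *ᵥ i.source t) t

/-- On each step the coefficients are Lipschitz in time, so the system can be solved up to the end
points of the step. -/
theorem exists_solves (hP : P.IsSmooth) (hu : ContDiff ℝ ∞ u) (hκ : 0 < κ) (hr : 1 ≤ r) :
    ∃ v, i.Solves v := by
  obtain ⟨v, hv1, hv2, hv3⟩ := exists_glue i.partition.lt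
    (Q := fun n f => ∀ t ∈ Ioo (i.τ n) (i.τ (n + 1)),
      HasDerivAt f (i.S.B t *ᵥ f t + (i.S.sqrtMass t)⁻¹ *ᵥ i.source t) t)
    (fun n hn x => exists_hasDerivAt_linear (i.partition.lt n hn)
      (fun p q => ((RegularStep.reg_B hP hκ p q).mono hr).exists_lipschitzOnWith (i.step hn))
      (fun p => ((RegularStep.reg_source hP hu hκ p).mono hr).exists_lipschitzOnWith (i.step hn)) x)
    (i.S.sqrtMass 0 *ᵥ i.S.initialVec P.u₀)
  rw [i.partition.zero, i.partition.last] at hv1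
  rw [i.partition.zero] at hv2
  refine ⟨v, hv1, hv2, fun n hn t ht => ?_⟩
  obtain ⟨f, hf1, hf2⟩ := hv3 n hn
  rw [hf2 (Ioo_subset_Icc_self ht)]
  refine (hf1 t ht).congr_of_eventuallyEq ?_
  filter_upwards [Icc_mem_nhds ht.1 ht.2] with s hs using hf2 hs

include i in
theorem zero_mem : (0 : ℝ) ∈ Icc 0 T :=
  ⟨le_rfl, by
    have := i.partition.monotone (Nat.zero_le i.N) le_rfl
    rwa [i.partition.zero, i.partition.last] at this⟩

variable {i}

/-- The solution in the original unknowns `u = √M⁻¹ v`. -/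
theorem Solves.isSemidiscreteSolution {v : ℝ → Interior J K → ℝ} (h : i.Solves v) :
    i.S.IsSemidiscreteSolution T i.N i.τ i.source fun t => (i.S.sqrtMass t)⁻¹ *ᵥ v t := by
  have e : ∀ t ∈ Icc 0 T, ∀ p, ((i.S.sqrtMass t)⁻¹ *ᵥ v t) p = (√(i.S.jac p.1.1 p.1.2 t))⁻¹ * v t p :=
    fun t ht p => by rw [Scheme.sqrtMass_inv (i.mass_pos ht), Matrix.mulVec_diagonal]
  refine ⟨continuousOn_pi.2 fun p => ?_, fun n hn t ht => ?_⟩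
  · refine ContinuousOn.congr (ContinuousOn.mul (ContinuousOn.inv₀ (i.continuousOn_jac p).sqrt
      fun t ht => (Real.sqrt_pos.2 (i.mass_pos ht p)).ne') (continuousOn_pi.1 h.continuousOn p))
      fun t ht => e t ht p
  · have ht' := i.mem_Icc hn ht
    have hd : ∀ p, HasDerivAt (fun t => ((i.S.sqrtMass t)⁻¹ *ᵥ v t) p)
        ((i.S.jac p.1.1 p.1.2 t)⁻¹ * (i.S.stiff t *ᵥ ((i.S.sqrtMass t)⁻¹ *ᵥ v t) + i.source t) p)
        t := by
      intro p
      have h1 := hasDerivAt_pi.1 (h.ode n hn t ht) p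
      have h2 := ((i.hasDerivAt_jac hn ht p).sqrt (i.mass_pos ht' p).ne').inv
        (Real.sqrt_pos.2 (i.mass_pos ht' p)).ne'
      refine ((h2.mul h1).congr_of_eventuallyEq ?_).congr_deriv ?_
      · filter_upwards [Icc_mem_nhds ht.1 ht.2] with s hs
        exact e s (i.partition.Icc_subset hn hs) p
      · have h3 := Scheme.B_mulVec_sqrtMass_add (i.mass_pos ht') (i.hasDerivAt_jac hn ht)
          ((i.S.sqrtMass t)⁻¹ *ᵥ v t) (i.source t) p
        rw [Scheme.sqrtMass_mulVec_inv (i.mass_pos ht')] at h3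
        rw [h3, e t ht' p]
        have h4 := Real.sqrt_pos.2 (i.mass_pos ht' p)
        have h5 := Real.sq_sqrt (i.mass_pos ht' p).le
        have h6 := i.mass_pos ht' p
        simp only [Pi.inv_apply]
        set s := √(i.S.jac p.1.1 p.1.2 t)
        rw [← h5]
        field_simp
        ring
    refine ⟨(hasDerivAt_pi.2 hd).differentiableAt, ?_⟩
    rw [(hasDerivAt_pi.2 hd).deriv]
    funext p
    rw [Scheme.mass, Matrix.mulVec_diagonal, ← mul_assoc, mul_inv_cancel₀ (i.mass_pos ht' p).ne',
      one_mul]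

/-! ### The error of the semi-discrete solution -/

theorem nodalVec_zero (i : RegularMesh P u T C κ J K r) : i.S.nodalVec u 0 = i.S.initialVec P.u₀ := by
  funext p
  obtain ⟨h1, h2, h3, h4⟩ := p.bounds
  refine i.sol.initial (i.S.x p.1.1 p.1.2 0, i.S.y p.1.1 p.1.2 0) ?_
  rw [i.consistent.nodes 0 (i.zero_mem) _ _ h1.le h2.le h3.le h4.le]
  exact ⟨_, (MeshStep.node_mem_interior_iff i.hJ i.hK).2 ⟨h1, h2, h3, h4⟩, rfl⟩

theorem continuousOn_exact (i : RegularMesh P u T C κ J K r) (hu : Continuous u) {n : ℕ}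
    (hn : n < i.N) : ContinuousOn i.exactVec (Icc (i.τ n) (i.τ (n + 1))) := by
  refine continuousOn_pi.2 fun p => ?_
  obtain ⟨h1, h2, h3, h4⟩ := p.bounds
  have hX : ContinuousOn (fun t => i.X t (MeshStep.node J K p.1.1 p.1.2)) (Icc (i.τ n) (i.τ (n + 1))) := by
    refine ContinuousOn.congr (f := fun t => i.X (i.τ n) (MeshStep.node J K p.1.1 p.1.2)
      + (t - i.τ n) • (i.step hn).1.V (MeshStep.node J K p.1.1 p.1.2)) ?_ fun t ht =>
      (i.step hn).1.X_eq ht _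
    exact Continuous.continuousOn (by fun_prop)
  have hU : ContinuousOn (fun t => u ((i.X t (MeshStep.node J K p.1.1 p.1.2)).1,
      (i.X t (MeshStep.node J K p.1.1 p.1.2)).2, t)) (Icc (i.τ n) (i.τ (n + 1))) :=
    hu.comp_continuousOn (hX.fst.prodMk (hX.snd.prodMk continuousOn_id))
  refine (((i.continuousOn_jac p).mono (i.partition.Icc_subset hn)).sqrt.mul hU).congr fun t ht => ?_
  have h := i.consistent.nodes t (i.partition.Icc_subset hn ht) _ _ h1.le h2.le h3.le h4.le
  have hx : i.S.x p.1.1 p.1.2 t = _ := congrArg Prod.fst h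
  have hy : i.S.y p.1.1 p.1.2 t = _ := congrArg Prod.snd h
  rw [exactVec, Scheme.sqrtMass, Matrix.mulVec_diagonal, Scheme.nodalVec, Scheme.nodal, hx, hy]
  rfl

/-- The truncation error, in the unknowns `v = √M u`. -/
theorem exists_hasDerivAt_exact (hP : P.IsSmooth) (hu : ContDiff ℝ ∞ u) (hκ : 0 < κ) :
    ∃ R, 0 ≤ R ∧ ∀ {J K r : ℕ} (i : RegularMesh P u T C κ J K r), ∀ n < i.N,
      ∀ t ∈ Ioo (i.τ n) (i.τ (n + 1)), ∃ d, euclid d ≤ R * meshSq J K ∧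
        HasDerivAt i.exactVec (i.S.B t *ᵥ i.exactVec t + (i.S.sqrtMass t)⁻¹ *ᵥ i.source t + d) t := by
  obtain ⟨D, hD0, hD⟩ := MeshTime.exists_truncation (T := T) (C := C) hP hu hκ
  refine ⟨D / √κ, by positivity, fun {J K r} i n hn t ht => ?_⟩
  have ht' := i.mem_Icc hn ht
  let o : MeshTime P u T C κ := ⟨J, K, (i.step hn).1, t, ht⟩
  -- the residual of the exact solution in the semi-discrete system
  let res : Interior J K → ℝ := fun p => i.S.jac p.1.1 p.1.2 t
      * MeshTime.rate (o, ((p.1.1 : ℝ) / J, (p.1.2 : ℝ) / K))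
    - (i.S.stiff t *ᵥ i.S.nodalVec u t + i.source t) p
  have hop : ∀ p : Interior J K, (i.S.stiff t *ᵥ i.S.nodalVec u t + i.source t) p
      = i.S.op o.nodalValue p.1.1 p.1.2 t + i.S.jac p.1.1 p.1.2 t
        * MeshTime.pull P.f (o, ((p.1.1 : ℝ) / J, (p.1.2 : ℝ) / K)) := by
    intro p
    obtain ⟨h1, h2, h3, h4⟩ := p.bounds
    rw [source, Scheme.stiff_mulVec_add_source]
    congr 1
    · refine i.S.op_congr (fun j k hj hj' hk hk' => ?_) h1 h2 h3 h4 t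
      have e : i.S.nodal u j k t = o.nodalValue j k := by
        have e1 := o.scheme_x_eq hj hj' hk hk'
        have e2 := o.scheme_y_eq hj hj' hk hk'
        change u (i.S.x j k t, i.S.y j k t, t) = _
        change i.S.x j k t = _ at e1
        change i.S.y j k t = _ at e2
        rw [e1, e2]
        rfl
      rw [← e]
      by_cases hb : 0 < j ∧ j < J ∧ 0 < k ∧ k < K
      · have hm : (j, k) ∈ Finset.Ioo (0 : ℤ) J ×ˢ Finset.Ioo (0 : ℤ) K := by
          rw [Finset.mem_product, Finset.mem_Ioo, Finset.mem_Ioo]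
          exact ⟨⟨hb.1, hb.2.1⟩, hb.2.2.1, hb.2.2.2⟩
        exact extendGrid_interior _ _ ⟨(j, k), hm⟩
      · rw [extendGrid_of_not _ _ hb]
        exact (i.step hn).1.nodal_eq_boundary ht hj hj' hk hk' hb
    · have e1 := o.scheme_x_eq h1.le h2.le h3.le h4.le
      have e2 := o.scheme_y_eq h1.le h2.le h3.le h4.le
      change i.S.x _ _ t = _ at e1
      change i.S.y _ _ t = _ at e2
      rw [Scheme.nodal, e1, e2]
      rfl
  have hJ : (0 : ℝ) < J := by exact_mod_cast i.hJ
  have hK : (0 : ℝ) < K := by exact_mod_cast i.hK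
  have hres : ∀ p, |res p| ≤ D * meshSq J K * (1 / J * (1 / K)) := fun p => by
    obtain ⟨h1, h2, h3, h4⟩ := p.bounds
    have h := hD o p.1.1 p.1.2 h1 h2 h3 h4
    refine le_of_eq_of_le (congrArg _ ?_) h
    change _ - _ = _
    rw [hop p, sub_add_eq_sub_sub]
    rfl
  have hμ := meshSq_nonneg J K
  refine ⟨fun p => (√(i.S.jac p.1.1 p.1.2 t))⁻¹ * res p, ?_, hasDerivAt_pi.2 fun p => ?_⟩
  · have hb : ∀ p : Interior J K, |(√(i.S.jac p.1.1 p.1.2 t))⁻¹ * res p|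
        ≤ D / √κ * meshSq J K * √(1 / J * (1 / K)) := fun p => by
      have h1 : √κ * √(1 / J * (1 / K)) ≤ √(i.S.jac p.1.1 p.1.2 t) := by
        rw [← Real.sqrt_mul hκ.le]
        exact Real.sqrt_le_sqrt (i.uniform.jac_ge t ht' _ _ p.bounds.1 p.bounds.2.1 p.bounds.2.2.1
          p.bounds.2.2.2)
      have h2 : 0 < √(1 / (J : ℝ) * (1 / K)) := Real.sqrt_pos.2 (by positivity)
      have h3 := Real.sqrt_pos.2 hκ
      have h4 : √(1 / (J : ℝ) * (1 / K)) ^ 2 = 1 / J * (1 / K) := Real.sq_sqrt (by positivity)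
      rw [abs_mul, abs_inv, abs_of_nonneg (Real.sqrt_nonneg _)]
      calc _ ≤ (√κ * √(1 / J * (1 / K)))⁻¹ * (D * meshSq J K * (1 / J * (1 / K))) :=
            mul_le_mul (inv_anti₀ (by positivity) h1) (hres p) (abs_nonneg _) (by positivity)
        _ = _ := by
          generalize √(1 / (J : ℝ) * (1 / K)) = q at h2 h4 ⊢
          rw [← h4]
          field_simp
    refine (euclid_le_of_abs_le hb).trans ?_
    have hcard : (Fintype.card (Interior J K) : ℝ) ≤ J * K := by
      have : Fintype.card (Interior J K) ≤ J * K := by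
        rw [Fintype.card_coe, Finset.card_product, Int.card_Ioo, Int.card_Ioo]
        exact Nat.mul_le_mul (by omega) (by omega)
      exact_mod_cast this
    have h5 : √(Fintype.card (Interior J K) : ℝ) * √(1 / J * (1 / K)) ≤ 1 := by
      rw [← Real.sqrt_mul (Nat.cast_nonneg _)]
      refine Real.sqrt_le_one.2 ?_
      calc _ ≤ ((J : ℝ) * K) * (1 / J * (1 / K)) :=
            mul_le_mul_of_nonneg_right hcard (by positivity)
        _ = 1 := by field_simp
    rw [abs_of_nonneg (by positivity)]
    calc _ = D / √κ * meshSq J K * (√(Fintype.card (Interior J K) : ℝ) * √(1 / J * (1 / K))) := by ring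
      _ ≤ D / √κ * meshSq J K * 1 := mul_le_mul_of_nonneg_left h5 (by positivity)
      _ = _ := mul_one _
  · obtain ⟨h1, h2, h3, h4⟩ := p.bounds
    have hU : HasDerivAt (i.S.nodal u p.1.1 p.1.2)
        (MeshTime.rate (o, ((p.1.1 : ℝ) / J, (p.1.2 : ℝ) / K))) t := by
      have hx := (i.step hn).1.hasDerivAt_x ht h1.le h2.le h3.le h4.le
      have hy := (i.step hn).1.hasDerivAt_y ht h1.le h2.le h3.le h4.le
      have h := HasDerivWithinAt.comp_spaceTime (s := univ) (hu.differentiable (by simp) _)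
        hx.hasDerivWithinAt hy.hasDerivWithinAt (hasDerivAt_id t).hasDerivWithinAt
      rw [hasDerivWithinAt_univ] at h
      refine h.congr_deriv ?_
      have e1 := o.scheme_x_eq h1.le h2.le h3.le h4.le
      have e2 := o.scheme_y_eq h1.le h2.le h3.le h4.le
      have e3 := (i.step hn).1.velocity_eq ht (MeshStep.node J K p.1.1 p.1.2)
      change i.S.x _ _ t = _ at e1
      change i.S.y _ _ t = _ at e2
      rw [← e3]
      change dX u (i.S.x _ _ t, i.S.y _ _ t, t) * _ + dY u (i.S.x _ _ t, i.S.y _ _ t, t) * _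
        + dT u (i.S.x _ _ t, i.S.y _ _ t, t) * 1 = _
      rw [e1, e2, mul_one, add_assoc, add_comm, MeshTime.rate, add_right_comm, add_comm _ (dT _ _),
        ← add_assoc, add_right_comm]
      rfl
    have hs := (i.hasDerivAt_jac hn ht p).sqrt (i.mass_pos ht' p).ne'
    refine ((hs.mul hU).congr_of_eventuallyEq (Filter.Eventually.of_forall fun t => ?_)).congr_deriv ?_
    · rw [exactVec, Scheme.sqrtMass, Matrix.mulVec_diagonal]
      rfl
    · rw [Pi.add_apply, exactVec, Scheme.B_mulVec_sqrtMass_add (i.mass_pos ht') (i.hasDerivAt_jac hn ht)]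
      have h4 := Real.sqrt_pos.2 (i.mass_pos ht' p)
      have h5 := Real.sq_sqrt (i.mass_pos ht' p).le
      have h6 : i.S.nodalVec u t p = i.S.nodal u p.1.1 p.1.2 t := rfl
      simp only [res, h6]
      set s := √(i.S.jac p.1.1 p.1.2 t)
      rw [← h5]
      field_simp
      ring

end RegularMesh

/-- Stability of a dissipative system under a perturbation of its right-hand side. -/
theorem euclid_le_of_perturbation {σ : Type*} [Fintype σ] {T : ℝ} {N : ℕ} {τ : ℕ → ℝ}
    (hτ : IsPartition T N τ) {B : ℝ → Matrix σ σ ℝ} {e : ℝ → σ → ℝ} {R : ℝ} (hR : 0 ≤ R)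
    (hB : ∀ n < N, ∀ t ∈ Ioo (τ n) (τ (n + 1)), ∀ z, z ⬝ᵥ (B t *ᵥ z) ≤ 0) (h0 : e 0 = 0)
    (hc : ∀ n < N, ContinuousOn e (Icc (τ n) (τ (n + 1))))
    (hd : ∀ n < N, ∀ t ∈ Ioo (τ n) (τ (n + 1)), ∃ d, euclid d ≤ R ∧
      HasDerivAt e (B t *ᵥ e t + d) t) :
    ∀ t ∈ Icc 0 T, euclid (e t) ≤ √(Real.exp T) * R := by
  -- `|e|² + R²` grows at most exponentially, since `(|e|²)' ≤ 2 d · e ≤ |e|² + R²`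
  set φ : ℝ → ℝ := fun t => (e t ⬝ᵥ e t + R ^ 2) * Real.exp (-t) with hφ
  have hanti : ∀ n < N, AntitoneOn φ (Icc (τ n) (τ (n + 1))) := by
    intro n hn
    have hcn := hc n hn
    have hφd : ∀ t ∈ Ioo (τ n) (τ (n + 1)), ∃ s, s ≤ 0 ∧ HasDerivAt φ s t := by
      intro t ht
      obtain ⟨d, hdR, hd'⟩ := hd n hn t ht
      have h1 : HasDerivAt (fun t => e t ⬝ᵥ e t) (2 * (e t ⬝ᵥ (B t *ᵥ e t + d))) t := by
        refine (HasDerivAt.fun_sum fun p _ =>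
          (hasDerivAt_pi.1 hd' p).mul (hasDerivAt_pi.1 hd' p)).congr_deriv ?_
        rw [dotProduct, Finset.mul_sum]
        exact Finset.sum_congr rfl fun p _ => by ring
      refine ⟨_, ?_, (h1.add_const (R ^ 2)).mul (hasDerivAt_neg t).exp⟩
      have h2 := hB n hn t ht (e t)
      have h3 := dotProduct_le_euclid (e t) d
      have h4 := euclid_sq (e t)
      have h5 := two_mul_le_add_sq (euclid (e t)) R
      have h6 : euclid (e t) * euclid d ≤ euclid (e t) * R :=
        mul_le_mul_of_nonneg_left hdR (euclid_nonneg _)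
      have h7 : 2 * (e t ⬝ᵥ (B t *ᵥ e t + d)) - (e t ⬝ᵥ e t + R ^ 2) ≤ 0 := by
        rw [dotProduct_add]
        linarith
      have h8 := mul_nonpos_of_nonpos_of_nonneg h7 (Real.exp_pos (-t)).le
      linarith
    refine antitoneOn_of_deriv_nonpos (convex_Icc _ _) ?_ ?_ ?_
    · refine ContinuousOn.mul (ContinuousOn.add ?_ continuousOn_const)
        (Real.continuous_exp.comp continuous_neg).continuousOn
      exact continuousOn_finsetSum _ fun p _ =>
        (continuousOn_pi.1 hcn p).mul (continuousOn_pi.1 hcn p)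
    · rw [interior_Icc]
      intro t ht
      obtain ⟨s, -, hs⟩ := hφd t ht
      exact hs.differentiableAt.differentiableWithinAt
    · rw [interior_Icc]
      intro t ht
      obtain ⟨s, hs0, hs⟩ := hφd t ht
      rw [hs.deriv]
      exact hs0
  have hle : ∀ n ≤ N, ∀ t ∈ Icc 0 (τ n), φ t ≤ φ 0 := by
    intro n
    induction n with
    | zero =>
      intro _ t ht
      rw [hτ.zero] at ht
      rw [le_antisymm ht.2 ht.1]
    | succ n ih =>
      intro hn t ht
      have hn' : 0 ≤ τ n := by
        have := hτ.monotone (Nat.zero_le n) (Nat.le_of_succ_le hn)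
        rwa [hτ.zero] at this
      rcases le_total t (τ n) with h | h
      · exact ih (Nat.le_of_succ_le hn) t ⟨ht.1, h⟩
      · exact (hanti n hn (left_mem_Icc.2 (hτ.lt n hn).le) ⟨h, ht.2⟩ h).trans
          (ih (Nat.le_of_succ_le hn) _ ⟨hn', le_rfl⟩)
  intro t ht
  have h1 := hle N le_rfl t (by rwa [hτ.last])
  simp only [hφ, h0, neg_zero, Real.exp_zero, mul_one, dotProduct_zero, zero_add] at h1
  rw [Real.exp_neg, ← div_eq_mul_inv, div_le_iff₀ (Real.exp_pos t)] at h1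
  have h2 : Real.exp t ≤ Real.exp T := Real.exp_le_exp.2 ht.2
  refine (Real.sqrt_le_sqrt (?_ : _ ≤ Real.exp T * R ^ 2)).trans_eq ?_
  · have := mul_le_mul_of_nonneg_left h2 (sq_nonneg R)
    have := sq_nonneg R
    linarith
  · rw [Real.sqrt_mul (Real.exp_pos T).le, Real.sqrt_sq hR]

namespace RegularMesh

variable {P : IBVP} {u : ℝ × ℝ × ℝ → ℝ} {T C κ : ℝ}

/-- Second-order convergence in space, with a constant that does not depend on the mesh. -/
theorem exists_space_error (hP : P.IsSmooth) (hu : ContDiff ℝ ∞ u) (hκ : 0 < κ) :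
    ∃ D, 0 ≤ D ∧ ∀ {J K r : ℕ} (i : RegularMesh P u T C κ J K r) (v), i.Solves v →
      ∀ t ∈ Icc 0 T, euclid (v t - i.exactVec t) ≤ D * meshSq J K := by
  obtain ⟨R, hR0, hR⟩ := exists_hasDerivAt_exact (T := T) (C := C) hP hu hκ
  refine ⟨√(Real.exp T) * R, by positivity, fun {J K r} i v hv t ht => ?_⟩
  rw [mul_assoc]
  refine euclid_le_of_perturbation (e := fun t => v t - i.exactVec t) (B := i.S.B) i.partition
    (mul_nonneg hR0 (meshSq_nonneg J K))
    (fun n hn t ht => Scheme.B_semidefinite_step i.partition i.nondegenerate i.coefficient i.gcl hn ht)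
    ?_ (fun n hn => (hv.continuousOn.mono (i.partition.Icc_subset hn)).sub
      (i.continuousOn_exact hu.continuous hn)) (fun n hn t ht => ?_) t ht
  · simp only [hv.initial, exactVec, i.nodalVec_zero, sub_self]
  · obtain ⟨d, hd1, hd2⟩ := hR i n hn t ht
    refine ⟨-d, ?_, ((hv.ode n hn t ht).sub hd2).congr_deriv ?_⟩
    · simpa only [euclid, neg_dotProduct_neg] using hd1
    · rw [Matrix.mulVec_sub]
      abel

/-! ### The error of the fully discrete solution -/

/-- The initial vectors are bounded, uniformly over all meshes of a given size. -/
theorem norm_exact_le {J K r : ℕ} (hu : ContDiff ℝ ∞ u) (hκ : 0 < κ) :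
    ∃ R, 0 ≤ R ∧ ∀ i : RegularMesh P u T C κ J K r, 0 < i.N → ‖i.exactVec 0‖ ≤ R := by
  have hb : ∀ p : Interior J K, (RegularStep.frame P u T C κ J K r).Bdd fun o =>
      √(o.1.1.S.jac p.1.1 p.1.2 o.2) * o.1.1.S.nodal u p.1.1 p.1.2 o.2 := fun p => by
    obtain ⟨h1, h2, h3, h4⟩ := p.bounds
    have hJ' : (0 : ℝ) < J := by exact_mod_cast h1.trans h2
    have hK' : (0 : ℝ) < K := by exact_mod_cast h3.trans h4
    have hc : 0 < κ * ((1 / (J : ℝ)) * (1 / (K : ℝ))) := by positivity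
    exact ((Frame.Reg.sqrt hc (RegularStep.reg_jac h1 h2 h3 h4) fun o ho =>
      o.1.1.uniform.jac_ge _ (o.1.1.Icc_subset (Ioo_subset_Icc_self ho)) _ _ h1 h2 h3 h4).mul
      (RegularStep.reg_nodal hu h1.le h2.le h3.le h4.le)).bdd
  obtain ⟨R, hR0, hR⟩ := Frame.exists_forall_le_of_finite (f := fun (p : Interior J K)
    (o : RegularStep P u T C κ J K r × ℝ) =>
      √(o.1.1.S.jac p.1.1 p.1.2 o.2) * o.1.1.S.nodal u p.1.1 p.1.2 o.2) hb
  refine ⟨R, hR0, fun i hi => (pi_norm_le_iff_of_nonneg hR0).2 fun p => ?_⟩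
  -- the bound on the first open interval extends to its starting point by continuity
  have hlt := i.partition.lt 0 hi
  have hmaps : MapsTo (fun t => i.exactVec t p) (Ioo (i.τ 0) (i.τ 1)) (Icc (-R) R) := fun t ht => by
    have h := hR p (i.step hi, t) ht
    change (i.S.sqrtMass t *ᵥ i.S.nodalVec u t) p ∈ _
    rw [Scheme.sqrtMass, Matrix.mulVec_diagonal]
    exact abs_le.1 h
  have h := hmaps.closure_of_continuousOn (by
    rw [closure_Ioo hlt.ne]
    exact continuousOn_pi.1 (i.continuousOn_exact hu.continuous hi) p)
  rw [closure_Ioo hlt.ne, isClosed_Icc.closure_eq, i.partition.zero] at h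
  have h0 := i.partition.zero
  exact abs_le.2 (h ⟨le_rfl, by rw [← h0]; exact hlt.le⟩)

variable {J K m : ℕ} {ρ : Fin m → ℝ}

/-- The collocation solutions are bounded, uniformly over all meshes of a given size. -/
theorem norm_collocation_le (hP : P.IsSmooth) (hu : ContDiff ℝ ∞ u) (hκ : 0 < κ)
    (hρ : IsGaussLegendre ρ) (hm : 1 ≤ m) :
    ∃ R, ∀ (i : RegularMesh P u T C κ J K (2 * m)) (v),
      i.S.IsCollocationSolution T i.N i.τ ρ i.source v → v 0 = i.exactVec 0 →
      ∀ n < i.N, ‖v (i.τ n)‖ ≤ R := by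
  obtain ⟨R, hR0, hR⟩ := norm_exact_le (P := P) (T := T) (C := C) (J := J) (K := K) (r := 2 * m) hu hκ
  obtain ⟨D, hD0, hD⟩ := exists_step_growth
    (a := fun s : RegularStep P u T C κ J K (2 * m) => s.1.a) (b := fun s => s.1.b)
    (B := fun s => s.1.S.B) (G := fun s t => (s.1.S.sqrtMass t)⁻¹ *ᵥ
      s.1.S.source (s.1.S.nodal P.f) (s.1.S.nodal P.g) t)
    (fun s => s.1.a_lt_b) hρ hm (fun p q => (RegularStep.reg_B hP hκ p q).bdd)
    (fun p => (RegularStep.reg_source hP hu hκ p).bdd)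
    (fun s t ht => Scheme.B_semidefinite_step s.1.partition s.1.nondegenerate s.1.coefficient s.1.gcl
      s.1.hn ht)
  refine ⟨Real.exp (D * T) * (R + 1), fun i v hv hv0 n hn => ?_⟩
  have key : ∀ n ≤ i.N, 0 < i.N → ‖v (i.τ n)‖ + 1 ≤ Real.exp (D * i.τ n) * (R + 1) := by
    intro n
    induction n with
    | zero =>
      intro _ hN
      rw [i.partition.zero, mul_zero, Real.exp_zero, one_mul, hv0]
      linarith [hR i hN]
    | succ n ih =>
      intro hn hN
      have hlt := i.partition.lt n hn
      obtain ⟨Q, hQ1, hQ2⟩ := hv.exists_step hρ hn hlt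
      have h1 := hD (i.step hn) Q hQ1
      have h2 : ‖v (i.τ (n + 1))‖ ≤ ‖v (i.τ n)‖
          + D * (i.τ (n + 1) - i.τ n) * (‖v (i.τ n)‖ + 1) := by
        have hδ := sub_pos.2 hlt
        refine (pi_norm_le_iff_of_nonneg (by positivity)).2 fun p => ?_
        have h3 := h1 p (i.τ (n + 1)) (right_mem_Icc.2 hlt.le)
        change |(Q p).eval (i.τ (n + 1)) - (Q p).eval (i.τ n)| ≤ D * (i.τ (n + 1) - i.τ n)
          * (‖fun q => (Q q).eval (i.τ n)‖ + 1) at h3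
        rw [← hQ2 _ (left_mem_Icc.2 hlt.le)] at h3
        have h4 := norm_le_pi_norm (v (i.τ n)) p
        have e1 : v (i.τ n) p = (Q p).eval (i.τ n) := congrFun (hQ2 _ (left_mem_Icc.2 hlt.le)) p
        have e2 : v (i.τ (n + 1)) p = (Q p).eval (i.τ (n + 1)) :=
          congrFun (hQ2 _ (right_mem_Icc.2 hlt.le)) p
        have h5 := abs_sub_abs_le_abs_sub (v (i.τ (n + 1)) p) (v (i.τ n) p)
        rw [← e1, ← e2] at h3
        rw [Real.norm_eq_abs] at h4 ⊢
        linarith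
      have h3 : D * i.τ (n + 1) = D * (i.τ (n + 1) - i.τ n) + D * i.τ n := by ring
      rw [h3, Real.exp_add, mul_assoc]
      have h4 := Real.add_one_le_exp (D * (i.τ (n + 1) - i.τ n))
      calc ‖v (i.τ (n + 1))‖ + 1 ≤ (D * (i.τ (n + 1) - i.τ n) + 1) * (‖v (i.τ n)‖ + 1) := by
            linarith
        _ ≤ _ := mul_le_mul h4 (ih (Nat.le_of_succ_le hn) hN) (by positivity) (Real.exp_pos _).le
  have h1 := key n hn.le (Nat.zero_lt_of_lt hn)
  have h2 : i.τ n ≤ T := by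
    have := i.partition.monotone hn.le le_rfl
    rwa [i.partition.last] at this
  have h3 : Real.exp (D * i.τ n) * (R + 1) ≤ Real.exp (D * T) * (R + 1) :=
    mul_le_mul_of_nonneg_right (Real.exp_le_exp.2 (mul_le_mul_of_nonneg_left h2 hD0)) (by positivity)
  linarith

/-- Convergence of order `2m` in time, with a constant that does not depend on the time steps. -/
theorem exists_time_error (hP : P.IsSmooth) (hu : ContDiff ℝ ∞ u) (hκ : 0 < κ)
    (hρ : IsGaussLegendre ρ) (hm : 1 ≤ m) :
    ∃ D, ∀ (i : RegularMesh P u T C κ J K (2 * m)) (v w) (Δ : ℝ),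
      i.S.IsCollocationSolution T i.N i.τ ρ i.source v → v 0 = i.exactVec 0 → i.Solves w →
      (∀ n < i.N, i.τ (n + 1) - i.τ n ≤ Δ) →
      ∀ n ≤ i.N, euclid (v (i.τ n) - w (i.τ n)) ≤ D * Δ ^ (2 * m) := by
  obtain ⟨R, hR⟩ := norm_collocation_le (P := P) (T := T) (C := C) (J := J) (K := K) hP hu hκ hρ hm
  -- the steps of all collocation solutions and all semi-discrete solutions
  let ι := {o : RegularStep P u T C κ J K (2 * m) × (Interior J K → Polynomial ℝ) ×
      (ℝ → Interior J K → ℝ) //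
    IsCollocationStep ρ o.1.1.a o.1.1.b o.1.1.S.B (fun t => (o.1.1.S.sqrtMass t)⁻¹ *ᵥ
      o.1.1.S.source (o.1.1.S.nodal P.f) (o.1.1.S.nodal P.g) t) o.2.1 ∧
    ‖fun p => (o.2.1 p).eval o.1.1.a‖ ≤ R ∧ ContinuousOn o.2.2 (Icc o.1.1.a o.1.1.b) ∧
    ∀ t ∈ Ioo o.1.1.a o.1.1.b, HasDerivAt o.2.2 (o.1.1.S.B t *ᵥ o.2.2 t +
      (o.1.1.S.sqrtMass t)⁻¹ *ᵥ o.1.1.S.source (o.1.1.S.nodal P.f) (o.1.1.S.nodal P.g) t) t}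
  obtain ⟨D, hD0, hD⟩ := exists_local_error (T := T)
    (a := fun o : ι => o.1.1.1.a) (b := fun o => o.1.1.1.b)
    (B := fun o => o.1.1.1.S.B) (G := fun o t => (o.1.1.1.S.sqrtMass t)⁻¹ *ᵥ
      o.1.1.1.S.source (o.1.1.1.S.nodal P.f) (o.1.1.1.S.nodal P.g) t)
    (P := fun o => o.1.2.1) (v := fun o => o.1.2.2)
    (fun o => o.1.1.1.a_lt_b) hρ hm
    (fun o => by
      have h1 := (o.1.1.1.Icc_subset (left_mem_Icc.2 o.1.1.1.a_lt_b.le)).1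
      have h2 := (o.1.1.1.Icc_subset (right_mem_Icc.2 o.1.1.1.a_lt_b.le)).2
      linarith)
    (fun p q => (RegularStep.reg_B hP hκ p q).comp_index fun o : ι => o.1.1)
    (fun p => (RegularStep.reg_source hP hu hκ p).comp_index fun o : ι => o.1.1)
    (fun o t ht => Scheme.B_semidefinite_step o.1.1.1.partition o.1.1.1.nondegenerate
      o.1.1.1.coefficient o.1.1.1.gcl o.1.1.1.hn ht)
    (fun o => o.2.1) ⟨R, fun o => o.2.2.1⟩ (fun o => o.2.2.2.1) (fun o => o.2.2.2.2)
  refine ⟨D * T, fun i v w Δ hv hv0 hw hΔ n hn => ?_⟩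
  have key : ∀ n ≤ i.N, euclid (v (i.τ n) - w (i.τ n)) ≤ D * i.τ n * Δ ^ (2 * m) := by
    intro n
    induction n with
    | zero =>
      intro _
      rw [i.partition.zero, hv0, hw.initial, exactVec, i.nodalVec_zero, sub_self, euclid_zero]
      simp
    | succ n ih =>
      intro hn
      have hlt := i.partition.lt n hn
      obtain ⟨Q, hQ1, hQ2⟩ := hv.exists_step hρ hn hlt
      have h1 := hD ⟨(i.step hn, Q, w), hQ1, by
        have := hR i v hv hv0 n hn
        rwa [hQ2 _ (left_mem_Icc.2 hlt.le)] at this,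
        hw.continuousOn.mono (i.partition.Icc_subset hn), hw.ode n hn⟩
      have h2 : euclid (v (i.τ (n + 1)) - w (i.τ (n + 1))) ≤ euclid (v (i.τ n) - w (i.τ n))
          + D * (i.τ (n + 1) - i.τ n) ^ (2 * m + 1) := by
        rw [hQ2 _ (left_mem_Icc.2 hlt.le), hQ2 _ (right_mem_Icc.2 hlt.le)]
        exact h1
      have hδ := sub_pos.2 hlt
      have h3 : (i.τ (n + 1) - i.τ n) ^ (2 * m + 1) ≤ Δ ^ (2 * m) * (i.τ (n + 1) - i.τ n) := by
        rw [pow_succ]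
        exact mul_le_mul_of_nonneg_right (pow_le_pow_left₀ hδ.le (hΔ n hn) _) hδ.le
      have h4 := mul_le_mul_of_nonneg_left h3 hD0
      have h5 := ih (Nat.le_of_succ_le hn)
      linarith
  refine (key n hn).trans (mul_le_mul_of_nonneg_right (mul_le_mul_of_nonneg_left ?_ hD0)
    (Even.pow_nonneg (even_two_mul m) Δ))
  have := i.partition.monotone hn le_rfl
  rwa [i.partition.last] at this

theorem energyNorm_inv_sub {r : ℕ} (i : RegularMesh P u T C κ J K r) {t : ℝ} (ht : t ∈ Icc 0 T)
    (v w : Interior J K → ℝ) : i.S.energyNorm t ((i.S.sqrtMass t)⁻¹ *ᵥ v - w)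
      = euclid (v - i.S.sqrtMass t *ᵥ w) := by
  rw [Scheme.energyNorm_eq_euclid (i.mass_pos ht), Matrix.mulVec_sub,
    Scheme.sqrtMass_mulVec_inv (i.mass_pos ht)]

end RegularMesh

theorem theorem4p1 :
    (∀ (J K : ℕ) (S : Scheme J K) (T : ℝ) (N : ℕ) (τ : ℕ → ℝ),
      IsPartition T N τ → S.IsNondegenerate T →
      S.CoefficientCondition N τ → S.GeometricConservationLaw N τ →
        -- the semi-definiteness condition
        (∀ n < N, ∀ t ∈ Ioo (τ n) (τ (n + 1)), ∀ z : Interior J K → ℝ,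
          z ⬝ᵥ ((S.stiff t + S.sqrtMass t * S.sqrtMassDeriv t) *ᵥ z) ≤ 0) ∧
        -- unconditional solvability and stability of the collocation scheme
        (∀ (m : ℕ) (ρ : Fin m → ℝ), 1 ≤ m → IsGaussLegendre ρ →
          (∀ (f g : ℤ → ℤ → ℝ → ℝ) (v₀ : Interior J K → ℝ),
            (∃ v, S.IsCollocationSolution T N τ ρ (S.source f g) v ∧ v 0 = v₀) ∧
            (∀ v v', S.IsCollocationSolution T N τ ρ (S.source f g) v →
              S.IsCollocationSolution T N τ ρ (S.source f g) v' →
              v 0 = v₀ → v' 0 = v₀ → EqOn v v' (Icc 0 T))) ∧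
          (∀ v, S.IsCollocationSolution T N τ ρ
              (S.source (fun _ _ _ => 0) (fun _ _ _ => 0)) v →
            ∀ n < N,
              v (τ (n + 1)) ⬝ᵥ v (τ (n + 1)) ≤ v (τ n) ⬝ᵥ v (τ n) ∧
              S.energyNorm (τ (n + 1)) ((S.sqrtMass (τ (n + 1)))⁻¹ *ᵥ v (τ (n + 1)))
                ≤ S.energyNorm (τ n) ((S.sqrtMass (τ n))⁻¹ *ᵥ v (τ n))))) ∧
    -- order `2m` in time and order `2` in space
    (∀ (P : IBVP) (u : ℝ × ℝ × ℝ → ℝ) (T C κ : ℝ), P.IsSmooth → ContDiff ℝ ∞ u → 0 < κ →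
      ∃ Cspace : ℝ, ∀ (m : ℕ) (ρ : Fin m → ℝ), 1 ≤ m → IsGaussLegendre ρ →
      ∀ J K : ℕ, 0 < J → 0 < K →
      ∃ Ctime : ℝ, ∀ (S : Scheme J K) (N : ℕ) (τ : ℕ → ℝ) (Δ : ℝ) (X : ℝ → ℝ × ℝ → ℝ × ℝ),
        IsPartition T N τ → (∀ n < N, τ (n + 1) - τ n ≤ Δ) →
        IsCoordinateTransformation T N τ C κ X →
        P.IsSolution T (physicalDomain X) u →
        S.IsNondegenerate T → S.IsUniform T κ →
        S.IsConsistent P T N τ C X → S.IsTimeRegular T N τ (2 * m) C →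
        S.CoefficientCondition N τ → S.GeometricConservationLaw N τ →
        ∃ w : ℝ → Interior J K → ℝ,
          S.IsSemidiscreteSolution T N τ (S.source (S.nodal P.f) (S.nodal P.g)) w ∧
          w 0 = S.initialVec P.u₀ ∧
          -- second order in space
          (∀ t ∈ Icc 0 T, S.energyNorm t (w t - S.nodalVec u t) ≤ Cspace * meshSq J K) ∧
          -- order `2m` in time, and the total error
          (∀ v, S.IsCollocationSolution T N τ ρ (S.source (S.nodal P.f) (S.nodal P.g)) v →
            v 0 = S.sqrtMass 0 *ᵥ S.initialVec P.u₀ →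
            ∀ n ≤ N,
              S.energyNorm (τ n) ((S.sqrtMass (τ n))⁻¹ *ᵥ v (τ n) - w (τ n))
                ≤ Ctime * Δ ^ (2 * m) ∧
              S.energyNorm (τ n) ((S.sqrtMass (τ n))⁻¹ *ᵥ v (τ n) - S.nodalVec u (τ n))
                ≤ Ctime * Δ ^ (2 * m) + Cspace * meshSq J K)) := by
  refine ⟨fun J K S T N τ hτ hS hC hG => ⟨fun n hn t ht z =>
    Scheme.stiff_semidefinite hτ hS hC hG hn ht z, fun m ρ hm hρ => ?_⟩, ?_⟩
  · have hB : ∀ n < N, ∀ t ∈ Ioo (τ n) (τ (n + 1)), ∀ z, z ⬝ᵥ (S.B t *ᵥ z) ≤ 0 :=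
      fun n hn t ht z => Scheme.B_semidefinite_step hτ hS hC hG hn ht z
    refine ⟨fun f g v₀ => ⟨Scheme.exists_isCollocationSolution hτ hρ hm hB v₀,
      fun v v' h h' h0 h0' => h.eqOn h' hτ hρ hm hB (h0.trans h0'.symm)⟩, fun v hv n hn => ?_⟩
    have h := hv.energy_le hτ hρ hm hB hn
    refine ⟨h, ?_⟩
    have ht := hτ.Icc_subset hn (left_mem_Icc.2 (hτ.lt n hn).le)
    have ht' := hτ.Icc_subset hn (right_mem_Icc.2 (hτ.lt n hn).le)
    rw [Scheme.energyNorm_eq_euclid (hS.mass_pos ht), Scheme.energyNorm_eq_euclid (hS.mass_pos ht'),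
      Scheme.sqrtMass_mulVec_inv (hS.mass_pos ht), Scheme.sqrtMass_mulVec_inv (hS.mass_pos ht')]
    exact Real.sqrt_le_sqrt h
  · intro P u T C κ hP hu hκ
    obtain ⟨D, hD0, hD⟩ := RegularMesh.exists_space_error (T := T) (C := C) hP hu hκ
    refine ⟨D, fun m ρ hm hρ J K hJ hK => ?_⟩
    obtain ⟨E, hE⟩ := RegularMesh.exists_time_error (T := T) (C := C) (J := J) (K := K) hP hu hκ hρ hm
    refine ⟨E, fun S N τ Δ X hτ hΔ hX hsol hS hU hcons hreg hC hG => ?_⟩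
    let i : RegularMesh P u T C κ J K (2 * m) :=
      ⟨S, N, τ, X, hJ, hK, hτ, hX, hsol, hS, hU, hcons, hC, hG, hreg⟩
    obtain ⟨w, hw⟩ := i.exists_solves hP hu hκ (by omega)
    have hspace : ∀ t ∈ Icc 0 T,
        S.energyNorm t ((S.sqrtMass t)⁻¹ *ᵥ w t - S.nodalVec u t) ≤ D * meshSq J K := fun t ht =>
      (i.energyNorm_inv_sub ht _ _).trans_le (hD i w hw t ht)
    refine ⟨fun t => (S.sqrtMass t)⁻¹ *ᵥ w t, hw.isSemidiscreteSolution, ?_, hspace,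
      fun v hv hv0 n hn => ?_⟩
    · simp only [hw.initial]
      exact Scheme.inv_mulVec_sqrtMass (i.mass_pos i.zero_mem) _
    · have ht : τ n ∈ Icc 0 T := by
        have h1 := hτ.monotone (Nat.zero_le n) hn
        have h2 := hτ.monotone hn le_rfl
        rw [hτ.zero] at h1
        rw [hτ.last] at h2
        exact ⟨h1, h2⟩
      have hv0' : v 0 = i.exactVec 0 := by
        rw [hv0, RegularMesh.exactVec, i.nodalVec_zero]
      have htime := hE i v w Δ hv hv0' hw hΔ n hn
      have hpos := i.mass_pos ht
      refine ⟨?_, ?_⟩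
      · rw [i.energyNorm_inv_sub ht, Scheme.sqrtMass_mulVec_inv hpos]
        exact htime
      · rw [i.energyNorm_inv_sub ht, ← sub_add_sub_cancel _ (w (τ n))]
        exact (euclid_add_le _ _).trans (add_le_add htime (hD i w hw _ ht))
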